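/- Let $X$ be a closed Kähler manifold of dimension $d$ with Kähler form $\omega$, and let $0\to(E_1,\Theta_1)\to(E,\Theta)\to(E_2,\Theta_2)\to0$ be an extension of Higgs bundles on $X$, of ranks $n_1,n,n_2$. All metrics and sections are smooth, $\alpha\in\mathbb R$, and integrals of functions, and the $L^2$ (semi)norms and inner products built from them, are taken with respect to $\omega^d$. Notation. Let $\nabla''=\bar\partial_E+\Theta$. For a Hermitian metric $H$ on $E$ let $\nabla=\nabla''+\nabla'_H$ be the Higgs connection, i.e. the Chern connection plus $\Theta+\Theta^*_H$, let $F_H=\nabla^2$, let $F_H^\perp=F_H-\frac1n\mathrm{Tr}(F_H)\mathbf I$, and let $\Lambda$ be the adjoint of wedging with $\omega$. Let $\mathbf T_H$ be $\frac{n_2}{n}$ on $E_1$ and $-\frac{n_1}{n}$ on its $H$-orthogonal complement, and put $$m^0_\alpha(H)=\Lambda F_H^\perp+i\alpha\mathbf T_H .$$ Let $S(H)$ be the space of $H$-self-adjoint trace-free sections of $\mathrm{End}E$. On $\mathrm{End}E$ use $(a,b)_H=\mathrm{Tr}(a^{*_H}b)$ and $\langle a,b\rangle_H=\int_X(a,b)_H$.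 Let $$M^{Higgs}_\alpha(H,K)=M_S(H,K)-2\alpha\int_X R_1(H_1,K_1)\,\omega^d,\qquad R_1(H_1,K_1)=\log\det(K_1^{-1}H_1),$$ where $H_1,K_1$ are the induced metrics on $E_1$ and $$M_S(H,K)=2i\int_0^1\!\int_X\mathrm{Tr}\big(L_t\,\Lambda F_{H_t}\big)\,\omega^d\,dt,\qquad L_t=H_t^{-1}\dot H_t,\quad H_t=(1-t)K+tH .$$ Let $\Delta=d^*d=2i\Lambda\bar\partial\partial$ be the positive Laplacian. Then: 1. For any three metrics $H,K,J$: $M^{Higgs}_\alpha(H,K)+M^{Higgs}_\alpha(K,J)=M^{Higgs}_\alpha(H,J)$. 2. For metrics $H,K$, $s\in S(H)$ and $H(t)=He^{ts}$, for all $t\in\mathbb R$: $$\frac{d}{dt}M^{Higgs}_\alpha(H(t),K)=2i\int_X\mathrm{Tr}\big(s\,m^0_\alpha(H(t))\big).$$ 3. For $H,K,s,H(t)$ as in 2, the derivative $L(s)=\frac{d}{dt}m^0_\alpha(H(t))|_{t=0}$ exists, and if $s=\begin{pmatrix}s_1&u\\u^*&s_2\end{pmatrix}$ in the $H$-orthogonal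 splitting $E=E_1\oplus E_2$, then $$2i\langle s,L(s)\rangle_H=\frac{d^2}{dt^2}M^{Higgs}_\alpha(H(t),K)\Big|_{t=0}=2\big(\|\nabla''(s)\|_H^2-\alpha\|u\|_H^2\big).$$ 4. Suppose $\alpha\le0$. If $H$ is a metric, $s\in S(H)$ and $K=He^s$, then $$\Delta|s|\le2\big(|m^0_\alpha(H)|_H+|m^0_\alpha(K)|_K\big)$$ pointwise where $s\neq0$, and on all of $X$ in the sense of distributions (tested against smooth functions $\psi\ge0$, with respect to $\omega^d$); here $|s|$ may be taken with respect to either $H$ or $K$. -/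

import Mathlib

open scoped Manifold ContDiff Matrix ComplexConjugate Nat

noncomputable section

namespace HiggsExtension

open Bundle MeasureTheory Complex

section Bundles

/-
`X` is a complex manifold of dimension `d`, modelled on `ℂ^d`, and `E` is a holomorphic vector
bundle of rank `n` over it.  Real smoothness is smoothness for the model `𝓘(ℝ, Fin d → ℂ)`.
All components below refer to the holomorphic frame `localFrame n E x₀` given by the preferred
trivialization of `E` around `x₀`, and to the preferred holomorphic chart around `x₀`.
The tangent space at `x` is identified with `ℂ^d` by the chart at `x`, as in Mathlib; the complex
structure `J` is multiplication by `Complex.I`.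
-/
variable {d n : ℕ} {X : Type*} [TopologicalSpace X] [ChartedSpace (Fin d → ℂ) X]
  (E : X → Type*) [∀ x, AddCommGroup (E x)] [∀ x, Module ℂ (E x)]
  [TopologicalSpace (TotalSpace (Fin n → ℂ) E)] [∀ x, TopologicalSpace (E x)]
  [FiberBundle (Fin n → ℂ) E] [VectorBundle ℂ (Fin n → ℂ) E]

variable (n) in
/-- The holomorphic local frame around `x₀`. -/
def localFrame (x₀ y : X) (i : Fin n) : E y :=
  (trivializationAt (Fin n → ℂ) E x₀).symm y (Pi.single i 1)

variable {E}

variable (n) in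
/-- The matrix of an endomorphism of the fibre at `y` in the frame around `x₀`. -/
def endCoord (x₀ y : X) (A : Module.End ℂ (E y)) : Matrix (Fin n) (Fin n) ℂ :=
  LinearMap.toMatrix'
    ((trivializationAt (Fin n → ℂ) E x₀).linearMapAt ℂ y ∘ₗ A ∘ₗ
      (trivializationAt (Fin n → ℂ) E x₀).symmₗ ℂ y)

/-- The endomorphism of the fibre at `x` with a given matrix in the frame around `x`. -/
def endOfCoord (x : X) (A : Matrix (Fin n) (Fin n) ℂ) : Module.End ℂ (E x) :=
  (trivializationAt (Fin n → ℂ) E x).symmₗ ℂ x ∘ₗ Matrix.toLin' A ∘ₗ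
    (trivializationAt (Fin n → ℂ) E x).linearMapAt ℂ x

variable (n) in
/-- Exponential of an endomorphism of a fibre. -/
def endExp (x : X) (A : Module.End ℂ (E x)) : Module.End ℂ (E x) :=
  endOfCoord x (NormedSpace.exp (endCoord n x x A))

variable (d n) in
/-- A section of `End E` is smooth. -/
def IsSmoothEnd (s : ∀ x, Module.End ℂ (E x)) : Prop :=
  ∀ (x₀ : X) (i j : Fin n),
    ContMDiffOn 𝓘(ℝ, Fin d → ℂ) 𝓘(ℝ, ℂ) ∞ (fun y => endCoord n x₀ y (s y) i j)
      (trivializationAt (Fin n → ℂ) E x₀).baseSet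

variable (E) in
/-- Fields of sesquilinear forms on the fibres, conjugate linear in the first variable. -/
abbrev FormField := ∀ x, E x →ₗ⋆[ℂ] E x →ₗ[ℂ] ℂ

variable (n) in
/-- The matrix `H(e_i, e_j)` in the frame around `x₀`. -/
def gram (H : FormField E) (x₀ y : X) : Matrix (Fin n) (Fin n) ℂ :=
  Matrix.of fun i j => H y (localFrame n E x₀ y i) (localFrame n E x₀ y j)

variable (d n) in
/-- Smooth Hermitian bundle metrics. -/
structure IsHermitianMetric (H : FormField E) : Prop where
  conj_symm : ∀ x v w, conj (H x v w) = H x w v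
  pos : ∀ x v, v ≠ 0 → 0 < (H x v v).re
  smooth : ∀ (x₀ : X) (i j : Fin n),
    ContMDiffOn 𝓘(ℝ, Fin d → ℂ) 𝓘(ℝ, ℂ) ∞ (fun y => gram n H x₀ y i j)
      (trivializationAt (Fin n → ℂ) E x₀).baseSet

variable (d n) in
/-- `S(H)`: smooth, `H`-self-adjoint, trace-free endomorphisms of `E`. -/
structure IsTraceFreeSelfAdjoint (H : FormField E) (s : ∀ x, Module.End ℂ (E x)) : Prop where
  smooth : IsSmoothEnd d n s
  selfAdjoint : ∀ x v w, H x (s x v) w = H x v (s x w)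
  trace_eq_zero : ∀ x, LinearMap.trace ℂ (E x) (s x) = 0

variable (n) in
/-- The form `H e^s`, i.e. `(v, w) ↦ H(v, e^s w)`. -/
def expForm (H : FormField E) (s : ∀ x, Module.End ℂ (E x)) : FormField E :=
  fun x => (H x).compl₂ (endExp n x (s x))

variable (n) in
/-- The adjoint of an endomorphism with respect to `H`. -/
def endAdjoint (H : FormField E) (x : X) (A : Module.End ℂ (E x)) : Module.End ℂ (E x) :=
  endOfCoord x ((gram n H x x)⁻¹ * (endCoord n x x A)ᴴ * gram n H x x)

variable (n) in
/-- The Hermitian inner product `Tr (A^* B)` on `End E`. -/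
def endInner (H : FormField E) (x : X) (A B : Module.End ℂ (E x)) : ℂ :=
  LinearMap.trace ℂ (E x) (endAdjoint n H x A * B)

variable (n) in
/-- The pointwise norm `|A|_H` on `End E`. -/
def endNorm (H : FormField E) (x : X) (A : Module.End ℂ (E x)) : ℝ :=
  √(endInner n H x A A).re

end Bundles

section Kaehler

variable {d : ℕ} {X : Type*} [TopologicalSpace X] [ChartedSpace (Fin d → ℂ) X]
  [IsManifold 𝓘(ℂ, Fin d → ℂ) 1 X]

variable (d X) in
/-- The holomorphic tangent bundle. -/
abbrev Tang : X → Type := fun x => TangentSpace 𝓘(ℂ, Fin d → ℂ) x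

/-- The vector at `y` whose components in the chart around `x₀` are `v`. -/
def tangVec (x₀ y : X) (v : Fin d → ℂ) : Tang d X y :=
  (trivializationAt (Fin d → ℂ) (Tang d X) x₀).symm y v

/-- The fundamental form `ω(v, w) = Re g(Jv, w) = Im g(v, w)` in the chart around `x₀`. -/
def localOmega (g : FormField (Tang d X)) (x₀ : X) (z v w : Fin d → ℂ) : ℝ :=
  (g ((chartAt (Fin d → ℂ) x₀).symm z) (tangVec x₀ _ v) (tangVec x₀ _ w)).im

/-- Kähler metrics: smooth Hermitian metrics on the tangent bundle with `dω = 0`. The Riemannian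
metric is `Re g`. -/
structure IsKaehler (g : FormField (Tang d X)) : Prop where
  hermitian : IsHermitianMetric d d g
  closed : ∀ (x₀ : X), ∀ z ∈ (chartAt (Fin d → ℂ) x₀).target, ∀ u v w : Fin d → ℂ,
    fderiv ℝ (fun p => localOmega g x₀ p v w) z u
      + fderiv ℝ (fun p => localOmega g x₀ p w u) z v
      + fderiv ℝ (fun p => localOmega g x₀ p u v) z w = 0

/-- The measure of the volume form `ω^d = d! det(g_{jk}) dx_1 dy_1 ⋯ dx_d dy_d` on the domain of
the chart around `x₀`, extended by zero to `X`. -/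
def chartVolume [MeasurableSpace X] (g : FormField (Tang d X)) (x₀ : X) : Measure X :=
  ((volume.restrict (chartAt (Fin d → ℂ) x₀).target).withDensity
    (fun z => ENNReal.ofReal
      ((d ! : ℝ) * (gram d g x₀ ((chartAt (Fin d → ℂ) x₀).symm z)).det.re))).map
    (chartAt (Fin d → ℂ) x₀).symm

/-- The measure of the volume form `ω^d` on `X`. The measures `chartVolume g x₀` agree on overlaps
of charts, so that their supremum is the measure that restricts to each of them. -/
def omegaPow [MeasurableSpace X] (g : FormField (Tang d X)) : Measure X :=
  ⨆ x₀ : X, chartVolume g x₀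

/-- The trace `∑ g^{j k̄} η(∂_j, ∂_{k̄})` at `x` of a real bilinear map `η` on the tangent space,
with `∂_j = (e_j - i J e_j) / 2` and `∂_{k̄} = (e_k + i J e_k) / 2`, `η` being extended complex
bilinearly. With respect to a `g`-unitary basis `u` it is
`¼ ∑_j (η(u_j, u_j) + η(J u_j, J u_j) + i η(u_j, J u_j) - i η(J u_j, u_j))`. -/
def mixedTrace {W : Type*} [AddCommGroup W] [Module ℂ W] (g : FormField (Tang d X)) (x : X)
    (η : (Fin d → ℂ) → (Fin d → ℂ) → W) : W :=
  ∑ j, ∑ k, ((gram d g x x)⁻¹ j k / 4) •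
    (η (Pi.single j 1) (Pi.single k 1) + η (Pi.single j I) (Pi.single k I)
      + I • η (Pi.single j 1) (Pi.single k I) - I • η (Pi.single j I) (Pi.single k 1))

/-- The contraction `Λ`, the adjoint of the product with `ω`, on two-forms at `x`: with respect to
a `g`-unitary basis `u` it is `Λ η = ∑_j η(u_j, J u_j)`, and `Λ ω = d`. -/
def contraction {W : Type*} [AddCommGroup W] [Module ℂ W] (g : FormField (Tang d X)) (x : X)
    (η : (Fin d → ℂ) → (Fin d → ℂ) → W) : W :=
  (-2 * I) • mixedTrace g x η

/-- The derivative at `z` of a function on `ℂ^d`, applied to `v`: its `(1,0)`-part. -/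
def del (f : (Fin d → ℂ) → ℂ) (z v : Fin d → ℂ) : ℂ :=
  (1 / 2) * (fderiv ℝ f z v - I * fderiv ℝ f z (I • v))

/-- The derivative at `z` of a function on `ℂ^d`, applied to `v`: its `(0,1)`-part. -/
def delbar (f : (Fin d → ℂ) → ℂ) (z v : Fin d → ℂ) : ℂ :=
  (1 / 2) * (fderiv ℝ f z v + I * fderiv ℝ f z (I • v))

/-- The positive Laplacian `Δ f = d^* d f = 2 i Λ ∂̄ ∂ f` of the Kähler metric, where `∂̄ ∂ f` is
the exterior derivative of `∂ f`. -/
def laplacian (g : FormField (Tang d X)) (f : X → ℝ) (x : X) : ℝ :=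
  let F : (Fin d → ℂ) → ℂ := fun z => (f ((chartAt (Fin d → ℂ) x).symm z) : ℂ)
  (2 * I * contraction g x (fun v w =>
    fderiv ℝ (fun z => del F z w) (chartAt (Fin d → ℂ) x x) v
      - fderiv ℝ (fun z => del F z v) (chartAt (Fin d → ℂ) x x) w)).re

end Kaehler

section Higgs

variable {d n : ℕ} {X : Type*} [TopologicalSpace X] [ChartedSpace (Fin d → ℂ) X]
  [IsManifold 𝓘(ℂ, Fin d → ℂ) 1 X]
  (E : X → Type*) [∀ x, AddCommGroup (E x)] [∀ x, Module ℂ (E x)]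
  [TopologicalSpace (TotalSpace (Fin n → ℂ) E)] [∀ x, TopologicalSpace (E x)]
  [FiberBundle (Fin n → ℂ) E] [VectorBundle ℂ (Fin n → ℂ) E]

variable (d n) in
/-- Higgs fields: holomorphic `End E`-valued one-forms `Θ` with `Θ ∧ Θ = 0`. -/
structure HiggsField where
  toFun : ∀ x, Tang d X x →ₗ[ℂ] Module.End ℂ (E x)
  holomorphic : ∀ (x₀ : X) (v : Fin d → ℂ) (i j : Fin n),
    ContMDiffOn 𝓘(ℂ, Fin d → ℂ) 𝓘(ℂ, ℂ) ω
      (fun y => endCoord n x₀ y (toFun y (tangVec x₀ y v)) i j)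
      ((trivializationAt (Fin d → ℂ) (Tang d X) x₀).baseSet ∩
        (trivializationAt (Fin n → ℂ) E x₀).baseSet)
  wedge_self : ∀ x v w, toFun x v * toFun x w = toFun x w * toFun x v

variable {E}

/-- The matrix of `Θ(v)` in the chart and the frame around `x₀`. -/
def higgsMatrix (Θ : HiggsField d n E) (x₀ : X) (z v : Fin d → ℂ) : Matrix (Fin n) (Fin n) ℂ :=
  endCoord n x₀ ((chartAt (Fin d → ℂ) x₀).symm z) (Θ.toFun _ (tangVec x₀ _ v))

/-- The matrix-valued connection one-form of the Higgs connection `∇ = ∇'' + ∇'_H` in the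
holomorphic frame around `x₀`: the sum of the connection form `h⁻¹ ∂h` of the Chern connection, of
`Θ`, and of the adjoint `Θ^*_H = h⁻¹ Θ^† h`. -/
def connectionForm (Θ : HiggsField d n E) (H : FormField E) (x₀ : X) (z v : Fin d → ℂ) :
    Matrix (Fin n) (Fin n) ℂ :=
  let h : (Fin d → ℂ) → Matrix (Fin n) (Fin n) ℂ :=
    fun p => gram n H x₀ ((chartAt (Fin d → ℂ) x₀).symm p)
  (h z)⁻¹ * (Matrix.of fun i j => del (fun p => h p i j) z v)
    + higgsMatrix Θ x₀ z v + (h z)⁻¹ * (higgsMatrix Θ x₀ z v)ᴴ * h z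

/-- The Higgs curvature `F_H = ∇²`, an `End E`-valued two-form: `dA + A ∧ A` for the connection
form `A`. -/
def higgsCurvature (Θ : HiggsField d n E) (H : FormField E) (x : X) (v w : Fin d → ℂ) :
    Module.End ℂ (E x) :=
  let z := chartAt (Fin d → ℂ) x x
  let A := connectionForm Θ H x
  endOfCoord x
    ((Matrix.of fun i j => fderiv ℝ (fun p => A p w i j) z v - fderiv ℝ (fun p => A p v i j) z w)
      + (A z v * A z w - A z w * A z v))

/-- The trace-free part of the Higgs curvature. -/
def higgsCurvaturePerp (Θ : HiggsField d n E) (H : FormField E) (x : X) (v w : Fin d → ℂ) :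
    Module.End ℂ (E x) :=
  higgsCurvature Θ H x v w
    - ((1 / (n : ℂ)) * LinearMap.trace ℂ (E x) (higgsCurvature Θ H x v w)) • 1

/-- `∇'' s = ∂̄ s + [Θ, s]` for a section `s` of `End E`, as an `End E`-valued one-form. -/
def nablaEnd (Θ : HiggsField d n E) (s : ∀ x, Module.End ℂ (E x)) (x : X) (v : Fin d → ℂ) :
    Module.End ℂ (E x) :=
  let z := chartAt (Fin d → ℂ) x x
  let S : (Fin d → ℂ) → Matrix (Fin n) (Fin n) ℂ :=
    fun p => endCoord n x ((chartAt (Fin d → ℂ) x).symm p) (s _)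
  let θ := higgsMatrix Θ x z v
  endOfCoord x ((Matrix.of fun i j => delbar (fun p => S p i j) z v) + (θ * S z - S z * θ))

variable (n) in
/-- The squared norm at `x` of an `End E`-valued one-form with respect to `g` and `H`; it is
`∑_a |η(u_a)|²` over a `Re g`-orthonormal real basis `u` of the tangent space. -/
def oneFormNormSq (g : FormField (Tang d X)) (H : FormField E) (x : X)
    (η : (Fin d → ℂ) → Module.End ℂ (E x)) : ℝ :=
  4 * (mixedTrace g x (fun v w => ((endInner n H x (η v) (η w)).re : ℂ))).re

/-- The form `(1 - t) K + t H`. -/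
def segment (K H : FormField E) (t : ℝ) : FormField E :=
  fun x => (((1 - t : ℝ) : ℂ)) • K x + (t : ℂ) • H x

/-- Simpson's functional: `2 i ∫_0^1 ∫_X Tr (L_t Λ F_{H_t}) ω^d dt` along the path
`H_t = (1 - t) K + t H` from `K` to `H`, with `L_t = H_t⁻¹ dH_t/dt`. Since
`Λ η ω^d = d η ∧ ω^{d-1}`, this is the integral against `d ω^{d-1}` of the Higgs Bott-Chern form of
the invariant polynomial `-½ Tr (AB + BA)`. -/
def simpsonFunctional [MeasurableSpace X] (g : FormField (Tang d X)) (Θ : HiggsField d n E)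
    (H K : FormField E) : ℂ :=
  ∫ t in (0 : ℝ)..1, ∫ x, 2 * I * LinearMap.trace ℂ (E x)
    (endOfCoord x ((gram n (segment K H t) x x)⁻¹ * (gram n H x x - gram n K x x))
      * contraction g x (higgsCurvature Θ (segment K H t) x)) ∂(omegaPow g)

end Higgs

section Extension

variable {d n₁ n n₂ : ℕ} {X : Type*} [TopologicalSpace X] [ChartedSpace (Fin d → ℂ) X]
  [IsManifold 𝓘(ℂ, Fin d → ℂ) 1 X]
  (E₁ E E₂ : X → Type*)
  [∀ x, AddCommGroup (E₁ x)] [∀ x, Module ℂ (E₁ x)]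
  [TopologicalSpace (TotalSpace (Fin n₁ → ℂ) E₁)] [∀ x, TopologicalSpace (E₁ x)]
  [FiberBundle (Fin n₁ → ℂ) E₁] [VectorBundle ℂ (Fin n₁ → ℂ) E₁]
  [∀ x, AddCommGroup (E x)] [∀ x, Module ℂ (E x)]
  [TopologicalSpace (TotalSpace (Fin n → ℂ) E)] [∀ x, TopologicalSpace (E x)]
  [FiberBundle (Fin n → ℂ) E] [VectorBundle ℂ (Fin n → ℂ) E]
  [∀ x, AddCommGroup (E₂ x)] [∀ x, Module ℂ (E₂ x)]
  [TopologicalSpace (TotalSpace (Fin n₂ → ℂ) E₂)] [∀ x, TopologicalSpace (E₂ x)]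
  [FiberBundle (Fin n₂ → ℂ) E₂] [VectorBundle ℂ (Fin n₂ → ℂ) E₂]

variable (d n₁ n n₂) in
/-- Extensions of Higgs bundles `0 → (E₁, Θ₁) → (E, Θ) → (E₂, Θ₂) → 0`. -/
structure HiggsExt where
  Θ₁ : HiggsField d n₁ E₁
  Θ : HiggsField d n E
  Θ₂ : HiggsField d n₂ E₂
  i : ∀ x, E₁ x →ₗ[ℂ] E x
  q : ∀ x, E x →ₗ[ℂ] E₂ x
  holomorphic_i : ContMDiff (𝓘(ℂ, Fin d → ℂ).prod 𝓘(ℂ, Fin n₁ → ℂ))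
    (𝓘(ℂ, Fin d → ℂ).prod 𝓘(ℂ, Fin n → ℂ)) ω
    (fun p : TotalSpace (Fin n₁ → ℂ) E₁ => (⟨p.1, i p.1 p.2⟩ : TotalSpace (Fin n → ℂ) E))
  holomorphic_q : ContMDiff (𝓘(ℂ, Fin d → ℂ).prod 𝓘(ℂ, Fin n → ℂ))
    (𝓘(ℂ, Fin d → ℂ).prod 𝓘(ℂ, Fin n₂ → ℂ)) ω
    (fun p : TotalSpace (Fin n → ℂ) E => (⟨p.1, q p.1 p.2⟩ : TotalSpace (Fin n₂ → ℂ) E₂))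
  injective_i : ∀ x, Function.Injective (i x)
  exact : ∀ x, Function.Exact (i x) (q x)
  surjective_q : ∀ x, Function.Surjective (q x)
  comm_i : ∀ x v, i x ∘ₗ Θ₁.toFun x v = Θ.toFun x v ∘ₗ i x
  comm_q : ∀ x v, q x ∘ₗ Θ.toFun x v = Θ₂.toFun x v ∘ₗ q x

variable {E₁ E E₂}

namespace HiggsExt

/-- The form on `E₁` induced by a form on `E`. -/
def inducedForm (e : HiggsExt d n₁ n n₂ E₁ E E₂) (H : FormField E) : FormField E₁ :=
  fun x => ((H x).comp (e.i x)).compl₂ (e.i x)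

/-- `R_1(H_1, K_1) = log det (K_1⁻¹ H_1)` for the induced metrics on `E₁`. -/
def R₁ (e : HiggsExt d n₁ n n₂ E₁ E E₂) (H K : FormField E) (x : X) : ℝ :=
  Real.log ((gram n₁ (e.inducedForm K) x x)⁻¹ * gram n₁ (e.inducedForm H) x x).det.re

/-- The matrix of the inclusion `i` at `x` in the frames around `x`. -/
def inclusionMatrix (e : HiggsExt d n₁ n n₂ E₁ E E₂) (x : X) : Matrix (Fin n) (Fin n₁) ℂ :=
  LinearMap.toMatrix'
    ((trivializationAt (Fin n → ℂ) E x).linearMapAt ℂ x ∘ₗ e.i x ∘ₗ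
      (trivializationAt (Fin n₁ → ℂ) E₁ x).symmₗ ℂ x)

/-- The `H`-orthogonal projection `i (i^* i)⁻¹ i^*` of `E` onto the image of `E₁`; in matrices,
`ι (ι^† h ι)⁻¹ ι^† h`. -/
def proj (e : HiggsExt d n₁ n n₂ E₁ E E₂) (H : FormField E) (x : X) : Module.End ℂ (E x) :=
  endOfCoord x (e.inclusionMatrix x *
    ((e.inclusionMatrix x)ᴴ * gram n H x x * e.inclusionMatrix x)⁻¹ *
    (e.inclusionMatrix x)ᴴ * gram n H x x)

/-- The automorphism `T_H`, equal to `n₂ / n` on `E₁` and to `-n₁ / n` on its `H`-orthogonal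
complement. -/
def T (e : HiggsExt d n₁ n n₂ E₁ E E₂) (H : FormField E) (x : X) : Module.End ℂ (E x) :=
  ((n₂ : ℂ) / n) • e.proj H x - ((n₁ : ℂ) / n) • (1 - e.proj H x)

/-- The component `u : E₂ → E₁` of `s`, with respect to the `H`-orthogonal splitting
`E = E₁ ⊕ E₂`, extended by zero to `E`. -/
def offDiagonal (e : HiggsExt d n₁ n n₂ E₁ E E₂) (H : FormField E) (s : ∀ x, Module.End ℂ (E x)) (x : X) :
    Module.End ℂ (E x) :=
  e.proj H x * s x * (1 - e.proj H x)

/-- `m⁰_α(H) = Λ F_H^⊥ + i α T_H`. -/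
def m₀ (e : HiggsExt d n₁ n n₂ E₁ E E₂) (g : FormField (Tang d X)) (α : ℝ) (H : FormField E) (x : X) :
    Module.End ℂ (E x) :=
  contraction g x (higgsCurvaturePerp e.Θ H x) + (I * α) • e.T H x

/-- `M_α(H, K) = M_S(H, K) - 2 α ∫_X R_1(H_1, K_1) ω^d`. -/
def M [MeasurableSpace X] (e : HiggsExt d n₁ n n₂ E₁ E E₂) (g : FormField (Tang d X)) (α : ℝ)
    (H K : FormField E) : ℂ :=
  simpsonFunctional g e.Θ H K - 2 * α * ∫ x, (e.R₁ H K x : ℂ) ∂(omegaPow g)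

/-- `L(s) = d/dt m⁰_α(H e^{ts})` at `t = 0`. -/
def linearization (e : HiggsExt d n₁ n n₂ E₁ E E₂) (g : FormField (Tang d X)) (α : ℝ) (H : FormField E)
    (s : ∀ x, Module.End ℂ (E x)) (x : X) : Module.End ℂ (E x) :=
  endOfCoord x (Matrix.of fun i j =>
    deriv (fun t : ℝ => endCoord n x x (e.m₀ g α (expForm n H (fun y => (t : ℂ) • s y)) x) i j) 0)

end HiggsExt

end Extension

end HiggsExtension

end

/-! Everything rests on one formula for the variation of `i Λ F`. Let the metric depend on
parameters and put `L = H⁻¹ ∂H` for a parameter derivative. The Chern connection form `H⁻¹ ∂H` is a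
logarithmic derivative too, so the flatness identity `d(H⁻¹dH) + H⁻¹dH ∧ H⁻¹dH = 0` (`cdM_chern`)
identifies its variation with the covariant derivative `∂_H L`, while `Θ^*` varies by the commutator
`[Θ^*, L]` (`cdM_adj`). Pairing with a section `A` and applying the Leibniz rule, `Tr (A δ(i Λ F))`
equals a divergence plus a form `Q(A, L)` (`trace_mul_cdM_higgsP`). On self-adjoint sections `conj
Q(A, L) = Q(L, A)` (`conj_formQ`), and `Q(s, s) = |∇'' s|²` pointwise (`oneFormNormSq_nablaEnd`). On
a closed Kähler manifold divergences integrate to zero (`IsOneForm.integral_div`).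

Parts 1 and 2. By the symmetry of `Q`, the one-form `L ↦ ∫ Tr (L i Λ F)` on the space of metrics is
closed (`integral_dpar_varForm`). Simpson's functional is twice its integral along a segment, so a
two-parameter family and the fundamental theorem of calculus show that the derivative of `M_S` in
its first argument is twice this one-form (`hasDerivAt_simpsonFunctional`). The logarithm of the
determinant of the induced metric varies by `Tr (π L)`, where `π` is the orthogonal projection to
`E₁` (`HiggsExt.dpar_R₁`). Hence the derivative of `M_α` in its first argument is `2 ∫ Tr (L (i Λ F
- α π))`, whatever the second argument is; with `M_α(K, K) = 0` this is additivity. Along `H e^{ts}`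
one has `L = s` (`chern_expFam`), and `m⁰_α` is `-i (i Λ F - α π)` up to a multiple of the identity,
which a trace-free `s` does not see.

Part 3. Differentiate once more, with `A = L = s`. The projection varies by `π s (1 - π)`, which is
the component `u`, so that the pointwise second variation is a divergence plus `|∇'' s|² - α |u|²`
(`dpar_momentForm_eq`).

Part 4. The same identity is used before integration. The norm `|s|² = Tr s²` is the same for all
the metrics `H e^{ts}`. With `ρ = (|s|² + ε)^{1/2}`, Bochner's formula and Kato's inequality bound
`ρ Δρ`, for every `t`, by `2 |∇'' s|²` minus four times the real part of the divergence
(`sqrt_mul_laplacian_le`). For `α ≤ 0` this is at most the `t`-derivative of `2 Tr (s (i Λ F - α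
π))`. Integrating over `t ∈ [0, 1]`, using Cauchy-Schwarz at both ends and dividing by `ρ ≥ |s|`
gives the bound for `Δρ`. Taking `ε = 0` where `s ≠ 0` gives the pointwise claim; Green's formula
and `ε → 0` give the distributional one.

The formal device is to read a family of metrics in a chart and a frame as one matrix-valued
function on `P × ℂ^d`, with `P` the parameter space. Parameter derivatives, `∂` and `∂̄` are then
the same operator `cd`, applied to different complex tangent vectors. -/

open scoped Manifold ContDiff Matrix ComplexConjugate Nat

noncomputable section

set_option linter.unusedSectionVars false

namespace HiggsExtension

open Bundle MeasureTheory Complex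

/-! ### Entrywise calculus of matrix-valued functions along complexified tangent vectors. -/

section MatrixCalculus

variable {W W' : Type*} [NormedAddCommGroup W] [NormedSpace ℝ W]
  [NormedAddCommGroup W'] [NormedSpace ℝ W']
variable {l m n : Type*} [Fintype l] [Fintype m] [Fintype n]

/-- The derivative of `f` along the complex tangent vector `ξ.1 + i ξ.2`. -/
def cd (ξ : W × W) (f : W → ℂ) (p : W) : ℂ := fderiv ℝ f p ξ.1 + I * fderiv ℝ f p ξ.2

/-- The entrywise derivative of a matrix-valued function along `ξ.1 + i ξ.2`. -/
def cdM {l m : Type*} (ξ : W × W) (F : W → Matrix l m ℂ) (p : W) : Matrix l m ℂ :=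
  Matrix.of fun i j => cd ξ (fun q => F q i j) p

/-- Smoothness at a point of all the entries of a matrix-valued function. -/
def SmoothAt {l m : Type*} (F : W → Matrix l m ℂ) (p : W) : Prop :=
  ∀ i j, ContDiffAt ℝ ∞ (fun q => F q i j) p

lemma cdM_apply {l m : Type*} (ξ : W × W) (F : W → Matrix l m ℂ) (p : W) (i : l) (j : m) :
    cdM ξ F p i j = cd ξ (fun q => F q i j) p := rfl

lemma cd_congr {ξ : W × W} {f g : W → ℂ} {p : W} (h : f =ᶠ[nhds p] g) : cd ξ f p = cd ξ g p := by
  simp only [cd, h.fderiv_eq]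

lemma cdM_congr {l m : Type*} {ξ : W × W} {F G : W → Matrix l m ℂ} {p : W}
    (h : F =ᶠ[nhds p] G) : cdM ξ F p = cdM ξ G p := by
  ext i j
  exact cd_congr (h.mono fun q hq => by simp only [hq])

lemma SmoothAt.congr {l m : Type*} {F G : W → Matrix l m ℂ} {p : W} (hF : SmoothAt F p)
    (h : G =ᶠ[nhds p] F) : SmoothAt G p := fun i j =>
  (hF i j).congr_of_eventuallyEq (h.mono fun q hq => by simp only [hq])

lemma contDiffAt_cd {f : W → ℂ} {p : W} (hf : ContDiffAt ℝ ∞ f p) (ξ : W × W) :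
    ContDiffAt ℝ ∞ (cd ξ f) p := by
  have h := hf.fderiv_right (m := ∞) (by simp)
  unfold cd
  exact (h.clm_apply contDiffAt_const).add
    (contDiffAt_const.mul (h.clm_apply contDiffAt_const))

lemma _root_.ContDiffAt.dAt {f : W → ℂ} {p : W} (hf : ContDiffAt ℝ ∞ f p) : DifferentiableAt ℝ f p :=
  hf.differentiableAt (by simp)

lemma SmoothAt.cdM {l m : Type*} {F : W → Matrix l m ℂ} {p : W} (hF : SmoothAt F p) (ξ : W × W) :
    SmoothAt (cdM ξ F) p := fun i j => contDiffAt_cd (hF i j) ξ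

lemma smoothAt_const {l m : Type*} (A : Matrix l m ℂ) (p : W) : SmoothAt (fun _ => A) p :=
  fun _ _ => contDiffAt_const

lemma SmoothAt.add {l m : Type*} {F G : W → Matrix l m ℂ} {p : W} (hF : SmoothAt F p)
    (hG : SmoothAt G p) : SmoothAt (fun q => F q + G q) p := fun i j => (hF i j).add (hG i j)

lemma SmoothAt.sub {l m : Type*} {F G : W → Matrix l m ℂ} {p : W} (hF : SmoothAt F p)
    (hG : SmoothAt G p) : SmoothAt (fun q => F q - G q) p := fun i j => (hF i j).sub (hG i j)

lemma SmoothAt.neg {l m : Type*} {F : W → Matrix l m ℂ} {p : W} (hF : SmoothAt F p) :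
    SmoothAt (fun q => -F q) p := fun i j => (hF i j).neg

lemma SmoothAt.smul {l m : Type*} {f : W → ℂ} {F : W → Matrix l m ℂ} {p : W}
    (hf : ContDiffAt ℝ ∞ f p) (hF : SmoothAt F p) : SmoothAt (fun q => f q • F q) p :=
  fun i j => hf.mul (hF i j)

lemma SmoothAt.mul {l n : Type*} {F : W → Matrix l m ℂ} {G : W → Matrix m n ℂ} {p : W}
    (hF : SmoothAt F p) (hG : SmoothAt G p) : SmoothAt (fun q => F q * G q) p := fun i j => by
  simp only [Matrix.mul_apply]
  exact ContDiffAt.sum fun k _ => (hF i k).mul (hG k j)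

lemma SmoothAt.sum {l m : Type*} {ι : Type*} {s : Finset ι} {F : ι → W → Matrix l m ℂ} {p : W}
    (hF : ∀ i ∈ s, SmoothAt (F i) p) : SmoothAt (fun q => ∑ i ∈ s, F i q) p := fun i j => by
  simp only [Matrix.sum_apply]
  exact ContDiffAt.sum fun k hk => hF k hk i j

lemma contDiffAt_conj {f : W → ℂ} {p : W} (hf : ContDiffAt ℝ ∞ f p) :
    ContDiffAt ℝ ∞ (fun q => conj (f q)) p :=
  (Complex.conjCLE.contDiff.contDiffAt).comp p hf

lemma SmoothAt.conjTranspose {l m : Type*} {F : W → Matrix l m ℂ} {p : W} (hF : SmoothAt F p) :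
    SmoothAt (fun q => (F q)ᴴ) p := fun i j => contDiffAt_conj (hF j i)

lemma SmoothAt.trace {F : W → Matrix m m ℂ} {p : W} (hF : SmoothAt F p) :
    ContDiffAt ℝ ∞ (fun q => (F q).trace) p := by
  simp only [Matrix.trace, Matrix.diag]
  exact ContDiffAt.sum fun k _ => hF k k

lemma SmoothAt.det [DecidableEq m] {F : W → Matrix m m ℂ} {p : W} (hF : SmoothAt F p) :
    ContDiffAt ℝ ∞ (fun q => (F q).det) p := by
  simp only [Matrix.det_apply']
  exact ContDiffAt.sum fun σ _ => contDiffAt_const.mul (contDiffAt_prod fun i _ => hF _ _)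

lemma SmoothAt.adjugate [DecidableEq m] {F : W → Matrix m m ℂ} {p : W} (hF : SmoothAt F p) :
    SmoothAt (fun q => (F q).adjugate) p := fun i j => by
  simp only [Matrix.adjugate_apply]
  refine SmoothAt.det fun a b => ?_
  by_cases h : a = j
  · subst h; simp only [Matrix.updateRow_self]; exact contDiffAt_const
  · simp only [Matrix.updateRow_ne h]; exact hF a b

lemma SmoothAt.inv [DecidableEq m] {F : W → Matrix m m ℂ} {p : W} (hF : SmoothAt F p)
    (h : IsUnit (F p).det) : SmoothAt (fun q => (F q)⁻¹) p := by
  simp only [Matrix.inv_def, Ring.inverse_eq_inv']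
  exact SmoothAt.smul (hF.det.inv h.ne_zero) hF.adjugate

lemma SmoothAt.eventually_isUnit [DecidableEq m] {F : W → Matrix m m ℂ} {p : W}
    (hF : SmoothAt F p) (h : IsUnit (F p).det) : ∀ᶠ q in nhds p, IsUnit (F q).det :=
  (hF.det.continuousAt.eventually_ne h.ne_zero).mono fun _ hq => hq.isUnit

lemma cd_add {f g : W → ℂ} {p : W} (ξ : W × W) (hf : DifferentiableAt ℝ f p)
    (hg : DifferentiableAt ℝ g p) : cd ξ (fun q => f q + g q) p = cd ξ f p + cd ξ g p := by
  simp only [cd, fderiv_fun_add hf hg, add_apply]; ring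

lemma cd_sub {f g : W → ℂ} {p : W} (ξ : W × W) (hf : DifferentiableAt ℝ f p)
    (hg : DifferentiableAt ℝ g p) : cd ξ (fun q => f q - g q) p = cd ξ f p - cd ξ g p := by
  simp only [cd, fderiv_fun_sub hf hg, sub_apply]; ring

lemma cd_neg {f : W → ℂ} {p : W} (ξ : W × W) : cd ξ (fun q => -f q) p = -cd ξ f p := by
  simp only [cd, fderiv_fun_neg, neg_apply]; ring

lemma cd_const (ξ : W × W) (c : ℂ) (p : W) : cd ξ (fun _ => c) p = 0 := by
  simp [cd]

lemma cd_mul {f g : W → ℂ} {p : W} (ξ : W × W) (hf : DifferentiableAt ℝ f p)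
    (hg : DifferentiableAt ℝ g p) :
    cd ξ (fun q => f q * g q) p = cd ξ f p * g p + f p * cd ξ g p := by
  simp only [cd, fderiv_fun_mul hf hg, add_apply, smul_apply, smul_eq_mul]; ring

lemma cd_sum {ι : Type*} {s : Finset ι} {f : ι → W → ℂ} {p : W} (ξ : W × W)
    (hf : ∀ i ∈ s, DifferentiableAt ℝ (f i) p) :
    cd ξ (fun q => ∑ i ∈ s, f i q) p = ∑ i ∈ s, cd ξ (f i) p := by
  simp only [cd, fderiv_fun_sum hf, sum_apply, Finset.mul_sum, Finset.sum_add_distrib]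

lemma cd_conj {f : W → ℂ} {p : W} (ξ : W × W) (hf : DifferentiableAt ℝ f p) :
    cd ξ (fun q => conj (f q)) p = conj (cd (ξ.1, -ξ.2) f p) := by
  have h : HasFDerivAt (fun q => conj (f q))
      ((Complex.conjCLE : ℂ →L[ℝ] ℂ).comp (fderiv ℝ f p)) p :=
    (Complex.conjCLE : ℂ →L[ℝ] ℂ).hasFDerivAt.comp p hf.hasFDerivAt
  simp only [cd, h.fderiv]
  simp

/-- Both directions are constant vectors, so this is the symmetry of the real second derivative,
extended complex bilinearly; there is no bracket term. -/
lemma cd_comm {f : W → ℂ} {p : W} (hf : ContDiffAt ℝ ∞ f p) (ξ η : W × W) :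
    cd ξ (cd η f) p = cd η (cd ξ f) p := by
  have h2 : ContDiffAt ℝ ∞ (fderiv ℝ f) p := hf.fderiv_right (m := ∞) (by simp)
  have hd : DifferentiableAt ℝ (fderiv ℝ f) p := h2.differentiableAt (by simp)
  have hs : IsSymmSndFDerivAt ℝ f p :=
    hf.isSymmSndFDerivAt (by
      simp only [minSmoothness_of_isRCLikeNormedField]
      exact WithTop.coe_le_coe.2 le_top)
  have e : ∀ (u v : W), fderiv ℝ (fun q => fderiv ℝ f q u) p v = fderiv ℝ (fderiv ℝ f) p v u := by
    intro u v
    rw [fderiv_clm_apply hd (differentiableAt_const u)]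
    simp
  have dd : ∀ u : W, DifferentiableAt ℝ (fun q => fderiv ℝ f q u) p := fun u =>
    hd.clm_apply (differentiableAt_const u)
  have key : ∀ ξ η : W × W, cd ξ (cd η f) p =
      fderiv ℝ (fderiv ℝ f) p ξ.1 η.1 + I * fderiv ℝ (fderiv ℝ f) p ξ.1 η.2
      + I * (fderiv ℝ (fderiv ℝ f) p ξ.2 η.1 + I * fderiv ℝ (fderiv ℝ f) p ξ.2 η.2) := by
    intro ξ η
    have : fderiv ℝ (cd η f) p = fderiv ℝ (fun q => fderiv ℝ f q η.1) p
        + I • fderiv ℝ (fun q => fderiv ℝ f q η.2) p := by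
      unfold cd
      rw [fderiv_fun_add (dd _) ((dd _).const_mul _), fderiv_const_mul (dd _)]
    rw [cd, this]
    simp only [add_apply, smul_apply, smul_eq_mul, e]
  rw [key, key, hs.eq ξ.1 η.1, hs.eq ξ.1 η.2, hs.eq ξ.2 η.1, hs.eq ξ.2 η.2]
  ring

lemma cd_comp {f : W' → ℂ} {ph : W → W'} {p : W} (hf : DifferentiableAt ℝ f (ph p))
    (hp : DifferentiableAt ℝ ph p) (ξ : W × W) :
    cd ξ (fun q => f (ph q)) p = cd (fderiv ℝ ph p ξ.1, fderiv ℝ ph p ξ.2) f (ph p) := by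
  have : fderiv ℝ (fun q => f (ph q)) p = (fderiv ℝ f (ph p)).comp (fderiv ℝ ph p) :=
    fderiv_comp p hf hp
  simp [cd, this]

lemma cdM_add {l m : Type*} {F G : W → Matrix l m ℂ} {p : W} (ξ : W × W) (hF : SmoothAt F p)
    (hG : SmoothAt G p) : cdM ξ (fun q => F q + G q) p = cdM ξ F p + cdM ξ G p := by
  ext i j; exact cd_add ξ (hF i j).dAt (hG i j).dAt

lemma cdM_sub {l m : Type*} {F G : W → Matrix l m ℂ} {p : W} (ξ : W × W) (hF : SmoothAt F p)
    (hG : SmoothAt G p) : cdM ξ (fun q => F q - G q) p = cdM ξ F p - cdM ξ G p := by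
  ext i j; exact cd_sub ξ (hF i j).dAt (hG i j).dAt

lemma cdM_neg {l m : Type*} {F : W → Matrix l m ℂ} {p : W} (ξ : W × W) :
    cdM ξ (fun q => -F q) p = -cdM ξ F p := by
  ext i j; exact cd_neg ξ

lemma cdM_const {l m : Type*} (ξ : W × W) (A : Matrix l m ℂ) (p : W) :
    cdM ξ (fun _ => A) p = 0 := by
  ext i j; exact cd_const ξ _ p

lemma cdM_smul {l m : Type*} {f : W → ℂ} {F : W → Matrix l m ℂ} {p : W} (ξ : W × W)
    (hf : ContDiffAt ℝ ∞ f p) (hF : SmoothAt F p) :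
    cdM ξ (fun q => f q • F q) p = cd ξ f p • F p + f p • cdM ξ F p := by
  ext i j; exact cd_mul ξ hf.dAt (hF i j).dAt

lemma cdM_mul {l n : Type*} {F : W → Matrix l m ℂ} {G : W → Matrix m n ℂ} {p : W} (ξ : W × W)
    (hF : SmoothAt F p) (hG : SmoothAt G p) :
    cdM ξ (fun q => F q * G q) p = cdM ξ F p * G p + F p * cdM ξ G p := by
  ext i j
  simp only [cdM_apply, Matrix.mul_apply, Matrix.add_apply]
  rw [cd_sum ξ fun k _ => ((hF i k).mul (hG k j)).dAt, ← Finset.sum_add_distrib]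
  exact Finset.sum_congr rfl fun k _ => cd_mul ξ (hF i k).dAt (hG k j).dAt

lemma cdM_sum {l m : Type*} {ι : Type*} {s : Finset ι} {F : ι → W → Matrix l m ℂ} {p : W}
    (ξ : W × W) (hF : ∀ i ∈ s, SmoothAt (F i) p) :
    cdM ξ (fun q => ∑ i ∈ s, F i q) p = ∑ i ∈ s, cdM ξ (F i) p := by
  ext i j
  simp only [cdM_apply, Matrix.sum_apply]
  rw [cd_sum ξ fun k hk => (hF k hk i j).dAt]

lemma cdM_conjTranspose {l m : Type*} {F : W → Matrix l m ℂ} {p : W} (ξ : W × W)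
    (hF : SmoothAt F p) : cdM ξ (fun q => (F q)ᴴ) p = (cdM (ξ.1, -ξ.2) F p)ᴴ := by
  ext i j; exact cd_conj ξ (hF j i).dAt

lemma cd_trace {F : W → Matrix m m ℂ} {p : W} (ξ : W × W) (hF : SmoothAt F p) :
    cd ξ (fun q => (F q).trace) p = (cdM ξ F p).trace := by
  simp only [Matrix.trace, Matrix.diag]
  rw [cd_sum ξ fun k _ => (hF k k).dAt]
  rfl

lemma cdM_comm {l m : Type*} {F : W → Matrix l m ℂ} {p : W} (hF : SmoothAt F p) (ξ η : W × W) :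
    cdM ξ (cdM η F) p = cdM η (cdM ξ F) p := by
  ext i j; exact cd_comm (hF i j) ξ η

lemma cdM_inv [DecidableEq m] {F : W → Matrix m m ℂ} {p : W} (ξ : W × W) (hF : SmoothAt F p)
    (h : IsUnit (F p).det) :
    cdM ξ (fun q => (F q)⁻¹) p = -((F p)⁻¹ * cdM ξ F p * (F p)⁻¹) := by
  have h1 : cdM ξ (fun q => F q * (F q)⁻¹) p = 0 := by
    rw [cdM_congr (G := fun _ => 1), cdM_const]
    exact (hF.eventually_isUnit h).mono fun q hq => Matrix.mul_nonsing_inv _ hq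
  rw [cdM_mul ξ hF (hF.inv h)] at h1
  have h2 := congrArg (fun M => (F p)⁻¹ * M) h1
  simp only [Matrix.mul_add, Matrix.nonsing_inv_mul_cancel_left _ _ h, Matrix.mul_zero] at h2
  rw [eq_neg_iff_add_eq_zero, ← h2, Matrix.mul_assoc, add_comm]

lemma SmoothAt.comp {l m : Type*} {F : W' → Matrix l m ℂ} {ph : W → W'} {p : W}
    (hF : SmoothAt F (ph p)) (hp : ContDiffAt ℝ ∞ ph p) : SmoothAt (fun q => F (ph q)) p :=
  fun i j => (hF i j).comp p hp

lemma cdM_comp {l m : Type*} {F : W' → Matrix l m ℂ} {ph : W → W'} {p : W}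
    (hF : SmoothAt F (ph p)) (hp : DifferentiableAt ℝ ph p) (ξ : W × W) :
    cdM ξ (fun q => F (ph q)) p = cdM (fderiv ℝ ph p ξ.1, fderiv ℝ ph p ξ.2) F (ph p) := by
  ext i j; exact cd_comp (hF i j).dAt hp ξ

end MatrixCalculus

/-! ### The variation of the Higgs curvature in a local frame. -/

section LocalHiggs

variable {W : Type*} [NormedAddCommGroup W] [NormedSpace ℝ W]
variable {m : Type*} [Fintype m] [DecidableEq m] {ι : Type*} [Fintype ι]

/-- The complex conjugate of a complex tangent vector. -/
def cj (ξ : W × W) : W × W := (ξ.1, -ξ.2)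

@[simp] lemma cj_cj (ξ : W × W) : cj (cj ξ) = ξ := by simp [cj]

/-- Smoothness in a neighbourhood of a point. -/
def SmoothNear {l m : Type*} (F : W → Matrix l m ℂ) (p : W) : Prop :=
  ∀ᶠ q in nhds p, SmoothAt F q

lemma SmoothNear.self {l m : Type*} {F : W → Matrix l m ℂ} {p : W} (h : SmoothNear F p) :
    SmoothAt F p := h.self_of_nhds

/-- The logarithmic derivative `h⁻¹ ∂_ξ h`. -/
def chern (h : W → Matrix m m ℂ) (ξ : W × W) (q : W) : Matrix m m ℂ := (h q)⁻¹ * cdM ξ h q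

/-- The covariant derivative `∂_ξ L + [h⁻¹ ∂_ξ h, L]`. -/
def nab (h L : W → Matrix m m ℂ) (ξ : W × W) (q : W) : Matrix m m ℂ :=
  cdM ξ L q + (chern h ξ q * L q - L q * chern h ξ q)

/-- The adjoint of a matrix with respect to the form `h`. -/
def adj (h X : Matrix m m ℂ) : Matrix m m ℂ := h⁻¹ * Xᴴ * h

/-- The expression of `i Λ F` in a holomorphic frame, for a metric `h`, a Higgs field `θ`, and the
inverse `γ` of the Kähler metric. -/
def higgsP (h : W → Matrix m m ℂ) (θ : ι → W → Matrix m m ℂ) (γ : W → Matrix ι ι ℂ)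
    (ξ : ι → W × W) (q : W) : Matrix m m ℂ :=
  (2 : ℂ) • ∑ j, ∑ k, γ q j k • (-cdM (cj (ξ k)) (chern h (ξ j)) q
    + (θ j q * adj (h q) (θ k q) - adj (h q) (θ k q) * θ j q))

/-- The divergence of the `(1,0)`-form `Tr (A ∂_h L)`. -/
def divT (h A L : W → Matrix m m ℂ) (γ : W → Matrix ι ι ℂ) (ξ : ι → W × W) (q : W) : ℂ :=
  ∑ j, ∑ k, γ q j k * cd (cj (ξ k)) (fun q => (A q * nab h L (ξ j) q).trace) q

/-- The form `2 (∂̄ A, ∂̄ L) + 2 ([θ, A], [θ, L])`. -/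
def formQ (h A L : W → Matrix m m ℂ) (θ : ι → W → Matrix m m ℂ) (γ : W → Matrix ι ι ℂ)
    (ξ : ι → W × W) (q : W) : ℂ :=
  2 * ∑ j, ∑ k, γ q j k * ((cdM (cj (ξ k)) A q * nab h L (ξ j) q).trace
    + ((A q * θ j q - θ j q * A q) *
      (adj (h q) (θ k q) * L q - L q * adj (h q) (θ k q))).trace)

lemma chern_smoothAt {h : W → Matrix m m ℂ} {q : W} (hs : SmoothAt h q)
    (hu : IsUnit (h q).det) (ξ : W × W) : SmoothAt (chern h ξ) q :=
  (hs.inv hu).mul (hs.cdM ξ)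

lemma nab_smoothAt {h L : W → Matrix m m ℂ} {q : W} (hs : SmoothAt h q)
    (hu : IsUnit (h q).det) (hL : SmoothAt L q) (ξ : W × W) : SmoothAt (nab h L ξ) q :=
  (hL.cdM ξ).add (((chern_smoothAt hs hu ξ).mul hL).sub (hL.mul (chern_smoothAt hs hu ξ)))

lemma adj_smoothAt {h X : W → Matrix m m ℂ} {q : W} (hs : SmoothAt h q)
    (hu : IsUnit (h q).det) (hX : SmoothAt X q) : SmoothAt (fun q => adj (h q) (X q)) q :=
  ((hs.inv hu).mul hX.conjTranspose).mul hs

lemma higgsP_smoothAt {h : W → Matrix m m ℂ} {θ : ι → W → Matrix m m ℂ} {γ : W → Matrix ι ι ℂ}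
    {ξ : ι → W × W} {q : W} (hs : SmoothAt h q) (hu : IsUnit (h q).det)
    (hθ : ∀ j, SmoothAt (θ j) q) (hγ : SmoothAt γ q) : SmoothAt (higgsP h θ γ ξ) q := by
  refine SmoothAt.smul contDiffAt_const (SmoothAt.sum fun j _ => SmoothAt.sum fun k _ => ?_)
  refine SmoothAt.smul (hγ j k) (((chern_smoothAt hs hu _).cdM _).neg.add ?_)
  exact ((hθ j).mul (adj_smoothAt hs hu (hθ k))).sub ((adj_smoothAt hs hu (hθ k)).mul (hθ j))

/-- The connection `h⁻¹ dh` is flat. For `ξ` of type `(1,0)` and `η` a parameter direction this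
computes the variation of the Chern connection form; for two parameter directions it measures how
far two logarithmic derivatives are from commuting. -/
lemma cdM_chern {h : W → Matrix m m ℂ} {q : W} (hs : SmoothAt h q) (hu : IsUnit (h q).det)
    (ξ η : W × W) : cdM η (chern h ξ) q = nab h (chern h η) ξ q := by
  have h1 : ∀ ξ η : W × W, cdM η (chern h ξ) q =
      -((h q)⁻¹ * cdM η h q * (h q)⁻¹) * cdM ξ h q + (h q)⁻¹ * cdM η (cdM ξ h) q := fun ξ η => by
    have : chern h ξ = fun q => (h q)⁻¹ * cdM ξ h q := rfl
    rw [this, cdM_mul η (hs.inv hu) (hs.cdM ξ), cdM_inv η hs hu]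
  rw [nab, h1, h1, cdM_comm hs ξ η]
  simp only [chern]
  noncomm_ring

/-- Since `X` is annihilated by the conjugate direction, `Xᴴ` does not vary along `η` and only the
two factors of `h` contribute. Used with `η` a parameter, for the variation of `Θ^*`, and with `η`
of type `(1,0)`, where it says that `Θ^*` is parallel for the `(1,0)` part of the Chern connection.
-/
lemma cdM_adj {h X : W → Matrix m m ℂ} {q : W} (hs : SmoothAt h q) (hu : IsUnit (h q).det)
    (hX : SmoothAt X q) (η : W × W) (h0 : cdM (cj η) X q = 0) :
    cdM η (fun q => adj (h q) (X q)) q =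
      adj (h q) (X q) * chern h η q - chern h η q * adj (h q) (X q) := by
  have e1 := cdM_mul η ((hs.inv hu).mul hX.conjTranspose) hs
  have e2 := cdM_mul η (hs.inv hu) hX.conjTranspose
  have e3 := cdM_conjTranspose η hX
  rw [cj] at h0
  rw [h0, Matrix.conjTranspose_zero] at e3
  simp only [adj]
  rw [e1, e2, e3, cdM_inv η hs hu]
  simp only [chern]
  have : (h q)⁻¹ * (X q)ᴴ * cdM η h q = (h q)⁻¹ * (X q)ᴴ * h q * ((h q)⁻¹ * cdM η h q) := by
    rw [Matrix.mul_assoc _ (h q), Matrix.mul_nonsing_inv_cancel_left _ _ hu]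
  rw [this]
  noncomm_ring

lemma eventually_good {h : W → Matrix m m ℂ} {q : W} (hs : SmoothNear h q)
    (hu : IsUnit (h q).det) : ∀ᶠ q in nhds q, SmoothAt h q ∧ IsUnit (h q).det :=
  hs.and (hs.self.eventually_isUnit hu)

/-- Along `η` only the metric `h` of the bundle varies. The derivative is moved inside `∂̄`, where
`cdM_chern` turns it into a covariant derivative of `h⁻¹ ∂_η h`. -/
lemma cdM_higgsP {h : W → Matrix m m ℂ} {θ : ι → W → Matrix m m ℂ} {γ : W → Matrix ι ι ℂ}
    {ξ : ι → W × W} {q : W} (hs : SmoothNear h q) (hu : IsUnit (h q).det)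
    (hθ : ∀ j, SmoothAt (θ j) q) (hγ : SmoothAt γ q) (η : W × W)
    (hθ0 : ∀ j, cdM η (θ j) q = 0) (hθ1 : ∀ j, cdM (cj η) (θ j) q = 0) (hγ0 : cdM η γ q = 0) :
    cdM η (higgsP h θ γ ξ) q = (2 : ℂ) • ∑ j, ∑ k, γ q j k •
      (-cdM (cj (ξ k)) (nab h (chern h η) (ξ j)) q
        + (θ j q * (adj (h q) (θ k q) * chern h η q - chern h η q * adj (h q) (θ k q))
          - (adj (h q) (θ k q) * chern h η q - chern h η q * adj (h q) (θ k q)) * θ j q)) := by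
  have hs' := hs.self
  have a1 : ∀ j k, SmoothAt (fun q => -cdM (cj (ξ k)) (chern h (ξ j)) q) q := fun j k =>
    ((chern_smoothAt hs' hu _).cdM _).neg
  have a2 : ∀ j k, SmoothAt (fun q => θ j q * adj (h q) (θ k q)) q := fun j k =>
    (hθ j).mul (adj_smoothAt hs' hu (hθ k))
  have a3 : ∀ j k, SmoothAt (fun q => adj (h q) (θ k q) * θ j q) q := fun j k =>
    (adj_smoothAt hs' hu (hθ k)).mul (hθ j)
  have a4 := fun j k => SmoothAt.smul (hγ j k) ((a1 j k).add ((a2 j k).sub (a3 j k)))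
  have e0 : higgsP h θ γ ξ = fun q => (2 : ℂ) • ∑ j, ∑ k, γ q j k •
    (-cdM (cj (ξ k)) (chern h (ξ j)) q
    + (θ j q * adj (h q) (θ k q) - adj (h q) (θ k q) * θ j q)) := rfl
  rw [e0, cdM_smul η contDiffAt_const (SmoothAt.sum fun j _ => SmoothAt.sum fun k _ => a4 j k),
    cd_const, zero_smul, zero_add,
    cdM_sum η (fun j _ => SmoothAt.sum fun k _ => a4 j k)]
  refine congrArg _ (Finset.sum_congr rfl fun j _ => ?_)
  rw [cdM_sum η (fun k _ => a4 j k)]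
  refine Finset.sum_congr rfl fun k _ => ?_
  rw [cdM_smul η (hγ j k) ((a1 j k).add ((a2 j k).sub (a3 j k)))]
  have : cd η (fun q => γ q j k) q = 0 := by
    rw [← cdM_apply, hγ0]; rfl
  rw [this, zero_smul, zero_add, cdM_add η (a1 j k) ((a2 j k).sub (a3 j k)),
    cdM_sub η (a2 j k) (a3 j k), cdM_mul η (hθ j) (adj_smoothAt hs' hu (hθ k)),
    cdM_mul η (adj_smoothAt hs' hu (hθ k)) (hθ j), hθ0 j,
    cdM_adj hs' hu (hθ k) η (hθ1 k), cdM_neg, cdM_comm (chern_smoothAt hs' hu _)]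
  have : cdM (cj (ξ k)) (cdM η (chern h (ξ j))) q
      = cdM (cj (ξ k)) (nab h (chern h η) (ξ j)) q :=
    cdM_congr ((eventually_good hs hu).mono fun q hq => cdM_chern hq.1 hq.2 _ _)
  rw [this]
  simp

/-- The Leibniz rule `Tr (A ∂̄ ∂_h L) = ∂̄ Tr (A ∂_h L) - Tr (∂̄A ∂_h L)`, with `L = h⁻¹ ∂_η h`,
splits off the divergence. With `A = L` it is the second variation; with `A` and `L` two different
logarithmic derivatives it yields closedness of the first. -/
lemma trace_mul_cdM_higgsP {h A : W → Matrix m m ℂ} {θ : ι → W → Matrix m m ℂ}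
    {γ : W → Matrix ι ι ℂ}
    {ξ : ι → W × W} {q : W} (hs : SmoothNear h q) (hu : IsUnit (h q).det)
    (hθ : ∀ j, SmoothAt (θ j) q) (hγ : SmoothAt γ q) (η : W × W)
    (hθ0 : ∀ j, cdM η (θ j) q = 0) (hθ1 : ∀ j, cdM (cj η) (θ j) q = 0) (hγ0 : cdM η γ q = 0)
    (hA : SmoothAt A q) :
    (A q * cdM η (higgsP h θ γ ξ) q).trace =
      -2 * divT h A (chern h η) γ ξ q + formQ h A (chern h η) θ γ ξ q := by
  rw [cdM_higgsP hs hu hθ hγ η hθ0 hθ1 hγ0]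
  simp only [divT, formQ, Matrix.mul_smul, Matrix.trace_smul, Finset.mul_sum,
    Matrix.trace_sum, ← Finset.sum_add_distrib, Finset.smul_sum]
  refine Finset.sum_congr rfl fun j _ => Finset.sum_congr rfl fun k _ => ?_
  have hn := nab_smoothAt hs.self hu (chern_smoothAt hs.self hu η) (ξ j)
  rw [cd_trace _ (hA.mul hn), cdM_mul _ hA hn]
  set T := adj (h q) (θ k q)
  set L := chern h η q
  -- Invariance of the trace form moves the commutator with `θ` from the variation to `A`.
  have h0 : ∀ Z, (A q * (θ j q * Z - Z * θ j q)).trace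
      = ((A q * θ j q - θ j q * A q) * Z).trace := fun Z => by
    rw [Matrix.mul_sub, Matrix.sub_mul, Matrix.trace_sub, Matrix.trace_sub, ← Matrix.mul_assoc,
      ← Matrix.mul_assoc, Matrix.trace_mul_comm (A q * Z), Matrix.mul_assoc (θ j q)]
  have h1 := h0 (T * L - L * T)
  rw [Matrix.mul_add, Matrix.trace_add, h1, Matrix.trace_add, Matrix.mul_neg, Matrix.trace_neg]
  simp only [smul_eq_mul]
  ring

end LocalHiggs

/-! ### Adjoints, and symmetry of the variation on self-adjoint sections. -/

section SelfAdjoint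

variable {W : Type*} [NormedAddCommGroup W] [NormedSpace ℝ W]
variable {m : Type*} [Fintype m] [DecidableEq m] {ι : Type*} [Fintype ι]

lemma adj_mul {h : Matrix m m ℂ} (hu : IsUnit h.det) (X Y : Matrix m m ℂ) :
    adj h (X * Y) = adj h Y * adj h X := by
  simp only [adj, Matrix.conjTranspose_mul, Matrix.mul_assoc,
    Matrix.mul_nonsing_inv_cancel_left _ _ hu]

lemma adj_sub (h X Y : Matrix m m ℂ) : adj h (X - Y) = adj h X - adj h Y := by
  simp only [adj, Matrix.conjTranspose_sub, Matrix.mul_sub, Matrix.sub_mul]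

lemma adj_add (h X Y : Matrix m m ℂ) : adj h (X + Y) = adj h X + adj h Y := by
  simp only [adj, Matrix.conjTranspose_add, Matrix.mul_add, Matrix.add_mul]

lemma adj_smul (h X : Matrix m m ℂ) (c : ℂ) : adj h (c • X) = conj c • adj h X := by
  simp [adj, Matrix.conjTranspose_smul]

lemma adj_sum {κ : Type*} (s : Finset κ) (h : Matrix m m ℂ) (X : κ → Matrix m m ℂ) :
    adj h (∑ i ∈ s, X i) = ∑ i ∈ s, adj h (X i) := by
  simp only [adj, Matrix.conjTranspose_sum, Matrix.mul_sum, Matrix.sum_mul]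

lemma adj_adj {h : Matrix m m ℂ} (hu : IsUnit h.det) (hh : hᴴ = h) (X : Matrix m m ℂ) :
    adj h (adj h X) = X := by
  simp only [adj, Matrix.conjTranspose_mul, Matrix.conjTranspose_nonsing_inv, hh,
    Matrix.conjTranspose_conjTranspose, Matrix.mul_assoc, Matrix.nonsing_inv_mul _ hu,
    Matrix.nonsing_inv_mul_cancel_left _ _ hu, Matrix.mul_one]

lemma trace_adj {h : Matrix m m ℂ} (hu : IsUnit h.det) (X : Matrix m m ℂ) :
    (adj h X).trace = conj X.trace := by
  rw [adj, Matrix.mul_assoc, Matrix.trace_mul_comm, Matrix.mul_assoc,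
    Matrix.mul_nonsing_inv _ hu, Matrix.mul_one, Matrix.trace_conjTranspose]; rfl

lemma adj_eq_self_iff {h : Matrix m m ℂ} (hu : IsUnit h.det) (X : Matrix m m ℂ) :
    adj h X = X ↔ Xᴴ * h = h * X := by
  rw [adj, Matrix.mul_assoc]
  constructor
  · intro e
    nth_rw 2 [← e]
    rw [Matrix.mul_nonsing_inv_cancel_left _ _ hu]
  · intro e
    rw [e, Matrix.nonsing_inv_mul_cancel_left _ _ hu]

lemma cdM_cj_of_hermitian {h : W → Matrix m m ℂ} {q : W} (hs : SmoothAt h q)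
    (hh : ∀ᶠ q in nhds q, (h q)ᴴ = h q) (ξ : W × W) : (cdM ξ h q)ᴴ = cdM (cj ξ) h q := by
  have := cdM_conjTranspose (cj ξ) hs
  rw [cdM_congr hh] at this
  rw [this]; simp [cj]

/-- Differentiate `Aᴴ h = h A`: for a self-adjoint section, `∂̄A` and `∂_h A` are adjoint to each
other. -/
lemma adj_cdM {h A : W → Matrix m m ℂ} {q : W} (hs : SmoothAt h q) (hu : IsUnit (h q).det)
    (hh : ∀ᶠ q in nhds q, (h q)ᴴ = h q) (hA : SmoothAt A q)
    (hAs : ∀ᶠ q in nhds q, (A q)ᴴ * h q = h q * A q) (ξ : W × W) :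
    adj (h q) (cdM (cj ξ) A q) = nab h A ξ q := by
  have e := cdM_congr (ξ := ξ) hAs
  rw [cdM_mul ξ hA.conjTranspose hs, cdM_mul ξ hs hA, cdM_conjTranspose ξ hA] at e
  have e' : (cdM (cj ξ) A q)ᴴ * h q = cdM ξ h q * A q + h q * cdM ξ A q - (A q)ᴴ * cdM ξ h q :=
    eq_sub_of_add_eq e
  rw [adj, Matrix.mul_assoc, e', Matrix.mul_sub, Matrix.mul_add,
    Matrix.nonsing_inv_mul_cancel_left _ _ hu, nab]
  have h2 : (h q)⁻¹ * ((A q)ᴴ * cdM ξ h q) = A q * chern h ξ q := by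
    have := (adj_eq_self_iff hu _).2 hAs.self_of_nhds
    nth_rw 2 [← this]
    rw [adj, chern, Matrix.mul_assoc, Matrix.mul_assoc, Matrix.mul_nonsing_inv_cancel_left _ _ hu]
  rw [h2, chern, Matrix.mul_assoc]
  abel

lemma adj_nab {h A : W → Matrix m m ℂ} {q : W} (hs : SmoothAt h q) (hu : IsUnit (h q).det)
    (hh : ∀ᶠ q in nhds q, (h q)ᴴ = h q) (hA : SmoothAt A q)
    (hAs : ∀ᶠ q in nhds q, (A q)ᴴ * h q = h q * A q) (ξ : W × W) :
    adj (h q) (nab h A ξ q) = cdM (cj ξ) A q := by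
  rw [← adj_cdM hs hu hh hA hAs, adj_adj hu hh.self_of_nhds]

/-- The trace of an adjoint is the conjugate trace. Taking adjoints exchanges `∂̄` with `∂_h` and
`θ` with `θ^*` and reverses products, while the Hermitian matrix `γ` absorbs the exchange of the two
indices. -/
lemma conj_formQ {h A L : W → Matrix m m ℂ} {θ : ι → W → Matrix m m ℂ} {γ : W → Matrix ι ι ℂ}
    {ξ : ι → W × W} {q : W} (hs : SmoothAt h q) (hu : IsUnit (h q).det)
    (hh : ∀ᶠ q in nhds q, (h q)ᴴ = h q) (hγ : (γ q)ᴴ = γ q) (hA : SmoothAt A q)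
    (hAs : ∀ᶠ q in nhds q, (A q)ᴴ * h q = h q * A q) (hL : SmoothAt L q)
    (hLs : ∀ᶠ q in nhds q, (L q)ᴴ * h q = h q * L q) :
    conj (formQ h A L θ γ ξ q) = formQ h L A θ γ ξ q := by
  have hA' := (adj_eq_self_iff hu _).2 hAs.self_of_nhds
  have hL' := (adj_eq_self_iff hu _).2 hLs.self_of_nhds
  have hγ' : ∀ j k, conj (γ q j k) = γ q k j := fun j k => congrFun (congrFun hγ k) j
  simp only [formQ, map_mul, map_sum, map_add, map_ofNat, hγ', ← trace_adj hu, adj_mul hu,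
    adj_sub, adj_nab hs hu hh hL hLs, adj_cdM hs hu hh hA hAs, hA', hL',
    adj_adj hu hh.self_of_nhds]
  rw [Finset.sum_comm]

/-- After multiplication by `h`, the curvature term is `∂̄_k ∂_j h - ∂̄_k h h⁻¹ ∂_j h`, whose
conjugate transpose is the same expression with `j` and `k` exchanged. Summation against a Hermitian
`γ` undoes the exchange. -/
lemma higgsP_selfAdjoint {h : W → Matrix m m ℂ} {θ : ι → W → Matrix m m ℂ}
    {γ : W → Matrix ι ι ℂ} {ξ : ι → W × W} {q : W} (hs : SmoothNear h q) (hu : IsUnit (h q).det)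
    (hh : ∀ᶠ q in nhds q, (h q)ᴴ = h q) (hγ : (γ q)ᴴ = γ q) :
    adj (h q) (higgsP h θ γ ξ q) = higgsP h θ γ ξ q := by
  have hγ' : ∀ j k, conj (γ q j k) = γ q k j := fun j k => congrFun (congrFun hγ k) j
  have hc : ∀ j k, adj (h q) (-cdM (cj (ξ k)) (chern h (ξ j)) q)
      = -cdM (cj (ξ j)) (chern h (ξ k)) q := by
    intro j k
    have hs' := hs.self
    have h1 : ∀ j k, cdM (cj (ξ k)) (chern h (ξ j)) q = (h q)⁻¹ *
        (cdM (cj (ξ k)) (cdM (ξ j) h) q - cdM (cj (ξ k)) h q * (h q)⁻¹ * cdM (ξ j) h q) := by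
      intro j k
      have : chern h (ξ j) = fun q => (h q)⁻¹ * cdM (ξ j) h q := rfl
      rw [this, cdM_mul _ (hs'.inv hu) (hs'.cdM _), cdM_inv _ hs' hu]
      noncomm_ring
    have hinv : ((h q)⁻¹)ᴴ = (h q)⁻¹ := by
      rw [Matrix.conjTranspose_nonsing_inv, hh.self_of_nhds]
    have h2 : (cdM (cj (ξ k)) (cdM (ξ j) h) q)ᴴ = cdM (cj (ξ j)) (cdM (ξ k) h) q := by
      have := cdM_conjTranspose (ξ k) (hs'.cdM (ξ j))
      rw [show (cdM (cj (ξ k)) (cdM (ξ j) h) q)ᴴ = _ from this.symm,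
        cdM_congr (G := cdM (cj (ξ j)) h), cdM_comm hs']
      filter_upwards [hs, hh.eventually_nhds] with q hq hq' using cdM_cj_of_hermitian hq hq' _
    rw [h1, h1, adj, Matrix.conjTranspose_neg, Matrix.conjTranspose_mul, hinv,
      Matrix.conjTranspose_sub, h2, Matrix.conjTranspose_mul, Matrix.conjTranspose_mul, hinv,
      cdM_cj_of_hermitian hs' hh, cdM_cj_of_hermitian hs' hh, cj_cj, Matrix.mul_assoc,
      Matrix.neg_mul, Matrix.mul_assoc, Matrix.nonsing_inv_mul _ hu, Matrix.mul_one,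
      Matrix.mul_neg, Matrix.mul_assoc]
  simp only [higgsP, adj_smul, adj_sum, adj_add, adj_sub, hc, adj_mul hu,
    adj_adj hu hh.self_of_nhds, hγ', map_ofNat]
  rw [Finset.sum_comm]

lemma chern_selfAdjoint {h : W → Matrix m m ℂ} {q : W} (hs : SmoothAt h q)
    (hu : IsUnit (h q).det) (hh : ∀ᶠ q in nhds q, (h q)ᴴ = h q) (η : W × W) (hη : cj η = η) :
    (chern h η q)ᴴ * h q = h q * chern h η q := by
  rw [chern, Matrix.conjTranspose_mul, Matrix.conjTranspose_nonsing_inv, hh.self_of_nhds,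
    cdM_cj_of_hermitian hs hh, hη, Matrix.mul_assoc, Matrix.nonsing_inv_mul _ hu,
    Matrix.mul_one, Matrix.mul_nonsing_inv_cancel_left _ _ hu]

lemma trace_mul_real {h X Y : Matrix m m ℂ} (hu : IsUnit h.det) (hX : adj h X = X)
    (hY : adj h Y = Y) : conj (X * Y).trace = (X * Y).trace := by
  rw [← trace_adj hu, adj_mul hu, hX, hY, Matrix.trace_mul_comm]

/-- The one-form `L ↦ Tr (L i Λ F)` on the space of metrics is closed up to divergences. -/
lemma re_cd_trace_sub {h : W → Matrix m m ℂ} {θ : ι → W → Matrix m m ℂ} {γ : W → Matrix ι ι ℂ}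
    {ξ : ι → W × W} {q : W} (hs : SmoothNear h q) (hu : IsUnit (h q).det)
    (hh : ∀ᶠ q in nhds q, (h q)ᴴ = h q) (hγh : (γ q)ᴴ = γ q)
    (hθ : ∀ j, SmoothAt (θ j) q) (hγ : SmoothAt γ q) (η ζ : W × W)
    (hη : cj η = η) (hζ : cj ζ = ζ)
    (hθη : ∀ j, cdM η (θ j) q = 0) (hγη : cdM η γ q = 0)
    (hθζ : ∀ j, cdM ζ (θ j) q = 0) (hγζ : cdM ζ γ q = 0) :
    (cd ζ (fun q => (chern h η q * higgsP h θ γ ξ q).trace) q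
      - cd η (fun q => (chern h ζ q * higgsP h θ γ ξ q).trace) q).re =
    (-2 * divT h (chern h η) (chern h ζ) γ ξ q + 2 * divT h (chern h ζ) (chern h η) γ ξ q).re := by
  have hs' := hs.self
  have hP := higgsP_smoothAt (ξ := ξ) hs' hu hθ hγ
  have hcη := chern_smoothAt hs' hu η
  have hcζ := chern_smoothAt hs' hu ζ
  have ev := (eventually_good hs hu).and hh.eventually_nhds
  have sη : ∀ᶠ q in nhds q, (chern h η q)ᴴ * h q = h q * chern h η q :=
    ev.mono fun q hq => chern_selfAdjoint hq.1.1 hq.1.2 hq.2 η hη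
  have sζ : ∀ᶠ q in nhds q, (chern h ζ q)ᴴ * h q = h q * chern h ζ q :=
    ev.mono fun q hq => chern_selfAdjoint hq.1.1 hq.1.2 hq.2 ζ hζ
  have aη := (adj_eq_self_iff hu _).2 sη.self_of_nhds
  have aζ := (adj_eq_self_iff hu _).2 sζ.self_of_nhds
  have aP := higgsP_selfAdjoint (θ := θ) (ξ := ξ) hs hu hh hγh
  rw [cd_trace _ (hcη.mul hP), cd_trace _ (hcζ.mul hP), cdM_mul _ hcη hP, cdM_mul _ hcζ hP,
    Matrix.trace_add, Matrix.trace_add,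
    trace_mul_cdM_higgsP hs hu hθ hγ ζ hθζ (by rwa [hζ]) hγζ hcη,
    trace_mul_cdM_higgsP hs hu hθ hγ η hθη (by rwa [hη]) hγη hcζ]
  have hQ := conj_formQ (θ := θ) (γ := γ) (ξ := ξ) hs' hu hh hγh hcη sη hcζ sζ
  have hQ' := congrArg Complex.re hQ
  rw [Complex.conj_re] at hQ'
  have hc : cdM ζ (chern h η) q = cdM η (chern h ζ) q + (chern h η q * chern h ζ q -
      chern h ζ q * chern h η q) := by
    rw [cdM_chern hs' hu, nab]
  -- The commutator of two self-adjoint matrices is anti-self-adjoint, so its trace against the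
  -- self-adjoint `i Λ F` is imaginary and disappears from the real part.
  have hI : ((chern h η q * chern h ζ q - chern h ζ q * chern h η q) *
      higgsP h θ γ ξ q).trace.re = 0 := by
    have : conj ((chern h η q * chern h ζ q - chern h ζ q * chern h η q) *
      higgsP h θ γ ξ q).trace = -((chern h η q * chern h ζ q - chern h ζ q * chern h η q) *
      higgsP h θ γ ξ q).trace := by
      rw [← trace_adj hu, adj_mul hu, adj_sub, adj_mul hu, adj_mul hu, aη, aζ, aP,
        Matrix.trace_mul_comm, ← Matrix.trace_neg]
      congr 1
      noncomm_ring
    have := congrArg Complex.re this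
    simp only [Complex.conj_re, Complex.neg_re] at this
    linarith
  rw [hc, Matrix.add_mul, Matrix.trace_add]
  simp only [Complex.add_re, Complex.sub_re, neg_mul, Complex.neg_re] at *
  linarith

end SelfAdjoint

/-! ### Change of frame for vectors, forms and endomorphisms. -/

section Frames

variable {d n : ℕ} {X : Type*} [TopologicalSpace X] [ChartedSpace (Fin d → ℂ) X]
  {E : X → Type*} [∀ x, AddCommGroup (E x)] [∀ x, Module ℂ (E x)]
  [TopologicalSpace (TotalSpace (Fin n → ℂ) E)] [∀ x, TopologicalSpace (E x)]
  [FiberBundle (Fin n → ℂ) E] [VectorBundle ℂ (Fin n → ℂ) E]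

variable (n E) in
/-- The domain of the frame around `x`. -/
abbrev frameSet (x : X) : Set X := (trivializationAt (Fin n → ℂ) E x).baseSet

lemma mem_frameSet (x : X) : x ∈ frameSet n E x := FiberBundle.mem_baseSet_trivializationAt' x

variable (n E) in
/-- The matrix expressing the frame around `x₁` in the frame around `x₀`. -/
def frameChange (x₀ x₁ y : X) : Matrix (Fin n) (Fin n) ℂ :=
  LinearMap.toMatrix' ((trivializationAt (Fin n → ℂ) E x₀).linearMapAt ℂ y ∘ₗ
    (trivializationAt (Fin n → ℂ) E x₁).symmₗ ℂ y)

lemma linearMapAt_symm_comp {x y : X} (h : y ∈ frameSet n E x) :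
    (trivializationAt (Fin n → ℂ) E x).linearMapAt ℂ y ∘ₗ
      (trivializationAt (Fin n → ℂ) E x).symmₗ ℂ y = LinearMap.id := by
  refine LinearMap.ext fun v => ?_
  simpa using Trivialization.linearMapAt_symmₗ (R := ℂ) _ h v

lemma frameChange_self {x y : X} (h : y ∈ frameSet n E x) : frameChange n E x x y = 1 := by
  rw [frameChange, linearMapAt_symm_comp h, LinearMap.toMatrix'_id]

lemma frameChange_mul {x₀ x₁ x₂ y : X} (h : y ∈ frameSet n E x₁) :
    frameChange n E x₀ x₁ y * frameChange n E x₁ x₂ y = frameChange n E x₀ x₂ y := by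
  rw [frameChange, frameChange, ← LinearMap.toMatrix'_comp, frameChange]
  congr 1
  refine LinearMap.ext fun v => ?_
  simp only [LinearMap.comp_apply]
  rw [Trivialization.symmₗ_linearMapAt _ h]

lemma frameChange_mul_cancel {x₀ x₁ y : X} (h₀ : y ∈ frameSet n E x₀) (h₁ : y ∈ frameSet n E x₁) :
    frameChange n E x₀ x₁ y * frameChange n E x₁ x₀ y = 1 := by
  rw [frameChange_mul h₁, frameChange_self h₀]

lemma frameChange_isUnit {x₀ x₁ y : X} (h₀ : y ∈ frameSet n E x₀) (h₁ : y ∈ frameSet n E x₁) :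
    IsUnit (frameChange n E x₀ x₁ y).det :=
  (Matrix.isUnit_iff_isUnit_det _).1 (IsUnit.of_mul_eq_one _ (frameChange_mul_cancel h₀ h₁))

lemma frameChange_inv {x₀ x₁ y : X} (h₀ : y ∈ frameSet n E x₀) (h₁ : y ∈ frameSet n E x₁) :
    (frameChange n E x₀ x₁ y)⁻¹ = frameChange n E x₁ x₀ y :=
  Matrix.inv_eq_left_inv (frameChange_mul_cancel h₁ h₀)

lemma symm_eq_symm_frameChange {x₀ x₁ y : X} (h₀ : y ∈ frameSet n E x₀) (v : Fin n → ℂ) :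
    (trivializationAt (Fin n → ℂ) E x₁).symmₗ ℂ y v =
      (trivializationAt (Fin n → ℂ) E x₀).symmₗ ℂ y (frameChange n E x₀ x₁ y *ᵥ v) := by
  rw [frameChange, LinearMap.toMatrix'_mulVec, LinearMap.comp_apply,
    Trivialization.symmₗ_linearMapAt _ h₀]

lemma form_symm {x y : X} (h : y ∈ frameSet n E x) (H : FormField E) (v w : Fin n → ℂ) :
    H y ((trivializationAt (Fin n → ℂ) E x).symmₗ ℂ y v)
      ((trivializationAt (Fin n → ℂ) E x).symmₗ ℂ y w) = star v ⬝ᵥ (gram n H x y *ᵥ w) := by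
  have hv : ∀ v : Fin n → ℂ, (trivializationAt (Fin n → ℂ) E x).symmₗ ℂ y v =
      ∑ i, v i • localFrame n E x y i := fun v => by
    conv_lhs => rw [pi_eq_sum_univ' v]
    rw [map_sum]
    refine Finset.sum_congr rfl fun i _ => ?_
    rw [map_smul, localFrame, Trivialization.symmₗ_apply _ h]
  rw [hv, hv]
  simp only [map_sum, LinearMap.sum_apply, LinearMap.map_smulₛₗ, LinearMap.smul_apply, map_smul,
    dotProduct, Matrix.mulVec, gram, Matrix.of_apply, Finset.mul_sum, smul_eq_mul, Pi.star_apply]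
  rw [Finset.sum_comm]
  refine Finset.sum_congr rfl fun i _ => ?_
  refine Finset.sum_congr rfl fun j _ => ?_
  simp only [starRingEnd_apply]
  ring

lemma gram_frameChange {x₀ x₁ y : X} (h₀ : y ∈ frameSet n E x₀) (h₁ : y ∈ frameSet n E x₁)
    (H : FormField E) :
    gram n H x₁ y = (frameChange n E x₀ x₁ y)ᴴ * gram n H x₀ y * frameChange n E x₀ x₁ y := by
  ext i j
  have : gram n H x₁ y i j = H y ((trivializationAt (Fin n → ℂ) E x₁).symmₗ ℂ y (Pi.single i 1))
      ((trivializationAt (Fin n → ℂ) E x₁).symmₗ ℂ y (Pi.single j 1)) := by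
    rw [Trivialization.symmₗ_apply _ h₁, Trivialization.symmₗ_apply _ h₁]; rfl
  simp only [this, symm_eq_symm_frameChange (x₁ := x₁) h₀, form_symm h₀]
  simp only [Matrix.mulVec_single_one, Matrix.mul_apply, dotProduct, Matrix.mulVec, Matrix.col_apply,
    Matrix.conjTranspose_apply, Finset.sum_mul, Pi.star_apply, Finset.mul_sum]
  rw [Finset.sum_comm]
  simp [Pi.single_apply, mul_assoc]

lemma endCoord_mul {x y : X} (h : y ∈ frameSet n E x) (A B : Module.End ℂ (E y)) :
    endCoord n x y (A * B) = endCoord n x y A * endCoord n x y B := by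
  rw [endCoord, endCoord, endCoord, ← LinearMap.toMatrix'_comp]
  congr 1
  refine LinearMap.ext fun v => ?_
  simp [Trivialization.symmₗ_linearMapAt _ h]

lemma endCoord_one {x y : X} (h : y ∈ frameSet n E x) :
    endCoord n x y (1 : Module.End ℂ (E y)) = 1 := by
  rw [endCoord, Module.End.one_eq_id, LinearMap.id_comp, linearMapAt_symm_comp h,
    LinearMap.toMatrix'_id]

/-- The matrix of an endomorphism of a fibre, as a linear map. -/
def endCoordₗ (x y : X) : Module.End ℂ (E y) →ₗ[ℂ] Matrix (Fin n) (Fin n) ℂ where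
  toFun := endCoord n x y
  map_add' A B := by simp [endCoord, LinearMap.add_comp, LinearMap.comp_add]
  map_smul' c A := by simp [endCoord, LinearMap.smul_comp, LinearMap.comp_smul]

lemma endCoord_add (x y : X) (A B : Module.End ℂ (E y)) :
    endCoord n x y (A + B) = endCoord n x y A + endCoord n x y B := map_add (endCoordₗ x y) A B

lemma endCoord_sub (x y : X) (A B : Module.End ℂ (E y)) :
    endCoord n x y (A - B) = endCoord n x y A - endCoord n x y B := map_sub (endCoordₗ x y) A B

lemma endCoord_smul (x y : X) (c : ℂ) (A : Module.End ℂ (E y)) :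
    endCoord n x y (c • A) = c • endCoord n x y A := map_smul (endCoordₗ x y) c A

lemma endCoord_frameChange {x₀ x₁ y : X} (h₀ : y ∈ frameSet n E x₀) (h₁ : y ∈ frameSet n E x₁)
    (A : Module.End ℂ (E y)) : endCoord n x₁ y A =
      (frameChange n E x₀ x₁ y)⁻¹ * endCoord n x₀ y A * frameChange n E x₀ x₁ y := by
  rw [frameChange_inv h₀ h₁, endCoord, endCoord, frameChange, frameChange,
    ← LinearMap.toMatrix'_comp, ← LinearMap.toMatrix'_comp]
  congr 1
  refine LinearMap.ext fun v => ?_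
  simp [Trivialization.symmₗ_linearMapAt _ h₀]

lemma endCoord_endOfCoord (x : X) (A : Matrix (Fin n) (Fin n) ℂ) :
    endCoord n x x (endOfCoord x A : Module.End ℂ (E x)) = A := by
  have h := mem_frameSet (n := n) (E := E) x
  have : (trivializationAt (Fin n → ℂ) E x).linearMapAt ℂ x ∘ₗ endOfCoord x A ∘ₗ
      (trivializationAt (Fin n → ℂ) E x).symmₗ ℂ x = Matrix.toLin' A := by
    refine LinearMap.ext fun v => ?_
    simp only [endOfCoord, LinearMap.comp_apply]
    rw [Trivialization.linearMapAt_symmₗ _ h, Trivialization.linearMapAt_symmₗ _ h]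
  rw [endCoord, this, LinearMap.toMatrix'_toLin']

lemma endOfCoord_endCoord (x : X) (A : Module.End ℂ (E x)) :
    endOfCoord x (endCoord n x x A) = A := by
  have h := mem_frameSet (n := n) (E := E) x
  rw [endOfCoord, endCoord, Matrix.toLin'_toMatrix']
  refine LinearMap.ext fun v => ?_
  simp only [LinearMap.comp_apply]
  rw [Trivialization.symmₗ_linearMapAt _ h, Trivialization.symmₗ_linearMapAt _ h]

lemma endCoord_injective (x : X) :
    Function.Injective (endCoord n x x : Module.End ℂ (E x) → _) :=
  Function.LeftInverse.injective (endOfCoord_endCoord x)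

lemma trace_eq_trace_endCoord {x y : X} (h : y ∈ frameSet n E x) (A : Module.End ℂ (E y)) :
    LinearMap.trace ℂ (E y) A = (endCoord n x y A).trace := by
  let e : E y ≃ₗ[ℂ] (Fin n → ℂ) := (trivializationAt (Fin n → ℂ) E x).linearEquivAt ℂ y h
  have : endCoord n x y A = LinearMap.toMatrix' (e.conj A) := by
    rw [endCoord]
    congr 1
    refine LinearMap.ext fun v => ?_
    simp only [LinearMap.comp_apply, LinearEquiv.conj_apply, LinearEquiv.coe_coe]
    rw [Trivialization.linearMapAt_apply, if_pos h, Trivialization.symmₗ_apply _ h]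
    rfl
  rw [this, ← LinearMap.trace_conj' A e, LinearMap.trace_eq_matrix_trace ℂ (Pi.basisFun ℂ (Fin n))]
  rfl

end Frames

/-! ### Holomorphic transition maps of charts and of frames. -/

section Charts

variable {d n : ℕ} {X : Type*} [TopologicalSpace X] [ChartedSpace (Fin d → ℂ) X]

lemma isManifold_real [IsManifold 𝓘(ℂ, Fin d → ℂ) ω X] : IsManifold 𝓘(ℝ, Fin d → ℂ) ∞ X := by
  refine isManifold_of_contDiffOn _ _ _ fun e e' he he' => ?_
  obtain ⟨h, -⟩ := (contDiffGroupoid ω 𝓘(ℂ, Fin d → ℂ)).compatible he he'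
  exact (ContDiffOn.restrict_scalars ℝ h).of_le le_top

lemma contDiffAt_comp_chart_symm {𝕜 : Type*} [NontriviallyNormedField 𝕜]
    [NormedSpace 𝕜 (Fin d → ℂ)] {F : Type*}
    [NormedAddCommGroup F] [NormedSpace 𝕜 F] {k : ℕ∞ω} [IsManifold 𝓘(𝕜, Fin d → ℂ) k X]
    {f : X → F} {x y : X} (hf : ContMDiffAt 𝓘(𝕜, Fin d → ℂ) 𝓘(𝕜, F) k f y)
    (hy : y ∈ (chartAt (Fin d → ℂ) x).source) :
    ContDiffAt 𝕜 k (fun z => f ((chartAt (Fin d → ℂ) x).symm z)) (chartAt (Fin d → ℂ) x y) := by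
  have h1 : ContMDiffAt 𝓘(𝕜, Fin d → ℂ) 𝓘(𝕜, Fin d → ℂ) k (chartAt (Fin d → ℂ) x).symm
      (chartAt (Fin d → ℂ) x y) :=
    contMDiffOn_chart_symm.contMDiffAt
      ((chartAt (Fin d → ℂ) x).open_target.mem_nhds ((chartAt (Fin d → ℂ) x).map_source hy))
  rw [← contMDiffAt_iff_contDiffAt]
  refine ContMDiffAt.comp (chartAt (Fin d → ℂ) x y) ?_ h1
  rwa [(chartAt (Fin d → ℂ) x).left_inv hy]

/-- The transition map from the chart around `x₁` to the chart around `x₀`. -/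
def chartChange (x₀ x₁ : X) (z : Fin d → ℂ) : Fin d → ℂ :=
  chartAt (Fin d → ℂ) x₀ ((chartAt (Fin d → ℂ) x₁).symm z)

lemma contDiffAt_chartChange [IsManifold 𝓘(ℂ, Fin d → ℂ) ω X] {x₀ x₁ y : X}
    (h₀ : y ∈ (chartAt (Fin d → ℂ) x₀).source) (h₁ : y ∈ (chartAt (Fin d → ℂ) x₁).source) :
    ContDiffAt ℂ ω (chartChange x₀ x₁) (chartAt (Fin d → ℂ) x₁ y) :=
  contDiffAt_comp_chart_symm (contMDiffOn_chart.contMDiffAt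
    ((chartAt (Fin d → ℂ) x₀).open_source.mem_nhds h₀)) h₁

lemma chartChange_apply {x₀ x₁ y : X} (h₁ : y ∈ (chartAt (Fin d → ℂ) x₁).source) :
    chartChange x₀ x₁ (chartAt (Fin d → ℂ) x₁ y) = chartAt (Fin d → ℂ) x₀ y := by
  rw [chartChange, (chartAt (Fin d → ℂ) x₁).left_inv h₁]

/-- The coordinate change of the tangent bundle is the complex derivative of the transition map.
This ties the components of `g` and `Θ`, taken in trivializations of the tangent bundle, to
derivatives of functions in charts. -/
lemma frameChange_tang [IsManifold 𝓘(ℂ, Fin d → ℂ) 1 X] {x₀ x₁ y : X}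
    (h₀ : y ∈ (chartAt (Fin d → ℂ) x₀).source) (h₁ : y ∈ (chartAt (Fin d → ℂ) x₁).source)
    (v : Fin d → ℂ) :
    frameChange d (Tang d X) x₀ x₁ y *ᵥ v
      = fderiv ℂ (chartChange x₀ x₁) (chartAt (Fin d → ℂ) x₁ y) v := by
  have e1 : frameChange d (Tang d X) x₀ x₁ y *ᵥ v =
      (trivializationAt (Fin d → ℂ) (Tang d X) x₁).coordChangeL ℂ
        (trivializationAt (Fin d → ℂ) (Tang d X) x₀) y v := by
    rw [frameChange, LinearMap.toMatrix'_mulVec, LinearMap.comp_apply,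
      Trivialization.coordChangeL_apply _ _ ⟨h₁, h₀⟩, Trivialization.symmₗ_apply _ h₁,
      Trivialization.linearMapAt_apply, if_pos (by exact h₀)]
  have e2 := (tangentBundleCore 𝓘(ℂ, Fin d → ℂ) X).trivializationAt_coordChange_eq
    (b₀ := x₁) (b₁ := x₀) (b := y) ⟨h₁, h₀⟩ v
  rw [e1]
  refine e2.trans ?_
  have e3 := tangentBundleCore_coordChange_achart (I := 𝓘(ℂ, Fin d → ℂ)) x₁ x₀ y
  refine (congrArg (fun f => f v) e3).trans ?_
  simp only [modelWithCornersSelf_coe, Set.range_id, fderivWithin_univ]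
  rfl

lemma tangVec_eq [IsManifold 𝓘(ℂ, Fin d → ℂ) 1 X] {x₀ x₁ y : X}
    (h₀ : y ∈ (chartAt (Fin d → ℂ) x₀).source) (h₁ : y ∈ (chartAt (Fin d → ℂ) x₁).source)
    (v : Fin d → ℂ) : tangVec x₁ y v =
      tangVec x₀ y (fderiv ℂ (chartChange x₀ x₁) (chartAt (Fin d → ℂ) x₁ y) v) := by
  have := symm_eq_symm_frameChange (n := d) (E := Tang d X) (x₀ := x₀) (x₁ := x₁) (y := y) h₀ v
  rw [frameChange_tang h₀ h₁, Trivialization.symmₗ_apply _ h₁, Trivialization.symmₗ_apply _ h₀]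
    at this
  exact this

variable {E : X → Type*} [∀ x, AddCommGroup (E x)] [∀ x, Module ℂ (E x)]
  [TopologicalSpace (TotalSpace (Fin n → ℂ) E)] [∀ x, TopologicalSpace (E x)]
  [FiberBundle (Fin n → ℂ) E] [VectorBundle ℂ (Fin n → ℂ) E]

lemma contDiffAt_frameChange [IsManifold 𝓘(ℂ, Fin d → ℂ) ω X]
    [ContMDiffVectorBundle ω (Fin n → ℂ) E 𝓘(ℂ, Fin d → ℂ)] {x x₀ x₁ y : X}
    (hx : y ∈ (chartAt (Fin d → ℂ) x).source)
    (h₀ : y ∈ frameSet n E x₀) (h₁ : y ∈ frameSet n E x₁) (i j : Fin n) :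
    ContDiffAt ℂ ω (fun z => frameChange n E x₀ x₁ ((chartAt (Fin d → ℂ) x).symm z) i j)
      (chartAt (Fin d → ℂ) x y) := by
  have h := contMDiffAt_coordChangeL (IB := 𝓘(ℂ, Fin d → ℂ)) (n := ω)
    (e := trivializationAt (Fin n → ℂ) E x₁) (e' := trivializationAt (Fin n → ℂ) E x₀) h₁ h₀
  have h2 := contDiffAt_comp_chart_symm h hx
  have h3 := h2.clm_apply (contDiffAt_const (c := (Pi.single j 1 : Fin n → ℂ)))
  have h4 := (contDiffAt_pi.1 h3) i
  refine h4.congr_of_eventuallyEq ?_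
  have hc : ContinuousAt (chartAt (Fin d → ℂ) x).symm (chartAt (Fin d → ℂ) x y) :=
    (chartAt (Fin d → ℂ) x).continuousAt_symm ((chartAt (Fin d → ℂ) x).map_source hx)
  have ho := (trivializationAt (Fin n → ℂ) E x₀).open_baseSet.inter
    (trivializationAt (Fin n → ℂ) E x₁).open_baseSet
  have := hc.preimage_mem_nhds (t := frameSet n E x₀ ∩ frameSet n E x₁)
    (ho.mem_nhds (by rw [(chartAt (Fin d → ℂ) x).left_inv hx]; exact ⟨h₀, h₁⟩))
  filter_upwards [this] with z hz
  rw [frameChange, LinearMap.toMatrix'_apply, LinearMap.comp_apply,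
      Trivialization.symmₗ_apply _ hz.2, Trivialization.linearMapAt_apply, if_pos hz.1]
  have := Trivialization.coordChangeL_apply (R := ℂ) (trivializationAt (Fin n → ℂ) E x₁)
    (trivializationAt (Fin n → ℂ) E x₀) ⟨hz.2, hz.1⟩ (Pi.single j 1)
  exact (congrFun this i).symm

end Charts

/-! ### Holomorphic, antiholomorphic and parameter directions on `P × ℂ^d`. -/

section Directions

variable {P : Type*} [NormedAddCommGroup P] [NormedSpace ℝ P] {d : ℕ}

variable (P) in
/-- The `(1,0)`-part of a tangent vector of `ℂ^d`, as a complex tangent vector of `P × ℂ^d`. -/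
def dh (v : Fin d → ℂ) : (P × (Fin d → ℂ)) × (P × (Fin d → ℂ)) :=
  ((0, (1 / 2 : ℝ) • v), (0, -((1 / 2 : ℝ) • (I • v))))

/-- A parameter direction, as a complex tangent vector of `P × ℂ^d`. -/
def dp (e : P) : (P × (Fin d → ℂ)) × (P × (Fin d → ℂ)) := ((e, 0), (0, 0))

variable (P d) in
/-- The coordinate vector fields of type `(1,0)`. -/
abbrev dhb (j : Fin d) : (P × (Fin d → ℂ)) × (P × (Fin d → ℂ)) := dh P (Pi.single j 1)

lemma cj_dp (e : P) : cj (dp e : (P × (Fin d → ℂ)) × (P × (Fin d → ℂ))) = dp e := by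
  simp [cj, dp]

lemma cd_dp (e : P) (f : P × (Fin d → ℂ) → ℂ) (q) : cd (dp e) f q = fderiv ℝ f q (e, 0) := by
  simp [cd, dp, ← Prod.zero_eq_mk]

lemma fderiv_slice {f : P × (Fin d → ℂ) → ℂ} {q : P × (Fin d → ℂ)} (hf : DifferentiableAt ℝ f q)
    (v : Fin d → ℂ) : fderiv ℝ (fun z => f (q.1, z)) q.2 v = fderiv ℝ f q (0, v) := by
  have h : HasFDerivAt (fun z : Fin d → ℂ => (q.1, z))
      ((0 : (Fin d → ℂ) →L[ℝ] P).prod (ContinuousLinearMap.id ℝ _)) q.2 :=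
    (hasFDerivAt_const q.1 q.2).prodMk (hasFDerivAt_id q.2)
  have := (HasFDerivAt.comp q.2 (f := fun z : Fin d → ℂ => (q.1, z)) (g := f) hf.hasFDerivAt h)
  rw [show (fun z => f (q.1, z)) = f ∘ fun z : Fin d → ℂ => (q.1, z) from rfl, this.fderiv]
  simp

lemma del_slice {f : P × (Fin d → ℂ) → ℂ} {q : P × (Fin d → ℂ)} (hf : DifferentiableAt ℝ f q)
    (v : Fin d → ℂ) : del (fun z => f (q.1, z)) q.2 v = cd (dh P v) f q := by
  have h1 : ((0 : P), (1 / 2 : ℝ) • v) = (1 / 2 : ℝ) • ((0 : P), v) := by simp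
  have h2 : ((0 : P), -((1 / 2 : ℝ) • (I • v))) = -((1 / 2 : ℝ) • ((0 : P), I • v)) := by simp
  simp only [del, cd, dh, fderiv_slice hf]
  rw [h1, h2, map_neg, map_smul, map_smul]
  simp only [Complex.real_smul]; push_cast; ring

lemma delbar_slice {f : P × (Fin d → ℂ) → ℂ} {q : P × (Fin d → ℂ)} (hf : DifferentiableAt ℝ f q)
    (v : Fin d → ℂ) : delbar (fun z => f (q.1, z)) q.2 v = cd (cj (dh P v)) f q := by
  have h1 : ((0 : P), (1 / 2 : ℝ) • v) = (1 / 2 : ℝ) • ((0 : P), v) := by simp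
  have h2 : ((0 : P), -((1 / 2 : ℝ) • (I • v))) = -((1 / 2 : ℝ) • ((0 : P), I • v)) := by simp
  simp only [delbar, cd, dh, cj, fderiv_slice hf]
  rw [h1, h2, map_neg, map_neg, map_smul, map_smul]
  simp only [Complex.real_smul]; push_cast; ring

lemma dh_add (v w : Fin d → ℂ) : dh P (v + w) = dh P v + dh P w := by
  simp [dh, smul_add]; abel

lemma cd_add_vec {W : Type*} [NormedAddCommGroup W] [NormedSpace ℝ W] (ξ η : W × W) (f : W → ℂ)
    (q : W) : cd (ξ + η) f q = cd ξ f q + cd η f q := by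
  simp [cd]; ring

lemma cd_dh_smul (c : ℂ) (v : Fin d → ℂ) (f : P × (Fin d → ℂ) → ℂ) (q) :
    cd (dh P (c • v)) f q = c * cd (dh P v) f q := by
  have e : ∀ u : Fin d → ℂ, c • u = c.re • u + c.im • (I • u) := fun u => by
    ext i; apply Complex.ext <;> simp [sub_eq_add_neg]
  have e2 : I • I • v = -v := by rw [smul_smul, I_mul_I, neg_one_smul]
  have key : ∀ u : Fin d → ℂ, fderiv ℝ f q (0, c • u) =
      c.re * fderiv ℝ f q (0, u) + c.im * fderiv ℝ f q (0, I • u) := fun u => by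
    have : ((0 : P), c • u) = c.re • ((0 : P), u) + c.im • ((0 : P), I • u) := by
      rw [e u]; simp
    rw [this, map_add, map_smul, map_smul]
    simp
  have hv : ∀ r : ℝ, ∀ u : Fin d → ℂ, fderiv ℝ f q (0, r • u) = r * fderiv ℝ f q (0, u) :=
    fun r u => by
    have : ((0 : P), r • u) = r • ((0 : P), u) := by simp
    rw [this, map_smul]; simp
  have hn : ∀ u : Fin d → ℂ, fderiv ℝ f q (0, -u) = - fderiv ℝ f q (0, u) := fun u => by
    have : ((0 : P), -u) = -((0 : P), u) := by simp
    rw [this, map_neg]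
  simp only [cd, dh, hn, hv, key, smul_comm I c, e2]
  linear_combination ((1 / 2 : ℝ) * fderiv ℝ f q (0, v) - I * ((1 / 2 : ℝ) *
    fderiv ℝ f q (0, I • v))) * Complex.re_add_im c
    + ((1 / 2 : ℝ) * c.im * fderiv ℝ f q (0, I • v)) * I_sq

lemma cj_dh_conj (c : ℂ) (v : Fin d → ℂ) (f : P × (Fin d → ℂ) → ℂ) (q)
    (hf : DifferentiableAt ℝ f q) :
    cd (cj (dh P (c • v))) f q = conj c * cd (cj (dh P v)) f q := by
  have h := fun ξ => cd_conj (p := q) ξ ((Complex.conjCLE.differentiableAt).comp q hf)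
  have hff : (fun q => conj (((Complex.conjCLE : ℂ → ℂ) ∘ f) q)) = f := by
    ext; simp
  rw [hff] at h
  rw [h, h]
  have hc : ∀ ξ : (P × (Fin d → ℂ)) × (P × (Fin d → ℂ)), ((cj ξ).1, -(cj ξ).2) = ξ := fun ξ => by
    simp [cj]
  rw [hc, hc, cd_dh_smul, map_mul]

lemma cd_dh_sum (v : Fin d → ℂ) (f : P × (Fin d → ℂ) → ℂ) (q) :
    cd (dh P v) f q = ∑ l, v l * cd (dhb P d l) f q := by
  let L : (Fin d → ℂ) →ₗ[ℂ] ℂ :=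
    { toFun := fun v => cd (dh P v) f q
      map_add' := fun v w => by rw [dh_add, cd_add_vec]
      map_smul' := fun c v => by rw [cd_dh_smul]; rfl }
  have : L v = ∑ l, v l * L (Pi.single l 1) := by
    conv_lhs => rw [pi_eq_sum_univ' v]
    simp only [map_sum, map_smul, smul_eq_mul]
  exact this

lemma cd_cj_dh_sum (v : Fin d → ℂ) {f : P × (Fin d → ℂ) → ℂ} {q} (hf : DifferentiableAt ℝ f q) :
    cd (cj (dh P v)) f q = ∑ l, conj (v l) * cd (cj (dhb P d l)) f q := by
  have hc : ∀ ξ : (P × (Fin d → ℂ)) × (P × (Fin d → ℂ)), ((cj ξ).1, -(cj ξ).2) = ξ := fun ξ => by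
    simp [cj]
  have h := fun ξ => cd_conj (p := q) ξ ((Complex.conjCLE.differentiableAt).comp q hf)
  have hff : (fun q => conj (((Complex.conjCLE : ℂ → ℂ) ∘ f) q)) = f := by
    ext; simp
  rw [hff] at h
  simp only [h, hc]
  rw [cd_dh_sum, map_sum]
  simp only [map_mul]

lemma cd_holomorphic {f : (Fin d → ℂ) → ℂ} {q : P × (Fin d → ℂ)} (hf : DifferentiableAt ℂ f q.2)
    (v : Fin d → ℂ) : cd (cj (dh P v)) (fun q => f q.2) q = 0 := by
  have hr : DifferentiableAt ℝ (fun q : P × (Fin d → ℂ) => f q.2) q :=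
    (hf.restrictScalars ℝ).comp q differentiableAt_snd
  rw [← delbar_slice hr, delbar, hf.fderiv_restrictScalars ℝ]
  simp only [ContinuousLinearMap.coe_restrictScalars', map_smul, smul_eq_mul, ← mul_assoc, I_mul_I]
  ring

lemma cd_dp_snd (f : (Fin d → ℂ) → ℂ) (q : P × (Fin d → ℂ)) (hf : DifferentiableAt ℝ f q.2) (e : P) :
    cd (dp e) (fun q => f q.2) q = 0 := by
  rw [cd_dp]
  have : HasFDerivAt (fun q : P × (Fin d → ℂ) => f q.2)
      ((fderiv ℝ f q.2).comp (ContinuousLinearMap.snd ℝ P (Fin d → ℂ))) q :=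
    hf.hasFDerivAt.comp q hasFDerivAt_snd
  rw [this.fderiv]
  simp

/-- The map `(p, z) ↦ (p, φ z)`. -/
def paramMap (P : Type*) (ph : (Fin d → ℂ) → (Fin d → ℂ)) (q : P × (Fin d → ℂ)) :
    P × (Fin d → ℂ) := (q.1, ph q.2)

lemma contDiffAt_paramMap {ph : (Fin d → ℂ) → (Fin d → ℂ)} {q : P × (Fin d → ℂ)}
    (h : ContDiffAt ℝ ∞ ph q.2) : ContDiffAt ℝ ∞ (paramMap P ph) q :=
  contDiffAt_fst.prodMk (h.comp q contDiffAt_snd)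

lemma fderiv_paramMap {ph : (Fin d → ℂ) → (Fin d → ℂ)} {q : P × (Fin d → ℂ)}
    (h : DifferentiableAt ℂ ph q.2) (u : P × (Fin d → ℂ)) :
    fderiv ℝ (paramMap P ph) q u = (u.1, fderiv ℂ ph q.2 u.2) := by
  have h1 : HasFDerivAt (fun q : P × (Fin d → ℂ) => ph q.2)
      ((fderiv ℝ ph q.2).comp (ContinuousLinearMap.snd ℝ P (Fin d → ℂ))) q :=
    (h.restrictScalars ℝ).hasFDerivAt.comp q hasFDerivAt_snd
  have h2 : HasFDerivAt (paramMap P ph) _ q := hasFDerivAt_fst.prodMk h1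
  rw [h2.fderiv, h.fderiv_restrictScalars ℝ]
  rfl

lemma push_dh {ph : (Fin d → ℂ) → (Fin d → ℂ)} {q : P × (Fin d → ℂ)}
    (h : DifferentiableAt ℂ ph q.2) (v : Fin d → ℂ) :
    (fderiv ℝ (paramMap P ph) q (dh P v).1, fderiv ℝ (paramMap P ph) q (dh P v).2)
      = dh P (fderiv ℂ ph q.2 v) := by
  simp only [fderiv_paramMap h, dh, map_neg]
  simp only [← Complex.coe_smul, map_smul]

lemma push_dp {ph : (Fin d → ℂ) → (Fin d → ℂ)} {q : P × (Fin d → ℂ)}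
    (h : DifferentiableAt ℂ ph q.2) (e : P) :
    (fderiv ℝ (paramMap P ph) q (dp e).1, fderiv ℝ (paramMap P ph) q (dp e).2) = dp e := by
  simp only [fderiv_paramMap h, dp, map_zero]

end Directions

/-! ### Behaviour of connection, covariant derivative and contraction under a change of frame. -/

section Transformation

variable {W W' : Type*} [NormedAddCommGroup W] [NormedSpace ℝ W]
  [NormedAddCommGroup W'] [NormedSpace ℝ W']
variable {m : Type*} [Fintype m] [DecidableEq m] {ι : Type*} [Fintype ι] [DecidableEq ι]

/-- The image of a complex tangent vector under the derivative of a map. -/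
def push (f : W → W') (q : W) (ξ : W × W) : W' × W' := (fderiv ℝ f q ξ.1, fderiv ℝ f q ξ.2)

lemma cj_push (f : W → W') (q : W) (ξ : W × W) : push f q (cj ξ) = cj (push f q ξ) := by
  simp [push, cj]

lemma cdM_comp_push {l m : Type*} {F : W' → Matrix l m ℂ} {f : W → W'} {p : W}
    (hF : SmoothAt F (f p)) (hf : ContDiffAt ℝ ∞ f p) (ξ : W × W) :
    cdM ξ (fun q => F (f q)) p = cdM (push f p ξ) F (f p) :=
  cdM_comp hF (hf.differentiableAt (by simp)) ξ

lemma inv_conj_mul {h a : Matrix m m ℂ} (hu : IsUnit h.det) (ha : IsUnit a.det) :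
    (aᴴ * h * a)⁻¹ = a⁻¹ * h⁻¹ * (aᴴ)⁻¹ := by
  rw [Matrix.mul_inv_rev, Matrix.mul_inv_rev, Matrix.mul_assoc]

lemma isUnit_conjTranspose {a : Matrix m m ℂ} (ha : IsUnit a.det) : IsUnit (aᴴ).det := by
  rw [Matrix.det_conjTranspose]; exact ha.star

lemma adj_conj {h a : Matrix m m ℂ} (hu : IsUnit h.det) (ha : IsUnit a.det) (X : Matrix m m ℂ) :
    adj (aᴴ * h * a) (a⁻¹ * X * a) = a⁻¹ * adj h X * a := by
  have hac := isUnit_conjTranspose ha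
  have e : (a⁻¹ * X * a)ᴴ = aᴴ * Xᴴ * (aᴴ)⁻¹ := by
    rw [Matrix.conjTranspose_mul, Matrix.conjTranspose_mul, Matrix.conjTranspose_nonsing_inv,
      Matrix.mul_assoc]
  rw [adj, adj, inv_conj_mul hu ha, e]
  simp only [Matrix.mul_assoc, Matrix.nonsing_inv_mul_cancel_left _ _ hac]

variable {h : W' → Matrix m m ℂ} {h' a : W → Matrix m m ℂ} {f : W → W'} {q : W}

/-- The hypothesis on `cj ξ` removes the derivative of `aᴴ`; what remains is the usual gauge law,
with inhomogeneous term `a⁻¹ ∂_ξ a`. -/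
lemma chern_trans (hs : SmoothAt h (f q)) (hu : IsUnit (h (f q)).det)
    (hf : ContDiffAt ℝ ∞ f q) (ha : SmoothAt a q) (hau : IsUnit (a q).det)
    (e : h' =ᶠ[nhds q] fun q => (a q)ᴴ * h (f q) * a q) (ξ : W × W) (h0 : cdM (cj ξ) a q = 0) :
    chern h' ξ q = (a q)⁻¹ * chern h (push f q ξ) (f q) * a q + (a q)⁻¹ * cdM ξ a q := by
  have hac := isUnit_conjTranspose hau
  have e1 : cdM ξ h' q = (a q)ᴴ * cdM (push f q ξ) h (f q) * a q
      + (a q)ᴴ * h (f q) * cdM ξ a q := by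
    rw [cdM_congr e, cdM_mul ξ (ha.conjTranspose.mul (hs.comp hf)) ha,
      cdM_mul ξ ha.conjTranspose (hs.comp hf), cdM_conjTranspose ξ ha, ← cj, h0,
      cdM_comp_push hs hf]
    simp
  rw [chern, e1, e.self_of_nhds, inv_conj_mul hu hau, chern]
  simp only [Matrix.mul_add, Matrix.mul_assoc, Matrix.nonsing_inv_mul_cancel_left _ _ hac,
    Matrix.nonsing_inv_mul_cancel_left _ _ hu]

lemma cdM_conj {l : W' → Matrix m m ℂ} {l' : W → Matrix m m ℂ} (hl : SmoothAt l (f q))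
    (hf : ContDiffAt ℝ ∞ f q) (ha : SmoothAt a q) (hau : IsUnit (a q).det)
    (e : l' =ᶠ[nhds q] fun q => (a q)⁻¹ * l (f q) * a q) (ξ : W × W) :
    cdM ξ l' q = (a q)⁻¹ * cdM (push f q ξ) l (f q) * a q
      + (l' q * ((a q)⁻¹ * cdM ξ a q) - (a q)⁻¹ * cdM ξ a q * l' q) := by
  rw [cdM_congr e, cdM_mul ξ ((ha.inv hau).mul (hl.comp hf)) ha,
    cdM_mul ξ (ha.inv hau) (hl.comp hf), cdM_inv ξ ha hau, cdM_comp_push hl hf, e.self_of_nhds]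
  have : (a q)⁻¹ * l (f q) * a q * ((a q)⁻¹ * cdM ξ a q) = (a q)⁻¹ * l (f q) * cdM ξ a q := by
    rw [Matrix.mul_assoc _ (a q), Matrix.mul_nonsing_inv_cancel_left _ _ hau]
  rw [this]
  noncomm_ring

/-- The inhomogeneous term of the connection cancels the derivative of the conjugation by `a`, so
the covariant derivative is tensorial. -/
lemma nab_trans (hs : SmoothAt h (f q)) (hu : IsUnit (h (f q)).det)
    (hf : ContDiffAt ℝ ∞ f q) (ha : SmoothAt a q) (hau : IsUnit (a q).det)
    (e : h' =ᶠ[nhds q] fun q => (a q)ᴴ * h (f q) * a q) (ξ : W × W) (h0 : cdM (cj ξ) a q = 0)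
    {l : W' → Matrix m m ℂ} {l' : W → Matrix m m ℂ} (hl : SmoothAt l (f q))
    (el : l' =ᶠ[nhds q] fun q => (a q)⁻¹ * l (f q) * a q) :
    nab h' l' ξ q = (a q)⁻¹ * nab h l (push f q ξ) (f q) * a q := by
  have c1 : ∀ X Y : Matrix m m ℂ, (a q)⁻¹ * X * a q * ((a q)⁻¹ * Y * a q)
      = (a q)⁻¹ * (X * Y) * a q := fun X Y => by
    simp only [Matrix.mul_assoc, Matrix.mul_nonsing_inv_cancel_left _ _ hau]
  rw [nab, nab, cdM_conj hl hf ha hau el, chern_trans hs hu hf ha hau e ξ h0]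
  simp only [Matrix.add_mul, Matrix.mul_add, Matrix.mul_sub, Matrix.sub_mul, ← c1]
  rw [el.self_of_nhds]
  abel

/-- The contraction of a sesquilinear form does not depend on the basis. -/
lemma contraction_invariant {γ γ' b : Matrix ι ι ℂ} (hγ : b * γ' * bᴴ = γ) {M : Type*}
    [AddCommGroup M] [Module ℂ M] (B : ι → ι → M) :
    ∑ j, ∑ k, γ' j k • ∑ l, ∑ r, (b l j * conj (b r k)) • B l r
      = ∑ l, ∑ r, γ l r • B l r := by
  have hγ' : ∀ l r, γ l r = ∑ j, ∑ k, γ' j k * (b l j * conj (b r k)) := fun l r => by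
    rw [← hγ]
    simp only [Matrix.mul_apply, Matrix.conjTranspose_apply, Finset.sum_mul]
    rw [Finset.sum_comm]
    refine Finset.sum_congr rfl fun j _ => Finset.sum_congr rfl fun k _ => ?_
    simp only [starRingEnd_apply]; ring
  simp only [hγ', Finset.smul_sum, Finset.sum_smul, smul_smul]
  have s1 : ∀ G : ι → ι → ι → ι → M, ∑ j, ∑ k, ∑ l, ∑ r, G j k l r
      = ∑ l, ∑ r, ∑ j, ∑ k, G j k l r := fun G => by
    have : ∀ j, ∑ k, ∑ l, ∑ r, G j k l r = ∑ l, ∑ r, ∑ k, G j k l r := fun j => by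
      rw [Finset.sum_comm]
      exact Finset.sum_congr rfl fun l _ => Finset.sum_comm
    simp only [this]
    rw [Finset.sum_comm]
    exact Finset.sum_congr rfl fun l _ => Finset.sum_comm
  exact s1 _

lemma inv_contraction {g b : Matrix ι ι ℂ} (hg : IsUnit g.det) (hb : IsUnit b.det) :
    b * (bᴴ * g * b)⁻¹ * bᴴ = g⁻¹ := by
  rw [inv_conj_mul hg hb]
  simp only [Matrix.mul_assoc, Matrix.mul_nonsing_inv_cancel_left _ _ hb,
    Matrix.nonsing_inv_mul _ (isUnit_conjTranspose hb), Matrix.mul_one]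

end Transformation

/-! ### Holomorphic changes of chart and frame, with parameters. -/

section Param

variable {P : Type*} [NormedAddCommGroup P] [NormedSpace ℝ P] {d : ℕ}
variable {m : Type*} [Fintype m] [DecidableEq m]

/-- A holomorphic change of chart `φ` and of frame `a` near `z`. -/
structure IsHolChange (ph : (Fin d → ℂ) → (Fin d → ℂ)) (a : (Fin d → ℂ) → Matrix m m ℂ)
    (z : Fin d → ℂ) : Prop where
  chart : ContDiffAt ℂ ω ph z
  frame : ∀ i j, ContDiffAt ℂ ω (fun z => a z i j) z
  isUnit : IsUnit (a z).det

namespace IsHolChange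

variable {ph : (Fin d → ℂ) → (Fin d → ℂ)} {a : (Fin d → ℂ) → Matrix m m ℂ}
  {q : P × (Fin d → ℂ)}

lemma contDiffAt (H : IsHolChange ph a q.2) : ContDiffAt ℝ ∞ (paramMap P ph) q :=
  contDiffAt_paramMap ((H.chart.restrict_scalars ℝ).of_le le_top)

lemma smoothAt (H : IsHolChange ph a q.2) : SmoothAt (fun q : P × (Fin d → ℂ) => a q.2) q :=
  fun i j => ((((H.frame i j).restrict_scalars ℝ).of_le le_top).comp q contDiffAt_snd)

lemma cdM_eq_zero (H : IsHolChange ph a q.2) (v : Fin d → ℂ) :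
    cdM (cj (dh P v)) (fun q : P × (Fin d → ℂ) => a q.2) q = 0 := by
  ext i j
  exact cd_holomorphic ((H.frame i j).differentiableAt (by simp)) v

lemma cdM_dp_eq_zero (H : IsHolChange ph a q.2) (e : P) :
    cdM (dp e) (fun q : P × (Fin d → ℂ) => a q.2) q = 0 := by
  ext i j
  exact cd_dp_snd _ _ (((H.frame i j).differentiableAt (by simp)).restrictScalars ℝ) e

lemma differentiableAt (H : IsHolChange ph a q.2) : DifferentiableAt ℂ ph q.2 :=
  H.chart.differentiableAt (by simp)

lemma push_dh (H : IsHolChange ph a q.2) (v : Fin d → ℂ) :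
    push (paramMap P ph) q (dh P v) = dh P (fderiv ℂ ph q.2 v) :=
  HiggsExtension.push_dh H.differentiableAt v

lemma push_dp (H : IsHolChange ph a q.2) (e : P) : push (paramMap P ph) q (dp e) = dp e :=
  HiggsExtension.push_dp H.differentiableAt e

lemma eventually (H : IsHolChange ph a q.2) :
    ∀ᶠ q' in nhds q, IsHolChange ph a (q' : P × (Fin d → ℂ)).2 := by
  have h1 := H.chart.eventually (by simp)
  have h2 : ∀ᶠ z in nhds q.2, ∀ i j, ContDiffAt ℂ ω (fun z => a z i j) z := by
    simp only [Filter.eventually_all]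
    exact fun i j => (H.frame i j).eventually (by simp)
  have h3 : ∀ᶠ z in nhds q.2, IsUnit (a z).det := by
    have : SmoothAt a q.2 := fun i j => ((H.frame i j).restrict_scalars ℝ).of_le le_top
    exact this.eventually_isUnit H.isUnit
  have := (h1.and (h2.and h3)).mono fun z hz => IsHolChange.mk hz.1 hz.2.1 hz.2.2
  exact continuousAt_snd.eventually this

/-- Derivatives of a function of the form `a⁻¹ β(φ'(z) v) a + c`, with `β` linear and `a`, `c`
holomorphic. -/
lemma cdM_cj_twist (H : IsHolChange ph a q.2) {β : Fin d → P × (Fin d → ℂ) → Matrix m m ℂ}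
    {F c : P × (Fin d → ℂ) → Matrix m m ℂ} (hβ : ∀ l, SmoothAt (β l) (paramMap P ph q))
    (hc : SmoothAt c q) (v w : Fin d → ℂ) (hc0 : cdM (cj (dh P w)) c q = 0)
    (hF : F =ᶠ[nhds q] fun q => (a q.2)⁻¹ * (∑ l, (fderiv ℂ ph q.2 v l) • β l (paramMap P ph q))
      * a q.2 + c q) :
    cdM (cj (dh P w)) F q = (a q.2)⁻¹ * (∑ l, ∑ r, (fderiv ℂ ph q.2 v l *
      conj (fderiv ℂ ph q.2 w r)) • cdM (cj (dhb P d r)) (β l) (paramMap P ph q)) * a q.2 := by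
  have hfd : ∀ l, ContDiffAt ℂ ω (fun z => fderiv ℂ ph z v l) q.2 := fun l => by
    have h1 : ContDiffAt ℂ ω (fderiv ℂ ph) q.2 := H.chart.fderiv_right (m := ω) le_rfl
    exact contDiffAt_pi.1 (h1.clm_apply contDiffAt_const) l
  have hfs : ∀ l, ContDiffAt ℝ ∞ (fun q : P × (Fin d → ℂ) => fderiv ℂ ph q.2 v l) q := fun l =>
    ((((hfd l).restrict_scalars ℝ).of_le le_top).comp q contDiffAt_snd)
  have hf0 : ∀ l, cd (cj (dh P w)) (fun q : P × (Fin d → ℂ) => fderiv ℂ ph q.2 v l) q = 0 :=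
    fun l => cd_holomorphic ((hfd l).differentiableAt (by simp)) w
  have hβ' : ∀ l, SmoothAt (fun q => β l (paramMap P ph q)) q := fun l => (hβ l).comp H.contDiffAt
  have hS : SmoothAt (fun q : P × (Fin d → ℂ) =>
      ∑ l, (fderiv ℂ ph q.2 v l) • β l (paramMap P ph q)) q :=
    SmoothAt.sum fun l _ => SmoothAt.smul (hfs l) (hβ' l)
  have ha := H.smoothAt
  have hai := ha.inv H.isUnit
  rw [cdM_congr hF, cdM_add _ ((hai.mul hS).mul ha) hc, hc0, cdM_mul _ (hai.mul hS) ha,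
    cdM_mul _ hai hS, cdM_inv _ ha H.isUnit, H.cdM_eq_zero,
    cdM_sum _ (fun l _ => SmoothAt.smul (hfs l) (hβ' l))]
  have e : ∀ l, cdM (cj (dh P w)) (fun q : P × (Fin d → ℂ) =>
      fderiv ℂ ph q.2 v l • β l (paramMap P ph q)) q = ∑ r, (fderiv ℂ ph q.2 v l *
      conj (fderiv ℂ ph q.2 w r)) • cdM (cj (dhb P d r)) (β l) (paramMap P ph q) := fun l => by
    rw [cdM_smul _ (hfs l) (hβ' l), hf0, zero_smul, zero_add, cdM_comp_push (hβ l) H.contDiffAt,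
      cj_push, H.push_dh]
    ext i j
    simp only [Matrix.smul_apply, cdM_apply, Matrix.sum_apply, smul_eq_mul]
    rw [cd_cj_dh_sum _ ((hβ l i j).dAt), Finset.mul_sum]
    simp only [mul_assoc]
  simp [e]

/-- Transformation of `chern` in the `(1,0)`-directions. -/
lemma chern_eventuallyEq (H : IsHolChange ph a q.2) {h h' : P × (Fin d → ℂ) → Matrix m m ℂ}
    (hs : SmoothNear h (paramMap P ph q)) (hu : IsUnit (h (paramMap P ph q)).det)
    (e : h' =ᶠ[nhds q] fun q => (a q.2)ᴴ * h (paramMap P ph q) * a q.2) (v : Fin d → ℂ) :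
    chern h' (dh P v) =ᶠ[nhds q] fun q => (a q.2)⁻¹ *
      (∑ l, (fderiv ℂ ph q.2 v l) • chern h (dhb P d l) (paramMap P ph q)) * a q.2
      + (a q.2)⁻¹ * cdM (dh P v) (fun q : P × (Fin d → ℂ) => a q.2) q := by
  have ev := H.contDiffAt.continuousAt.eventually (eventually_good hs hu)
  filter_upwards [ev, H.eventually, e.eventually_nhds] with q hq hH he
  rw [chern_trans (h := h) hq.1 hq.2 hH.contDiffAt hH.smoothAt hH.isUnit he _ (hH.cdM_eq_zero v),
    hH.push_dh]
  congr 3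
  simp only [chern]
  ext i j
  simp only [Matrix.mul_apply, cdM_apply, Matrix.sum_apply, Matrix.smul_apply, smul_eq_mul,
    Finset.mul_sum]
  rw [Finset.sum_comm]
  refine Finset.sum_congr rfl fun k _ => ?_
  rw [cd_dh_sum, Finset.mul_sum]
  refine Finset.sum_congr rfl fun l _ => ?_
  ring

/-- The only non-tensorial term of the connection form, `a⁻¹ ∂a`, is holomorphic and is killed by
`∂̄`; no derivative of the Jacobian of the chart change survives for the same reason. The rest is a
sesquilinear expression contracted with `γ`. -/
lemma higgsP_trans (H : IsHolChange ph a q.2) {h h' : P × (Fin d → ℂ) → Matrix m m ℂ}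
    (hs : SmoothNear h (paramMap P ph q)) (hu : IsUnit (h (paramMap P ph q)).det)
    (e : h' =ᶠ[nhds q] fun q => (a q.2)ᴴ * h (paramMap P ph q) * a q.2)
    {θ θ' : Fin d → P × (Fin d → ℂ) → Matrix m m ℂ}
    (eθ : ∀ j, θ' j q = (a q.2)⁻¹ * (∑ l, fderiv ℂ ph q.2 (Pi.single j 1) l •
      θ l (paramMap P ph q)) * a q.2)
    {γ γ' : P × (Fin d → ℂ) → Matrix (Fin d) (Fin d) ℂ}
    (eγ : (Matrix.of fun l j => fderiv ℂ ph q.2 (Pi.single j 1) l) * γ' q *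
      (Matrix.of fun l j => fderiv ℂ ph q.2 (Pi.single j 1) l)ᴴ = γ (paramMap P ph q)) :
    higgsP h' θ' γ' (dhb P d) q =
      (a q.2)⁻¹ * higgsP h θ γ (dhb P d) (paramMap P ph q) * a q.2 := by
  set b : Matrix (Fin d) (Fin d) ℂ :=
    Matrix.of fun l j => fderiv ℂ ph q.2 (Pi.single j 1) l with hb
  have hus := eventually_good hs hu
  have hc : ∀ j k, cdM (cj (dhb P d k)) (chern h' (dhb P d j)) q =
      (a q.2)⁻¹ * (∑ l, ∑ r, (b l j * conj (b r k)) •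
        cdM (cj (dhb P d r)) (chern h (dhb P d l)) (paramMap P ph q)) * a q.2 := fun j k => by
    have hai := H.smoothAt.inv H.isUnit
    refine H.cdM_cj_twist (β := fun l => chern h (dhb P d l))
      (c := fun q => (a q.2)⁻¹ * cdM (dhb P d j) (fun q : P × (Fin d → ℂ) => a q.2) q)
      (fun l => chern_smoothAt hs.self hu _) (hai.mul (H.smoothAt.cdM _)) _ _ ?_
      (H.chern_eventuallyEq hs hu e _)
    rw [cdM_mul _ hai (H.smoothAt.cdM _), cdM_inv _ H.smoothAt H.isUnit, H.cdM_eq_zero,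
      cdM_comm H.smoothAt]
    rw [cdM_congr (G := fun _ => 0) (H.eventually.mono fun q hq => hq.cdM_eq_zero _), cdM_const]
    simp
  have hθ : ∀ k, adj (h' q) (θ' k q) = (a q.2)⁻¹ * (∑ r, conj (b r k) •
      adj (h (paramMap P ph q)) (θ r (paramMap P ph q))) * a q.2 := fun k => by
    rw [eθ, e.self_of_nhds, adj_conj hu H.isUnit, adj_sum]
    simp only [adj_smul]
    rfl
  have c1 : ∀ X Y : Matrix m m ℂ, (a q.2)⁻¹ * X * a q.2 * ((a q.2)⁻¹ * Y * a q.2)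
      = (a q.2)⁻¹ * (X * Y) * a q.2 := fun X Y => by
    simp only [Matrix.mul_assoc, Matrix.mul_nonsing_inv_cancel_left _ _ H.isUnit]
  have key : ∀ j k, -cdM (cj (dhb P d k)) (chern h' (dhb P d j)) q
      + (θ' j q * adj (h' q) (θ' k q) - adj (h' q) (θ' k q) * θ' j q)
      = (a q.2)⁻¹ * (∑ l, ∑ r, (b l j * conj (b r k)) •
        (-cdM (cj (dhb P d r)) (chern h (dhb P d l)) (paramMap P ph q)
      + (θ l (paramMap P ph q) * adj (h (paramMap P ph q)) (θ r (paramMap P ph q))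
        - adj (h (paramMap P ph q)) (θ r (paramMap P ph q)) * θ l (paramMap P ph q)))) * a q.2 := by
    intro j k
    rw [hc, hθ, eθ, c1, c1]
    simp only [Matrix.sum_mul, Matrix.mul_sum, smul_add, smul_neg, smul_sub, Finset.sum_add_distrib,
      Finset.sum_sub_distrib, Finset.sum_neg_distrib, Matrix.mul_add, Matrix.add_mul,
      Matrix.mul_sub, Matrix.sub_mul, Matrix.neg_mul, Matrix.mul_neg, Matrix.smul_mul,
      Matrix.mul_smul, hb, Matrix.of_apply]
    congr 2
    · simp only [Finset.smul_sum, smul_smul]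
      rw [Finset.sum_comm]
      refine Finset.sum_congr rfl fun l _ => Finset.sum_congr rfl fun r _ => ?_
      rw [mul_comm]
    · simp only [Finset.smul_sum, smul_smul]
  simp only [higgsP, key]
  rw [← contraction_invariant eγ]
  simp only [Matrix.mul_smul, Matrix.smul_mul, Matrix.mul_sum, Matrix.sum_mul]

end IsHolChange

end Param

/-! ### Smooth families of metrics, endomorphisms and functions, read in charts and frames. -/

section Families

variable {P : Type*} [NormedAddCommGroup P] [NormedSpace ℝ P]
variable {d n : ℕ} {X : Type*} [TopologicalSpace X] [ChartedSpace (Fin d → ℂ) X]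
  {E : X → Type*} [∀ x, AddCommGroup (E x)] [∀ x, Module ℂ (E x)]
  [TopologicalSpace (TotalSpace (Fin n → ℂ) E)] [∀ x, TopologicalSpace (E x)]
  [FiberBundle (Fin n → ℂ) E] [VectorBundle ℂ (Fin n → ℂ) E]

variable (d n E) in
/-- The common domain of the chart and the frame around `x`. -/
def dom (x : X) : Set X := (chartAt (Fin d → ℂ) x).source ∩ frameSet n E x

lemma isOpen_dom (x : X) : IsOpen (dom d n E x) :=
  (chartAt (Fin d → ℂ) x).open_source.inter (trivializationAt (Fin n → ℂ) E x).open_baseSet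

lemma mem_dom (x : X) : x ∈ dom d n E x := ⟨mem_chart_source _ x, mem_frameSet x⟩

lemma eventually_symm_mem {x y : X} (hy : y ∈ (chartAt (Fin d → ℂ) x).source) {s : Set X}
    (hs : IsOpen s) (hys : y ∈ s) (p : P) :
    ∀ᶠ q : P × (Fin d → ℂ) in nhds (p, chartAt (Fin d → ℂ) x y),
      q.2 ∈ (chartAt (Fin d → ℂ) x).target ∧ (chartAt (Fin d → ℂ) x).symm q.2 ∈ s := by
  have hc : ContinuousAt (chartAt (Fin d → ℂ) x).symm (chartAt (Fin d → ℂ) x y) :=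
    (chartAt (Fin d → ℂ) x).continuousAt_symm ((chartAt (Fin d → ℂ) x).map_source hy)
  have h1 := hc.preimage_mem_nhds (t := s)
    (hs.mem_nhds (by rwa [(chartAt (Fin d → ℂ) x).left_inv hy]))
  have h2 := (chartAt (Fin d → ℂ) x).open_target.mem_nhds
    ((chartAt (Fin d → ℂ) x).map_source hy)
  have := Filter.inter_mem h2 h1
  exact (continuousAt_snd (p := ((p, chartAt (Fin d → ℂ) x y) : P × (Fin d → ℂ)))).eventually this

variable (n) in
/-- The matrix of a family of metrics in the chart and frame around `x`. -/
def gramL (H : P → FormField E) (x : X) (q : P × (Fin d → ℂ)) : Matrix (Fin n) (Fin n) ℂ :=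
  gram n (H q.1) x ((chartAt (Fin d → ℂ) x).symm q.2)

variable (d n) in
/-- Smooth families of Hermitian metrics. -/
structure IsMetricFamily (H : P → FormField E) : Prop where
  herm : ∀ p, IsHermitianMetric d n (H p)
  smooth : ∀ x p, ∀ y ∈ dom d n E x, SmoothAt (gramL n H x) (p, chartAt (Fin d → ℂ) x y)

variable (P d) in
/-- The transition map between charts, with parameters. -/
abbrev chg (x x' : X) : P × (Fin d → ℂ) → P × (Fin d → ℂ) := paramMap P (chartChange x x')

variable (d n E) in
/-- The change of frame, in the chart around `x'`. -/
def frameL (x x' : X) (z : Fin d → ℂ) : Matrix (Fin n) (Fin n) ℂ :=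
  frameChange n E x x' ((chartAt (Fin d → ℂ) x').symm z)

lemma chg_apply {x x' y : X} (h : y ∈ (chartAt (Fin d → ℂ) x').source) (p : P) :
    chg P d x x' (p, chartAt (Fin d → ℂ) x' y) = (p, chartAt (Fin d → ℂ) x y) := by
  simp only [paramMap, chartChange_apply h]

/-- Families of smooth sections of `End E`, given by their matrices in all frames. -/
structure IsEndFamily (A : ∀ x : X, P × (Fin d → ℂ) → Matrix (Fin n) (Fin n) ℂ)
    (E : X → Type*) [∀ x, AddCommGroup (E x)] [∀ x, Module ℂ (E x)]
    [TopologicalSpace (TotalSpace (Fin n → ℂ) E)] [∀ x, TopologicalSpace (E x)]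
    [FiberBundle (Fin n → ℂ) E] [VectorBundle ℂ (Fin n → ℂ) E] : Prop where
  smooth : ∀ x p, ∀ y ∈ dom d n E x, SmoothAt (A x) (p, chartAt (Fin d → ℂ) x y)
  trans : ∀ x x' p, ∀ y ∈ dom d n E x ∩ dom d n E x', A x' (p, chartAt (Fin d → ℂ) x' y) =
    (frameChange n E x x' y)⁻¹ * A x (p, chartAt (Fin d → ℂ) x y) * frameChange n E x x' y

/-- Smooth families of functions on `X`. -/
def SmoothFam (f : P → X → ℂ) : Prop :=
  ∀ p x, ContDiffAt ℝ ∞ (fun q : P × (Fin d → ℂ) => f q.1 ((chartAt (Fin d → ℂ) x).symm q.2))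
    (p, chartAt (Fin d → ℂ) x x)

/-- The value at the centre of the frame. -/
def atC {M : Type*} (A : X → P × (Fin d → ℂ) → M) (p : P) (x : X) : M :=
  A x (p, chartAt (Fin d → ℂ) x x)

namespace IsEndFamily

variable {A B : ∀ x : X, P × (Fin d → ℂ) → Matrix (Fin n) (Fin n) ℂ}

lemma eventuallyEq (hA : IsEndFamily A E) {x x' y : X} (p : P)
    (hy : y ∈ dom d n E x ∩ dom d n E x') : A x' =ᶠ[nhds (p, chartAt (Fin d → ℂ) x' y)]
      fun q => (frameL d n E x x' q.2)⁻¹ * A x (chg P d x x' q) * frameL d n E x x' q.2 := by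
  filter_upwards [eventually_symm_mem hy.2.1 ((isOpen_dom x).inter (isOpen_dom x')) hy p] with q hq
  have := hA.trans x x' q.1 _ hq.2
  rwa [(chartAt (Fin d → ℂ) x').right_inv hq.1] at this

lemma mul (hA : IsEndFamily A E) (hB : IsEndFamily B E) :
    IsEndFamily (fun x q => A x q * B x q) E where
  smooth x p y hy := (hA.smooth x p y hy).mul (hB.smooth x p y hy)
  trans x x' p y hy := by
    have hu := frameChange_isUnit (n := n) (E := E) hy.1.2 hy.2.2
    rw [hA.trans x x' p y hy, hB.trans x x' p y hy]
    simp only [Matrix.mul_assoc, Matrix.mul_nonsing_inv_cancel_left _ _ hu]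

lemma sub (hA : IsEndFamily A E) (hB : IsEndFamily B E) :
    IsEndFamily (fun x q => A x q - B x q) E where
  smooth x p y hy := (hA.smooth x p y hy).sub (hB.smooth x p y hy)
  trans x x' p y hy := by
    rw [hA.trans x x' p y hy, hB.trans x x' p y hy]
    simp only [Matrix.mul_sub, Matrix.sub_mul]

lemma smul (c : ℂ) (hA : IsEndFamily A E) : IsEndFamily (fun x q => c • A x q) E where
  smooth x p y hy := SmoothAt.smul contDiffAt_const (hA.smooth x p y hy)
  trans x x' p y hy := by
    rw [hA.trans x x' p y hy]
    simp only [Matrix.mul_smul, Matrix.smul_mul]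

lemma one : IsEndFamily (fun (_ : X) (_ : P × (Fin d → ℂ)) => (1 : Matrix (Fin n) (Fin n) ℂ)) E where
  smooth x p y hy := smoothAt_const _ _
  trans x x' p y hy := by
    rw [Matrix.mul_one, Matrix.nonsing_inv_mul _ (frameChange_isUnit hy.1.2 hy.2.2)]

lemma trace_trans (hA : IsEndFamily A E) {x x' y : X} (p : P)
    (hy : y ∈ dom d n E x ∩ dom d n E x') : (A x' (p, chartAt (Fin d → ℂ) x' y)).trace =
      (A x (p, chartAt (Fin d → ℂ) x y)).trace := by
  rw [hA.trans x x' p y hy, Matrix.trace_mul_comm,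
    Matrix.mul_nonsing_inv_cancel_left _ _ (frameChange_isUnit hy.1.2 hy.2.2)]

/-- `atC` reads every point in its own preferred frame, a choice that need not vary continuously.
The trace does not depend on the frame, so near `x` it may be read in the single frame around `x`.
-/
lemma trace_eventuallyEq (hA : IsEndFamily A E) (p : P) (x : X) :
    (fun q : P × (Fin d → ℂ) => (atC A q.1 ((chartAt (Fin d → ℂ) x).symm q.2)).trace)
      =ᶠ[nhds (p, chartAt (Fin d → ℂ) x x)] fun q => (A x q).trace := by
  filter_upwards [eventually_symm_mem (mem_chart_source _ x) (isOpen_dom (d := d) (n := n) (E := E) x)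
    (mem_dom x) p] with q hq
  rw [atC, hA.trace_trans (x := x) q.1 ⟨hq.2, mem_dom (d := d) _⟩, (chartAt (Fin d → ℂ) x).right_inv hq.1]

lemma smoothFam_trace (hA : IsEndFamily A E) :
    SmoothFam (d := d) (fun p x => (atC A p x).trace) := fun p x =>
  (hA.smooth x p x (mem_dom x)).trace.congr_of_eventuallyEq (hA.trace_eventuallyEq p x)

end IsEndFamily

section Hermitian

open scoped ComplexOrder

lemma gram_isHermitian {H : FormField E} (hH : IsHermitianMetric d n H) (x y : X) :
    (gram n H x y)ᴴ = gram n H x y := by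
  ext i j; exact hH.conj_symm _ _ _

lemma gram_posDef {H : FormField E} (hH : IsHermitianMetric d n H) {x y : X}
    (hy : y ∈ frameSet n E x) : (gram n H x y).PosDef := by
  refine Matrix.PosDef.of_dotProduct_mulVec_pos (gram_isHermitian hH x y) fun v hv => ?_
  rw [← form_symm hy]
  have hne : (trivializationAt (Fin n → ℂ) E x).symmₗ ℂ y v ≠ 0 := fun h0 => hv (by
    have := Trivialization.linearMapAt_symmₗ (R := ℂ) (trivializationAt (Fin n → ℂ) E x) hy v
    rw [h0, map_zero] at this
    exact this.symm)
  have h1 := hH.pos y _ hne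
  have h2 := Complex.conj_eq_iff_im.1 (hH.conj_symm y ((trivializationAt (Fin n → ℂ) E x).symmₗ ℂ y v)
    ((trivializationAt (Fin n → ℂ) E x).symmₗ ℂ y v))
  exact Complex.lt_def.2 ⟨h1, h2.symm⟩

lemma gram_isUnit {H : FormField E} (hH : IsHermitianMetric d n H) {x y : X}
    (hy : y ∈ frameSet n E x) : IsUnit (gram n H x y).det :=
  (gram_posDef hH hy).det_pos.ne'.isUnit

end Hermitian

section Smooth

variable [IsManifold 𝓘(ℂ, Fin d → ℂ) ω X]

lemma contDiffAt_chart_of_contMDiffOn {f : X → ℂ} {s : Set X} (hs : IsOpen s) {x y : X}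
    (hf : ContMDiffOn 𝓘(ℝ, Fin d → ℂ) 𝓘(ℝ, ℂ) ∞ f s) (hy : y ∈ s)
    (hx : y ∈ (chartAt (Fin d → ℂ) x).source) (p : P) :
    ContDiffAt ℝ ∞ (fun q : P × (Fin d → ℂ) => f ((chartAt (Fin d → ℂ) x).symm q.2))
      (p, chartAt (Fin d → ℂ) x y) := by
  have : IsManifold 𝓘(ℝ, Fin d → ℂ) ∞ X := isManifold_real
  exact ContDiffAt.comp (g := fun z => f ((chartAt (Fin d → ℂ) x).symm z)) (p, chartAt (Fin d → ℂ) x y)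
    (contDiffAt_comp_chart_symm (hf.contMDiffAt (hs.mem_nhds hy)) hx) contDiffAt_snd

lemma IsHermitianMetric.isMetricFamily {H : FormField E} (hH : IsHermitianMetric d n H) :
    IsMetricFamily d n (fun _ : P => H) where
  herm _ := hH
  smooth x p y hy i j := contDiffAt_chart_of_contMDiffOn
    (trivializationAt (Fin n → ℂ) E x).open_baseSet (hH.smooth x i j) hy.2 hy.1 p

lemma isHolChange [ContMDiffVectorBundle ω (Fin n → ℂ) E 𝓘(ℂ, Fin d → ℂ)] {x x' y : X}
    (hy : y ∈ dom d n E x ∩ dom d n E x') :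
    IsHolChange (chartChange x x') (frameL d n E x x') (chartAt (Fin d → ℂ) x' y) where
  chart := contDiffAt_chartChange hy.1.1 hy.2.1
  frame i j := contDiffAt_frameChange hy.2.1 hy.1.2 hy.2.2 i j
  isUnit := by
    rw [frameL, (chartAt (Fin d → ℂ) x').left_inv hy.2.1]
    exact frameChange_isUnit hy.1.2 hy.2.2

lemma endCoord_isEndFamily {s : ∀ x, Module.End ℂ (E x)} (hs : IsSmoothEnd d n s) :
    IsEndFamily (fun x (q : P × (Fin d → ℂ)) => endCoord n x ((chartAt (Fin d → ℂ) x).symm q.2)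
      (s _)) E where
  smooth x p y hy i j := contDiffAt_chart_of_contMDiffOn
    (trivializationAt (Fin n → ℂ) E x).open_baseSet (hs x i j) hy.2 hy.1 p
  trans x x' p y hy := by
    simp only
    rw [(chartAt (Fin d → ℂ) x).left_inv hy.1.1, (chartAt (Fin d → ℂ) x').left_inv hy.2.1]
    exact endCoord_frameChange hy.1.2 hy.2.2 _

end Smooth

namespace IsMetricFamily

variable {H : P → FormField E}

lemma smoothNear (hH : IsMetricFamily d n H) {x y : X} (p : P) (hy : y ∈ dom d n E x) :
    SmoothNear (gramL n H x) (p, chartAt (Fin d → ℂ) x y) := by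
  filter_upwards [eventually_symm_mem hy.1 (isOpen_dom x) hy p] with q hq
  have := hH.smooth x q.1 _ hq.2
  rwa [(chartAt (Fin d → ℂ) x).right_inv hq.1] at this

lemma isUnit (hH : IsMetricFamily d n H) {x y : X} (p : P) (hy : y ∈ dom d n E x) :
    IsUnit (gramL n H x (p, chartAt (Fin d → ℂ) x y)).det := by
  rw [gramL, (chartAt (Fin d → ℂ) x).left_inv hy.1]
  exact gram_isUnit (hH.herm p) hy.2

lemma hermitian (hH : IsMetricFamily d n H) (x : X) (q : P × (Fin d → ℂ)) :
    (gramL n H x q)ᴴ = gramL n H x q := gram_isHermitian (hH.herm q.1) _ _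

lemma eventuallyEq (H : P → FormField E) {x x' y : X} (p : P)
    (hy : y ∈ dom d n E x ∩ dom d n E x') : gramL n H x' =ᶠ[nhds (p, chartAt (Fin d → ℂ) x' y)]
      fun q => (frameL d n E x x' q.2)ᴴ * gramL n H x (chg P d x x' q) * frameL d n E x x' q.2 := by
  filter_upwards [eventually_symm_mem hy.2.1 ((isOpen_dom x).inter (isOpen_dom x')) hy p] with q hq
  rw [gramL, gram_frameChange hq.2.1.2 hq.2.2.2, gramL, frameL]
  simp only [paramMap, chartChange, (chartAt (Fin d → ℂ) x).left_inv hq.2.1.1]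

end IsMetricFamily

variable [IsManifold 𝓘(ℂ, Fin d → ℂ) ω X]
  [ContMDiffVectorBundle ω (Fin n → ℂ) E 𝓘(ℂ, Fin d → ℂ)]

/-- Frame changes do not depend on the parameter, so in parameter directions the gauge law has no
inhomogeneous term: `H⁻¹ ∂H` is a genuine section of `End E`. -/
lemma chern_dp_isEndFamily {H : P → FormField E} (hH : IsMetricFamily d n H) (e : P) :
    IsEndFamily (fun x : X => chern (gramL (d := d) n H x) (dp e)) E where
  smooth x p y hy := chern_smoothAt (hH.smooth x p y hy) (hH.isUnit p hy) _
  trans x x' p y hy := by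
    have hc := isHolChange hy
    have hgo : paramMap P (chartChange x x') (p, chartAt (Fin d → ℂ) x' y) =
      (p, chartAt (Fin d → ℂ) x y) := chg_apply hy.2.1 p
    have h0 := IsHolChange.cdM_dp_eq_zero (q := (p, chartAt (Fin d → ℂ) x' y)) hc e
    rw [chern_trans (h := gramL n H x) (f := paramMap P (chartChange x x')) (by rw [hgo]; exact hH.smooth x p y hy.1)
      (by rw [hgo]; exact hH.isUnit p hy.1)
      (IsHolChange.contDiffAt (q := (p, chartAt (Fin d → ℂ) x' y)) hc)
      (IsHolChange.smoothAt (q := (p, chartAt (Fin d → ℂ) x' y)) hc) hc.isUnit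
      (IsMetricFamily.eventuallyEq H p hy) (dp e) (by rw [cj_dp]; exact h0), h0,
      IsHolChange.push_dp (q := (p, chartAt (Fin d → ℂ) x' y)) hc, hgo]
    simp [frameL, (chartAt (Fin d → ℂ) x').left_inv hy.2.1]

variable (n) in
/-- The matrix of the component `Θ(∂_j)` of the Higgs field in the chart and frame around `x`. -/
def thetaL (P : Type*) (Θ : HiggsField d n E) (x : X) (j : Fin d) (q : P × (Fin d → ℂ)) :
    Matrix (Fin n) (Fin n) ℂ := higgsMatrix Θ x q.2 (Pi.single j 1)

/-- The inverse of the matrix of the Kähler metric in the chart around `x`. -/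
def gammaL (P : Type*) (g : FormField (Tang d X)) (x : X) (q : P × (Fin d → ℂ)) :
    Matrix (Fin d) (Fin d) ℂ := (gram d g x ((chartAt (Fin d → ℂ) x).symm q.2))⁻¹

lemma thetaL_smoothAt (Θ : HiggsField d n E) {x y : X} (hy : y ∈ dom d n E x) (j : Fin d) (p : P) :
    SmoothAt (thetaL n P Θ x j) (p, chartAt (Fin d → ℂ) x y) := fun i k => by
  have h := (Θ.holomorphic x (Pi.single j 1) i k).contMDiffAt
    (((trivializationAt (Fin d → ℂ) (Tang d X) x).open_baseSet.inter
      (trivializationAt (Fin n → ℂ) E x).open_baseSet).mem_nhds ⟨hy.1, hy.2⟩)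
  have h2 := contDiffAt_comp_chart_symm h hy.1
  exact ContDiffAt.comp (p, chartAt (Fin d → ℂ) x y)
    ((h2.restrict_scalars ℝ).of_le le_top) contDiffAt_snd

lemma thetaL_cdM (Θ : HiggsField d n E) {x y : X} (hy : y ∈ dom d n E x) (j : Fin d) (p : P)
    (v : Fin d → ℂ) : cdM (cj (dh P v)) (thetaL n P Θ x j) (p, chartAt (Fin d → ℂ) x y) = 0 := by
  ext i k
  have h := (Θ.holomorphic x (Pi.single j 1) i k).contMDiffAt
    (((trivializationAt (Fin d → ℂ) (Tang d X) x).open_baseSet.inter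
      (trivializationAt (Fin n → ℂ) E x).open_baseSet).mem_nhds ⟨hy.1, hy.2⟩)
  have h2 := contDiffAt_comp_chart_symm h hy.1
  exact cd_holomorphic (P := P) (q := (p, chartAt (Fin d → ℂ) x y))
    (h2.differentiableAt (by simp)) v

lemma thetaL_cdM_dp (Θ : HiggsField d n E) {x y : X} (hy : y ∈ dom d n E x) (j : Fin d) (p : P)
    (e : P) : cdM (dp e) (thetaL n P Θ x j) (p, chartAt (Fin d → ℂ) x y) = 0 := by
  ext i k
  have h := (Θ.holomorphic x (Pi.single j 1) i k).contMDiffAt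
    (((trivializationAt (Fin d → ℂ) (Tang d X) x).open_baseSet.inter
      (trivializationAt (Fin n → ℂ) E x).open_baseSet).mem_nhds ⟨hy.1, hy.2⟩)
  have h2 := contDiffAt_comp_chart_symm h hy.1
  exact cd_dp_snd _ (p, chartAt (Fin d → ℂ) x y)
    ((h2.differentiableAt (by simp)).restrictScalars ℝ) e

lemma fderiv_sum_single (L : (Fin d → ℂ) →L[ℂ] (Fin d → ℂ)) (v : Fin d → ℂ) :
    L v = ∑ l, L v l • Pi.single l (1 : ℂ) := pi_eq_sum_univ' (L v)

lemma higgsMatrix_chart (Θ : HiggsField d n E) {x y : X}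
    (hy : y ∈ (chartAt (Fin d → ℂ) x).source) (v : Fin d → ℂ) :
    higgsMatrix Θ x (chartAt (Fin d → ℂ) x y) v =
      endCoord n x y (Θ.toFun y (tangVec x y v)) := by
  have : ∀ w, w = y → endCoord n x w (Θ.toFun w (tangVec x w v)) =
      endCoord n x y (Θ.toFun y (tangVec x y v)) := by
    rintro _ rfl; rfl
  exact this _ ((chartAt (Fin d → ℂ) x).left_inv hy)

lemma thetaL_trans (Θ : HiggsField d n E) {x x' y : X} (hy : y ∈ dom d n E x ∩ dom d n E x')
    (p : P) (j : Fin d) : thetaL n P Θ x' j (p, chartAt (Fin d → ℂ) x' y) =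
      (frameChange n E x x' y)⁻¹ * (∑ l, fderiv ℂ (chartChange x x') (chartAt (Fin d → ℂ) x' y)
        (Pi.single j 1) l • thetaL n P Θ x l (p, chartAt (Fin d → ℂ) x y)) *
        frameChange n E x x' y := by
  simp only [thetaL, higgsMatrix_chart Θ hy.1.1, higgsMatrix_chart Θ hy.2.1]
  rw [endCoord_frameChange hy.1.2 hy.2.2, tangVec_eq hy.1.1 hy.2.1]
  congr 2
  set L := fderiv ℂ (chartChange x x') (chartAt (Fin d → ℂ) x' y)
  have hl : ∀ v, (tangVec x y v : Tang d X y) =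
      (trivializationAt (Fin d → ℂ) (Tang d X) x).symmₗ ℂ y v := fun v =>
    (Trivialization.symmₗ_apply _ (show y ∈ frameSet d (Tang d X) x from hy.1.1) v).symm
  have h2 : ∀ A : Module.End ℂ (E y), endCoord n x y A = endCoordₗ (n := n) x y A := fun _ => rfl
  rw [fderiv_sum_single L, hl, map_sum, map_sum, h2, map_sum]
  simp only [map_smul, h2, hl]
  rw [← fderiv_sum_single L]

lemma gammaL_smoothAt {g : FormField (Tang d X)} (hg : IsHermitianMetric d d g) {x y : X}
    (hy : y ∈ (chartAt (Fin d → ℂ) x).source) (p : P) :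
    SmoothAt (gammaL P g x) (p, chartAt (Fin d → ℂ) x y) := by
  refine SmoothAt.inv (fun i j => ?_) ?_
  · exact contDiffAt_chart_of_contMDiffOn
      (trivializationAt (Fin d → ℂ) (Tang d X) x).open_baseSet (hg.smooth x i j) hy hy p
  · simp only [(chartAt (Fin d → ℂ) x).left_inv hy]
    exact gram_isUnit (E := Tang d X) hg hy

lemma gammaL_hermitian {g : FormField (Tang d X)} (hg : IsHermitianMetric d d g) (x : X)
    (q : P × (Fin d → ℂ)) : (gammaL P g x q)ᴴ = gammaL P g x q := by
  rw [gammaL, Matrix.conjTranspose_nonsing_inv, gram_isHermitian (E := Tang d X) hg]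

lemma gammaL_cdM_dp {g : FormField (Tang d X)} (hg : IsHermitianMetric d d g) {x y : X}
    (hy : y ∈ (chartAt (Fin d → ℂ) x).source) (p : P) (e : P) :
    cdM (dp e) (gammaL P g x) (p, chartAt (Fin d → ℂ) x y) = 0 := by
  ext i k
  have h := (gammaL_smoothAt (P := P) hg hy p i k).comp (f := fun z : Fin d → ℂ => (p, z))
    (chartAt (Fin d → ℂ) x y) (contDiffAt_const.prodMk contDiffAt_id)
  exact cd_dp_snd _ (p, chartAt (Fin d → ℂ) x y) (h.differentiableAt (by simp)) e

lemma frameChange_tang_apply {x x' y : X} (hx : y ∈ (chartAt (Fin d → ℂ) x).source)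
    (hx' : y ∈ (chartAt (Fin d → ℂ) x').source) : (Matrix.of fun l j =>
      fderiv ℂ (chartChange x x') (chartAt (Fin d → ℂ) x' y) (Pi.single j 1) l) =
      frameChange d (Tang d X) x x' y := by
  ext l j
  rw [Matrix.of_apply, ← frameChange_tang hx hx', Matrix.mulVec_single_one]
  rfl

lemma gammaL_trans {g : FormField (Tang d X)} (hg : IsHermitianMetric d d g) {x x' y : X}
    (hx : y ∈ (chartAt (Fin d → ℂ) x).source)
    (hx' : y ∈ (chartAt (Fin d → ℂ) x').source) (p : P) :
    (Matrix.of fun l j => fderiv ℂ (chartChange x x') (chartAt (Fin d → ℂ) x' y)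
      (Pi.single j 1) l) * gammaL P g x' (p, chartAt (Fin d → ℂ) x' y) *
      (Matrix.of fun l j => fderiv ℂ (chartChange x x') (chartAt (Fin d → ℂ) x' y)
      (Pi.single j 1) l)ᴴ = gammaL P g x (p, chartAt (Fin d → ℂ) x y) := by
  rw [frameChange_tang_apply hx hx']
  simp only [gammaL, (chartAt (Fin d → ℂ) x).left_inv hx, (chartAt (Fin d → ℂ) x').left_inv hx']
  rw [gram_frameChange (E := Tang d X) (x₀ := x) hx hx']
  exact inv_contraction (gram_isUnit (E := Tang d X) hg hx) (frameChange_isUnit hx hx')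

/-- The matrices of `i Λ F` for a family of metrics. -/
def higgsL (g : FormField (Tang d X)) (Θ : HiggsField d n E) (H : P → FormField E) (x : X) :
    P × (Fin d → ℂ) → Matrix (Fin n) (Fin n) ℂ :=
  higgsP (gramL n H x) (thetaL n P Θ x) (gammaL P g x) (dhb P d)

lemma higgsL_isEndFamily {g : FormField (Tang d X)} (hg : IsHermitianMetric d d g)
    (Θ : HiggsField d n E) {H : P → FormField E} (hH : IsMetricFamily d n H) :
    IsEndFamily (higgsL g Θ H) E where
  smooth x p y hy := higgsP_smoothAt (hH.smooth x p y hy) (hH.isUnit p hy)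
    (fun j => thetaL_smoothAt Θ hy j p) (gammaL_smoothAt hg hy.1 p)
  trans x x' p y hy := by
    have hc := isHolChange hy
    have hgo : paramMap P (chartChange x x') (p, chartAt (Fin d → ℂ) x' y) =
      (p, chartAt (Fin d → ℂ) x y) := chg_apply hy.2.1 p
    have hfr : frameL d n E x x' (chartAt (Fin d → ℂ) x' y) = frameChange n E x x' y := by
      rw [frameL, (chartAt (Fin d → ℂ) x').left_inv hy.2.1]
    have := IsHolChange.higgsP_trans (q := (p, chartAt (Fin d → ℂ) x' y)) hc
      (h := gramL n H x) (h' := gramL n H x') (by rw [hgo]; exact hH.smoothNear p hy.1)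
      (by rw [hgo]; exact hH.isUnit p hy.1) (IsMetricFamily.eventuallyEq H p hy)
      (θ := thetaL n P Θ x) (θ' := thetaL n P Θ x')
      (by intro j; rw [hgo]; simp only [hfr]; exact thetaL_trans Θ hy p j)
      (γ := gammaL P g x) (γ' := gammaL P g x')
      (by rw [hgo]; exact gammaL_trans hg hy.1.1 hy.2.1 p)
    rw [hgo] at this
    simp only [hfr] at this
    exact this

end Families

/-! ### The measure of `ω^d`. -/

section Volume

variable {d : ℕ} {X : Type*} [TopologicalSpace X] [ChartedSpace (Fin d → ℂ) X]
  [IsManifold 𝓘(ℂ, Fin d → ℂ) ω X]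

/-- The density of `ω^d` in the chart around `x`. -/
def density (g : FormField (Tang d X)) (x : X) (z : Fin d → ℂ) : ℝ :=
  (d ! : ℝ) * (gram d g x ((chartAt (Fin d → ℂ) x).symm z)).det.re

open scoped ComplexOrder in
lemma density_nonneg {g : FormField (Tang d X)} (hg : IsHermitianMetric d d g) {x : X}
    {z : Fin d → ℂ} (hz : z ∈ (chartAt (Fin d → ℂ) x).target) : 0 ≤ density g x z := by
  refine mul_nonneg (Nat.cast_nonneg _) ?_
  have := (gram_posDef (E := Tang d X) hg (x := x) (y := (chartAt (Fin d → ℂ) x).symm z)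
    ((chartAt (Fin d → ℂ) x).map_target hz)).det_pos
  exact (Complex.lt_def.1 this).1.le

lemma continuousOn_density {g : FormField (Tang d X)} (hg : IsHermitianMetric d d g) (x : X) :
    ContinuousOn (density g x) (chartAt (Fin d → ℂ) x).target := by
  refine continuousOn_const.mul (Complex.continuous_re.comp_continuousOn ?_)
  have h : ∀ i j, ContinuousOn (fun z => gram d g x ((chartAt (Fin d → ℂ) x).symm z) i j)
      (chartAt (Fin d → ℂ) x).target := fun i j =>
    (hg.smooth x i j).continuousOn.comp (chartAt (Fin d → ℂ) x).continuousOn_symm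
      fun z hz => (chartAt (Fin d → ℂ) x).map_target hz
  simp only [Matrix.det_apply']
  exact continuousOn_finsetSum _ fun σ _ => continuousOn_const.mul
    (continuousOn_finsetProd _ fun i _ => h _ _)

lemma det_restrictScalars_complex (L : (Fin d → ℂ) →L[ℂ] (Fin d → ℂ)) :
    |(L.restrictScalars ℝ).det| = Complex.normSq (LinearMap.det (L : (Fin d → ℂ) →ₗ[ℂ] _)) := by
  rw [ContinuousLinearMap.det, ContinuousLinearMap.coe_restrictScalars,
    LinearMap.det_restrictScalars, Algebra.norm_complex_apply, abs_of_nonneg (normSq_nonneg _)]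

lemma det_frameChange_tang {x₀ x₁ y : X} (h₀ : y ∈ (chartAt (Fin d → ℂ) x₀).source)
    (h₁ : y ∈ (chartAt (Fin d → ℂ) x₁).source) : (frameChange d (Tang d X) x₀ x₁ y).det =
      LinearMap.det (fderiv ℂ (chartChange x₀ x₁) (chartAt (Fin d → ℂ) x₁ y) :
        (Fin d → ℂ) →ₗ[ℂ] (Fin d → ℂ)) := by
  rw [← LinearMap.det_toLin']
  congr 1
  refine LinearMap.ext fun v => ?_
  rw [Matrix.toLin'_apply, frameChange_tang h₀ h₁]
  rfl

-- The real Jacobian of a holomorphic map is the squared modulus of its complex Jacobian, which is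
-- the factor by which the determinant of a Hermitian form changes.
open scoped ComplexOrder in
lemma density_change {g : FormField (Tang d X)} (hg : IsHermitianMetric d d g) {x₀ x₁ y : X}
    (h₀ : y ∈ (chartAt (Fin d → ℂ) x₀).source)
    (h₁ : y ∈ (chartAt (Fin d → ℂ) x₁).source) : density g x₁ (chartAt (Fin d → ℂ) x₁ y) =
      |((fderiv ℂ (chartChange x₀ x₁) (chartAt (Fin d → ℂ) x₁ y)).restrictScalars ℝ).det| *
        density g x₀ (chartAt (Fin d → ℂ) x₀ y) := by
  rw [det_restrictScalars_complex, ← det_frameChange_tang h₀ h₁, density, density,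
    (chartAt (Fin d → ℂ) x₀).left_inv h₀, (chartAt (Fin d → ℂ) x₁).left_inv h₁,
    gram_frameChange (E := Tang d X) (x₀ := x₀) (x₁ := x₁) h₀ h₁, Matrix.det_mul, Matrix.det_mul,
    Matrix.det_conjTranspose]
  set D := (frameChange d (Tang d X) x₀ x₁ y).det
  have : star D * (gram d g x₀ y).det * D = (normSq D : ℂ) * (gram d g x₀ y).det := by
    rw [Complex.normSq_eq_conj_mul_self]
    simp only [starRingEnd_apply]; ring
  rw [this, Complex.re_ofReal_mul]
  ring

variable [MeasurableSpace X] [BorelSpace X]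

lemma aemeasurable_chart_symm (x : X) : AEMeasurable (chartAt (Fin d → ℂ) x).symm
    ((volume : Measure (Fin d → ℂ)).restrict (chartAt (Fin d → ℂ) x).target) :=
  (chartAt (Fin d → ℂ) x).continuousOn_symm.aemeasurable
    (chartAt (Fin d → ℂ) x).open_target.measurableSet

lemma chartVolume_apply (g : FormField (Tang d X)) (x : X) {S : Set X} (hS : MeasurableSet S) :
    chartVolume g x S = ∫⁻ z in (chartAt (Fin d → ℂ) x).symm ⁻¹' S ∩ (chartAt (Fin d → ℂ) x).target,
      ENNReal.ofReal (density g x z) := by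
  rw [chartVolume, Measure.map_apply_of_aemeasurable
    ((aemeasurable_chart_symm x).mono_ac (withDensity_absolutelyContinuous _ _)) hS,
    withDensity_apply', Measure.restrict_restrict' (chartAt _ x).open_target.measurableSet]
  rfl

lemma chartVolume_inter_source (g : FormField (Tang d X)) (x : X) {S : Set X}
    (hS : MeasurableSet S) :
    chartVolume g x (S ∩ (chartAt (Fin d → ℂ) x).source) = chartVolume g x S := by
  rw [chartVolume_apply g x hS, chartVolume_apply g x
    (hS.inter (chartAt (Fin d → ℂ) x).open_source.measurableSet)]
  congr 2
  ext z
  constructor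
  · rintro ⟨h1, h2⟩; exact ⟨h1.1, h2⟩
  · rintro ⟨h1, h2⟩; exact ⟨⟨h1, (chartAt (Fin d → ℂ) x).map_target h2⟩, h2⟩

lemma measurableSet_chart_preimage (x : X) {S : Set X} (hS : MeasurableSet S) :
    MeasurableSet ((chartAt (Fin d → ℂ) x).symm ⁻¹' S ∩ (chartAt (Fin d → ℂ) x).target) := by
  have h := (chartAt (Fin d → ℂ) x).open_target.measurableSet
  have := (continuousOn_iff_continuous_domRestrict.1
    (chartAt (Fin d → ℂ) x).continuousOn_symm).measurable hS
  have := (MeasurableEmbedding.subtype_coe h).measurableSet_image' this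
  convert! this using 1
  ext z
  simp [Set.domRestrict]

lemma chartVolume_eq {g : FormField (Tang d X)} (hg : IsHermitianMetric d d g) (x₀ x₁ : X)
    {S : Set X} (hS : MeasurableSet S) (h₀ : S ⊆ (chartAt (Fin d → ℂ) x₀).source)
    (h₁ : S ⊆ (chartAt (Fin d → ℂ) x₁).source) : chartVolume g x₀ S = chartVolume g x₁ S := by
  rw [chartVolume_apply g x₀ hS, chartVolume_apply g x₁ hS]
  set e₀ := chartAt (Fin d → ℂ) x₀ with he₀
  set e₁ := chartAt (Fin d → ℂ) x₁ with he₁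
  have him : chartChange x₀ x₁ '' (e₁.symm ⁻¹' S ∩ e₁.target) = e₀.symm ⁻¹' S ∩ e₀.target := by
    ext z
    constructor
    · rintro ⟨w, ⟨hw, hw'⟩, rfl⟩
      have hw0 := h₀ hw
      refine ⟨?_, e₀.map_source hw0⟩
      change e₀.symm (e₀ (e₁.symm w)) ∈ S
      rwa [e₀.left_inv hw0]
    · rintro ⟨hz, hz'⟩
      have hz1 := h₁ hz
      refine ⟨e₁ (e₀.symm z), ⟨?_, e₁.map_source hz1⟩, ?_⟩
      · change e₁.symm (e₁ (e₀.symm z)) ∈ S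
        rwa [e₁.left_inv hz1]
      · change e₀ (e₁.symm (e₁ (e₀.symm z))) = z
        rw [e₁.left_inv hz1, e₀.right_inv hz']
  rw [← him, lintegral_image_eq_lintegral_abs_det_fderiv_mul volume
    (measurableSet_chart_preimage x₁ hS)
    (f' := fun z => (fderiv ℂ (chartChange x₀ x₁) z).restrictScalars ℝ)]
  · refine setLIntegral_congr_fun (measurableSet_chart_preimage x₁ hS) fun z hz => ?_
    have e := density_change hg (h₀ hz.1) (h₁ hz.1)
    rw [← he₁, e₁.right_inv hz.2] at e
    rw [← ENNReal.ofReal_mul (abs_nonneg _), e]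
    rfl
  · intro z hz
    have := contDiffAt_chartChange (h₀ hz.1) (h₁ hz.1)
    rw [← he₁, e₁.right_inv hz.2] at this
    exact ((this.differentiableAt (by simp)).hasFDerivAt.restrictScalars ℝ).hasFDerivWithinAt
  · intro z hz w hw hzw
    have := e₀.injOn (h₀ hz.1) (h₀ hw.1) hzw
    exact e₁.symm.injOn hz.2 hw.2 this

lemma exists_source_cover [CompactSpace X] [Nonempty X] :
    ∃ f : ℕ → X, ⋃ k, (chartAt (Fin d → ℂ) (f k)).source = Set.univ := by
  obtain ⟨t, ht⟩ := isCompact_univ.elim_finite_subcover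
    (fun x : X => (chartAt (Fin d → ℂ) x).source) (fun x => (chartAt _ x).open_source)
    fun x _ => Set.mem_iUnion.2 ⟨x, mem_chart_source _ x⟩
  have hne : (t : Set X).Nonempty := by
    obtain ⟨x⟩ := ‹Nonempty X›
    obtain ⟨y, hy⟩ := Set.mem_iUnion.1 (ht (Set.mem_univ x))
    obtain ⟨hy, -⟩ := Set.mem_iUnion.1 hy
    exact ⟨y, hy⟩
  obtain ⟨f, hf⟩ := t.finite_toSet.countable.exists_eq_range hne
  refine ⟨f, Set.eq_univ_of_univ_subset fun x _ => ?_⟩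
  obtain ⟨y, hy⟩ := Set.mem_iUnion.1 (ht (Set.mem_univ x))
  obtain ⟨hy, hxy⟩ := Set.mem_iUnion.1 hy
  have : y ∈ Set.range f := hf ▸ hy
  obtain ⟨k, rfl⟩ := this
  exact Set.mem_iUnion.2 ⟨k, hxy⟩

/-- A measure `ν` glued from the chart measures over a countable disjoint decomposition restricts to
each of them, by `chartVolume_eq`. It therefore dominates their supremum, and on a chart domain
supremum, `ν` and chart measure coincide. -/
lemma omegaPow_apply [CompactSpace X] {g : FormField (Tang d X)} (hg : IsHermitianMetric d d g)
    (x : X) {S : Set X} (hS : MeasurableSet S) (h : S ⊆ (chartAt (Fin d → ℂ) x).source) :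
    omegaPow g S = chartVolume g x S := by
  have : Nonempty X := ⟨x⟩
  obtain ⟨f, hf⟩ := exists_source_cover (d := d) (X := X)
  set A := disjointed fun k => (chartAt (Fin d → ℂ) (f k)).source with hA
  have hAm : ∀ k, MeasurableSet (A k) := fun k =>
    MeasurableSet.disjointed (fun k => (chartAt (Fin d → ℂ) (f k)).open_source.measurableSet) k
  have hAs : ∀ k, A k ⊆ (chartAt (Fin d → ℂ) (f k)).source := fun k => disjointed_subset _ k
  have hAU : ⋃ k, A k = Set.univ := by rw [hA, iUnion_disjointed, hf]
  set ν := Measure.sum fun k => (chartVolume g (f k)).restrict (A k) with hν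
  have key : ∀ (y : X) {S : Set X}, MeasurableSet S → S ⊆ (chartAt (Fin d → ℂ) y).source →
      ν S = chartVolume g y S := by
    intro y S hS hy
    rw [hν, Measure.sum_apply _ hS]
    have : S = ⋃ k, S ∩ A k := by rw [← Set.inter_iUnion, hAU, Set.inter_univ]
    conv_rhs => rw [this]
    rw [measure_iUnion (fun i j hij => ((disjoint_disjointed _ hij).mono
      Set.inter_subset_right Set.inter_subset_right)) (fun k => hS.inter (hAm k))]
    refine tsum_congr fun k => ?_
    rw [Measure.restrict_apply hS]
    exact chartVolume_eq hg _ _ (hS.inter (hAm k)) (Set.inter_subset_right.trans (hAs k))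
      (Set.inter_subset_left.trans hy)
  -- A chart measure is carried by the domain of its chart, where it agrees with `ν`.
  have hle : omegaPow g ≤ ν := by
    refine iSup_le fun y => Measure.le_iff.2 fun S hS => ?_
    rw [← chartVolume_inter_source g y hS, ← key y
      (hS.inter (chartAt (Fin d → ℂ) y).open_source.measurableSet) Set.inter_subset_right]
    exact measure_mono Set.inter_subset_left
  refine le_antisymm ?_ ?_
  · rw [← key x hS h]; exact hle S
  · exact le_iSup (fun y => chartVolume g y) x S

lemma restrict_omegaPow [CompactSpace X] {g : FormField (Tang d X)}
    (hg : IsHermitianMetric d d g) (x : X) :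
    (omegaPow g).restrict (chartAt (Fin d → ℂ) x).source = chartVolume g x := by
  refine Measure.ext fun S hS => ?_
  rw [Measure.restrict_apply hS, omegaPow_apply hg x
    (hS.inter (chartAt (Fin d → ℂ) x).open_source.measurableSet) Set.inter_subset_right,
    chartVolume_inter_source g x hS]

lemma isFiniteMeasure_omegaPow [CompactSpace X] {g : FormField (Tang d X)}
    (hg : IsHermitianMetric d d g) : IsFiniteMeasure (omegaPow g) := by
  refine ⟨isCompact_univ.measure_lt_top_of_nhdsWithin fun x _ => ?_⟩
  rw [nhdsWithin_univ]
  set e := chartAt (Fin d → ℂ) x with he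
  have hx : e x ∈ e.target := e.map_source (mem_chart_source _ x)
  obtain ⟨K, hK, hxK, hKt⟩ := exists_compact_subset e.open_target hx
  refine ⟨e.source ∩ e ⁻¹' (interior K), (e.isOpen_inter_preimage isOpen_interior).mem_nhds
    ⟨mem_chart_source _ x, hxK⟩, ?_⟩
  rw [omegaPow_apply hg x (e.isOpen_inter_preimage isOpen_interior).measurableSet
    Set.inter_subset_left, chartVolume_apply g x
    (e.isOpen_inter_preimage isOpen_interior).measurableSet]
  have hsub : e.symm ⁻¹' (e.source ∩ e ⁻¹' (interior K)) ∩ e.target ⊆ K := by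
    rintro z ⟨⟨_, h2⟩, h3⟩
    have : e (e.symm z) ∈ interior K := h2
    rw [e.right_inv h3] at this
    exact interior_subset this
  refine (lintegral_mono_set hsub).trans_lt ?_
  obtain ⟨C, hC⟩ := (hK.image_of_continuousOn ((continuousOn_density hg x).mono hKt)).bddAbove
  refine (setLIntegral_mono (measurable_const (a := ENNReal.ofReal C))
    fun z hz => ENNReal.ofReal_le_ofReal (hC ⟨z, hz, rfl⟩)).trans_lt ?_
  rw [setLIntegral_const]
  exact ENNReal.mul_lt_top ENNReal.ofReal_lt_top hK.measure_lt_top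

lemma integral_omegaPow_of_support [CompactSpace X] {g : FormField (Tang d X)}
    (hg : IsHermitianMetric d d g) (x : X) {f : X → ℂ} (hf : Continuous f)
    (hs : ∀ y ∉ (chartAt (Fin d → ℂ) x).source, f y = 0) :
    ∫ y, f y ∂(omegaPow g) = ∫ z in (chartAt (Fin d → ℂ) x).target,
      (density g x z : ℂ) * f ((chartAt (Fin d → ℂ) x).symm z) := by
  rw [← setIntegral_eq_integral_of_forall_compl_eq_zero (s := (chartAt (Fin d → ℂ) x).source) hs,
    restrict_omegaPow hg, chartVolume, integral_map
      ((aemeasurable_chart_symm x).mono_ac (withDensity_absolutelyContinuous _ _))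
      hf.aestronglyMeasurable]
  rw [integral_withDensity_eq_integral_toReal_smul₀]
  · refine setIntegral_congr_fun (chartAt (Fin d → ℂ) x).open_target.measurableSet fun z hz => ?_
    have h0 := density_nonneg hg hz
    rw [density] at h0
    rw [ENNReal.toReal_ofReal h0, Complex.real_smul]
    rfl
  · exact ((continuousOn_density hg x).aemeasurable
      (chartAt (Fin d → ℂ) x).open_target.measurableSet).ennreal_ofReal
  · exact Filter.Eventually.of_forall fun z => ENNReal.ofReal_lt_top

end Volume

/-! ### Jacobi's formula. -/

section Determinant

variable {W : Type*} [NormedAddCommGroup W] [NormedSpace ℝ W] {m : Type*} [Fintype m]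
  [DecidableEq m]

lemma cd_prod {ι : Type*} [DecidableEq ι] (s : Finset ι) {f : ι → W → ℂ} {p : W} (ξ : W × W)
    (hf : ∀ i ∈ s, DifferentiableAt ℝ (f i) p) :
    cd ξ (fun q => ∏ i ∈ s, f i q) p = ∑ i ∈ s, (∏ j ∈ s.erase i, f j p) * cd ξ (f i) p := by
  have h : HasFDerivAt (fun q => ∏ i ∈ s, f i q)
      (∑ i ∈ s, (∏ j ∈ s.erase i, f j p) • fderiv ℝ (f i) p) p :=
    HasFDerivAt.finsetProd fun i hi => (hf i hi).hasFDerivAt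
  simp only [cd, h.fderiv, sum_apply, smul_apply, smul_eq_mul, mul_add, Finset.sum_add_distrib,
    Finset.mul_sum]
  congr 1
  exact Finset.sum_congr rfl fun i _ => by ring

/-- Jacobi's formula. -/
lemma cd_det {F : W → Matrix m m ℂ} {p : W} (hF : SmoothAt F p) (ξ : W × W) :
    cd ξ (fun q => (F q).det) p = ((F p).adjugate * cdM ξ F p).trace := by
  have e1 : (fun q => (F q).det) = fun q => ∑ σ : Equiv.Perm m,
      ((Equiv.Perm.sign σ : ℤ) : ℂ) * ∏ i, F q (σ i) i := by
    ext q; rw [Matrix.det_apply']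
  have hd : ∀ i j, DifferentiableAt ℝ (fun q => F q i j) p := fun i j => (hF i j).dAt
  have hp : ∀ σ : Equiv.Perm m, ContDiffAt ℝ ∞ (fun q => ∏ i, F q (σ i) i) p := fun σ =>
    contDiffAt_prod fun i _ => hF _ _
  rw [e1, cd_sum _ fun σ _ => (contDiffAt_const.mul (hp σ)).dAt]
  have e2 : ∀ i, ((F p).adjugate * cdM ξ F p) i i =
      ((F p).updateCol i fun k => cdM ξ F p k i).det := fun i => by
    rw [← Matrix.cramer_apply, Matrix.cramer_eq_adjugate_mulVec]
    rfl
  simp only [Matrix.trace, Matrix.diag, e2, Matrix.det_apply']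
  rw [Finset.sum_comm]
  refine Finset.sum_congr rfl fun σ _ => ?_
  rw [cd_mul _ (differentiableAt_const _) (hp σ).dAt, cd_const, zero_mul, zero_add,
    cd_prod _ _ fun i _ => hd _ _, Finset.mul_sum]
  refine Finset.sum_congr rfl fun i _ => ?_
  rw [← Finset.mul_prod_erase _ _ (Finset.mem_univ i), Matrix.updateCol_self, cdM_apply,
    mul_comm (∏ _ ∈ _, _)]
  congr 2
  refine Finset.prod_congr rfl fun j hj => ?_
  rw [Matrix.updateCol_ne (Finset.ne_of_mem_erase hj)]

lemma cd_det_of_isUnit {F : W → Matrix m m ℂ} {p : W} (hF : SmoothAt F p)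
    (hu : IsUnit (F p).det) (ξ : W × W) :
    cd ξ (fun q => (F q).det) p = (F p).det * (chern F ξ p).trace := by
  rw [cd_det hF, chern, ← smul_eq_mul (F p).det, ← Matrix.trace_smul, ← Matrix.smul_mul, Matrix.inv_def,
    smul_smul, Ring.mul_inverse_cancel _ hu, one_smul]

end Determinant

/-! ### The Kähler condition in complex coordinates. -/

section Kaehler

variable {P : Type*} [NormedAddCommGroup P] [NormedSpace ℝ P] {d : ℕ} {X : Type*}
  [TopologicalSpace X] [ChartedSpace (Fin d → ℂ) X] [IsManifold 𝓘(ℂ, Fin d → ℂ) ω X]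

lemma localOmega_single (g : FormField (Tang d X)) {x : X} {z : Fin d → ℂ}
    (hz : z ∈ (chartAt (Fin d → ℂ) x).target) (a b : Fin d) (r s : ℂ) :
    localOmega g x z (Pi.single a r) (Pi.single b s) =
      (conj r * s * gram d g x ((chartAt (Fin d → ℂ) x).symm z) a b).im := by
  have hm : (chartAt (Fin d → ℂ) x).symm z ∈ (trivializationAt (Fin d → ℂ) (Tang d X) x).baseSet :=
    (chartAt (Fin d → ℂ) x).map_target hz
  have hs : ∀ (a : Fin d) (r : ℂ), tangVec x ((chartAt (Fin d → ℂ) x).symm z) (Pi.single a r) =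
      r • (localFrame d (Tang d X) x ((chartAt (Fin d → ℂ) x).symm z) a) := fun a r => by
    rw [tangVec, localFrame, ← Trivialization.symmₗ_apply (R := ℂ) _ hm,
      ← Trivialization.symmₗ_apply (R := ℂ) _ hm, ← map_smul, ← Pi.single_smul, smul_eq_mul, mul_one]
  rw [localOmega, hs, hs]
  simp only [map_smulₛₗ, LinearMap.smul_apply, smul_eq_mul, gram, Matrix.of_apply]
  rw [← mul_assoc]
  congr 1
  simp only [RingHom.id_apply]
  ring

lemma fderiv_im_mul {V : Type*} [NormedAddCommGroup V] [NormedSpace ℝ V] {f : V → ℂ} {z : V}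
    (hf : DifferentiableAt ℝ f z) (c : ℂ) (u : V) :
    fderiv ℝ (fun p => (c * f p).im) z u = (c * fderiv ℝ f z u).im := by
  have : HasFDerivAt (fun p => (c * f p).im) (Complex.imCLM.comp (c • fderiv ℝ f z)) z :=
    Complex.imCLM.hasFDerivAt.comp z (hf.hasFDerivAt.const_mul c)
  rw [this.fderiv]
  rfl

/-- The Kähler condition in a holomorphic chart. -/
lemma IsKaehler.cd_gram {g : FormField (Tang d X)} (hg : IsKaehler g) {x y : X}
    (hy : y ∈ (chartAt (Fin d → ℂ) x).source) (p : P) (l j k : Fin d) :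
    cd (cj (dhb P d l)) (fun q => gramL d (fun _ : P => g) x q j k) (p, chartAt (Fin d → ℂ) x y) =
      cd (cj (dhb P d j)) (fun q => gramL d (fun _ : P => g) x q l k) (p, chartAt (Fin d → ℂ) x y) := by
  have hsm : ∀ a b, DifferentiableAt ℝ (fun q => gramL d (fun _ : P => g) x q a b)
      (p, chartAt (Fin d → ℂ) x y) := fun a b =>
    (hg.hermitian.isMetricFamily.smooth x p y ⟨hy, hy⟩ a b).dAt
  set z := chartAt (Fin d → ℂ) x y with hz
  have hzt : z ∈ (chartAt (Fin d → ℂ) x).target := (chartAt (Fin d → ℂ) x).map_source hy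
  set G : (Fin d → ℂ) → Matrix (Fin d) (Fin d) ℂ :=
    fun w => gram d g x ((chartAt (Fin d → ℂ) x).symm w) with hG
  have hGs : ∀ a b, DifferentiableAt ℝ (fun w => G w a b) z := fun a b =>
    (hsm a b).comp (f := fun w : Fin d → ℂ => (p, w)) z
      ((differentiableAt_const p).prodMk differentiableAt_id)
  rw [← delbar_slice (hsm j k), ← delbar_slice (hsm l k)]
  simp only [delbar, ← Pi.single_smul, smul_eq_mul, mul_one]
  change 1 / 2 * (fderiv ℝ (fun w => G w j k) z _ + I * fderiv ℝ (fun w => G w j k) z _) =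
    1 / 2 * (fderiv ℝ (fun w => G w l k) z _ + I * fderiv ℝ (fun w => G w l k) z _)
  have hconj : ∀ a b u, fderiv ℝ (fun w => G w a b) z u = conj (fderiv ℝ (fun w => G w b a) z u) := by
    intro a b u
    have h : HasFDerivAt (fun q => conj (G q b a))
        ((Complex.conjCLE : ℂ →L[ℝ] ℂ).comp (fderiv ℝ (fun w => G w b a) z)) z :=
      (Complex.conjCLE : ℂ →L[ℝ] ℂ).hasFDerivAt.comp z (hGs b a).hasFDerivAt
    have e : (fun q => conj (G q b a)) = fun w => G w a b := by
      ext w; exact hg.hermitian.conj_symm _ _ _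
    rw [e] at h
    rw [h.fderiv]; simp
  -- Closedness of `ω` on complex multiples of coordinate vectors. The choices `r, s, t ∈ {1, I}`
  -- give eight real linear equations, from which the real and imaginary parts of the identity are
  -- combined.
  have key : ∀ r s t : ℂ,
      (conj s * t * fderiv ℝ (fun w => G w k j) z (Pi.single l r)).im
      + (conj t * r * fderiv ℝ (fun w => G w j l) z (Pi.single k s)).im
      + (conj r * s * fderiv ℝ (fun w => G w l k) z (Pi.single j t)).im = 0 := by
    intro r s t
    have := hg.closed x z hzt (Pi.single l r) (Pi.single k s) (Pi.single j t)
    have he : ∀ (a b : Fin d) (r s : ℂ), (fun w => localOmega g x w (Pi.single a r) (Pi.single b s))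
        =ᶠ[nhds z] fun w => (conj r * s * G w a b).im := fun a b r s => by
      filter_upwards [(chartAt (Fin d → ℂ) x).open_target.mem_nhds hzt] with w hw
        using localOmega_single g hw a b r s
    rw [(he _ _ _ _).fderiv_eq, (he _ _ _ _).fderiv_eq, (he _ _ _ _).fderiv_eq,
      fderiv_im_mul (hGs _ _), fderiv_im_mul (hGs _ _), fderiv_im_mul (hGs _ _)] at this
    exact this
  rw [hconj j k, hconj j k]
  simp only [hconj k j, hconj j l] at key
  have k1 := key 1 1 1
  have k2 := key 1 1 I
  have k3 := key 1 I 1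
  have k4 := key 1 I I
  have k5 := key I 1 1
  have k6 := key I 1 I
  have k7 := key I I 1
  have k8 := key I I I
  simp only [map_one, conj_I, one_mul, mul_one, neg_mul, I_mul_I, neg_neg, mul_neg, neg_im,
    conj_im, conj_re, mul_im, I_re, I_im, zero_mul, zero_add] at k1 k2 k3 k4 k5 k6 k7 k8
  rw [hconj k j, hconj k j]
  apply Complex.ext
  · simp only [mul_re, add_re, add_im, I_re, I_im, conj_re, conj_im, mul_im]
    norm_num
    linarith
  · simp only [mul_re, add_re, add_im, I_re, I_im, conj_re, conj_im, mul_im]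
    norm_num
    linarith

end Kaehler

/-! ### Divergence of `(1,0)`-forms. -/

section OneForms

variable {P : Type*} [NormedAddCommGroup P] [NormedSpace ℝ P]
variable {d n : ℕ} {X : Type*} [TopologicalSpace X] [ChartedSpace (Fin d → ℂ) X]
  {E : X → Type*} [∀ x, AddCommGroup (E x)] [∀ x, Module ℂ (E x)]
  [TopologicalSpace (TotalSpace (Fin n → ℂ) E)] [∀ x, TopologicalSpace (E x)]
  [FiberBundle (Fin n → ℂ) E] [VectorBundle ℂ (Fin n → ℂ) E]

/-- Families of smooth `(1,0)`-forms, given by their components in all charts. -/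
structure IsOneForm (B : X → P × (Fin d → ℂ) → Fin d → ℂ)
    (E : X → Type*) [∀ x, AddCommGroup (E x)] [∀ x, Module ℂ (E x)]
    [TopologicalSpace (TotalSpace (Fin n → ℂ) E)] [∀ x, TopologicalSpace (E x)]
    [FiberBundle (Fin n → ℂ) E] [VectorBundle ℂ (Fin n → ℂ) E] : Prop where
  smooth : ∀ x p, ∀ y ∈ dom d n E x, ∀ j,
    ContDiffAt ℝ ∞ (fun q => B x q j) (p, chartAt (Fin d → ℂ) x y)
  trans : ∀ x x' p, ∀ y ∈ dom d n E x ∩ dom d n E x', ∀ j, B x' (p, chartAt (Fin d → ℂ) x' y) j =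
    ∑ l, fderiv ℂ (chartChange x x') (chartAt (Fin d → ℂ) x' y) (Pi.single j 1) l *
      B x (p, chartAt (Fin d → ℂ) x y) l

variable [IsManifold 𝓘(ℂ, Fin d → ℂ) ω X]

/-- The divergence of a `(1,0)`-form in the chart around `x`. -/
def divL (g : FormField (Tang d X))
    (B : X → P × (Fin d → ℂ) → Fin d → ℂ) (x : X) (q : P × (Fin d → ℂ)) : ℂ :=
  ∑ j, ∑ k, gammaL P g x q j k * cd (cj (dhb P d k)) (fun q => B x q j) q

lemma isHolChange_one {x x' y : X} (hx : y ∈ (chartAt (Fin d → ℂ) x).source)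
    (hx' : y ∈ (chartAt (Fin d → ℂ) x').source) :
    IsHolChange (chartChange x x') (fun _ => (1 : Matrix Unit Unit ℂ))
      (chartAt (Fin d → ℂ) x' y) where
  chart := contDiffAt_chartChange hx hx'
  frame i j := contDiffAt_const
  isUnit := by simp

/-- The components change by the holomorphic Jacobian, which `∂̄` does not differentiate, so `g^{j
k̄} ∂_k̄ B_j` is independent of the chart without any correction term. -/
lemma IsOneForm.divL_trans {g : FormField (Tang d X)} (hg : IsHermitianMetric d d g)
    {B : X → P × (Fin d → ℂ) → Fin d → ℂ} (hB : IsOneForm (n := n) B E) {x x' y : X} (p : P)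
    (hy : y ∈ dom d n E x ∩ dom d n E x') :
    divL g B x' (p, chartAt (Fin d → ℂ) x' y) = divL g B x (p, chartAt (Fin d → ℂ) x y) := by
  have hc := isHolChange_one hy.1.1 hy.2.1
  set q : P × (Fin d → ℂ) := (p, chartAt (Fin d → ℂ) x' y) with hq
  have hgo : paramMap P (chartChange x x') q = (p, chartAt (Fin d → ℂ) x y) := chg_apply hy.2.1 p
  have hF : ∀ j, (fun q => Matrix.of fun _ _ : Unit => B x' q j) =ᶠ[nhds q]
      fun q => ((1 : Matrix Unit Unit ℂ))⁻¹ * (∑ l, (fderiv ℂ (chartChange x x') q.2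
        (Pi.single j 1) l) • Matrix.of fun _ _ : Unit =>
          B x (paramMap P (chartChange x x') q) l) * 1 + 0 := fun j => by
    filter_upwards [eventually_symm_mem hy.2.1 ((isOpen_dom x).inter (isOpen_dom x')) hy p]
      with q hq
    have := hB.trans x x' q.1 _ hq.2 j
    rw [(chartAt (Fin d → ℂ) x').right_inv hq.1] at this
    ext a b
    simp only [Matrix.of_apply, inv_one, one_mul, mul_one, add_zero, Matrix.sum_apply,
      Matrix.smul_apply, smul_eq_mul]
    rw [this]
    rfl
  have key : ∀ j k, cd (cj (dhb P d k)) (fun q => B x' q j) q = ∑ l, ∑ r,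
      (fderiv ℂ (chartChange x x') q.2 (Pi.single j 1) l *
        conj (fderiv ℂ (chartChange x x') q.2 (Pi.single k 1) r)) •
        cd (cj (dhb P d r)) (fun q => B x q l) (p, chartAt (Fin d → ℂ) x y) := fun j k => by
    -- A function is treated as a matrix of size one, with the trivial frame change.
    have h := IsHolChange.cdM_cj_twist (q := q) hc
      (β := fun l q => Matrix.of fun _ _ : Unit => B x q l) (c := fun _ => 0)
      (fun l _ _ => by rw [hgo]; exact hB.smooth x p y hy.1 l) (smoothAt_const _ _)
      (Pi.single j 1) (Pi.single k 1) (cdM_const _ _ _) (hF j)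
    rw [hgo] at h
    have h := congrFun (congrFun h ()) ()
    simp only [inv_one, one_mul, mul_one, Matrix.sum_apply, Matrix.smul_apply] at h
    exact h
  simp only [divL, key]
  exact contraction_invariant (γ := gammaL P g x (p, chartAt (Fin d → ℂ) x y))
    (γ' := gammaL P g x' q) (b := Matrix.of fun l j => fderiv ℂ (chartChange x x') q.2
      (Pi.single j 1) l) (gammaL_trans hg hy.1.1 hy.2.1 p)
    (fun l r => cd (cj (dhb P d r)) (fun q => B x q l) (p, chartAt (Fin d → ℂ) x y))

lemma IsOneForm.smoothFam_div {g : FormField (Tang d X)} (hg : IsHermitianMetric d d g)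
    {B : X → P × (Fin d → ℂ) → Fin d → ℂ} (hB : IsOneForm (n := n) B E) :
    SmoothFam (d := d) (atC (divL g B)) := by
  intro p x
  have h1 : ContDiffAt ℝ ∞ (divL g B x) (p, chartAt (Fin d → ℂ) x x) :=
    ContDiffAt.sum fun j _ => ContDiffAt.sum fun k _ =>
      ((gammaL_smoothAt hg (mem_chart_source _ x) p) j k).mul
        (contDiffAt_cd (hB.smooth x p x (mem_dom x) j) _)
  refine h1.congr_of_eventuallyEq ?_
  filter_upwards [eventually_symm_mem (mem_chart_source _ x) (isOpen_dom (d := d) (n := n) (E := E) x)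
    (mem_dom x) p] with q hq
  rw [atC, hB.divL_trans hg (x := x) q.1 ⟨hq.2, mem_dom (d := d) _⟩,
    (chartAt (Fin d → ℂ) x).right_inv hq.1]

lemma SmoothFam.continuousAt {f : P → X → ℂ} (hf : SmoothFam (d := d) f) (p : P) (x : X) :
    ContinuousAt (fun q : P × X => f q.1 q.2) (p, x) := by
  have h := (hf p x).continuousAt
  have h2 : ContinuousAt (fun q : P × X => (q.1, chartAt (Fin d → ℂ) x q.2)) (p, x) :=
    continuousAt_fst.prodMk (((chartAt (Fin d → ℂ) x).continuousAt (mem_chart_source _ x)).comp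
      continuousAt_snd)
  refine (ContinuousAt.comp (f := fun q : P × X => (q.1, chartAt (Fin d → ℂ) x q.2))
    (x := (p, x)) h h2).congr ?_
  have : ∀ᶠ q : P × X in nhds (p, x), q.2 ∈ (chartAt (Fin d → ℂ) x).source :=
    continuousAt_snd.eventually ((chartAt (Fin d → ℂ) x).open_source.mem_nhds
      (mem_chart_source (Fin d → ℂ) x))
  filter_upwards [this] with q hq
  simp [(chartAt (Fin d → ℂ) x).left_inv hq]

lemma SmoothFam.continuous {f : P → X → ℂ} (hf : SmoothFam (d := d) f) :
    Continuous (fun q : P × X => f q.1 q.2) :=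
  continuous_iff_continuousAt.2 fun q => hf.continuousAt q.1 q.2

/-- Smooth families are smooth in every chart. -/
lemma SmoothFam.contDiffAt {f : P → X → ℂ} (hf : SmoothFam (d := d) f) (p : P) {x y : X}
    (hy : y ∈ (chartAt (Fin d → ℂ) x).source) :
    ContDiffAt ℝ ∞ (fun q : P × (Fin d → ℂ) => f q.1 ((chartAt (Fin d → ℂ) x).symm q.2))
      (p, chartAt (Fin d → ℂ) x y) := by
  have hc := isHolChange_one (d := d) (x := y) (mem_chart_source _ y) hy
  have h1 := IsHolChange.contDiffAt (q := (p, chartAt (Fin d → ℂ) x y)) hc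
  have hgo : chg P d y x (p, chartAt (Fin d → ℂ) x y) = (p, chartAt (Fin d → ℂ) y y) :=
    chg_apply hy p
  have h2 := hf p y
  rw [← hgo] at h2
  refine (ContDiffAt.comp _ h2 h1).congr_of_eventuallyEq ?_
  filter_upwards [eventually_symm_mem hy ((chartAt (Fin d → ℂ) y).open_source)
    (mem_chart_source _ y) p] with q hq
  simp only [Function.comp, paramMap, chartChange, (chartAt (Fin d → ℂ) y).left_inv hq.2]

lemma IsOneForm.mul_fun {B : X → P × (Fin d → ℂ) → Fin d → ℂ} (hB : IsOneForm (n := n) B E)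
    {f : X → ℂ} (hf : ∀ (p : P) (x : X), ∀ y ∈ (chartAt (Fin d → ℂ) x).source,
      ContDiffAt ℝ ∞ (fun q : P × (Fin d → ℂ) => f ((chartAt (Fin d → ℂ) x).symm q.2))
        (p, chartAt (Fin d → ℂ) x y)) :
    IsOneForm (n := n) (fun x (q : P × (Fin d → ℂ)) j =>
      f ((chartAt (Fin d → ℂ) x).symm q.2) * B x q j) E where
  smooth x p y hy j := (hf p x y hy.1).mul (hB.smooth x p y hy j)
  trans x x' p y hy j := by
    rw [hB.trans x x' p y hy j, Finset.mul_sum]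
    simp only [(chartAt (Fin d → ℂ) x).left_inv hy.1.1, (chartAt (Fin d → ℂ) x').left_inv hy.2.1]
    exact Finset.sum_congr rfl fun l _ => by ring

end OneForms

/-! ### Stokes' theorem for divergences. -/

section Stokes

variable {P : Type*} [NormedAddCommGroup P] [NormedSpace ℝ P]
variable {d n : ℕ} {X : Type*} [TopologicalSpace X] [ChartedSpace (Fin d → ℂ) X]
  {E : X → Type*} [∀ x, AddCommGroup (E x)] [∀ x, Module ℂ (E x)]
  [TopologicalSpace (TotalSpace (Fin n → ℂ) E)] [∀ x, TopologicalSpace (E x)]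
  [FiberBundle (Fin n → ℂ) E] [VectorBundle ℂ (Fin n → ℂ) E]

/-- Integration by parts against the constant function `1`. -/
lemma integral_fderiv_eq_zero {f : (Fin d → ℂ) → ℂ} (hf : ContDiff ℝ ∞ f)
    (hc : HasCompactSupport f) (v : Fin d → ℂ) :
    Integrable (fun z => fderiv ℝ f z v) ∧ ∫ z, fderiv ℝ f z v = 0 := by
  have h1 : Integrable (fun z => fderiv ℝ f z v) := by
    refine Continuous.integrable_of_hasCompactSupport
      ((hf.continuous_fderiv (by simp)).clm_apply continuous_const) ?_
    exact (hc.fderiv ℝ).comp_left (g := fun L : (Fin d → ℂ) →L[ℝ] ℂ => L v) rfl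
  have h2 : Integrable f := hf.continuous.integrable_of_hasCompactSupport hc
  have := integral_mul_fderiv_eq_neg_fderiv_mul_of_integrable (μ := (volume : Measure (Fin d → ℂ)))
    (f := fun _ => (1 : ℂ)) (g := f) (v := v) (by simp) (by simpa using h1) (by simpa using h2)
    (fun _ _ => differentiableAt_const _) (fun z _ => (hf.differentiable (by simp)) z)
  exact ⟨h1, by simpa using this⟩

lemma integral_delbar_eq_zero {f : (Fin d → ℂ) → ℂ} (hf : ContDiff ℝ ∞ f)
    (hc : HasCompactSupport f) (v : Fin d → ℂ) :
    Integrable (fun z => delbar f z v) ∧ ∫ z, delbar f z v = 0 := by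
  obtain ⟨i1, e1⟩ := integral_fderiv_eq_zero hf hc v
  obtain ⟨i2, e2⟩ := integral_fderiv_eq_zero hf hc (I • v)
  refine ⟨(i1.add (i2.const_mul I)).const_mul _, ?_⟩
  simp only [delbar]
  rw [integral_const_mul, integral_add i1 (i2.const_mul I), integral_const_mul, e1, e2]
  simp

variable [IsManifold 𝓘(ℂ, Fin d → ℂ) ω X]

lemma SmoothFam.continuous_slice {f : P → X → ℂ} (hf : SmoothFam (d := d) f) (p : P) :
    Continuous (f p) := by
  have h : Continuous fun x : X => (p, x) := by fun_prop
  exact Continuous.comp (g := fun q : P × X => f q.1 q.2) hf.continuous h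

/-- The vector fields `∑_k det (g) g^{j k̄} ∂_k̄` are divergence free. -/
lemma IsKaehler.sum_cd_gammaL_mul_det {g : FormField (Tang d X)} (hg : IsKaehler g) {x y : X}
    (hy : y ∈ (chartAt (Fin d → ℂ) x).source) (p : P) (j : Fin d) :
    ∑ k, cd (cj (dhb P d k)) (fun q => gammaL P g x q j k * (gramL (d := d) (E := Tang d X) d (fun _ : P => g) x q).det)
      (p, chartAt (Fin d → ℂ) x y) = 0 := by
  set q : P × (Fin d → ℂ) := (p, chartAt (Fin d → ℂ) x y) with hq
  set h := gramL (d := d) (E := Tang d X) d (fun _ : P => g) x with hh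
  have hs : SmoothAt h q := (hg.hermitian.isMetricFamily (n := d) (E := Tang d X)).smooth x p y ⟨hy, hy⟩
  have hu : IsUnit (h q).det := (hg.hermitian.isMetricFamily (n := d) (E := Tang d X)).isUnit p ⟨hy, hy⟩
  have hγ : SmoothAt (gammaL P g x) q := gammaL_smoothAt hg.hermitian hy p
  have hM : ∀ k a b, cdM (cj (dhb P d k)) h q a b = cdM (cj (dhb P d a)) h q k b := fun k a b =>
    hg.cd_gram hy p k a b
  have e : ∀ k, cd (cj (dhb P d k)) (fun q => gammaL P g x q j k * (h q).det) q =
      -(((h q)⁻¹ * cdM (cj (dhb P d k)) h q * (h q)⁻¹) j k) * (h q).det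
        + (h q)⁻¹ j k * ((h q).det * ((h q)⁻¹ * cdM (cj (dhb P d k)) h q).trace) := fun k => by
    rw [cd_mul _ (hγ j k).dAt hs.det.dAt, cd_det_of_isUnit hs hu, ← cdM_apply]
    have : cdM (cj (dhb P d k)) (gammaL P g x) q = -((h q)⁻¹ * cdM (cj (dhb P d k)) h q * (h q)⁻¹) :=
      cdM_inv _ hs hu
    rw [this]
    rfl
  simp only [e, Finset.sum_add_distrib, ← Finset.sum_mul, Finset.sum_neg_distrib]
  -- The Kähler symmetry `hM` exchanges the direction of differentiation with the row index. It
  -- turns the derivative of the inverse metric into the trace that Jacobi's formula produces from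
  -- the determinant, with opposite sign.
  have e2 : ∑ k, ((h q)⁻¹ * cdM (cj (dhb P d k)) h q * (h q)⁻¹) j k =
      ∑ a, (h q)⁻¹ j a * ((h q)⁻¹ * cdM (cj (dhb P d a)) h q).trace := by
    simp only [Matrix.mul_assoc, Matrix.mul_apply (M := (h q)⁻¹) (i := j)]
    rw [Finset.sum_comm]
    refine Finset.sum_congr rfl fun a _ => ?_
    rw [Matrix.trace_mul_comm, ← Finset.mul_sum]
    congr 1
    refine Finset.sum_congr rfl fun k _ => ?_
    simp only [Matrix.diag, Matrix.mul_apply]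
    exact Finset.sum_congr rfl fun b _ => by rw [hM]
  rw [e2, neg_mul, neg_add_eq_zero, Finset.sum_mul]
  exact Finset.sum_congr rfl fun a _ => by ring

variable [MeasurableSpace X] [BorelSpace X] [CompactSpace X] [T2Space X]

lemma IsOneForm.atC_divL_eq_zero {g : FormField (Tang d X)} 
    {B : X → P × (Fin d → ℂ) → Fin d → ℂ} {K : Set X} (hK : IsClosed K) (p : P)
    (h0 : ∀ (p : P) (y : X), y ∉ K → ∀ x, y ∈ dom d n E x → B x (p, chartAt (Fin d → ℂ) x y) = 0)
    {y : X} (hy : y ∉ K) : atC (divL g B) p y = 0 := by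
  rw [atC, divL]
  refine Finset.sum_eq_zero fun j _ => Finset.sum_eq_zero fun k _ => ?_
  rw [cd_congr (g := fun _ => 0), cd_const, mul_zero]
  filter_upwards [eventually_symm_mem (mem_chart_source _ y)
    ((isOpen_dom (d := d) (n := n) (E := E) y).inter hK.isOpen_compl) ⟨mem_dom y, hy⟩ p] with q hq
  have := h0 q.1 _ hq.2.2 y hq.2.1
  rw [(chartAt (Fin d → ℂ) y).right_inv hq.1] at this
  rw [this]; rfl

open scoped ComplexOrder in
lemma density_eq {g : FormField (Tang d X)} (hg : IsHermitianMetric d d g) {x : X}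
    {z : Fin d → ℂ} (hz : z ∈ (chartAt (Fin d → ℂ) x).target) :
    (density g x z : ℂ) = (d ! : ℂ) * (gram d g x ((chartAt (Fin d → ℂ) x).symm z)).det := by
  have := (gram_posDef (E := Tang d X) hg (x := x) (y := (chartAt (Fin d → ℂ) x).symm z)
    ((chartAt (Fin d → ℂ) x).map_target hz)).det_pos
  have h2 := (Complex.lt_def.1 this).2
  rw [density]
  push_cast
  congr 1
  exact Complex.ext (by simp) (by simpa using h2)

/-- The density of `ω^d` is `d!` times `det g`, and the fields `det g · g^{j k̄} ∂_k̄` are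
divergence free by the Kähler condition. In the chart, density times divergence is therefore the
total derivative `d! ∑ ∂_k̄ (det g · g^{j k̄} B_j)` of functions of compact support. -/
lemma IsOneForm.integral_div_of_support {g : FormField (Tang d X)} (hg : IsKaehler g)
    {B : X → P × (Fin d → ℂ) → Fin d → ℂ} (hB : IsOneForm (n := n) B E) {K : Set X}
    (hK : IsClosed K) {x : X} (hKx : K ⊆ dom d n E x) (p : P)
    (h0 : ∀ (p : P) (y : X), y ∉ K → ∀ x, y ∈ dom d n E x → B x (p, chartAt (Fin d → ℂ) x y) = 0) :
    ∫ y, atC (divL g B) p y ∂(omegaPow g) = 0 := by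
  have hgh := hg.hermitian
  set c := chartAt (Fin d → ℂ) x with hc
  have hz := fun y (hy : y ∉ K) => IsOneForm.atC_divL_eq_zero (g := g) (n := n) hK p h0 hy
  have hcont : Continuous (atC (divL g B) p) :=
    (hB.smoothFam_div hgh).continuous_slice p
  rw [integral_omegaPow_of_support hgh x hcont fun y hy => hz y fun h => hy (hKx h).1]
  have hKs : K ⊆ c.source := fun y hy => (hKx hy).1
  have hKc : IsCompact (c '' K) := hK.isCompact.image_of_continuousOn (c.continuousOn.mono hKs)
  have hKt : c '' K ⊆ c.target := by
    rintro _ ⟨y, hy, rfl⟩; exact c.map_source (hKs hy)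
  set f : Fin d → (Fin d → ℂ) → ℂ := fun k z =>
    ∑ j, gammaL P g x (p, z) j k * (gramL (d := d) (E := Tang d X) d (fun _ : P => g) x (p, z)).det * B x (p, z) j with hf
  -- Extension by zero outside the compact set `c '' K`. The form vanishes off `K`, so `F` coincides
  -- with `f` in a neighbourhood of every point of `c '' K` and is smooth everywhere.
  set F : Fin d → (Fin d → ℂ) → ℂ := fun k => (c '' K).indicator (f k) with hF
  have hF0 : ∀ z ∉ c '' K, ∀ k, F k =ᶠ[nhds z] fun _ => 0 := fun z hz k => by
    have hn : (c '' K)ᶜ ∈ nhds z := hKc.isClosed.isOpen_compl.mem_nhds hz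
    filter_upwards [hn] with w hw
    exact Set.indicator_of_notMem hw (f k)
  have hF1 : ∀ y ∈ K, ∀ k, F k =ᶠ[nhds (c y)] f k := fun y hy k => by
    have h2 := (eventually_symm_mem (P := P) (hKs hy)
      (isOpen_dom (d := d) (n := n) (E := E) x) (hKx hy) p).curry_nhds.self_of_nhds
    filter_upwards [h2] with w hw
    by_cases hwK : w ∈ c '' K
    · exact Set.indicator_of_mem hwK _
    · rw [hF]
      simp only
      rw [Set.indicator_of_notMem hwK]
      have h3 : c.symm w ∉ K := fun h => hwK ⟨_, h, c.right_inv hw.1⟩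
      have := h0 p _ h3 x hw.2
      rw [← hc, c.right_inv hw.1] at this
      simp [hf, this]
  have hγ : ∀ y ∈ K, ∀ j k, ContDiffAt ℝ ∞ (fun q => gammaL P g x q j k) (p, c y) :=
    fun y hy j k => gammaL_smoothAt hgh (hKs hy) p j k
  have hD : ∀ y ∈ K, ContDiffAt ℝ ∞ (fun q => (gramL (d := d) (E := Tang d X) d (fun _ : P => g) x q).det) (p, c y) :=
    fun y hy => ((hgh.isMetricFamily (n := d) (E := Tang d X)).smooth x p y ⟨hKs hy, hKs hy⟩).det
  have hfs : ∀ y ∈ K, ∀ k, ContDiffAt ℝ ∞ (fun q => ∑ j, gammaL P g x q j k *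
      (gramL (d := d) (E := Tang d X) d (fun _ : P => g) x q).det * B x q j) (p, c y) := fun y hy k =>
    ContDiffAt.sum fun j _ => ((hγ y hy j k).mul (hD y hy)).mul (hB.smooth x p y (hKx hy) j)
  have hFs : ∀ k, ContDiff ℝ ∞ (F k) := fun k => contDiff_iff_contDiffAt.2 fun z => by
    by_cases hzK : z ∈ c '' K
    · obtain ⟨y, hy, rfl⟩ := hzK
      refine ContDiffAt.congr_of_eventuallyEq ?_ (hF1 y hy k)
      exact ContDiffAt.comp (f := fun w : Fin d → ℂ => (p, w)) (c y) (hfs y hy k)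
        (contDiffAt_const.prodMk contDiffAt_id)
    · exact contDiffAt_const.congr_of_eventuallyEq (hF0 z hzK k)
  have hFc : ∀ k, HasCompactSupport (F k) := fun k =>
    HasCompactSupport.intro hKc fun z hz => Set.indicator_of_notMem hz _
  have hFi := fun k => integral_delbar_eq_zero (hFs k) (hFc k) (Pi.single k 1)
  have key : ∀ z, c.target.indicator (fun z => (density g x z : ℂ) *
      atC (divL g B) p (c.symm z)) z = (d ! : ℂ) * ∑ k, delbar (F k) z (Pi.single k 1) := by
    intro z
    by_cases hzK : z ∈ c '' K
    · obtain ⟨y, hy, rfl⟩ := hzK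
      rw [Set.indicator_of_mem (c.map_source (hKs hy)), density_eq hgh (c.map_source (hKs hy)),
        c.left_inv (hKs hy), atC, hB.divL_trans hgh (x := x) p ⟨hKx hy, mem_dom (d := d) _⟩, mul_assoc]
      congr 1
      have e1 : ∀ k, delbar (F k) (c y) (Pi.single k 1) = ∑ j,
          (cd (cj (dhb P d k)) (fun q => gammaL P g x q j k * (gramL (d := d) (E := Tang d X) d (fun _ : P => g) x q).det)
            (p, c y) * B x (p, c y) j + gammaL P g x (p, c y) j k *
            (gramL (d := d) (E := Tang d X) d (fun _ : P => g) x (p, c y)).det *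
              cd (cj (dhb P d k)) (fun q => B x q j) (p, c y)) := fun k => by
        have : delbar (F k) (c y) (Pi.single k 1) = delbar (f k) (c y) (Pi.single k 1) := by
          simp only [delbar, (hF1 y hy k).fderiv_eq]
        rw [this, hf]
        rw [delbar_slice (q := (p, c y)) (hfs y hy k).dAt, cd_sum _ fun j _ =>
          (((hγ y hy j k).mul (hD y hy)).mul (hB.smooth x p y (hKx hy) j)).dAt]
        exact Finset.sum_congr rfl fun j _ =>
          cd_mul _ ((hγ y hy j k).mul (hD y hy)).dAt (hB.smooth x p y (hKx hy) j).dAt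
      simp only [e1]
      rw [Finset.sum_comm]
      simp only [Finset.sum_add_distrib, ← Finset.sum_mul]
      have e3 := fun j => hg.sum_cd_gammaL_mul_det (P := P) (hKs hy) p j
      rw [← hc] at e3
      simp only [e3, zero_mul, Finset.sum_const_zero, zero_add, divL, Finset.mul_sum, ← hc]
      refine Finset.sum_congr rfl fun j _ => Finset.sum_congr rfl fun k _ => ?_
      simp only [gramL, ← hc, c.left_inv (hKs hy)]
      ring
    · have e1 : ∀ k, delbar (F k) z (Pi.single k 1) = 0 := fun k => by
        simp [delbar, (hF0 z hzK k).fderiv_eq]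
      simp only [e1, Finset.sum_const_zero, mul_zero]
      by_cases hzt : z ∈ c.target
      · rw [Set.indicator_of_mem hzt, hz _ fun h => hzK ⟨_, h, c.right_inv hzt⟩, mul_zero]
      · exact Set.indicator_of_notMem hzt _
  rw [← integral_indicator c.open_target.measurableSet]
  rw [funext key]
  rw [integral_const_mul, integral_finsetSum _ fun k _ => (hFi k).1]
  simp [fun k => (hFi k).2]

lemma SmoothFam.integrable {g : FormField (Tang d X)} (hg : IsHermitianMetric d d g)
    {f : P → X → ℂ} (hf : SmoothFam (d := d) f) (p : P) : Integrable (f p) (omegaPow g) := by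
  have := isFiniteMeasure_omegaPow hg
  exact (hf.continuous_slice p).integrable_of_hasCompactSupport (HasCompactSupport.of_compactSpace _)

/-- **Stokes' theorem** on a closed Kähler manifold. -/
theorem IsOneForm.integral_div {g : FormField (Tang d X)} (hg : IsKaehler g)
    {B : X → P × (Fin d → ℂ) → Fin d → ℂ} (hB : IsOneForm (n := n) B E) (p : P) :
    ∫ y, atC (divL g B) p y ∂(omegaPow g) = 0 := by
  have : IsManifold 𝓘(ℝ, Fin d → ℂ) ∞ X := isManifold_real
  obtain ⟨t, ht⟩ := isCompact_univ.elim_finite_subcover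
    (fun x : X => dom d n E x) (fun x => isOpen_dom x)
    fun x _ => Set.mem_iUnion.2 ⟨x, mem_dom x⟩
  obtain ⟨ρ, hρ⟩ := SmoothPartitionOfUnity.exists_isSubordinate 𝓘(ℝ, Fin d → ℂ)
    (s := (Set.univ : Set X)) isClosed_univ (fun x : t => dom d n E (x : X))
    (fun x => isOpen_dom _) (by simpa [Set.iUnion_subtype] using ht)
  have hsum : ∀ x, ∑ i, (ρ i x : ℂ) = 1 := fun x => by
    have := ρ.sum_eq_one (Set.mem_univ x)
    rw [finsum_eq_sum_of_fintype] at this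
    exact_mod_cast this
  have hρs : ∀ (i : t) (p : P) (x : X), ∀ y ∈ (chartAt (Fin d → ℂ) x).source,
      ContDiffAt ℝ ∞ (fun q : P × (Fin d → ℂ) => (ρ i ((chartAt (Fin d → ℂ) x).symm q.2) : ℂ))
        (p, chartAt (Fin d → ℂ) x y) := fun i p x y hy => by
    have h := contDiffAt_comp_chart_symm ((ρ i).contMDiff.contMDiffAt (x := y)) hy
    exact Complex.ofRealCLM.contDiff.contDiffAt.comp _
      (ContDiffAt.comp (p, chartAt (Fin d → ℂ) x y) (f := Prod.snd) h contDiffAt_snd)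
  have hBi := fun i => hB.mul_fun (f := fun y => (ρ i y : ℂ)) (hρs i)
  -- No gradient of the cut-off functions appears: the sum over `i` is taken inside the derivative,
  -- where `∑ ρ_i = 1`.
  have e : ∀ y, atC (divL g B) p y = ∑ i, atC (divL g fun x (q : P × (Fin d → ℂ)) j =>
      (ρ i ((chartAt (Fin d → ℂ) x).symm q.2) : ℂ) * B x q j) p y := fun y => by
    simp only [atC, divL]
    conv_rhs => rw [Finset.sum_comm]
    refine Finset.sum_congr rfl fun j _ => ?_
    rw [Finset.sum_comm]
    refine Finset.sum_congr rfl fun k _ => ?_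
    rw [← Finset.mul_sum, ← cd_sum _ fun i _ => ((hBi i).smooth y p y (mem_dom y) j).dAt]
    congr 2
    ext q
    rw [← Finset.sum_mul, hsum, one_mul]
  simp only [e]
  rw [integral_finsetSum _ fun i _ => ((hBi i).smoothFam_div hg.hermitian).integrable hg.hermitian p]
  have hz : ∀ i : t, ∫ y, atC (divL g fun x (q : P × (Fin d → ℂ)) j =>
      (ρ i ((chartAt (Fin d → ℂ) x).symm q.2) : ℂ) * B x q j) p y ∂(omegaPow g) = 0 := ?_
  · rw [Fintype.sum_congr _ _ hz, Finset.sum_const_zero]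
  intro i
  refine (hBi i).integral_div_of_support hg (isClosed_tsupport (ρ i)) (hρ i) p ?_
  intro p y hy x hyx
  ext j
  simp only [(chartAt (Fin d → ℂ) x).left_inv hyx.1, image_eq_zero_of_notMem_tsupport hy]
  simp

end Stokes

/-! ### Types of bilinear maps and of real derivatives; the Laplacian as a divergence. -/

section Types

variable {d n : ℕ} {X : Type*} [TopologicalSpace X] [ChartedSpace (Fin d → ℂ) X]

/-- `mixedTrace` only sees the part of a real bilinear map which is complex linear in the first
and conjugate linear in the second variable. -/
lemma mixedTrace_eq [IsManifold 𝓘(ℂ, Fin d → ℂ) 1 X] {M : Type*} [AddCommGroup M] [Module ℂ M]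
    (g : FormField (Tang d X)) (x : X) {η : (Fin d → ℂ) → (Fin d → ℂ) → M}
    {f₁ f₂ f₃ f₄ : Fin d → Fin d → M}
    (h : ∀ j k, ∀ c c' : ℂ, η (Pi.single j c) (Pi.single k c') = (c * c') • f₁ j k
      + (c * conj c') • f₂ j k + (conj c * c') • f₃ j k + (conj c * conj c') • f₄ j k) :
    mixedTrace g x η = ∑ j, ∑ k, (gram d g x x)⁻¹ j k • f₂ j k := by
  refine Finset.sum_congr rfl fun j _ => Finset.sum_congr rfl fun k _ => ?_
  have : η (Pi.single j 1) (Pi.single k 1) + η (Pi.single j I) (Pi.single k I)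
      + I • η (Pi.single j 1) (Pi.single k I) - I • η (Pi.single j I) (Pi.single k 1)
      = (4 : ℂ) • f₂ j k := by
    simp only [h, map_one, conj_I, smul_add, smul_smul, one_mul, mul_one, mul_neg, neg_mul,
      I_mul_I, neg_neg]
    module
  rw [this, smul_smul, div_mul_cancel₀ _ (by norm_num)]

end Types

section Directions

variable {P : Type*} [NormedAddCommGroup P] [NormedSpace ℝ P] {d : ℕ}

lemma dh_single (j : Fin d) (c : ℂ) : dh P (Pi.single j c) = dh P (c • Pi.single j 1) := by
  rw [← Pi.single_smul, smul_eq_mul, mul_one]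

lemma cd_dh_single (j : Fin d) (c : ℂ) (f : P × (Fin d → ℂ) → ℂ) (q) :
    cd (dh P (Pi.single j c)) f q = c * cd (dhb P d j) f q := by
  rw [dh_single, cd_dh_smul]

lemma cd_cj_dh_single (j : Fin d) (c : ℂ) {f : P × (Fin d → ℂ) → ℂ} {q}
    (hf : DifferentiableAt ℝ f q) :
    cd (cj (dh P (Pi.single j c))) f q = conj c * cd (cj (dhb P d j)) f q := by
  rw [dh_single, cj_dh_conj _ _ _ _ hf]

/-- The real derivative in terms of the `(1,0)`- and `(0,1)`-derivatives. -/
lemma fderiv_slice_single {f : P × (Fin d → ℂ) → ℂ} {q : P × (Fin d → ℂ)}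
    (hf : DifferentiableAt ℝ f q) (j : Fin d) (c : ℂ) :
    fderiv ℝ (fun z => f (q.1, z)) q.2 (Pi.single j c) =
      c * cd (dhb P d j) f q + conj c * cd (cj (dhb P d j)) f q := by
  rw [← cd_dh_single, ← cd_cj_dh_single _ _ hf, ← del_slice hf, ← delbar_slice hf, del, delbar]
  ring

end Directions

section Families

variable {P : Type*} [NormedAddCommGroup P] [NormedSpace ℝ P]
variable {d n : ℕ} {X : Type*} [TopologicalSpace X] [ChartedSpace (Fin d → ℂ) X]
  {E : X → Type*} [∀ x, AddCommGroup (E x)] [∀ x, Module ℂ (E x)]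
  [TopologicalSpace (TotalSpace (Fin n → ℂ) E)] [∀ x, TopologicalSpace (E x)]
  [FiberBundle (Fin n → ℂ) E] [VectorBundle ℂ (Fin n → ℂ) E]
  [IsManifold 𝓘(ℂ, Fin d → ℂ) ω X]

lemma nab_dh (h L : P × (Fin d → ℂ) → Matrix (Fin n) (Fin n) ℂ) (v : Fin d → ℂ) (q) :
    nab h L (dh P v) q = ∑ l, v l • nab h L (dhb P d l) q := by
  have hc : ∀ F : P × (Fin d → ℂ) → Matrix (Fin n) (Fin n) ℂ,
      cdM (dh P v) F q = ∑ l, v l • cdM (dhb P d l) F q := fun F => by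
    ext i j
    simp only [cdM_apply, Matrix.sum_apply, Matrix.smul_apply, smul_eq_mul]
    exact cd_dh_sum _ _ _
  simp only [nab, chern, hc, Finset.mul_sum, Finset.sum_mul, Matrix.mul_smul, Matrix.smul_mul,
    smul_add, smul_sub, Finset.sum_add_distrib, Finset.sum_sub_distrib]

/-- These are the one-forms to which Stokes' theorem is applied: `nab_trans` makes the covariant
derivative tensorial, and the trace removes the change of frame. -/
lemma nabForm_isOneForm [ContMDiffVectorBundle ω (Fin n → ℂ) E 𝓘(ℂ, Fin d → ℂ)]
    {H : P → FormField E} (hH : IsMetricFamily d n H)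
    {A L : ∀ x : X, P × (Fin d → ℂ) → Matrix (Fin n) (Fin n) ℂ} (hA : IsEndFamily A E)
    (hL : IsEndFamily L E) : IsOneForm (n := n) (fun x q j =>
      (A x q * nab (gramL n H x) (L x) (dhb P d j) q).trace) E where
  smooth x p y hy j := ((hA.smooth x p y hy).mul (nab_smoothAt (hH.smooth x p y hy)
    (hH.isUnit p hy) (hL.smooth x p y hy) _)).trace
  trans x x' p y hy j := by
    have hc := isHolChange hy
    set q : P × (Fin d → ℂ) := (p, chartAt (Fin d → ℂ) x' y) with hq
    have hgo : paramMap P (chartChange x x') q = (p, chartAt (Fin d → ℂ) x y) := chg_apply hy.2.1 p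
    have hfr : frameL d n E x x' (chartAt (Fin d → ℂ) x' y) = frameChange n E x x' y := by
      rw [frameL, (chartAt (Fin d → ℂ) x').left_inv hy.2.1]
    have e := nab_trans (q := q) (h := gramL n H x) (h' := gramL n H x')
      (f := paramMap P (chartChange x x')) (by rw [hgo]; exact hH.smooth x p y hy.1)
      (by rw [hgo]; exact hH.isUnit p hy.1) (IsHolChange.contDiffAt (q := q) hc)
      (IsHolChange.smoothAt (q := q) hc) hc.isUnit
      (IsMetricFamily.eventuallyEq H p hy) (dhb P d j)
      (IsHolChange.cdM_eq_zero (q := q) hc _) (l := L x) (l' := L x')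
      (by rw [hgo]; exact hL.smooth x p y hy.1) (hL.eventuallyEq p hy)
    have hu := frameChange_isUnit (n := n) (E := E) hy.1.2 hy.2.2
    rw [e, hA.trans x x' p y hy, IsHolChange.push_dh (q := q) hc, hgo]
    simp only [hq, hfr, Matrix.mul_assoc, Matrix.mul_nonsing_inv_cancel_left _ _ hu]
    rw [Matrix.trace_mul_comm]
    simp only [Matrix.mul_assoc]
    rw [Matrix.mul_nonsing_inv _ hu, Matrix.mul_one, nab_dh, Matrix.mul_sum, Matrix.trace_sum]
    simp only [Matrix.mul_smul, Matrix.trace_smul, smul_eq_mul]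

/-- The components of `∂f`. -/
def delForm (d : ℕ) [ChartedSpace (Fin d → ℂ) X] (f : P → X → ℂ) (x : X) (q : P × (Fin d → ℂ))
    (j : Fin d) : ℂ :=
  cd (dhb P d j) (fun q => f q.1 ((chartAt (Fin d → ℂ) x).symm q.2)) q

lemma delForm_isOneForm {f : P → X → ℂ} (hf : SmoothFam (d := d) f) :
    IsOneForm (n := n) (delForm d f) E where
  smooth x p y hy j := contDiffAt_cd (hf.contDiffAt p hy.1) _
  trans x x' p y hy j := by
    have hc := isHolChange_one hy.1.1 hy.2.1
    set q : P × (Fin d → ℂ) := (p, chartAt (Fin d → ℂ) x' y) with hq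
    have hgo : paramMap P (chartChange x x') q = (p, chartAt (Fin d → ℂ) x y) := chg_apply hy.2.1 p
    have h1 := hf.contDiffAt p hy.1.1
    have e : (fun q => f q.1 ((chartAt (Fin d → ℂ) x').symm q.2)) =ᶠ[nhds q] fun q =>
        f (paramMap P (chartChange x x') q).1 ((chartAt (Fin d → ℂ) x).symm
          (paramMap P (chartChange x x') q).2) := by
      filter_upwards [eventually_symm_mem hy.2.1 ((isOpen_dom x).inter (isOpen_dom x')) hy p]
        with q hq
      simp only [paramMap, chartChange, (chartAt (Fin d → ℂ) x).left_inv hq.2.1.1]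
    rw [delForm, cd_congr e]
    rw [← hgo] at h1
    have e2 := cd_comp (ph := paramMap P (chartChange x x')) (p := q)
      (f := fun q => f q.1 ((chartAt (Fin d → ℂ) x).symm q.2)) h1.dAt
      ((IsHolChange.contDiffAt (q := q) hc).differentiableAt (by simp)) (dhb P d j)
    have e3 := IsHolChange.push_dh (q := q) hc (Pi.single j 1)
    rw [push] at e3
    rw [e3] at e2
    rw [e2, cd_dh_sum, hgo]
    rfl

/-- The Laplacian as a divergence. -/
lemma laplacian_eq_of_eventually (g : FormField (Tang d X)) {f : P → X → ℝ} (p : P) (x : X)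
    (hf : ∀ᶠ q : P × (Fin d → ℂ) in nhds (p, chartAt (Fin d → ℂ) x x), ContDiffAt ℝ ∞
      (fun q : P × (Fin d → ℂ) => (f q.1 ((chartAt (Fin d → ℂ) x).symm q.2) : ℂ)) q) :
    laplacian g (f p) x =
      (-4 * divL g (delForm d fun p x => (f p x : ℂ)) x (p, chartAt (Fin d → ℂ) x x)).re := by
  set q : P × (Fin d → ℂ) := (p, chartAt (Fin d → ℂ) x x) with hq
  set F : P × (Fin d → ℂ) → ℂ := fun q => (f q.1 ((chartAt (Fin d → ℂ) x).symm q.2) : ℂ) with hF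
  have hs : ∀ᶠ q in nhds q, DifferentiableAt ℝ F q := hf.mono fun q hq => hq.dAt
  have hs2 : ∀ᶠ z in nhds q.2, DifferentiableAt ℝ F (p, z) :=
    (hs : ∀ᶠ q' in nhds (p, q.2), _).curry_nhds.self_of_nhds
  have hd : ∀ k, DifferentiableAt ℝ (cd (dhb P d k) F) q := fun k => (contDiffAt_cd hf.self_of_nhds _).dAt
  have e1 : ∀ j k (c c' : ℂ), fderiv ℝ (fun z => del (fun z => F (p, z)) z (Pi.single k c')) q.2
      (Pi.single j c) = c' * (c * cd (dhb P d j) (cd (dhb P d k) F) q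
        + conj c * cd (cj (dhb P d j)) (cd (dhb P d k) F) q) := fun j k c c' => by
    have : (fun z => del (fun z => F (p, z)) z (Pi.single k c')) =ᶠ[nhds q.2]
        fun z => c' * cd (dhb P d k) F (p, z) := hs2.mono fun z hz => by
      simp only [← cd_dh_single]
      exact del_slice (q := (p, z)) hz _
    rw [this.fderiv_eq, ← fderiv_slice_single (hd k), fderiv_const_mul]
    · simp [hq]
    · exact DifferentiableAt.comp (f := fun z : Fin d → ℂ => (p, z)) q.2 (hd k)
        ((differentiableAt_const p).prodMk differentiableAt_id)
  -- Of the four types only `f₂` enters the trace. It is `-∂_k̄ ∂_j F`, and the constant `-4` arises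
  -- from it with `2i · (-2i) = 4`.
  have key := mixedTrace_eq g x (η := fun v w => fderiv ℝ (fun z => del (fun z => F (p, z)) z w) q.2 v
      - fderiv ℝ (fun z => del (fun z => F (p, z)) z v) q.2 w)
    (f₁ := fun j k => cd (dhb P d j) (cd (dhb P d k) F) q - cd (dhb P d k) (cd (dhb P d j) F) q)
    (f₂ := fun j k => -cd (cj (dhb P d k)) (cd (dhb P d j) F) q)
    (f₃ := fun j k => cd (cj (dhb P d j)) (cd (dhb P d k) F) q) (f₄ := fun _ _ => 0)
    (fun j k c c' => by
      simp only [e1, smul_eq_mul]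
      ring)
  change (2 * I * ((-2 * I) • mixedTrace g x _)).re = _
  refine congrArg Complex.re ?_
  refine (congrArg (fun t => 2 * I * ((-2 * I) • t)) key).trans ?_
  simp only [divL, smul_eq_mul, mul_neg, Finset.sum_neg_distrib, gammaL]
  rw [show (gram d g x ((chartAt (Fin d → ℂ) x).symm q.2)) = gram d g x x by
    rw [hq, (chartAt (Fin d → ℂ) x).left_inv (mem_chart_source _ x)]]
  have : ∀ j, (fun q => delForm d (fun p x => (f p x : ℂ)) x q j) = cd (dhb P d j) F := fun j => rfl
  simp only [this]
  linear_combination (4 * ∑ j, ∑ k, (gram d g x x)⁻¹ j k *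
    cd (cj (dhb P d k)) (cd (dhb P d j) F) q) * I_sq

lemma laplacian_eq (g : FormField (Tang d X)) {f : P → X → ℝ}
    (hf : SmoothFam (d := d) fun p x => (f p x : ℂ)) (p : P) (x : X) :
    laplacian g (f p) x =
      (-4 * divL g (delForm d fun p x => (f p x : ℂ)) x (p, chartAt (Fin d → ℂ) x x)).re := by
  refine laplacian_eq_of_eventually g p x ?_
  filter_upwards [eventually_symm_mem (mem_chart_source _ x)
    (chartAt (Fin d → ℂ) x).open_source (mem_chart_source _ x) p] with q hq
  have := hf.contDiffAt q.1 hq.2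
  rwa [(chartAt (Fin d → ℂ) x).right_inv hq.1] at this

end Families

/-! ### Identification of `Λ F` and of `|∇'' s|²` with the local expressions. -/

section Curvature

variable {P : Type*} [NormedAddCommGroup P] [NormedSpace ℝ P]
variable {d n : ℕ} {X : Type*} [TopologicalSpace X] [ChartedSpace (Fin d → ℂ) X]
  {E : X → Type*} [∀ x, AddCommGroup (E x)] [∀ x, Module ℂ (E x)]
  [TopologicalSpace (TotalSpace (Fin n → ℂ) E)] [∀ x, TopologicalSpace (E x)]
  [FiberBundle (Fin n → ℂ) E] [VectorBundle ℂ (Fin n → ℂ) E]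
  [IsManifold 𝓘(ℂ, Fin d → ℂ) ω X] [ContMDiffVectorBundle ω (Fin n → ℂ) E 𝓘(ℂ, Fin d → ℂ)]

lemma endCoord_mixedTrace (g : FormField (Tang d X)) (x : X)
    (η : (Fin d → ℂ) → (Fin d → ℂ) → Module.End ℂ (E x)) :
    endCoord n x x (mixedTrace g x η) = mixedTrace g x (fun v w => endCoord n x x (η v w)) := by
  have h : ∀ A : Module.End ℂ (E x), endCoord n x x A = endCoordₗ (n := n) x x A := fun _ => rfl
  simp only [h, mixedTrace, map_sum, map_smul, map_add, map_sub]

lemma higgsMatrix_single (Θ : HiggsField d n E) {x : X} {z : Fin d → ℂ}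
    (hz : z ∈ (chartAt (Fin d → ℂ) x).target) (j : Fin d) (c : ℂ) :
    higgsMatrix Θ x z (Pi.single j c) = c • higgsMatrix Θ x z (Pi.single j 1) := by
  have hm : (chartAt (Fin d → ℂ) x).symm z ∈ (trivializationAt (Fin d → ℂ) (Tang d X) x).baseSet :=
    (chartAt (Fin d → ℂ) x).map_target hz
  have h : ∀ A, endCoord n x ((chartAt (Fin d → ℂ) x).symm z) A =
    endCoordₗ (n := n) (E := E) x ((chartAt (Fin d → ℂ) x).symm z) A := fun _ => rfl
  have hs : tangVec x ((chartAt (Fin d → ℂ) x).symm z) (Pi.single j c) =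
      c • tangVec x ((chartAt (Fin d → ℂ) x).symm z) (Pi.single j 1) := by
    rw [tangVec, tangVec, ← Trivialization.symmₗ_apply (R := ℂ) _ hm,
      ← Trivialization.symmₗ_apply (R := ℂ) _ hm, ← map_smul, ← Pi.single_smul, smul_eq_mul, mul_one]
  rw [higgsMatrix, hs, h, map_smul, map_smul]
  rfl

/-- The curvature in the centre of the chart: `i Λ F` is given by `higgsL`. -/
lemma endCoord_contraction_higgsCurvature {g : FormField (Tang d X)} (Θ : HiggsField d n E)
    {H : P → FormField E} (hH : IsMetricFamily d n H) (p : P) (x : X) :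
    endCoord n x x (contraction g x (higgsCurvature Θ (H p) x)) =
      (-I) • atC (higgsL g Θ H) p x := by
  set q : P × (Fin d → ℂ) := (p, chartAt (Fin d → ℂ) x x) with hq
  set h := gramL (d := d) n H x with hh
  have hx := mem_dom (d := d) (n := n) (E := E) x
  have hs := hH.smoothNear p hx
  have hu := hH.isUnit p hx
  have hθ := fun j => thetaL_smoothAt Θ hx j p
  -- The connection form on `c ∂_k` is `c α_k + conj c β_k`: Chern form plus `Θ` of type `(1,0)`,
  -- and `Θ^*` of type `(0,1)`.
  set α : Fin d → P × (Fin d → ℂ) → Matrix (Fin n) (Fin n) ℂ :=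
    fun j q => chern h (dhb P d j) q + thetaL n P Θ x j q with hα
  set β : Fin d → P × (Fin d → ℂ) → Matrix (Fin n) (Fin n) ℂ :=
    fun j q => adj (h q) (thetaL n P Θ x j q) with hβ
  have sα : ∀ j, SmoothAt (α j) q := fun j => (chern_smoothAt hs.self hu _).add (hθ j)
  have sβ : ∀ j, SmoothAt (β j) q := fun j => adj_smoothAt hs.self hu (hθ j)
  have hev : ∀ᶠ z in nhds q.2, z ∈ (chartAt (Fin d → ℂ) x).target ∧ SmoothAt h (p, z) := by
    have h1 : ∀ᶠ q' in nhds (p, q.2), SmoothAt h q' := hs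
    have h0 : ∀ᶠ z in nhds q.2, z ∈ (chartAt (Fin d → ℂ) x).target :=
      (chartAt (Fin d → ℂ) x).open_target.mem_nhds
        ((chartAt (Fin d → ℂ) x).map_source (mem_chart_source _ x))
    exact h0.and h1.curry_nhds.self_of_nhds
  have eA : ∀ᶠ z in nhds q.2, ∀ k c, connectionForm Θ (H p) x z (Pi.single k c) =
      c • α k (p, z) + conj c • β k (p, z) := by
    filter_upwards [hev] with z hz k c
    have e1 : (Matrix.of fun i j => del (fun w => gram n (H p) x
        ((chartAt (Fin d → ℂ) x).symm w) i j) z (Pi.single k c)) = c • cdM (dhb P d k) h (p, z) := by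
      ext i j
      rw [Matrix.of_apply, Matrix.smul_apply, cdM_apply, smul_eq_mul, ← cd_dh_single]
      exact del_slice (q := (p, z)) (hz.2 i j).dAt _
    rw [connectionForm, higgsMatrix_single Θ hz.1]
    simp only
    rw [e1]
    simp only [hα, hβ, chern, adj, Matrix.conjTranspose_smul, Matrix.mul_smul, Matrix.smul_mul,
      smul_add]
    rfl
  have eD : ∀ j k c c', (Matrix.of fun i l => fderiv ℝ (fun z => connectionForm Θ (H p) x z
      (Pi.single k c') i l) q.2 (Pi.single j c)) =
      (c * c') • cdM (dhb P d j) (α k) q + (c * conj c') • cdM (dhb P d j) (β k) q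
      + (conj c * c') • cdM (cj (dhb P d j)) (α k) q
      + (conj c * conj c') • cdM (cj (dhb P d j)) (β k) q := by
    intro j k c c'
    ext i l
    have e1 : (fun z => connectionForm Θ (H p) x z (Pi.single k c') i l) =ᶠ[nhds q.2]
        fun z => (fun q => c' * α k q i l + conj c' * β k q i l) (p, z) := by
      filter_upwards [eA] with z hz
      rw [hz]; rfl
    have hd1 : DifferentiableAt ℝ (fun q => c' * α k q i l) q := (sα k i l).dAt.const_mul c'
    have hd2 : DifferentiableAt ℝ (fun q => conj c' * β k q i l) q := (sβ k i l).dAt.const_mul _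
    have ec : ∀ (ξ : (P × (Fin d → ℂ)) × (P × (Fin d → ℂ))) (a : ℂ) (f : P × (Fin d → ℂ) → ℂ),
        DifferentiableAt ℝ f q → cd ξ (fun q => a * f q) q = a * cd ξ f q := fun ξ a f hf => by
      rw [cd_mul _ (differentiableAt_const _) hf, cd_const, zero_mul, zero_add]
    rw [Matrix.of_apply, e1.fderiv_eq]
    have := fderiv_slice_single (f := fun q => c' * α k q i l + conj c' * β k q i l) (hd1.add hd2) j c
    refine this.trans ?_
    rw [cd_add _ hd1 hd2, cd_add _ hd1 hd2, ec _ _ _ (sα k i l).dAt, ec _ _ _ (sα k i l).dAt,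
      ec _ _ _ (sβ k i l).dAt, ec _ _ _ (sβ k i l).dAt]
    simp only [Matrix.add_apply, Matrix.smul_apply, cdM_apply, smul_eq_mul]
    ring
  have key := mixedTrace_eq g x
    (η := fun v w => endCoord n x x (higgsCurvature Θ (H p) x v w))
    (f₁ := fun j k => cdM (dhb P d j) (α k) q - cdM (dhb P d k) (α j) q
      + (α j q * α k q - α k q * α j q))
    (f₂ := fun j k => cdM (dhb P d j) (β k) q - cdM (cj (dhb P d k)) (α j) q
      + (α j q * β k q - β k q * α j q))
    (f₃ := fun j k => cdM (cj (dhb P d j)) (α k) q - cdM (dhb P d k) (β j) q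
      + (β j q * α k q - α k q * β j q))
    (f₄ := fun j k => cdM (cj (dhb P d j)) (β k) q - cdM (cj (dhb P d k)) (β j) q
      + (β j q * β k q - β k q * β j q))
    (fun j k c c' => by
      rw [higgsCurvature, endCoord_endOfCoord]
      have e1 : ∀ A B : Matrix (Fin n) (Fin n) ℂ, (Matrix.of fun i l => A i l - B i l) = A - B :=
        fun _ _ => rfl
      have e2 := eD j k c c'
      have e3 := eD k j c' c
      simp only [hq] at e2 e3
      refine (congrArg₂ (fun M N => M + N) ((e1 _ _).trans (congrArg₂ (fun M N => M - N) e2 e3))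
        rfl).trans ?_
      have eA0 := eA.self_of_nhds
      simp only [hq] at eA0
      rw [eA0, eA0]
      simp only [Matrix.add_mul, Matrix.mul_add, Matrix.smul_mul, Matrix.mul_smul, hq]
      module)
  -- Here `Θ` is holomorphic and `Θ^*` is covariantly constant in `(1,0)` directions, so the mixed
  -- Chern-Higgs terms cancel and only the Chern curvature and `[Θ, Θ^*]` remain.
  have h2 : ∀ j k, cdM (dhb P d j) (β k) q - cdM (cj (dhb P d k)) (α j) q
      + (α j q * β k q - β k q * α j q) = -cdM (cj (dhb P d k)) (chern h (dhb P d j)) q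
      + (thetaL n P Θ x j q * β k q - β k q * thetaL n P Θ x j q) := fun j k => by
    have e1 : cdM (dhb P d j) (β k) q = β k q * chern h (dhb P d j) q - chern h (dhb P d j) q * β k q :=
      cdM_adj hs.self hu (hθ k) _ (thetaL_cdM Θ hx k p _)
    have e2 : cdM (cj (dhb P d k)) (α j) q = cdM (cj (dhb P d k)) (chern h (dhb P d j)) q := by
      rw [hα, cdM_add _ (chern_smoothAt hs.self hu _) (hθ j), thetaL_cdM Θ hx j p, add_zero]
    rw [e1, e2]
    simp only [hα]
    noncomm_ring
  have hsm : ∀ (c : ℂ) A, endCoord n x x (c • A) = c • endCoord n x x A := fun c A =>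
    map_smul (endCoordₗ (n := n) (E := E) x x) c A
  rw [contraction, hsm, endCoord_mixedTrace, key]
  simp only [h2, atC, higgsL, higgsP, smul_smul, gammaL]
  rw [show (gram d g x ((chartAt (Fin d → ℂ) x).symm (chartAt (Fin d → ℂ) x x))) = gram d g x x by
    rw [(chartAt (Fin d → ℂ) x).left_inv (mem_chart_source _ x)]]
  congr 1
  ring

lemma endInner_eq {H : FormField E} (x : X) (A B : Module.End ℂ (E x)) :
    endInner n H x A B = (adj (gram n H x x) (endCoord n x x A) * endCoord n x x B).trace := by
  rw [endInner, trace_eq_trace_endCoord (mem_frameSet (n := n) (E := E) x), endCoord_mul (mem_frameSet x), endAdjoint,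
    endCoord_endOfCoord]
  rfl

variable (n) in
/-- The matrices of a section of `End E`. -/
def endL (P : Type*) (s : ∀ x, Module.End ℂ (E x)) (x : X) (q : P × (Fin d → ℂ)) :
    Matrix (Fin n) (Fin n) ℂ := endCoord n x ((chartAt (Fin d → ℂ) x).symm q.2) (s _)

lemma endL_center (P : Type*) (s : ∀ x, Module.End ℂ (E x)) {x y : X} (p : P)
    (hy : y ∈ (chartAt (Fin d → ℂ) x).source) :
    endL n P s x (p, chartAt (Fin d → ℂ) x y) = endCoord n x y (s y) := by
  have : ∀ w, w = y → endCoord n x w (s w) = endCoord n x y (s y) := by rintro _ rfl; rfl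
  exact this _ ((chartAt (Fin d → ℂ) x).left_inv hy)

lemma gram_center {H : FormField E} {x y : X} (hy : y ∈ (chartAt (Fin d → ℂ) x).source) :
    gram n H x ((chartAt (Fin d → ℂ) x).symm (chartAt (Fin d → ℂ) x y)) = gram n H x y := by
  rw [(chartAt (Fin d → ℂ) x).left_inv hy]

/-- The form `∇'' s` has `(0,1)`-part `∂̄s` and `(1,0)`-part `[Θ, s]`; `mixedTrace` drops the
products of different type. Self-adjointness rewrites the adjoints of the two parts as `∂_h s` and a
commutator with `Θ^*`. The factor `4` of the norm and the `1/2` of the real part make the `2` in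
`formQ`. -/
lemma oneFormNormSq_nablaEnd {g : FormField (Tang d X)} (Θ : HiggsField d n E)
    {H : P → FormField E} (hH : IsMetricFamily d n H) {s : ∀ x, Module.End ℂ (E x)}
    (hs : IsSmoothEnd d n s) (p : P) (x : X)
    (hsa : ∀ᶠ q in nhds (p, chartAt (Fin d → ℂ) x x),
      (endL n P s x q)ᴴ * gramL n H x q = gramL n H x q * endL n P s x q) :
    oneFormNormSq n g (H p) x (nablaEnd Θ s x) =
      (formQ (gramL n H x) (endL n P s x) (endL n P s x) (thetaL n P Θ x) (gammaL P g x)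
        (dhb P d) (p, chartAt (Fin d → ℂ) x x)).re := by
  have hx := mem_dom (d := d) (n := n) (E := E) x
  have hsc := mem_chart_source (Fin d → ℂ) x
  set q : P × (Fin d → ℂ) := (p, chartAt (Fin d → ℂ) x x) with hq
  set h := gramL (d := d) n H x with hh
  set S := endL (d := d) n P s x with hS
  have hu : IsUnit (h q).det := hH.isUnit p hx
  have hh' : ∀ᶠ q in nhds q, (h q)ᴴ = h q := Filter.Eventually.of_forall fun q => hH.hermitian x q
  have sS : SmoothAt S q := (endCoord_isEndFamily (P := P) hs).smooth x p x hx
  have sh : SmoothAt h q := hH.smooth x p x hx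
  set X' : Fin d → Matrix (Fin n) (Fin n) ℂ := fun j => cdM (cj (dhb P d j)) S q with hX
  set Y : Fin d → Matrix (Fin n) (Fin n) ℂ :=
    fun j => thetaL n P Θ x j q * S q - S q * thetaL n P Θ x j q with hY
  have e1 : ∀ j c, endCoord n x x (nablaEnd Θ s x (Pi.single j c)) = conj c • X' j + c • Y j := by
    intro j c
    have e2 : (Matrix.of fun i l => delbar (fun z => endCoord n x ((chartAt (Fin d → ℂ) x).symm z)
        (s _) i l) q.2 (Pi.single j c)) = conj c • X' j := by
      ext i l
      refine Eq.trans ?_ (cd_cj_dh_single (P := P) j c (sS i l).dAt)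
      exact delbar_slice (q := q) (sS i l).dAt _
    rw [nablaEnd, endCoord_endOfCoord, higgsMatrix_single Θ ((chartAt (Fin d → ℂ) x).map_source hsc)]
    refine (congrArg₂ (fun M N => M + N) e2 rfl).trans ?_
    rw [Matrix.smul_mul, Matrix.mul_smul, ← smul_sub]
    rfl
  have hadj : ∀ A B : Matrix (Fin n) (Fin n) ℂ, conj (adj (h q) A * B).trace =
      (adj (h q) B * A).trace := fun A B => by
    rw [← trace_adj hu, adj_mul hu, adj_adj hu hh'.self_of_nhds]
  have hre : ∀ z : ℂ, ((z.re : ℝ) : ℂ) = (1 / 2 : ℂ) * (z + conj z) := fun z => by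
    rw [Complex.add_conj]; push_cast; ring
  have key := mixedTrace_eq g x
    (η := fun v w => ((endInner n (H p) x (nablaEnd Θ s x v) (nablaEnd Θ s x w)).re : ℂ))
    (f₁ := fun j k => (1 / 2 : ℂ) * ((adj (h q) (X' j) * Y k).trace + (adj (h q) (X' k) * Y j).trace))
    (f₂ := fun j k => (1 / 2 : ℂ) * ((adj (h q) (X' j) * X' k).trace + (adj (h q) (Y k) * Y j).trace))
    (f₃ := fun j k => (1 / 2 : ℂ) * ((adj (h q) (Y j) * Y k).trace + (adj (h q) (X' k) * X' j).trace))
    (f₄ := fun j k => (1 / 2 : ℂ) * ((adj (h q) (Y j) * X' k).trace + (adj (h q) (Y k) * X' j).trace))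
    (fun j k c c' => by
      have hg : gram n (H p) x x = h q := (gram_center hsc).symm
      rw [hre, endInner_eq, e1, e1, hg, hadj]
      simp only [adj_add, adj_smul, Matrix.add_mul, Matrix.mul_add, Matrix.smul_mul,
        Matrix.mul_smul, Matrix.trace_add, Matrix.trace_smul, smul_eq_mul, Complex.conj_conj]
      ring)
  rw [oneFormNormSq, key]
  have hSa : adj (h q) (S q) = S q := (adj_eq_self_iff hu _).2 hsa.self_of_nhds
  have e3 : ∀ j k, (X' k * nab h S (dhb P d j) q).trace
      + ((S q * thetaL n P Θ x j q - thetaL n P Θ x j q * S q) *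
      (adj (h q) (thetaL n P Θ x k q) * S q - S q * adj (h q) (thetaL n P Θ x k q))).trace =
      (adj (h q) (X' j) * X' k).trace + (adj (h q) (Y k) * Y j).trace := fun j k => by
    rw [← adj_cdM sh hu hh' sS hsa, Matrix.trace_mul_comm]
    congr 1
    rw [hY]
    simp only [adj_sub, adj_mul hu, hSa]
    rw [Matrix.trace_mul_comm, ← neg_mul_neg]
    congr 2 <;> abel
  have e4 : ∀ z : ℂ, 4 * z.re = ((4 : ℂ) * z).re := fun z => by simp
  rw [e4]
  refine congrArg Complex.re ?_
  simp only [formQ, gammaL, hq, gram_center (E := Tang d X) hsc, smul_eq_mul, Finset.mul_sum]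
  refine Finset.sum_congr rfl fun j _ => Finset.sum_congr rfl fun k _ => ?_
  rw [← hq, e3]
  ring

end Curvature

/-! ### Differentiation under the integral sign. -/

section ParametricIntegrals

/-- The dominating constant is a bound for the jointly continuous `f'` on the compact set
`closedBall t 1 × s`. -/
lemma hasDerivAt_setIntegral_of_isCompact {Y : Type*} [TopologicalSpace Y] [T2Space Y]
    [MeasurableSpace Y] [BorelSpace Y] {μ : Measure Y} [IsFiniteMeasureOnCompacts μ]
    {s : Set Y} (hs : IsCompact s) {f f' : ℝ → Y → ℂ}
    (hf : Continuous fun q : ℝ × Y => f q.1 q.2) (hf' : Continuous fun q : ℝ × Y => f' q.1 q.2)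
    (hd : ∀ t y, HasDerivAt (fun t => f t y) (f' t y) t) (t : ℝ) :
    HasDerivAt (fun t => ∫ y in s, f t y ∂μ) (∫ y in s, f' t y ∂μ) t := by
  have hcs : ∀ t, Continuous (f t) := fun t =>
    Continuous.comp (g := fun q : ℝ × Y => f q.1 q.2) hf (by fun_prop : Continuous fun y : Y => (t, y))
  have hcs' : ∀ t, Continuous (f' t) := fun t =>
    Continuous.comp (g := fun q : ℝ × Y => f' q.1 q.2) hf' (by fun_prop : Continuous fun y : Y => (t, y))
  obtain ⟨C, hC⟩ := (((isCompact_closedBall t 1).prod hs).image_of_continuousOn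
    hf'.norm.continuousOn).bddAbove
  have hbd : ∀ᵐ y ∂(μ.restrict s), ∀ r ∈ Metric.ball t 1, ‖f' r y‖ ≤ C := by
    filter_upwards [ae_restrict_mem hs.measurableSet] with y hy r hr
    exact hC ⟨(r, y), ⟨Metric.ball_subset_closedBall hr, hy⟩, rfl⟩
  have : IsFiniteMeasure (μ.restrict s) := ⟨by simpa using hs.measure_lt_top⟩
  refine (hasDerivAt_integral_of_dominated_loc_of_deriv_le (bound := fun _ => C)
    (Metric.ball_mem_nhds t one_pos) ?_ ?_ ?_ hbd (integrable_const C) ?_).2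
  · exact Filter.Eventually.of_forall fun t => (hcs t).aestronglyMeasurable
  · exact (hcs t).continuousOn.integrableOn_compact hs
  · exact (hcs' t).aestronglyMeasurable
  · exact Filter.Eventually.of_forall fun y r _ => hd r y

end ParametricIntegrals

section Families

variable {P : Type*} [NormedAddCommGroup P] [NormedSpace ℝ P]
variable {d n : ℕ} {X : Type*} [TopologicalSpace X] [ChartedSpace (Fin d → ℂ) X]
  [IsManifold 𝓘(ℂ, Fin d → ℂ) ω X]

/-- The derivative of a family of functions in a parameter direction. -/
def dpar (e : P) (f : P → X → ℂ) (p : P) (x : X) : ℂ := fderiv ℝ (fun p => f p x) p e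

lemma fderiv_param_slice {F : P × (Fin d → ℂ) → ℂ} {p : P} {z : Fin d → ℂ}
    (hF : DifferentiableAt ℝ F (p, z)) :
    HasFDerivAt (fun p => F (p, z))
      ((fderiv ℝ F (p, z)).comp ((ContinuousLinearMap.id ℝ P).prod 0)) p := by
  have h : HasFDerivAt (fun p : P => (p, z)) ((ContinuousLinearMap.id ℝ P).prod
      (0 : P →L[ℝ] (Fin d → ℂ))) p := (hasFDerivAt_id p).prodMk (hasFDerivAt_const z p)
  exact HasFDerivAt.comp p (f := fun p : P => (p, z)) (g := F) hF.hasFDerivAt h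

namespace SmoothFam

variable {f : P → X → ℂ}

lemma eventually_contDiffAt (hf : SmoothFam (d := d) f) (p : P) (x : X) :
    ∀ᶠ q : P × (Fin d → ℂ) in nhds (p, chartAt (Fin d → ℂ) x x),
      ContDiffAt ℝ ∞ (fun q : P × (Fin d → ℂ) => f q.1 ((chartAt (Fin d → ℂ) x).symm q.2)) q := by
  filter_upwards [eventually_symm_mem (mem_chart_source _ x)
    (chartAt (Fin d → ℂ) x).open_source (mem_chart_source _ x) p] with q hq
  have := hf.contDiffAt q.1 hq.2
  rwa [(chartAt (Fin d → ℂ) x).right_inv hq.1] at this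

lemma hasFDerivAt (hf : SmoothFam (d := d) f) (p : P) (x : X) :
    HasFDerivAt (fun p => f p x) (fderiv ℝ (fun p => f p x) p) p := by
  have h := fderiv_param_slice (hf p x).dAt
  simp only [(chartAt (Fin d → ℂ) x).left_inv (mem_chart_source (Fin d → ℂ) x)] at h
  exact h.differentiableAt.hasFDerivAt

lemma dpar_eq (hf : SmoothFam (d := d) f) (e : P) (p : P) (x : X) {G : P × (Fin d → ℂ) → ℂ}
    (hG : (fun q : P × (Fin d → ℂ) => f q.1 ((chartAt (Fin d → ℂ) x).symm q.2))
      =ᶠ[nhds (p, chartAt (Fin d → ℂ) x x)] G) :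
    dpar e f p x = cd (dp e) G (p, chartAt (Fin d → ℂ) x x) := by
  have h := fderiv_param_slice (hf p x).dAt
  simp only [(chartAt (Fin d → ℂ) x).left_inv (mem_chart_source (Fin d → ℂ) x)] at h
  rw [← cd_congr hG, cd_dp, dpar, h.fderiv]
  rfl

lemma dpar (hf : SmoothFam (d := d) f) (e : P) : SmoothFam (d := d) (dpar e f) := by
  intro p x
  refine (contDiffAt_cd (hf p x) (dp e)).congr_of_eventuallyEq ?_
  filter_upwards [hf.eventually_contDiffAt p x] with q hq
  have h := fderiv_param_slice (p := q.1) (z := q.2) hq.dAt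
  rw [HiggsExtension.dpar, cd_dp, h.fderiv]
  rfl

lemma hasDerivAt (hf : SmoothFam (d := d) f) {ph : ℝ → P} {e : P} {t : ℝ}
    (hph : HasDerivAt ph e t) (x : X) :
    HasDerivAt (fun t => f (ph t) x) (HiggsExtension.dpar e f (ph t) x) t :=
  (hf.hasFDerivAt (ph t) x).comp_hasDerivAt t hph

lemma add {f' : P → X → ℂ} (hf : SmoothFam (d := d) f) (hf' : SmoothFam (d := d) f') :
    SmoothFam (d := d) (fun p x => f p x + f' p x) := fun p x => (hf p x).add (hf' p x)

variable [MeasurableSpace X] [BorelSpace X] [CompactSpace X] [T2Space X]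

/-- Compactness of `X` makes `f p'` uniformly close to `f p` for `p'` near `p`, which supplies a
constant bound on the finite measure space. -/
lemma continuous_integral {g : FormField (Tang d X)} (hg : IsHermitianMetric d d g)
    (hf : SmoothFam (d := d) f) : Continuous fun p => ∫ x, f p x ∂(omegaPow g) := by
  have := isFiniteMeasure_omegaPow hg
  refine continuous_iff_continuousAt.2 fun p => ?_
  have h : ∀ ε > 0, ∀ᶠ p' in nhds p, ∀ x, ‖f p' x - f p x‖ < ε := fun ε hε => by
    have hc : Continuous fun q : P × X => ‖f q.1 q.2 - f p q.2‖ :=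
      (hf.continuous.sub ((hf.continuous_slice p).comp continuous_snd)).norm
    have := (isCompact_univ (X := X)).eventually_forall_of_forall_eventually (x₀ := p)
      (P := fun p' x => ‖f p' x - f p x‖ < ε)
      (fun x _ => (hc.tendsto (p, x)).eventually_lt_const (by simpa using hε))
    simpa using this
  refine tendsto_integral_filter_of_norm_le_const
    (Filter.Eventually.of_forall fun p => (hf.continuous_slice p).aestronglyMeasurable) ?_ ?_
  · obtain ⟨C, hC⟩ := (isCompact_univ.image (hf.continuous_slice p).norm).bddAbove
    refine ⟨C + 1, ?_⟩
    filter_upwards [h 1 one_pos] with p' hp'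
    refine Filter.Eventually.of_forall fun x => ?_
    have h1 := hC ⟨x, Set.mem_univ _, rfl⟩
    have h2 := norm_le_norm_add_norm_sub' (f p' x) (f p x)
    simp only at h1
    linarith [hp' x]
  · refine Filter.Eventually.of_forall fun x => ?_
    exact (hf.hasFDerivAt p x).continuousAt

lemma hasDerivAt_integral {g : FormField (Tang d X)} (hg : IsHermitianMetric d d g)
    (hf : SmoothFam (d := d) f) {ph : ℝ → P} {e : P} (hph : ∀ t, HasDerivAt ph e t) (t : ℝ) :
    HasDerivAt (fun t => ∫ x, f (ph t) x ∂(omegaPow g))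
      (∫ x, HiggsExtension.dpar e f (ph t) x ∂(omegaPow g)) t := by
  have := isFiniteMeasure_omegaPow hg
  have hc : Continuous ph := continuous_iff_continuousAt.2 fun t => (hph t).continuousAt
  have hc2 : Continuous fun q : ℝ × X => (ph q.1, q.2) := by fun_prop
  have h := hasDerivAt_setIntegral_of_isCompact (μ := omegaPow g) (isCompact_univ (X := X))
    (f := fun t x => f (ph t) x) (f' := fun t x => HiggsExtension.dpar e f (ph t) x)
    (Continuous.comp (g := fun q : P × X => f q.1 q.2) hf.continuous hc2)
    (Continuous.comp (g := fun q : P × X => HiggsExtension.dpar e f q.1 q.2)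
      (hf.dpar e).continuous hc2)
    (fun t x => hf.hasDerivAt (hph t) x) t
  simpa only [Measure.restrict_univ] using h

end SmoothFam

end Families

/-! ### Reparametrization of the unit interval. -/

section Substitution

/-- A smooth reparametrization of `[0, 1]` with values in `[0, 1]`. -/
def sigma (u : ℝ) : ℝ := (1 - Real.cos (Real.pi * u)) / 2

lemma sigma_zero : sigma 0 = 0 := by simp [sigma]

lemma sigma_one : sigma 1 = 1 := by simp [sigma]

/-- This holds for every real `u`, which is the purpose of `sigma`: the form `(1 - t) K + t H` is
positive for `t ∈ [0, 1]` but in general not beyond, whereas families of metrics are required over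
the whole parameter space. -/
lemma sigma_mem (u : ℝ) : sigma u ∈ Set.Icc (0 : ℝ) 1 := by
  have h1 := Real.cos_le_one (Real.pi * u)
  have h2 := Real.neg_one_le_cos (Real.pi * u)
  constructor <;> rw [sigma] <;> linarith

lemma contDiff_sigma : ContDiff ℝ ∞ sigma := by
  unfold sigma; fun_prop

lemma hasDerivAt_sigma (u : ℝ) : HasDerivAt sigma (Real.pi / 2 * Real.sin (Real.pi * u)) u := by
  have h := ((((hasDerivAt_id u).const_mul Real.pi).cos).const_sub 1).div_const 2
  refine h.congr_deriv ?_
  simp; ring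

lemma sigma_image : sigma '' Set.Icc 0 1 = Set.Icc 0 1 := by
  refine Set.Subset.antisymm (Set.image_subset_iff.2 fun u _ => sigma_mem u) ?_
  have := intermediate_value_Icc zero_le_one (contDiff_sigma.continuous.continuousOn (s := Set.Icc 0 1))
  rwa [sigma_zero, sigma_one] at this

/-- `sigma` maps `[0, 1]` bijectively to itself with nonnegative derivative; the change of variables
for injective maps then needs no assumption on `G`. -/
lemma integral_comp_sigma (G : ℝ → ℂ) : ∫ t in (0 : ℝ)..1, G t =
    ∫ u in (0 : ℝ)..1, ((deriv sigma u : ℝ) : ℂ) * G (sigma u) := by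
  rw [intervalIntegral.integral_of_le zero_le_one, intervalIntegral.integral_of_le zero_le_one,
    ← integral_Icc_eq_integral_Ioc, ← integral_Icc_eq_integral_Ioc]
  conv_lhs => rw [← sigma_image]
  rw [integral_image_eq_integral_abs_deriv_smul measurableSet_Icc
    (fun u _ => (hasDerivAt_sigma u).hasDerivWithinAt) ?_]
  · refine setIntegral_congr_fun measurableSet_Icc fun u hu => ?_
    have : 0 ≤ Real.pi / 2 * Real.sin (Real.pi * u) := by
      refine mul_nonneg (by positivity) (Real.sin_nonneg_of_nonneg_of_le_pi ?_ ?_)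
      · exact mul_nonneg Real.pi_pos.le hu.1
      · nlinarith [Real.pi_pos, hu.2]
    rw [abs_of_nonneg this, (hasDerivAt_sigma u).deriv, Complex.real_smul]
  · intro u hu v hv huv
    have h : Real.cos (Real.pi * u) = Real.cos (Real.pi * v) := by
      simp only [sigma] at huv; linarith
    have hm : ∀ w ∈ Set.Icc (0 : ℝ) 1, Real.pi * w ∈ Set.Icc 0 Real.pi := fun w hw =>
      ⟨mul_nonneg Real.pi_pos.le hw.1, by nlinarith [Real.pi_pos, hw.2]⟩
    exact mul_left_cancel₀ Real.pi_pos.ne' (Real.injOn_cos (hm u hu) (hm v hv) h)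

end Substitution

/-! ### Segments of metrics and changes of parameter. -/

section Segments

variable {P : Type*} [NormedAddCommGroup P] [NormedSpace ℝ P]
variable {d n : ℕ} {X : Type*} [TopologicalSpace X] [ChartedSpace (Fin d → ℂ) X]
  {E : X → Type*} [∀ x, AddCommGroup (E x)] [∀ x, Module ℂ (E x)]
  [TopologicalSpace (TotalSpace (Fin n → ℂ) E)] [∀ x, TopologicalSpace (E x)]
  [FiberBundle (Fin n → ℂ) E] [VectorBundle ℂ (Fin n → ℂ) E]

lemma gram_segment (K H : FormField E) (t : ℝ) (x y : X) : gram n (segment K H t) x y =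
    ((1 - t : ℝ) : ℂ) • gram n K x y + (t : ℂ) • gram n H x y := by
  ext i j
  simp [gram, segment]

lemma segment_zero (K H : FormField E) : segment K H 0 = K := by
  ext x v w; simp [segment]

lemma segment_one (K H : FormField E) : segment K H 1 = H := by
  ext x v w; simp [segment]

lemma IsHermitianMetric.segment {K H : FormField E} (hK : IsHermitianMetric d n K)
    (hH : IsHermitianMetric d n H) {t : ℝ} (ht : t ∈ Set.Icc (0 : ℝ) 1) :
    IsHermitianMetric d n (segment K H t) where
  conj_symm x v w := by
    simp only [HiggsExtension.segment, LinearMap.add_apply, LinearMap.smul_apply, smul_eq_mul,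
      map_add, map_mul, Complex.conj_ofReal, hK.conj_symm, hH.conj_symm]
  pos x v hv := by
    simp only [HiggsExtension.segment, LinearMap.add_apply, LinearMap.smul_apply, smul_eq_mul,
      Complex.add_re, Complex.re_ofReal_mul]
    have h1 := hK.pos x v hv
    have h2 := hH.pos x v hv
    rcases ht.1.eq_or_lt with h | h
    · rw [← h]; simpa using h1
    · have := mul_pos h h2
      have := mul_nonneg (sub_nonneg.2 ht.2) h1.le
      linarith
  smooth x i j := by
    simp only [gram_segment, Matrix.add_apply, Matrix.smul_apply, smul_eq_mul]
    have hc : ∀ c : ℂ, ContMDiff 𝓘(ℝ, ℂ) 𝓘(ℝ, ℂ) ∞ fun z : ℂ => c * z := fun c =>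
      (contDiff_const.mul contDiff_id).contMDiff
    exact ((hc _).comp_contMDiffOn (hK.smooth x i j)).add ((hc _).comp_contMDiffOn (hH.smooth x i j))

lemma gramL_segment (K H : P → FormField E) (t : P → ℝ) (x : X) :
    gramL (d := d) n (fun p => segment (K p) (H p) (t p)) x = fun q =>
      ((1 - t q.1 : ℝ) : ℂ) • gramL n K x q + (t q.1 : ℂ) • gramL n H x q := by
  ext q : 1
  exact gram_segment _ _ _ _ _

lemma IsMetricFamily.segment {K H : P → FormField E} (hK : IsMetricFamily d n K)
    (hH : IsMetricFamily d n H) {t : P → ℝ} (ht : ∀ p, t p ∈ Set.Icc (0 : ℝ) 1)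
    (hs : ContDiff ℝ ∞ t) : IsMetricFamily d n (fun p => segment (K p) (H p) (t p)) where
  herm p := (hK.herm p).segment (hH.herm p) (ht p)
  smooth x p y hy := by
    have h : ContDiffAt ℝ ∞ (fun q : P × (Fin d → ℂ) => (t q.1 : ℂ))
        (p, chartAt (Fin d → ℂ) x y) :=
      Complex.ofRealCLM.contDiff.contDiffAt.comp _ (hs.contDiffAt.comp _ contDiffAt_fst)
    have h' : ContDiffAt ℝ ∞ (fun q : P × (Fin d → ℂ) => ((1 - t q.1 : ℝ) : ℂ))
        (p, chartAt (Fin d → ℂ) x y) := by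
      simp only [Complex.ofReal_sub, Complex.ofReal_one]
      exact contDiffAt_const.sub h
    rw [gramL_segment]
    exact (SmoothAt.smul h' (hK.smooth x p y hy)).add (SmoothAt.smul h (hH.smooth x p y hy))

lemma cdM_dp_gramL_segment {K H : P → FormField E} (hK : IsMetricFamily d n K)
    (hH : IsMetricFamily d n H) {t : P → ℝ} (hs : ContDiff ℝ ∞ t) (e p : P) {x y : X}
    (hy : y ∈ dom d n E x) : cdM (dp e) (gramL n (fun p => segment (K p) (H p) (t p)) x)
      (p, chartAt (Fin d → ℂ) x y) =
      ((fderiv ℝ t p e : ℝ) : ℂ) • (gram n (H p) x y - gram n (K p) x y) +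
      (((1 - t p : ℝ) : ℂ) • cdM (dp e) (gramL n K x) (p, chartAt (Fin d → ℂ) x y)
        + (t p : ℂ) • cdM (dp e) (gramL n H x) (p, chartAt (Fin d → ℂ) x y)) := by
  set q : P × (Fin d → ℂ) := (p, chartAt (Fin d → ℂ) x y) with hq
  have h : ContDiffAt ℝ ∞ (fun q : P × (Fin d → ℂ) => (t q.1 : ℂ)) q :=
    Complex.ofRealCLM.contDiff.contDiffAt.comp _ (hs.contDiffAt.comp _ contDiffAt_fst)
  have e1 : (fun q : P × (Fin d → ℂ) => ((1 - t q.1 : ℝ) : ℂ)) =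
      fun q => (1 : ℂ) - (t q.1 : ℂ) := by ext; simp
  have h' : ContDiffAt ℝ ∞ (fun q : P × (Fin d → ℂ) => ((1 - t q.1 : ℝ) : ℂ)) q := by
    rw [e1]; exact contDiffAt_const.sub h
  have e2 : cd (dp e) (fun q : P × (Fin d → ℂ) => (t q.1 : ℂ)) q = (fderiv ℝ t p e : ℝ) := by
    have : HasFDerivAt (fun q : P × (Fin d → ℂ) => (t q.1 : ℂ)) (Complex.ofRealCLM.comp
        ((fderiv ℝ t p).comp (ContinuousLinearMap.fst ℝ P (Fin d → ℂ)))) q :=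
      Complex.ofRealCLM.hasFDerivAt.comp q
        (((hs.differentiable (by simp)) p).hasFDerivAt.comp q hasFDerivAt_fst)
    rw [cd_dp, this.fderiv]
    rfl
  have e3 : cd (dp e) (fun q : P × (Fin d → ℂ) => ((1 - t q.1 : ℝ) : ℂ)) q =
      -(fderiv ℝ t p e : ℝ) := by
    rw [e1, cd_sub _ (differentiableAt_const _) h.dAt, cd_const, e2, zero_sub]
  have g1 : ∀ H : P → FormField E, gramL n H x q = gram n (H p) x y := fun H => by
    rw [hq, gramL, (chartAt (Fin d → ℂ) x).left_inv hy.1]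
  rw [gramL_segment, cdM_add _ (SmoothAt.smul h' (hK.smooth x p y hy))
    (SmoothAt.smul h (hH.smooth x p y hy)), cdM_smul _ h' (hK.smooth x p y hy),
    cdM_smul _ h (hH.smooth x p y hy), e2, e3, g1, g1]
  module

variable {P' : Type*} [NormedAddCommGroup P'] [NormedSpace ℝ P']

lemma IsMetricFamily.comp_param {H : P → FormField E} (hH : IsMetricFamily d n H) {ph : P' → P}
    (hph : ContDiff ℝ ∞ ph) : IsMetricFamily d n (fun p' => H (ph p')) where
  herm p' := hH.herm (ph p')
  smooth x p' y hy := SmoothAt.comp (F := gramL n H x) (p := (p', chartAt (Fin d → ℂ) x y))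
    (ph := fun q : P' × (Fin d → ℂ) => (ph q.1, q.2))
    (hH.smooth x (ph p') y hy) ((hph.contDiffAt.comp _ contDiffAt_fst).prodMk contDiffAt_snd)

lemma cdM_dp_gramL_comp {H : P → FormField E} (hH : IsMetricFamily d n H) {ph : P' → P}
    (hph : ContDiff ℝ ∞ ph) (e p' : P') {x y : X} (hy : y ∈ dom d n E x) :
    cdM (dp e) (gramL n (fun p' => H (ph p')) x) (p', chartAt (Fin d → ℂ) x y) =
      cdM (dp (fderiv ℝ ph p' e)) (gramL n H x) (ph p', chartAt (Fin d → ℂ) x y) := by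
  have h : HasFDerivAt (fun q : P' × (Fin d → ℂ) => (ph q.1, q.2))
      (((fderiv ℝ ph p').comp (ContinuousLinearMap.fst ℝ P' (Fin d → ℂ))).prod
        (ContinuousLinearMap.snd ℝ P' (Fin d → ℂ))) (p', chartAt (Fin d → ℂ) x y) :=
    (((hph.differentiable (by simp)) p').hasFDerivAt.comp (p', chartAt (Fin d → ℂ) x y)
      hasFDerivAt_fst).prodMk hasFDerivAt_snd
  have := cdM_comp (ph := fun q : P' × (Fin d → ℂ) => (ph q.1, q.2))
    (F := gramL n H x) (p := (p', chartAt (Fin d → ℂ) x y)) (hH.smooth x (ph p') y hy)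
    h.differentiableAt (dp e)
  refine this.trans ?_
  rw [h.fderiv]
  simp [dp]

end Segments

/-! ### Closedness of the one-form `L ↦ ∫ Tr (L i Λ F)` on the space of metrics. -/

section Variation

variable {P : Type*} [NormedAddCommGroup P] [NormedSpace ℝ P]
variable {d n : ℕ} {X : Type*} [TopologicalSpace X] [ChartedSpace (Fin d → ℂ) X]
  {E : X → Type*} [∀ x, AddCommGroup (E x)] [∀ x, Module ℂ (E x)]
  [TopologicalSpace (TotalSpace (Fin n → ℂ) E)] [∀ x, TopologicalSpace (E x)]
  [FiberBundle (Fin n → ℂ) E] [VectorBundle ℂ (Fin n → ℂ) E]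
  [IsManifold 𝓘(ℂ, Fin d → ℂ) ω X] [ContMDiffVectorBundle ω (Fin n → ℂ) E 𝓘(ℂ, Fin d → ℂ)]

variable (n) in
/-- The one-form `Tr (H⁻¹ ∂_e H i Λ F)` on the space of metrics, for a family of metrics. -/
def varForm (g : FormField (Tang d X)) (Θ : HiggsField d n E) (H : P → FormField E) (e : P) (p : P)
    (x : X) : ℂ :=
  (atC (fun x q => chern (gramL n H x) (dp e) q * higgsL g Θ H x q) p x).trace

variable {g : FormField (Tang d X)} {Θ : HiggsField d n E} {H : P → FormField E}

lemma varForm_smoothFam (hg : IsHermitianMetric d d g) (Θ : HiggsField d n E)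
    (hH : IsMetricFamily d n H) (e : P) : SmoothFam (d := d) (varForm n g Θ H e) :=
  ((chern_dp_isEndFamily hH e).mul (higgsL_isEndFamily hg Θ hH)).smoothFam_trace

lemma chern_dp_selfAdjoint (hH : IsMetricFamily d n H) (e p : P) {x y : X}
    (hy : y ∈ dom d n E x) : adj (gramL n H x (p, chartAt (Fin d → ℂ) x y))
      (chern (gramL n H x) (dp e) (p, chartAt (Fin d → ℂ) x y)) =
      chern (gramL n H x) (dp e) (p, chartAt (Fin d → ℂ) x y) :=
  (adj_eq_self_iff (hH.isUnit p hy) _).2 (chern_selfAdjoint (hH.smooth x p y hy) (hH.isUnit p hy)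
    (Filter.Eventually.of_forall fun q => hH.hermitian x q) _ (cj_dp e))

lemma higgsL_selfAdjoint (hg : IsHermitianMetric d d g) (hH : IsMetricFamily d n H) (p : P) {x y : X}
    (hy : y ∈ dom d n E x) : adj (gramL n H x (p, chartAt (Fin d → ℂ) x y))
      (higgsL g Θ H x (p, chartAt (Fin d → ℂ) x y)) =
      higgsL g Θ H x (p, chartAt (Fin d → ℂ) x y) :=
  higgsP_selfAdjoint (hH.smoothNear p hy) (hH.isUnit p hy)
    (Filter.Eventually.of_forall fun q => hH.hermitian x q) (gammaL_hermitian hg x _)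

lemma conj_varForm (hg : IsHermitianMetric d d g) (hH : IsMetricFamily d n H) (e p : P) (x : X) :
    conj (varForm n g Θ H e p x) = varForm n g Θ H e p x :=
  trace_mul_real (hH.isUnit p (mem_dom x)) (chern_dp_selfAdjoint hH e p (mem_dom x))
    (higgsL_selfAdjoint hg hH p (mem_dom x))

lemma conj_dpar {f : P → X → ℂ} (hf : SmoothFam (d := d) f) (hr : ∀ p x, conj (f p x) = f p x)
    (e p : P) (x : X) : conj (dpar e f p x) = dpar e f p x := by
  have h := (hf.hasFDerivAt p x)
  have h2 : HasFDerivAt (fun p => f p x)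
      ((Complex.conjCLE : ℂ →L[ℝ] ℂ).comp (fderiv ℝ (fun p => f p x) p)) p := by
    have := (Complex.conjCLE : ℂ →L[ℝ] ℂ).hasFDerivAt.comp p h
    refine this.congr_of_eventuallyEq (Filter.Eventually.of_forall fun p => ?_)
    exact (hr p x).symm
  have := congrArg (fun L : P →L[ℝ] ℂ => L e) (h.unique h2)
  exact this.symm

lemma dpar_varForm (hg : IsHermitianMetric d d g) (Θ : HiggsField d n E)
    (hH : IsMetricFamily d n H) (e e' p : P) (x : X) : dpar e' (varForm n g Θ H e) p x =
      cd (dp e') (fun q => (chern (gramL n H x) (dp e) q * higgsL g Θ H x q).trace)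
        (p, chartAt (Fin d → ℂ) x x) :=
  (varForm_smoothFam hg Θ hH e).dpar_eq e' p x
    (((chern_dp_isEndFamily hH e).mul (higgsL_isEndFamily hg Θ hH)).trace_eventuallyEq p x)

/-- The divergence of `Tr (A ∂_H L)`. -/
def divNab (g : FormField (Tang d X)) (H : P → FormField E)
    (A L : X → P × (Fin d → ℂ) → Matrix (Fin n) (Fin n) ℂ) : P → X → ℂ :=
  atC (divL g fun x q j => (A x q * nab (gramL n H x) (L x) (dhb P d j) q).trace)

/-- Both derivatives are real, because `varForm` is the trace of a product of self-adjoint matrices.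
The difference thus equals its real part, which `re_cd_trace_sub` expresses by divergences. -/
lemma dpar_varForm_sub (hg : IsHermitianMetric d d g) (Θ : HiggsField d n E)
    (hH : IsMetricFamily d n H) (e e' p : P) (x : X) :
    dpar e' (varForm n g Θ H e) p x - dpar e (varForm n g Θ H e') p x =
      (((-2 * divNab g H (fun x => chern (gramL n H x) (dp e))
          (fun x => chern (gramL n H x) (dp e')) p x
        + 2 * divNab g H (fun x => chern (gramL n H x) (dp e'))
          (fun x => chern (gramL n H x) (dp e)) p x).re : ℝ) : ℂ) := by
  have hx := mem_dom (d := d) (n := n) (E := E) x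
  have hr : ∀ e e', (dpar e' (varForm n g Θ H e) p x).im = 0 := fun e e' =>
    Complex.conj_eq_iff_im.1 (conj_dpar (varForm_smoothFam hg Θ hH e)
      (fun p x => conj_varForm hg hH e p x) e' p x)
  have key := re_cd_trace_sub (hH.smoothNear p hx) (hH.isUnit p hx)
    (Filter.Eventually.of_forall fun q => hH.hermitian x q) (gammaL_hermitian hg x _)
    (ξ := dhb P d) (fun j => thetaL_smoothAt Θ hx j p) (gammaL_smoothAt hg hx.1 p) (dp e) (dp e')
    (cj_dp e) (cj_dp e') (fun j => thetaL_cdM_dp Θ hx j p e) (gammaL_cdM_dp hg hx.1 p e)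
    (fun j => thetaL_cdM_dp Θ hx j p e') (gammaL_cdM_dp hg hx.1 p e')
  refine Complex.ext ?_ ?_
  · rw [dpar_varForm hg Θ hH, dpar_varForm hg Θ hH, Complex.ofReal_re]
    exact key
  · rw [Complex.sub_im, hr, hr, Complex.ofReal_im, sub_zero]

variable [MeasurableSpace X] [BorelSpace X] [CompactSpace X] [T2Space X]

lemma integral_divNab (hg : IsKaehler g) (hH : IsMetricFamily d n H)
    {A L : X → P × (Fin d → ℂ) → Matrix (Fin n) (Fin n) ℂ} (hA : IsEndFamily A E)
    (hL : IsEndFamily L E) (p : P) : Integrable (divNab g H A L p) (omegaPow g) ∧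
      ∫ x, divNab g H A L p x ∂(omegaPow g) = 0 := by
  have hB := nabForm_isOneForm hH hA hL
  exact ⟨(hB.smoothFam_div hg.hermitian).integrable hg.hermitian p, hB.integral_div hg p⟩

/-- The one-form `Tr (H⁻¹ ∂_e H i Λ F)` on the space of metrics becomes closed after integration. -/
lemma integral_dpar_varForm (hg : IsKaehler g) (Θ : HiggsField d n E) (hH : IsMetricFamily d n H)
    (e e' p : P) : ∫ x, dpar e' (varForm n g Θ H e) p x ∂(omegaPow g) =
      ∫ x, dpar e (varForm n g Θ H e') p x ∂(omegaPow g) := by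
  have hgh := hg.hermitian
  have i1 := ((varForm_smoothFam hgh Θ hH e).dpar e').integrable hgh p
  have i2 := ((varForm_smoothFam hgh Θ hH e').dpar e).integrable hgh p
  obtain ⟨j1, k1⟩ := integral_divNab hg hH (chern_dp_isEndFamily hH e) (chern_dp_isEndFamily hH e') p
  obtain ⟨j2, k2⟩ := integral_divNab hg hH (chern_dp_isEndFamily hH e') (chern_dp_isEndFamily hH e) p
  rw [← sub_eq_zero, ← integral_sub i1 i2]
  simp only [dpar_varForm_sub hgh Θ hH]
  refine (integral_ofReal (𝕜 := ℂ)).trans ?_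
  have hi := (j1.const_mul (-2)).add (j2.const_mul 2)
  have := Complex.reCLM.integral_comp_comm hi
  simp only [Complex.reCLM_apply, Pi.add_apply] at this
  refine (congrArg _ this).trans ?_
  rw [integral_add (j1.const_mul (-2)) (j2.const_mul 2), integral_const_mul,
    integral_const_mul, k1, k2]
  simp

end Variation

/-! ### First variation of Simpson's functional. -/

section Simpson

lemma cdM_dp_zero {P : Type*} [NormedAddCommGroup P] [NormedSpace ℝ P] {d : ℕ} {l m : Type*}
    (F : P × (Fin d → ℂ) → Matrix l m ℂ) (q : P × (Fin d → ℂ)) : cdM (dp (0 : P)) F q = 0 := by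
  ext i j
  rw [cdM_apply, cd_dp, ← Prod.zero_eq_mk, map_zero]
  rfl

variable {P : Type*} [NormedAddCommGroup P] [NormedSpace ℝ P]
variable {d n : ℕ} {X : Type*} [TopologicalSpace X] [ChartedSpace (Fin d → ℂ) X]
  {E : X → Type*} [∀ x, AddCommGroup (E x)] [∀ x, Module ℂ (E x)]
  [TopologicalSpace (TotalSpace (Fin n → ℂ) E)] [∀ x, TopologicalSpace (E x)]
  [FiberBundle (Fin n → ℂ) E] [VectorBundle ℂ (Fin n → ℂ) E]
  [IsManifold 𝓘(ℂ, Fin d → ℂ) ω X] [ContMDiffVectorBundle ω (Fin n → ℂ) E 𝓘(ℂ, Fin d → ℂ)]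
  {g : FormField (Tang d X)} {H : P → FormField E}

/-- `i Λ F` only depends on the metric. -/
lemma higgsL_center_congr {P' : Type*} [NormedAddCommGroup P'] [NormedSpace ℝ P']
    (Θ : HiggsField d n E) (hH : IsMetricFamily d n H) {H' : P' → FormField E}
    (hH' : IsMetricFamily d n H') {p : P} {p' : P'} (h : H p = H' p') (x : X) :
    atC (higgsL g Θ H) p x = atC (higgsL g Θ H') p' x := by
  have h1 := endCoord_contraction_higgsCurvature (g := g) Θ hH p x
  rw [h, endCoord_contraction_higgsCurvature (g := g) Θ hH' p' x] at h1
  exact (smul_right_injective _ (neg_ne_zero.2 I_ne_zero) h1).symm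

lemma two_I_trace_contraction (Θ : HiggsField d n E) (hH : IsMetricFamily d n H) (p : P) (x : X)
    (A : Matrix (Fin n) (Fin n) ℂ) : 2 * I * LinearMap.trace ℂ (E x)
      (endOfCoord x A * contraction g x (higgsCurvature Θ (H p) x)) =
      2 * (A * atC (higgsL g Θ H) p x).trace := by
  rw [trace_eq_trace_endCoord (mem_frameSet (n := n) (E := E) x),
    endCoord_mul (mem_frameSet (n := n) (E := E) x), endCoord_endOfCoord,
    endCoord_contraction_higgsCurvature Θ hH, Matrix.mul_smul, Matrix.trace_smul, smul_eq_mul]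
  linear_combination (-2 * (A * atC (higgsL g Θ H) p x).trace) * I_sq

variable [MeasurableSpace X] [BorelSpace X] [CompactSpace X] [T2Space X]

/-- The first variation of Simpson's functional. -/
theorem hasDerivAt_simpsonFunctional (hg : IsKaehler g) (Θ : HiggsField d n E)
    {γ : ℝ → FormField E} (hγ : IsMetricFamily d n γ) {J : FormField E}
    (hJ : IsHermitianMetric d n J) (τ : ℝ) :
    HasDerivAt (fun τ => simpsonFunctional g Θ (γ τ) J)
      (2 * ∫ x, varForm n g Θ γ 1 τ x ∂(omegaPow g)) τ := by
  have hgh := hg.hermitian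
  have hJ' : IsMetricFamily d n (fun _ : ℝ × ℝ => J) := hJ.isMetricFamily
  have hγ' : IsMetricFamily d n (fun p : ℝ × ℝ => γ p.2) := hγ.comp_param contDiff_snd
  have hs : ContDiff ℝ ∞ fun p : ℝ × ℝ => sigma p.1 := contDiff_sigma.comp contDiff_fst
  -- A two-parameter family: `u` runs along the segment from `J` to `γ v`, and `v` along the curve
  -- `γ`.
  have hC := hJ'.segment hγ' (t := fun p => sigma p.1) (fun p => sigma_mem _) hs
  set C : ℝ × ℝ → FormField E := fun p => segment J (γ p.2) (sigma p.1) with hCdef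
  have sa := varForm_smoothFam hgh Θ hC (1, 0)
  have sb := varForm_smoothFam hgh Θ hC (0, 1)
  -- the derivatives of the family
  have hσ : ∀ u v a b : ℝ, fderiv ℝ (fun p : ℝ × ℝ => sigma p.1) (u, v) (a, b) =
      deriv sigma u * a := fun u v a b => by
    have h := HasFDerivAt.comp (g := sigma) (f := (Prod.fst : ℝ × ℝ → ℝ)) (u, v)
      (hasDerivAt_sigma u).hasFDerivAt hasFDerivAt_fst
    change HasFDerivAt (fun p : ℝ × ℝ => sigma p.1) _ (u, v) at h
    rw [h.fderiv, (hasDerivAt_sigma u).deriv]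
    simp [mul_comm]
  have hder : ∀ (u v a b : ℝ) (x : X), cdM (dp (a, b)) (gramL n C x) ((u, v), chartAt (Fin d → ℂ) x x) =
      ((deriv sigma u * a : ℝ) : ℂ) • (gram n (γ v) x x - gram n J x x) +
      (sigma u : ℂ) • cdM (dp b) (gramL n γ x) (v, chartAt (Fin d → ℂ) x x) := by
    intro u v a b x
    have h := cdM_dp_gramL_segment hJ' hγ' hs (a, b) (u, v) (mem_dom x)
    rw [hσ, cdM_dp_gramL_comp hγ contDiff_snd _ _ (mem_dom x)] at h
    have h0 : cdM (dp (a, b)) (gramL n (fun _ : ℝ × ℝ => J) x)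
        ((u, v), chartAt (Fin d → ℂ) x x) = 0 := by
      have h1 := cdM_dp_gramL_comp (P' := ℝ × ℝ) (H := fun _ : ℝ => J) (ph := fun _ => 0)
        hJ.isMetricFamily contDiff_const (a, b) (u, v) (mem_dom x)
      rw [fderiv_const_apply, zero_apply, cdM_dp_zero] at h1
      exact h1
    rw [h0, smul_zero, zero_add] at h
    refine h.trans ?_
    simp [fderiv_snd]
  have hgr : ∀ (u v : ℝ) (x : X), gramL n C x ((u, v), chartAt (Fin d → ℂ) x x) =
      gram n (segment J (γ v) (sigma u)) x x := fun u v x => by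
    rw [gramL, (chartAt (Fin d → ℂ) x).left_inv (mem_chart_source _ x)]
  have hva : ∀ (u v : ℝ) (x : X), varForm n g Θ C (1, 0) (u, v) x = ((deriv sigma u : ℝ) : ℂ) *
      ((gram n (segment J (γ v) (sigma u)) x x)⁻¹ * (gram n (γ v) x x - gram n J x x) *
        atC (higgsL g Θ C) (u, v) x).trace := fun u v x => by
    rw [varForm, atC, chern, hder, cdM_dp_zero, hgr]
    simp [Matrix.mul_assoc, atC]
  have h1 : ∀ τ, simpsonFunctional g Θ (γ τ) J =
      2 * ∫ u in (0 : ℝ)..1, ∫ x, varForm n g Θ C (1, 0) (u, τ) x ∂(omegaPow g) := fun τ => by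
    rw [simpsonFunctional, integral_comp_sigma, ← intervalIntegral.integral_const_mul]
    refine intervalIntegral.integral_congr fun u _ => ?_
    rw [← integral_const_mul, ← integral_const_mul]
    refine integral_congr_ae (Filter.Eventually.of_forall fun x => ?_)
    have h2 := two_I_trace_contraction (g := g) Θ hC (u, τ) x
      ((gram n (segment J (γ τ) (sigma u)) x x)⁻¹ * (gram n (γ τ) x x - gram n J x x))
    simp only at h2 ⊢
    rw [h2, hva]
    ring
  have h2 : HasDerivAt (fun τ => ∫ u in (0 : ℝ)..1, ∫ x, varForm n g Θ C (1, 0) (u, τ) x ∂(omegaPow g))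
      (∫ u in (0 : ℝ)..1, ∫ x, dpar (0, 1) (varForm n g Θ C (1, 0)) (u, τ) x ∂(omegaPow g)) τ := by
    simp only [intervalIntegral.integral_of_le zero_le_one, ← integral_Icc_eq_integral_Ioc]
    have hsw : Continuous fun q : ℝ × ℝ => (q.2, q.1) := by fun_prop
    refine hasDerivAt_setIntegral_of_isCompact (μ := volume) isCompact_Icc
      (f := fun τ u => ∫ x, varForm n g Θ C (1, 0) (u, τ) x ∂(omegaPow g))
      (f' := fun τ u => ∫ x, dpar (0, 1) (varForm n g Θ C (1, 0)) (u, τ) x ∂(omegaPow g))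
      ((sa.continuous_integral hgh).comp hsw) (((sa.dpar (0, 1)).continuous_integral hgh).comp hsw)
      (fun t u => ?_) τ
    exact sa.hasDerivAt_integral hgh (ph := fun t => (u, t)) (e := (0, 1))
      (fun t => (hasDerivAt_const t u).prodMk (hasDerivAt_id t)) t
  -- By closedness the `v`-derivative of the `u`-component is the `u`-derivative of the
  -- `v`-component, and the `u`-integral becomes a difference of end values. At `u = 0` the family
  -- is constantly `J` and contributes nothing (`h4`); at `u = 1` it is `γ` (`h5`).
  have h3 : ∫ u in (0 : ℝ)..1, ∫ x, dpar (0, 1) (varForm n g Θ C (1, 0)) (u, τ) x ∂(omegaPow g) =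
      (∫ x, varForm n g Θ C (0, 1) (1, τ) x ∂(omegaPow g)) -
        ∫ x, varForm n g Θ C (0, 1) (0, τ) x ∂(omegaPow g) := by
    simp only [integral_dpar_varForm hg Θ hC (1, 0) (0, 1)]
    refine intervalIntegral.integral_eq_sub_of_hasDerivAt
      (f := fun u => ∫ x, varForm n g Θ C (0, 1) (u, τ) x ∂(omegaPow g)) (fun u _ => ?_) ?_
    · exact sb.hasDerivAt_integral hgh (ph := fun u => (u, τ)) (e := (1, 0))
        (fun u => (hasDerivAt_id u).prodMk (hasDerivAt_const u τ)) u
    · refine Continuous.intervalIntegrable ?_ _ _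
      exact ((sb.dpar (1, 0)).continuous_integral hgh).comp
        (by fun_prop : Continuous fun u : ℝ => (u, τ))
  have h4 : ∀ x, varForm n g Θ C (0, 1) (0, τ) x = 0 := fun x => by
    rw [varForm, atC, chern, hder, sigma_zero]
    simp
  have h5 : ∀ x, varForm n g Θ C (0, 1) (1, τ) x = varForm n g Θ γ 1 τ x := fun x => by
    have e1 : C (1, τ) = γ τ := by rw [hCdef]; simp only [sigma_one, segment_one]
    have e2 := higgsL_center_congr (g := g) Θ hC hγ e1 x
    simp only [atC] at e2
    simp only [varForm, atC, chern, e2, hder, hgr, sigma_one, segment_one]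
    rw [gramL, (chartAt (Fin d → ℂ) x).left_inv (mem_chart_source _ x)]
    simp
  rw [h3] at h2
  simp only [h4, h5, integral_zero, sub_zero] at h2
  simp only [h1]
  exact h2.const_mul 2

end Simpson

/-! ### Orthogonal projections and their variation. -/

section OrthogonalProjection

variable {m l : Type*} [Fintype m] [DecidableEq m] [Fintype l] [DecidableEq l]

/-- The orthogonal projection to the column space of `ι` with respect to the form `h`. -/
def orthProj (ι : Matrix m l ℂ) (h : Matrix m m ℂ) : Matrix m m ℂ := ι * (ιᴴ * h * ι)⁻¹ * ιᴴ * h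

variable {ι : Matrix m l ℂ} {h : Matrix m m ℂ}

lemma orthProj_mul_self (hu : IsUnit (ιᴴ * h * ι).det) :
    orthProj ι h * orthProj ι h = orthProj ι h := by
  calc orthProj ι h * orthProj ι h
      = ι * ((ιᴴ * h * ι)⁻¹ * (ιᴴ * h * ι)) * (ιᴴ * h * ι)⁻¹ * ιᴴ * h := by
        simp only [orthProj, Matrix.mul_assoc]
    _ = _ := by rw [Matrix.nonsing_inv_mul _ hu, Matrix.mul_one, orthProj]

lemma adj_orthProj (hh : hᴴ = h) (hu : IsUnit h.det) : adj h (orthProj ι h) = orthProj ι h := by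
  rw [adj_eq_self_iff hu, orthProj]
  simp only [Matrix.conjTranspose_mul, Matrix.conjTranspose_nonsing_inv, hh,
    Matrix.conjTranspose_conjTranspose, Matrix.mul_assoc]

lemma orthProj_mul_right (ι : Matrix m l ℂ) (h : Matrix m m ℂ) {b : Matrix l l ℂ}
    (hb : IsUnit b.det) : orthProj (ι * b) h = orthProj ι h := by
  have hb' : IsUnit (bᴴ).det := by rw [Matrix.det_conjTranspose]; exact hb.star
  have e1 : (ι * b)ᴴ * h * (ι * b) = bᴴ * (ιᴴ * h * ι) * b := by
    simp only [Matrix.conjTranspose_mul, Matrix.mul_assoc]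
  rw [orthProj, e1, Matrix.mul_inv_rev, Matrix.mul_inv_rev, Matrix.conjTranspose_mul]
  calc ι * b * (b⁻¹ * ((ιᴴ * h * ι)⁻¹ * (bᴴ)⁻¹)) * (bᴴ * ιᴴ) * h
      = ι * (b * b⁻¹) * (ιᴴ * h * ι)⁻¹ * ((bᴴ)⁻¹ * bᴴ) * ιᴴ * h := by
        simp only [Matrix.mul_assoc]
    _ = _ := by
        rw [Matrix.mul_nonsing_inv _ hb, Matrix.nonsing_inv_mul _ hb', Matrix.mul_one,
          Matrix.mul_one, orthProj]

lemma orthProj_conj (ι : Matrix m l ℂ) (h : Matrix m m ℂ) {a : Matrix m m ℂ}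
    (ha : IsUnit a.det) : orthProj (a⁻¹ * ι) (aᴴ * h * a) = a⁻¹ * orthProj ι h * a := by
  have ha' : IsUnit (aᴴ).det := by rw [Matrix.det_conjTranspose]; exact ha.star
  have e2 : (a⁻¹ * ι)ᴴ * (aᴴ * h * a) = ιᴴ * h * a := by
    rw [Matrix.conjTranspose_mul, Matrix.conjTranspose_nonsing_inv]
    simp only [Matrix.mul_assoc, Matrix.nonsing_inv_mul_cancel_left _ _ ha']
  have e1 : (a⁻¹ * ι)ᴴ * (aᴴ * h * a) * (a⁻¹ * ι) = ιᴴ * h * ι := by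
    rw [e2, Matrix.mul_assoc _ a, Matrix.mul_nonsing_inv_cancel_left _ _ ha]
  rw [orthProj, e1, Matrix.mul_assoc _ _ (aᴴ * h * a), e2, orthProj]
  simp only [Matrix.mul_assoc]

section PosDef

open scoped ComplexOrder

lemma posDef_gramSub (hι : Function.Injective fun v => ι *ᵥ v)
    (hh : h.PosDef) : (ιᴴ * h * ι).PosDef := hh.conjTranspose_mul_mul_same (B := ι) hι

lemma isUnit_of_injective (hι : Function.Injective fun v => ι *ᵥ v)
    (hh : h.PosDef) : IsUnit (ιᴴ * h * ι).det :=
  (posDef_gramSub hι hh).det_pos.ne'.isUnit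

lemma det_inv_mul_pos {k : Matrix m m ℂ} (hk : k.PosDef) (hh : h.PosDef) :
    0 < (k⁻¹ * h).det.re ∧ (((k⁻¹ * h).det.re : ℝ) : ℂ) = (k⁻¹ * h).det := by
  have hp : 0 < (k⁻¹ * h).det := by
    rw [Matrix.det_mul]
    exact mul_pos hk.inv.det_pos hh.det_pos
  have := Complex.lt_def.1 hp
  exact ⟨this.1, Complex.ext rfl this.2⟩

end PosDef

variable {W : Type*} [NormedAddCommGroup W] [NormedSpace ℝ W] {F : W → Matrix m l ℂ}
  {H : W → Matrix m m ℂ} {q : W}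

lemma orthProj_smoothAt (hF : SmoothAt F q) (hH : SmoothAt H q)
    (hu : IsUnit ((F q)ᴴ * H q * F q).det) : SmoothAt (fun q => orthProj (F q) (H q)) q :=
  (((hF.mul (((hF.conjTranspose.mul hH).mul hF).inv hu)).mul hF.conjTranspose).mul hH)

lemma cdM_gramSub (ξ : W × W) (hF : SmoothAt F q) (hH : SmoothAt H q) (h1 : cdM ξ F q = 0)
    (h2 : cdM (cj ξ) F q = 0) (hHu : IsUnit (H q).det) :
    cdM ξ (fun q => (F q)ᴴ * H q * F q) q = (F q)ᴴ * H q * chern H ξ q * F q := by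
  have h3 : cdM ξ (fun q => (F q)ᴴ) q = 0 := by
    rw [cdM_conjTranspose ξ hF]
    exact (congrArg _ h2).trans Matrix.conjTranspose_zero
  rw [cdM_mul ξ (hF.conjTranspose.mul hH) hF, cdM_mul ξ hF.conjTranspose hH, h1, h3, chern]
  simp only [Matrix.zero_mul, Matrix.mul_zero, zero_add, add_zero, Matrix.mul_assoc,
    Matrix.mul_nonsing_inv_cancel_left _ _ hHu]

/-- Only the metric varies, not the subspace. Differentiating `ι (ι^† h ι)⁻¹ ι^† h` gives `π L` from
the last factor and `-π L π` from the inverse, with `L = h⁻¹ ∂h`. -/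
lemma cdM_orthProj (ξ : W × W) (hF : SmoothAt F q) (hH : SmoothAt H q) (h1 : cdM ξ F q = 0)
    (h2 : cdM (cj ξ) F q = 0) (hHu : IsUnit (H q).det) (hu : IsUnit ((F q)ᴴ * H q * F q).det) :
    cdM ξ (fun q => orthProj (F q) (H q)) q =
      orthProj (F q) (H q) * chern H ξ q * (1 - orthProj (F q) (H q)) := by
  have h3 : cdM ξ (fun q => (F q)ᴴ) q = 0 := by
    rw [cdM_conjTranspose ξ hF]
    exact (congrArg _ h2).trans Matrix.conjTranspose_zero
  have hg := (hF.conjTranspose.mul hH).mul hF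
  simp only [orthProj]
  rw [cdM_mul ξ ((hF.mul (hg.inv hu)).mul hF.conjTranspose) hH,
    cdM_mul ξ (hF.mul (hg.inv hu)) hF.conjTranspose, cdM_mul ξ hF (hg.inv hu), cdM_inv ξ hg hu,
    cdM_gramSub ξ hF hH h1 h2 hHu, h1, h3]
  have e : cdM ξ H q = H q * chern H ξ q := by
    rw [chern, Matrix.mul_nonsing_inv_cancel_left _ _ hHu]
  rw [e]
  simp only [Matrix.mul_assoc, Matrix.mul_sub, Matrix.mul_one, Matrix.zero_mul, Matrix.mul_zero,
    zero_add, add_zero, Matrix.mul_neg, Matrix.neg_mul]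
  abel

/-- Cyclicity of the trace: this logarithmic derivative of the determinant of the induced metric is
that of the full metric, compressed by the projection. -/
lemma trace_chern_gramSub (ξ : W × W) (hF : SmoothAt F q) (hH : SmoothAt H q) (h1 : cdM ξ F q = 0)
    (h2 : cdM (cj ξ) F q = 0) (hHu : IsUnit (H q).det) :
    (chern (fun q => (F q)ᴴ * H q * F q) ξ q).trace =
      (orthProj (F q) (H q) * chern H ξ q).trace := by
  rw [chern, cdM_gramSub ξ hF hH h1 h2 hHu, orthProj, ← Matrix.mul_assoc, Matrix.trace_mul_comm]
  simp only [Matrix.mul_assoc]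

end OrthogonalProjection

/-! ### The subbundle `E₁`: inclusion, projection and the variation of `R_1`. -/

section Extension

variable {P : Type*} [NormedAddCommGroup P] [NormedSpace ℝ P]
variable {d n₁ n n₂ : ℕ} {X : Type*} [TopologicalSpace X] [ChartedSpace (Fin d → ℂ) X]
  [IsManifold 𝓘(ℂ, Fin d → ℂ) ω X] {E₁ E E₂ : X → Type*}
  [∀ x, AddCommGroup (E₁ x)] [∀ x, Module ℂ (E₁ x)]
  [TopologicalSpace (TotalSpace (Fin n₁ → ℂ) E₁)] [∀ x, TopologicalSpace (E₁ x)]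
  [FiberBundle (Fin n₁ → ℂ) E₁] [VectorBundle ℂ (Fin n₁ → ℂ) E₁]
  [ContMDiffVectorBundle ω (Fin n₁ → ℂ) E₁ 𝓘(ℂ, Fin d → ℂ)]
  [∀ x, AddCommGroup (E x)] [∀ x, Module ℂ (E x)]
  [TopologicalSpace (TotalSpace (Fin n → ℂ) E)] [∀ x, TopologicalSpace (E x)]
  [FiberBundle (Fin n → ℂ) E] [VectorBundle ℂ (Fin n → ℂ) E]
  [ContMDiffVectorBundle ω (Fin n → ℂ) E 𝓘(ℂ, Fin d → ℂ)]
  [∀ x, AddCommGroup (E₂ x)] [∀ x, Module ℂ (E₂ x)]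
  [TopologicalSpace (TotalSpace (Fin n₂ → ℂ) E₂)] [∀ x, TopologicalSpace (E₂ x)]
  [FiberBundle (Fin n₂ → ℂ) E₂] [VectorBundle ℂ (Fin n₂ → ℂ) E₂]

namespace HiggsExt

variable (e : HiggsExt d n₁ n n₂ E₁ E E₂)

/-- The matrix of the inclusion at `y` in the frame of `E` around `x` and the frame of `E₁`
around `x₁`. -/
def inclM (x x₁ y : X) : Matrix (Fin n) (Fin n₁) ℂ :=
  LinearMap.toMatrix'
    ((trivializationAt (Fin n → ℂ) E x).linearMapAt ℂ y ∘ₗ e.i y ∘ₗ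
      (trivializationAt (Fin n₁ → ℂ) E₁ x₁).symmₗ ℂ y)

lemma inclM_mulVec (x x₁ y : X) (v : Fin n₁ → ℂ) : e.inclM x x₁ y *ᵥ v =
    (trivializationAt (Fin n → ℂ) E x).linearMapAt ℂ y (e.i y
      ((trivializationAt (Fin n₁ → ℂ) E₁ x₁).symmₗ ℂ y v)) := by
  rw [inclM, LinearMap.toMatrix'_mulVec]; rfl

lemma inclM_injective {x x₁ y : X} (hx : y ∈ frameSet n E x) (hx₁ : y ∈ frameSet n₁ E₁ x₁) :
    Function.Injective fun v => e.inclM x x₁ y *ᵥ v := by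
  intro v w hvw
  simp only [inclM_mulVec] at hvw
  have h1 := congrArg ((trivializationAt (Fin n → ℂ) E x).symmₗ ℂ y) hvw
  rw [Trivialization.symmₗ_linearMapAt _ hx, Trivialization.symmₗ_linearMapAt _ hx] at h1
  have h2 := congrArg ((trivializationAt (Fin n₁ → ℂ) E₁ x₁).linearMapAt ℂ y) (e.injective_i y h1)
  rwa [Trivialization.linearMapAt_symmₗ _ hx₁, Trivialization.linearMapAt_symmₗ _ hx₁] at h2

lemma inclM_frameChange {x x' x₁ x₁' y : X} (hx : y ∈ frameSet n E x)
    (hx₁ : y ∈ frameSet n₁ E₁ x₁) : e.inclM x' x₁' y =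
      frameChange n E x' x y * e.inclM x x₁ y * frameChange n₁ E₁ x₁ x₁' y := by
  rw [inclM, inclM, frameChange, frameChange, ← LinearMap.toMatrix'_comp,
    ← LinearMap.toMatrix'_comp]
  congr 1
  refine LinearMap.ext fun v => ?_
  simp only [LinearMap.comp_apply]
  rw [Trivialization.symmₗ_linearMapAt _ hx, Trivialization.symmₗ_linearMapAt _ hx₁]

lemma gram_inducedForm {x y : X} (hx : y ∈ frameSet n E x) (x₁ : X) (hx₁ : y ∈ frameSet n₁ E₁ x₁)
    (H : FormField E) : gram n₁ (e.inducedForm H) x₁ y =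
      (e.inclM x x₁ y)ᴴ * gram n H x y * e.inclM x x₁ y := by
  ext i j
  have hf : ∀ i, e.i y (localFrame n₁ E₁ x₁ y i) = (trivializationAt (Fin n → ℂ) E x).symmₗ ℂ y
      (e.inclM x x₁ y *ᵥ Pi.single i 1) := fun i => by
    rw [inclM_mulVec, Trivialization.symmₗ_linearMapAt _ hx, Trivialization.symmₗ_apply _ hx₁]
    rfl
  have : gram n₁ (e.inducedForm H) x₁ y i j =
      H y (e.i y (localFrame n₁ E₁ x₁ y i)) (e.i y (localFrame n₁ E₁ x₁ y j)) := rfl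
  rw [this, hf, hf, form_symm hx]
  simp only [Matrix.mulVec_single_one, Matrix.mul_assoc]
  rw [Matrix.mul_apply]
  simp only [dotProduct, Matrix.mul_apply, Matrix.mulVec, Matrix.conjTranspose_apply, Pi.star_apply,
    Matrix.col_apply]

lemma inclM_smoothAt {x x₁ x' y : X} (hx' : y ∈ (chartAt (Fin d → ℂ) x').source)
    (hx : y ∈ frameSet n E x) (hx₁ : y ∈ frameSet n₁ E₁ x₁) (p : P) :
    SmoothAt (fun q : P × (Fin d → ℂ) => e.inclM x x₁ ((chartAt (Fin d → ℂ) x').symm q.2))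
      (p, chartAt (Fin d → ℂ) x' y) := by
  intro i j
  set t₁ := trivializationAt (Fin n₁ → ℂ) E₁ x₁
  set t := trivializationAt (Fin n → ℂ) E x
  have h1 : ContMDiffAt 𝓘(ℂ, Fin d → ℂ) (𝓘(ℂ, Fin d → ℂ).prod 𝓘(ℂ, Fin n₁ → ℂ)) ω
      (fun y => (t₁.toOpenPartialHomeomorph.symm (y, Pi.single j 1) : TotalSpace (Fin n₁ → ℂ) E₁)) y :=
    ContMDiffAt.comp y ((t₁.contMDiffOn_symm (IB := 𝓘(ℂ, Fin d → ℂ)) (n := ω)).contMDiffAt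
      (t₁.open_target.mem_nhds (t₁.mem_target.2 hx₁)))
      (contMDiffAt_id.prodMk contMDiffAt_const)
  have h2 := ContMDiffAt.comp y (e.holomorphic_i _) h1
  have h3 := ContMDiffAt.comp y ((t.contMDiffOn (IB := 𝓘(ℂ, Fin d → ℂ)) (n := ω)).contMDiffAt
    (t.open_source.mem_nhds (t.mem_source.2 (by
      change (t₁.toOpenPartialHomeomorph.symm (y, Pi.single j 1)).1 ∈ _
      rw [show (t₁.toOpenPartialHomeomorph.symm (y, Pi.single j 1)).1 = y from
        t₁.proj_symm_apply (t₁.mem_target.2 hx₁)]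
      exact hx)))) h2
  have h4 := contDiffAt_comp_chart_symm (contMDiffAt_snd.comp y h3) hx'
  have h5 := (contDiffAt_pi.1 h4) i
  refine ContDiffAt.congr_of_eventuallyEq (ContDiffAt.comp (p, chartAt (Fin d → ℂ) x' y)
    ((h5.restrict_scalars ℝ).of_le le_top) contDiffAt_snd) ?_
  filter_upwards [eventually_symm_mem hx' (t.open_baseSet.inter t₁.open_baseSet) ⟨hx, hx₁⟩ p] with q hq
  have key : ∀ (T : TotalSpace (Fin n₁ → ℂ) E₁) (y : X) (v : E₁ y), ⟨y, v⟩ = T →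
      (t ⟨T.proj, e.i T.proj T.2⟩).2 i = (t ⟨y, e.i y v⟩).2 i := by
    rintro _ y v rfl; rfl
  refine Eq.trans ?_ (key _ _ _ (t₁.mk_symm hq.2.2 (Pi.single j (1 : ℂ)))).symm
  rw [inclM, LinearMap.toMatrix'_apply, LinearMap.comp_apply, LinearMap.comp_apply,
    Trivialization.symmₗ_apply _ hq.2.2, Trivialization.linearMapAt_apply, if_pos hq.2.1]

/-- The matrices of the orthogonal projections to `E₁` for a family of metrics. -/
def projL (H : P → FormField E) (x : X) (q : P × (Fin d → ℂ)) : Matrix (Fin n) (Fin n) ℂ :=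
  endCoord n x ((chartAt (Fin d → ℂ) x).symm q.2) (e.proj (H q.1) _)

variable {e}

lemma isUnit_gramSub {H : FormField E} (hH : IsHermitianMetric d n H) {x x₁ y : X}
    (hx : y ∈ frameSet n E x) (hx₁ : y ∈ frameSet n₁ E₁ x₁) :
    IsUnit ((e.inclM x x₁ y)ᴴ * gram n H x y * e.inclM x x₁ y).det :=
  isUnit_of_injective (e.inclM_injective hx hx₁) (gram_posDef hH hx)

lemma endCoord_proj (H : FormField E) {x x₁ y : X}
    (hx : y ∈ frameSet n E x) (hx₁ : y ∈ frameSet n₁ E₁ x₁) :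
    endCoord n x y (e.proj H y) = orthProj (e.inclM x x₁ y) (gram n H x y) := by
  have hy := mem_frameSet (n := n) (E := E) y
  have hy₁ := mem_frameSet (n := n₁) (E := E₁) y
  have h0 : endCoord n y y (e.proj H y) = orthProj (e.inclM y y y) (gram n H y y) := by
    rw [proj, endCoord_endOfCoord]
    rfl
  rw [endCoord_frameChange hy hx, h0, e.inclM_frameChange (x := y) (x₁ := y) (x' := x) (x₁' := x₁) hy hy₁,
    orthProj_mul_right _ _ (frameChange_isUnit hy₁ hx₁), gram_frameChange hy hx,
    ← frameChange_inv hy hx, orthProj_conj _ _ (frameChange_isUnit hy hx)]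

/-- The set `dom` controls only the chart and the frame of `E`. The bundle `E₁` is therefore read in
its frame around `y` itself, which is harmless since the projection depends only on the image of the
inclusion. -/
lemma projL_eventuallyEq (H : P → FormField E) {x y : X} (hy : y ∈ dom d n E x) (p : P) :
    e.projL H x =ᶠ[nhds (p, chartAt (Fin d → ℂ) x y)] fun q =>
      orthProj (e.inclM x y ((chartAt (Fin d → ℂ) x).symm q.2)) (gramL n H x q) := by
  filter_upwards [eventually_symm_mem hy.1 ((isOpen_dom x).inter
    (trivializationAt (Fin n₁ → ℂ) E₁ y).open_baseSet) ⟨hy, mem_frameSet y⟩ p] with q hq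
  exact endCoord_proj (H q.1) hq.2.1.2 hq.2.2

lemma projL_apply (H : P → FormField E) {x y : X} (hy : y ∈ dom d n E x) (p : P) :
    e.projL H x (p, chartAt (Fin d → ℂ) x y) = endCoord n x y (e.proj (H p) y) := by
  rw [projL, (chartAt (Fin d → ℂ) x).left_inv hy.1]

lemma isUnit_gramSubL {H : P → FormField E} (hH : IsMetricFamily d n H) {x y : X}
    (hy : y ∈ dom d n E x) (p : P) {x₁ : X} (hx₁ : y ∈ frameSet n₁ E₁ x₁) :
    IsUnit ((e.inclM x x₁ ((chartAt (Fin d → ℂ) x).symm (chartAt (Fin d → ℂ) x y)))ᴴ *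
      gramL n H x (p, chartAt (Fin d → ℂ) x y) *
      e.inclM x x₁ ((chartAt (Fin d → ℂ) x).symm (chartAt (Fin d → ℂ) x y))).det := by
  rw [gramL, (chartAt (Fin d → ℂ) x).left_inv hy.1]
  exact isUnit_gramSub (hH.herm p) hy.2 hx₁

lemma projL_isEndFamily {H : P → FormField E} (hH : IsMetricFamily d n H) :
    IsEndFamily (e.projL H) E where
  smooth x p y hy := by
    have h := orthProj_smoothAt (e.inclM_smoothAt hy.1 hy.2 (mem_frameSet y) p) (hH.smooth x p y hy)
      (isUnit_gramSubL hH hy p (mem_frameSet y))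
    exact h.congr (projL_eventuallyEq H hy p)
  trans x x' p y hy := by
    rw [projL_apply H hy.1, projL_apply H hy.2]
    exact endCoord_frameChange hy.1.2 hy.2.2 _

lemma inclM_cdM_dp {x x₁ y : X} (hy : y ∈ dom d n E x) (hx₁ : y ∈ frameSet n₁ E₁ x₁) (p v : P) :
    cdM (dp v) (fun q : P × (Fin d → ℂ) => e.inclM x x₁ ((chartAt (Fin d → ℂ) x).symm q.2))
      (p, chartAt (Fin d → ℂ) x y) = 0 := by
  ext i k
  have h := (e.inclM_smoothAt hy.1 hy.2 hx₁ p i k).comp (f := fun z : Fin d → ℂ => (p, z))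
    (chartAt (Fin d → ℂ) x y) (contDiffAt_const.prodMk contDiffAt_id)
  exact cd_dp_snd _ (p, chartAt (Fin d → ℂ) x y) (h.differentiableAt (by simp)) v

lemma cdM_dp_projL {H : P → FormField E} (hH : IsMetricFamily d n H) {x y : X}
    (hy : y ∈ dom d n E x) (p v : P) :
    cdM (dp v) (e.projL H x) (p, chartAt (Fin d → ℂ) x y) =
      e.projL H x (p, chartAt (Fin d → ℂ) x y) *
        chern (gramL n H x) (dp v) (p, chartAt (Fin d → ℂ) x y) *
        (1 - e.projL H x (p, chartAt (Fin d → ℂ) x y)) := by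
  have h0 := inclM_cdM_dp (e := e) hy (mem_frameSet y) p v
  rw [cdM_congr (projL_eventuallyEq H hy p),
    cdM_orthProj (dp v) (e.inclM_smoothAt hy.1 hy.2 (mem_frameSet y) p) (hH.smooth x p y hy)
      h0 (by rw [cj_dp]; exact h0) (hH.isUnit p hy) (isUnit_gramSubL hH hy p (mem_frameSet y)),
    (projL_eventuallyEq H hy p).self_of_nhds]

lemma projL_mul_self {H : P → FormField E} (hH : IsMetricFamily d n H) {x y : X}
    (hy : y ∈ dom d n E x) (p : P) : e.projL H x (p, chartAt (Fin d → ℂ) x y) *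
      e.projL H x (p, chartAt (Fin d → ℂ) x y) = e.projL H x (p, chartAt (Fin d → ℂ) x y) := by
  rw [(projL_eventuallyEq H hy p).self_of_nhds]
  exact orthProj_mul_self (isUnit_gramSubL hH hy p (mem_frameSet y))

lemma projL_selfAdjoint {H : P → FormField E} (hH : IsMetricFamily d n H) {x y : X}
    (hy : y ∈ dom d n E x) (p : P) : adj (gramL n H x (p, chartAt (Fin d → ℂ) x y))
      (e.projL H x (p, chartAt (Fin d → ℂ) x y)) = e.projL H x (p, chartAt (Fin d → ℂ) x y) := by
  rw [(projL_eventuallyEq H hy p).self_of_nhds]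
  exact adj_orthProj (hH.hermitian x _) (hH.isUnit p hy)

lemma R₁_eq {H K : FormField E} {x x₁ y : X}
    (hx : y ∈ frameSet n E x) (hx₁ : y ∈ frameSet n₁ E₁ x₁) : e.R₁ H K y =
      Real.log ((((e.inclM x x₁ y)ᴴ * gram n K x y * e.inclM x x₁ y)⁻¹ *
        ((e.inclM x x₁ y)ᴴ * gram n H x y * e.inclM x x₁ y)).det.re) := by
  have hy₁ := mem_frameSet (n := n₁) (E := E₁) y
  have ha := frameChange_isUnit hy₁ hx₁
  have ha' : IsUnit ((frameChange n₁ E₁ y x₁ y)ᴴ).det := by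
    rw [Matrix.det_conjTranspose]; exact ha.star
  rw [← e.gram_inducedForm hx x₁ hx₁, ← e.gram_inducedForm hx x₁ hx₁, gram_frameChange hy₁ hx₁,
    gram_frameChange hy₁ hx₁, R₁]
  congr 2
  set a := frameChange n₁ E₁ y x₁ y
  simp only [Matrix.mul_inv_rev, Matrix.det_mul, Matrix.det_nonsing_inv]
  simp only [Ring.inverse_eq_inv']
  have h1 := ha.ne_zero
  have h2 := ha'.ne_zero
  field_simp

lemma R₁_self (H : FormField E) (hH : IsHermitianMetric d n H) (x : X) : e.R₁ H H x = 0 := by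
  have h := isUnit_gramSub (e := e) hH (mem_frameSet x) (mem_frameSet x)
  rw [R₁_eq (mem_frameSet x) (mem_frameSet x), Matrix.nonsing_inv_mul _ h]
  simp

variable (e) in
/-- The matrices of the induced metrics on `E₁`. -/
def gramSubL (H : P → FormField E) (x : X) (q : P × (Fin d → ℂ)) : Matrix (Fin n₁) (Fin n₁) ℂ :=
  (e.inclM x x ((chartAt (Fin d → ℂ) x).symm q.2))ᴴ * gramL n H x q *
    e.inclM x x ((chartAt (Fin d → ℂ) x).symm q.2)

lemma gramSubL_smoothAt {H : P → FormField E} (hH : IsMetricFamily d n H) (p : P) (x : X) :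
    SmoothAt (e.gramSubL H x) (p, chartAt (Fin d → ℂ) x x) := by
  have h := e.inclM_smoothAt (mem_chart_source _ x) (mem_frameSet x) (mem_frameSet x) p
  exact (h.conjTranspose.mul (hH.smooth x p x (mem_dom x))).mul h

lemma R₁_eventually {H K : P → FormField E} (hH : IsMetricFamily d n H) (hK : IsMetricFamily d n K)
    (p : P) (x : X) : ∀ᶠ q : P × (Fin d → ℂ) in nhds (p, chartAt (Fin d → ℂ) x x),
      e.R₁ (H q.1) (K q.1) ((chartAt (Fin d → ℂ) x).symm q.2) =
        Real.log ((e.gramSubL K x q)⁻¹ * e.gramSubL H x q).det.re ∧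
      0 < ((e.gramSubL K x q)⁻¹ * e.gramSubL H x q).det.re ∧
      ((((e.gramSubL K x q)⁻¹ * e.gramSubL H x q).det.re : ℝ) : ℂ) =
        ((e.gramSubL K x q)⁻¹ * e.gramSubL H x q).det := by
  filter_upwards [eventually_symm_mem (mem_chart_source _ x) ((isOpen_dom (d := d) (n := n) (E := E) x).inter
    (trivializationAt (Fin n₁ → ℂ) E₁ x).open_baseSet) ⟨mem_dom x, mem_frameSet x⟩ p] with q hq
  have hi := e.inclM_injective hq.2.1.2 hq.2.2
  exact ⟨R₁_eq hq.2.1.2 hq.2.2, det_inv_mul_pos (posDef_gramSub hi (gram_posDef (hK.herm _) hq.2.1.2))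
    (posDef_gramSub hi (gram_posDef (hH.herm _) hq.2.1.2))⟩

lemma isUnit_gramSubL_center {H : P → FormField E} (hH : IsMetricFamily d n H) (p : P) (x : X) :
    IsUnit (e.gramSubL H x (p, chartAt (Fin d → ℂ) x x)).det :=
  isUnit_gramSubL hH (mem_dom x) p (mem_frameSet x)

lemma R₁_smoothFam {H K : P → FormField E} (hH : IsMetricFamily d n H) (hK : IsMetricFamily d n K) :
    SmoothFam (d := d) (fun p x => (e.R₁ (H p) (K p) x : ℂ)) := by
  intro p x
  have h := R₁_eventually (e := e) hH hK p x
  have hs := (((gramSubL_smoothAt (e := e) hK p x).inv (isUnit_gramSubL_center hK p x)).mul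
    (gramSubL_smoothAt (e := e) hH p x)).det
  have hr := (Complex.reCLM.contDiff.contDiffAt (n := ∞)).comp _ hs
  have hl := hr.log h.self_of_nhds.2.1.ne'
  refine ((Complex.ofRealCLM.contDiff.contDiffAt (n := ∞)).comp _ hl).congr_of_eventuallyEq ?_
  filter_upwards [h] with q hq
  rw [hq.1]
  rfl

/-- Near the point `exp R_1` is `det H₁ / det J₁`, with a denominator that is constant in the
parameter. Jacobi's formula applied to this identity gives `Tr (H₁⁻¹ ∂H₁)`, and
`trace_chern_gramSub` rewrites it through the projection. -/
lemma dpar_R₁ {H : P → FormField E} (hH : IsMetricFamily d n H) {J : FormField E}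
    (hJ : IsHermitianMetric d n J) (v p : P) (x : X) :
    dpar v (fun p x => (e.R₁ (H p) J x : ℂ)) p x =
      (atC (e.projL H) p x * atC (fun x => chern (gramL (d := d) n H x) (dp v)) p x).trace := by
  have hJ' : IsMetricFamily d n (fun _ : P => J) := hJ.isMetricFamily
  have hf := R₁_smoothFam (e := e) hH hJ'
  have h := R₁_eventually (d := d) (e := e) hH hJ' p x
  set q : P × (Fin d → ℂ) := (p, chartAt (Fin d → ℂ) x x) with hq
  set f : P × (Fin d → ℂ) → ℂ :=
    fun q => (e.R₁ (H q.1) J ((chartAt (Fin d → ℂ) x).symm q.2) : ℂ) with hfdef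
  have hfd : DifferentiableAt ℝ f q := (hf p x).dAt
  have hi := e.inclM_smoothAt (mem_chart_source _ x) (mem_frameSet x) (mem_frameSet x) p
  have h0 := inclM_cdM_dp (e := e) (mem_dom x) (mem_frameSet x) p v
  have e1 : (fun q => Complex.exp (f q)) =ᶠ[nhds q] fun q =>
      (e.gramSubL (fun _ => J) x q).det⁻¹ * (e.gramSubL H x q).det := by
    filter_upwards [h] with q hq
    rw [hfdef]
    simp only
    rw [hq.1, ← Complex.ofReal_exp, Real.exp_log hq.2.1, hq.2.2, Matrix.det_mul,
      Matrix.det_nonsing_inv, Ring.inverse_eq_inv']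
  have uJ := isUnit_gramSubL_center (e := e) hJ' p x
  have uH := isUnit_gramSubL_center (e := e) hH p x
  have sJ : ContDiffAt ℝ ∞ (fun q => (e.gramSubL (fun _ => J) x q).det⁻¹) q :=
    (gramSubL_smoothAt (e := e) hJ' p x).det.inv uJ.ne_zero
  have sH := gramSubL_smoothAt (e := e) hH p x
  have e2 : cd (dp v) (fun q => (e.gramSubL (fun _ => J) x q).det⁻¹) q = 0 := by
    have h1 := sJ.comp (f := fun z : Fin d → ℂ => (p, z))
      (chartAt (Fin d → ℂ) x x) (contDiffAt_const.prodMk contDiffAt_id)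
    exact cd_dp_snd _ q (h1.differentiableAt (by simp)) v
  have e3 : cd (dp v) (fun q => Complex.exp (f q)) q = Complex.exp (f q) * cd (dp v) f q := by
    rw [cd_dp, cd_dp, hfd.hasFDerivAt.cexp.fderiv]
    rfl
  have e4 := cd_congr (ξ := dp v) e1
  rw [e3, cd_mul _ sJ.dAt sH.det.dAt, e2, cd_det_of_isUnit sH uH, zero_mul, zero_add,
    ← mul_assoc] at e4
  have e5 := mul_left_cancel₀ (Complex.exp_ne_zero (f q))
    (e4.trans (congrArg (fun c => c * _) e1.self_of_nhds.symm))
  rw [hf.dpar_eq v p x Filter.EventuallyEq.rfl, e5]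
  have e6 := trace_chern_gramSub (dp v) hi (hH.smooth x p x (mem_dom x)) h0 (by rw [cj_dp]; exact h0)
    (hH.isUnit p (mem_dom x))
  refine e6.trans ?_
  rw [atC, (projL_eventuallyEq H (mem_dom x) p).self_of_nhds]
  rfl

end HiggsExt

end Extension

/-! ### First variation and additivity of `M_α`. -/

section Functional

variable {P : Type*} [NormedAddCommGroup P] [NormedSpace ℝ P]
variable {d n₁ n n₂ : ℕ} {X : Type*} [TopologicalSpace X] [ChartedSpace (Fin d → ℂ) X]
  [IsManifold 𝓘(ℂ, Fin d → ℂ) ω X] {E₁ E E₂ : X → Type*}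
  [∀ x, AddCommGroup (E₁ x)] [∀ x, Module ℂ (E₁ x)]
  [TopologicalSpace (TotalSpace (Fin n₁ → ℂ) E₁)] [∀ x, TopologicalSpace (E₁ x)]
  [FiberBundle (Fin n₁ → ℂ) E₁] [VectorBundle ℂ (Fin n₁ → ℂ) E₁]
  [ContMDiffVectorBundle ω (Fin n₁ → ℂ) E₁ 𝓘(ℂ, Fin d → ℂ)]
  [∀ x, AddCommGroup (E x)] [∀ x, Module ℂ (E x)]
  [TopologicalSpace (TotalSpace (Fin n → ℂ) E)] [∀ x, TopologicalSpace (E x)]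
  [FiberBundle (Fin n → ℂ) E] [VectorBundle ℂ (Fin n → ℂ) E]
  [ContMDiffVectorBundle ω (Fin n → ℂ) E 𝓘(ℂ, Fin d → ℂ)]
  [∀ x, AddCommGroup (E₂ x)] [∀ x, Module ℂ (E₂ x)]
  [TopologicalSpace (TotalSpace (Fin n₂ → ℂ) E₂)] [∀ x, TopologicalSpace (E₂ x)]
  [FiberBundle (Fin n₂ → ℂ) E₂] [VectorBundle ℂ (Fin n₂ → ℂ) E₂]

namespace HiggsExt

variable (e : HiggsExt d n₁ n n₂ E₁ E E₂)

/-- The matrices of `i Λ F - α π` for a family of metrics, `π` being the projection to `E₁`. -/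
def momentL (g : FormField (Tang d X)) (α : ℝ) (H : P → FormField E) (x : X)
    (q : P × (Fin d → ℂ)) : Matrix (Fin n) (Fin n) ℂ :=
  higgsL g e.Θ H x q - (α : ℂ) • e.projL H x q

/-- The one-form `Tr (H⁻¹ ∂_v H (i Λ F - α π))` on the space of metrics. -/
def momentForm (g : FormField (Tang d X)) (α : ℝ) (H : P → FormField E) (v p : P) (x : X) : ℂ :=
  (atC (fun x q => chern (gramL n H x) (dp v) q * e.momentL g α H x q) p x).trace

variable {e} {g : FormField (Tang d X)} {α : ℝ}

lemma momentL_isEndFamily (hg : IsHermitianMetric d d g) {H : P → FormField E}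
    (hH : IsMetricFamily d n H) : IsEndFamily (e.momentL g α H) E :=
  (higgsL_isEndFamily hg e.Θ hH).sub ((projL_isEndFamily hH).smul α)

lemma momentForm_smoothFam (hg : IsHermitianMetric d d g) {H : P → FormField E}
    (hH : IsMetricFamily d n H) (v : P) : SmoothFam (d := d) (e.momentForm g α H v) :=
  ((chern_dp_isEndFamily hH v).mul (momentL_isEndFamily hg hH)).smoothFam_trace

lemma momentForm_eq (H : P → FormField E) (v p : P) (x : X) : e.momentForm g α H v p x =
    varForm n g e.Θ H v p x - α * (atC (e.projL H) p x *
      atC (fun x => chern (gramL (d := d) n H x) (dp v)) p x).trace := by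
  rw [momentForm, varForm, Matrix.trace_mul_comm (atC (e.projL H) p x)]
  simp only [atC, momentL, Matrix.mul_sub, Matrix.trace_sub, Matrix.mul_smul, Matrix.trace_smul,
    smul_eq_mul]

variable [MeasurableSpace X] [BorelSpace X] [CompactSpace X] [T2Space X]

/-- The first variation of the functional `M_α`. -/
theorem hasDerivAt_M (hg : IsKaehler g) {γ : ℝ → FormField E} (hγ : IsMetricFamily d n γ)
    {J : FormField E} (hJ : IsHermitianMetric d n J) (τ : ℝ) :
    HasDerivAt (fun τ => e.M g α (γ τ) J)
      (2 * ∫ x, e.momentForm g α γ 1 τ x ∂(omegaPow g)) τ := by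
  have hgh := hg.hermitian
  have h1 := hasDerivAt_simpsonFunctional hg e.Θ hγ hJ τ
  have h2 := (R₁_smoothFam (e := e) hγ (hJ.isMetricFamily (P := ℝ))).hasDerivAt_integral hgh
    (ph := fun t => t) (e := 1) (fun t => hasDerivAt_id t) τ
  simp only [dpar_R₁ hγ hJ] at h2
  refine (h1.sub (h2.const_mul (2 * α : ℂ))).congr_deriv ?_
  simp only [momentForm_eq]
  have i1 := (varForm_smoothFam hgh e.Θ hγ 1).integrable hgh τ
  have i2 := ((projL_isEndFamily (e := e) hγ).mul (chern_dp_isEndFamily hγ 1)).smoothFam_trace.integrable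
    hgh τ
  refine Eq.trans ?_ (congrArg (fun c => 2 * c) (integral_sub i1 (i2.const_mul (α : ℂ))).symm)
  rw [integral_const_mul]
  simp only [atC]
  ring

lemma M_self {K : FormField E} (hK : IsHermitianMetric d n K) : e.M g α K K = 0 := by
  have h0 : ∀ x : X, (endOfCoord x (0 : Matrix (Fin n) (Fin n) ℂ) : Module.End ℂ (E x)) = 0 :=
    fun x => endCoord_injective x (by
      rw [endCoord_endOfCoord]; exact (map_zero (endCoordₗ (n := n) (E := E) x x)).symm)
  rw [M, simpsonFunctional]
  simp [h0, R₁_self K hK]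

/-- The derivative of `M_α` in its first argument does not involve the second one. Along a path from
`K` to `H` the difference of the functionals based at `J` and at `K` is therefore constant, and
`M_α(K, K) = 0` evaluates it. -/
theorem M_add (hg : IsKaehler g) {H K J : FormField E} (hH : IsHermitianMetric d n H)
    (hK : IsHermitianMetric d n K) (hJ : IsHermitianMetric d n J) :
    e.M g α H K + e.M g α K J = e.M g α H J := by
  have hγ : IsMetricFamily d n (fun τ : ℝ => segment K H (sigma τ)) :=
    hK.isMetricFamily.segment hH.isMetricFamily sigma_mem contDiff_sigma
  have hd : ∀ τ, HasDerivAt (fun τ => e.M g α (segment K H (sigma τ)) J -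
      e.M g α (segment K H (sigma τ)) K) 0 τ := fun τ =>
    ((hasDerivAt_M hg hγ hJ τ).sub (hasDerivAt_M hg hγ hK τ)).congr_deriv (sub_self _)
  have hc := is_const_of_deriv_eq_zero (fun τ => (hd τ).differentiableAt) (fun τ => (hd τ).deriv) 1 0
  simp only [sigma_one, sigma_zero, segment_one, segment_zero, M_self hK, sub_zero] at hc
  rw [← hc]
  ring

end HiggsExt

end Functional

/-! ### `m⁰_α` in terms of `i Λ F - α π`. -/

section Moment

variable {P : Type*} [NormedAddCommGroup P] [NormedSpace ℝ P]
variable {d n₁ n n₂ : ℕ} {X : Type*} [TopologicalSpace X] [ChartedSpace (Fin d → ℂ) X]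
  [IsManifold 𝓘(ℂ, Fin d → ℂ) ω X] {E₁ E E₂ : X → Type*}
  [∀ x, AddCommGroup (E₁ x)] [∀ x, Module ℂ (E₁ x)]
  [TopologicalSpace (TotalSpace (Fin n₁ → ℂ) E₁)] [∀ x, TopologicalSpace (E₁ x)]
  [FiberBundle (Fin n₁ → ℂ) E₁] [VectorBundle ℂ (Fin n₁ → ℂ) E₁]
  [ContMDiffVectorBundle ω (Fin n₁ → ℂ) E₁ 𝓘(ℂ, Fin d → ℂ)]
  [∀ x, AddCommGroup (E x)] [∀ x, Module ℂ (E x)]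
  [TopologicalSpace (TotalSpace (Fin n → ℂ) E)] [∀ x, TopologicalSpace (E x)]
  [FiberBundle (Fin n → ℂ) E] [VectorBundle ℂ (Fin n → ℂ) E]
  [ContMDiffVectorBundle ω (Fin n → ℂ) E 𝓘(ℂ, Fin d → ℂ)]
  [∀ x, AddCommGroup (E₂ x)] [∀ x, Module ℂ (E₂ x)]
  [TopologicalSpace (TotalSpace (Fin n₂ → ℂ) E₂)] [∀ x, TopologicalSpace (E₂ x)]
  [FiberBundle (Fin n₂ → ℂ) E₂] [VectorBundle ℂ (Fin n₂ → ℂ) E₂]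

/-- The trace-free part of an endomorphism of a space with trace form `Tr 1 = n`. -/
def traceFreeₗ (n : ℕ) (V : Type*) [AddCommGroup V] [Module ℂ V] :
    Module.End ℂ V →ₗ[ℂ] Module.End ℂ V :=
  LinearMap.id - ((1 / (n : ℂ)) • LinearMap.trace ℂ V).smulRight 1

lemma contraction_comp {W W' : Type*} [AddCommGroup W] [Module ℂ W] [AddCommGroup W'] [Module ℂ W']
    (g : FormField (Tang d X)) (x : X) (L : W →ₗ[ℂ] W') (η : (Fin d → ℂ) → (Fin d → ℂ) → W) :
    contraction g x (fun v w => L (η v w)) = L (contraction g x η) := by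
  simp only [contraction, mixedTrace, map_smul, map_sum, map_add, map_sub]

lemma contraction_higgsCurvaturePerp (g : FormField (Tang d X)) (Θ : HiggsField d n E)
    (H : FormField E) (x : X) : contraction g x (higgsCurvaturePerp Θ H x) =
      traceFreeₗ n (E x) (contraction g x (higgsCurvature Θ H x)) := by
  rw [← contraction_comp]
  rfl

namespace HiggsExt

variable {e : HiggsExt d n₁ n n₂ E₁ E E₂} {g : FormField (Tang d X)} {α : ℝ}

lemma rank_add (e : HiggsExt d n₁ n n₂ E₁ E E₂) (x : X) : n₁ + n₂ = n := by
  let l₁ := (trivializationAt (Fin n₁ → ℂ) E₁ x).linearEquivAt ℂ x (mem_frameSet x)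
  let l := (trivializationAt (Fin n → ℂ) E x).linearEquivAt ℂ x (mem_frameSet x)
  let l₂ := (trivializationAt (Fin n₂ → ℂ) E₂ x).linearEquivAt ℂ x (mem_frameSet x)
  have f : FiniteDimensional ℂ (E x) := l.symm.finiteDimensional
  have h := LinearMap.finrank_range_add_finrank_ker (e.q x)
  rw [LinearMap.range_eq_top.2 (e.surjective_q x), finrank_top, LinearMap.exact_iff.1 (e.exact x),
    LinearMap.finrank_range_of_inj (e.injective_i x), l₁.finrank_eq, l.finrank_eq, l₂.finrank_eq]
    at h
  simp only [Module.finrank_fintype_fun_eq_card, Fintype.card_fin] at h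
  omega

/-- The matrix of `m⁰_α` in terms of the matrix of `i Λ F - α π`. -/
lemma endCoord_m₀ {H : P → FormField E} (hH : IsMetricFamily d n H) (p : P) (x : X) :
    endCoord n x x (e.m₀ g α (H p) x) = (-I) • (atC (e.momentL g α H) p x +
      (-(1 / (n : ℂ)) * (atC (higgsL g e.Θ H) p x).trace + α * (n₁ / n : ℂ)) • 1) := by
  have hx := mem_frameSet (n := n) (E := E) x
  have hp : endCoord n x x (e.proj (H p) x) = atC (e.projL H) p x :=
    (projL_apply H (mem_dom x) p).symm
  rcases Nat.eq_zero_or_pos n with rfl | hn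
  · ext i; exact i.elim0
  have hn' : (n : ℂ) ≠ 0 := Nat.cast_ne_zero.2 hn.ne'
  -- Since the ranks add up, `T_H` is `π - n₁ / n`; this identifies the coefficient of the identity.
  have hr : (n₂ : ℂ) = n - n₁ := by rw [← e.rank_add x]; push_cast; ring
  have hF := endCoord_contraction_higgsCurvature (g := g) e.Θ hH p x
  have ht : LinearMap.trace ℂ (E x) (contraction g x (higgsCurvature e.Θ (H p) x)) =
      -I * (atC (higgsL g e.Θ H) p x).trace := by
    rw [trace_eq_trace_endCoord hx, hF, Matrix.trace_smul, smul_eq_mul]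
  rw [m₀, contraction_higgsCurvaturePerp, traceFreeₗ, T]
  simp only [LinearMap.sub_apply, LinearMap.id_apply, LinearMap.smulRight_apply,
    LinearMap.smul_apply, ht, endCoord_add, endCoord_sub, endCoord_smul, endCoord_one hx, hp, hF, hr]
  simp only [momentL, atC]
  ext i j
  simp only [Matrix.add_apply, Matrix.sub_apply, Matrix.smul_apply, smul_eq_mul]
  field_simp
  ring

end HiggsExt

end Moment

/-! ### Smoothness of the matrix exponential. -/

section MatrixExp

variable {n : ℕ}

section Norm

open scoped Matrix.Norms.Operator

lemma contDiff_exp_matrix : ContDiff ℝ ∞ (NormedSpace.exp : Matrix (Fin n) (Fin n) ℂ → _) := by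
  rw [← contDiffOn_univ]
  intro A _
  exact (((NormedSpace.exp_analytic (𝕂 := ℂ) A).contDiffAt (n := ∞)).restrict_scalars
    ℝ).contDiffWithinAt

/-- Exported entry by entry and over plain functions, so that the norm on matrices stays confined to
the section above. -/
lemma contDiff_exp_apply (i j : Fin n) :
    ContDiff ℝ ∞ (fun M : Fin n → Fin n → ℂ => NormedSpace.exp (Matrix.of M) i j) := by
  let L : Matrix (Fin n) (Fin n) ℂ →ₗ[ℝ] ℂ :=
    { toFun := fun M => M i j, map_add' := fun _ _ => rfl, map_smul' := fun _ _ => rfl }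
  let L' : (Fin n → Fin n → ℂ) →ₗ[ℝ] Matrix (Fin n) (Fin n) ℂ :=
    { toFun := fun M => Matrix.of M, map_add' := fun _ _ => rfl, map_smul' := fun _ _ => rfl }
  have h1 : ContDiff ℝ ∞ L := L.toContinuousLinearMap.contDiff
  have h2 : ContDiff ℝ ∞ L' := L'.toContinuousLinearMap.contDiff
  exact h1.comp (contDiff_exp_matrix.comp h2)

lemma hasDerivAt_exp_smul_apply (S : Matrix (Fin n) (Fin n) ℂ) (t : ℝ) (i j : Fin n) :
    HasDerivAt (fun t : ℝ => NormedSpace.exp ((t : ℂ) • S) i j)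
      ((NormedSpace.exp ((t : ℂ) • S) * S) i j) t := by
  let L : Matrix (Fin n) (Fin n) ℂ →ₗ[ℂ] ℂ :=
    { toFun := fun M => M i j, map_add' := fun _ _ => rfl, map_smul' := fun _ _ => rfl }
  have h := L.toContinuousLinearMap.hasFDerivAt.comp_hasDerivAt (t : ℂ)
    (hasDerivAt_exp_smul_const (𝕂 := ℂ) S (t : ℂ))
  exact h.comp_ofReal

end Norm

lemma SmoothAt.exp {W : Type*} [NormedAddCommGroup W] [NormedSpace ℝ W]
    {F : W → Matrix (Fin n) (Fin n) ℂ} {q : W} (hF : SmoothAt F q) :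
    SmoothAt (fun q => NormedSpace.exp (F q)) q := fun i j =>
  ContDiffAt.comp (g := fun M : Fin n → Fin n → ℂ => NormedSpace.exp (Matrix.of M) i j)
    (f := fun q i j => F q i j) q (contDiff_exp_apply i j).contDiffAt
    (contDiffAt_pi.2 fun i => contDiffAt_pi.2 fun j => hF i j)

end MatrixExp

/-! ### The metrics `H e^{ts}`. -/

section ExpForm

variable {d n : ℕ} {X : Type*} [TopologicalSpace X] [ChartedSpace (Fin d → ℂ) X]
  {E : X → Type*} [∀ x, AddCommGroup (E x)] [∀ x, Module ℂ (E x)]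
  [TopologicalSpace (TotalSpace (Fin n → ℂ) E)] [∀ x, TopologicalSpace (E x)]
  [FiberBundle (Fin n → ℂ) E] [VectorBundle ℂ (Fin n → ℂ) E]

lemma endCoord_endExp {x y : X} (hx : y ∈ frameSet n E x) (A : Module.End ℂ (E y)) :
    endCoord n x y (endExp n y A) = NormedSpace.exp (endCoord n x y A) := by
  have hy := mem_frameSet (n := n) (E := E) y
  have hu := frameChange_isUnit hy hx
  rw [endCoord_frameChange hy hx, endCoord_frameChange hy hx A, endExp, endCoord_endOfCoord,
    Matrix.exp_conj' _ _ ((Matrix.isUnit_iff_isUnit_det _).2 hu)]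

lemma form_end_mul {x y : X} (hx : y ∈ frameSet n E x) (H : FormField E) (A : Module.End ℂ (E y))
    (i j : Fin n) : H y (localFrame n E x y i) (A (localFrame n E x y j)) =
      (gram n H x y * endCoord n x y A) i j := by
  have h1 : localFrame n E x y i = (trivializationAt (Fin n → ℂ) E x).symmₗ ℂ y (Pi.single i 1) :=
    (Trivialization.symmₗ_apply _ hx _).symm
  have h2 : A (localFrame n E x y j) = (trivializationAt (Fin n → ℂ) E x).symmₗ ℂ y
      (endCoord n x y A *ᵥ Pi.single j 1) := by
    rw [endCoord, LinearMap.toMatrix'_mulVec, LinearMap.comp_apply,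
      Trivialization.symmₗ_linearMapAt _ hx, LinearMap.comp_apply, Trivialization.symmₗ_apply _ hx]
    rfl
  rw [h2, h1, form_symm hx, Matrix.mulVec_single_one, Matrix.mul_apply, ← Pi.single_star, star_one,
    single_one_dotProduct]
  rfl

lemma gram_expForm {x y : X} (hx : y ∈ frameSet n E x) (H : FormField E)
    (s : ∀ x, Module.End ℂ (E x)) : gram n (expForm n H s) x y =
      gram n H x y * NormedSpace.exp (endCoord n x y (s y)) := by
  ext i j
  rw [← endCoord_endExp hx, ← form_end_mul hx]
  rfl

lemma endCoord_selfAdjoint {H : FormField E} {x y : X} (hx : y ∈ frameSet n E x)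
    (hH : IsHermitianMetric d n H) {A : Module.End ℂ (E y)}
    (hA : ∀ v w, H y (A v) w = H y v (A w)) :
    (endCoord n x y A)ᴴ * gram n H x y = gram n H x y * endCoord n x y A := by
  ext i j
  rw [← form_end_mul hx, ← hA, ← hH.conj_symm, form_end_mul hx]
  conv_lhs => rw [← gram_isHermitian hH, ← Matrix.conjTranspose_mul]
  rfl

lemma selfAdjoint_of_endCoord {H : FormField E} {x y : X} (hx : y ∈ frameSet n E x)
    {A : Module.End ℂ (E y)}
    (hA : (endCoord n x y A)ᴴ * gram n H x y = gram n H x y * endCoord n x y A) (v w : E y) :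
    H y (A v) w = H y v (A w) := by
  have hs : ∀ v : E y, v = (trivializationAt (Fin n → ℂ) E x).symmₗ ℂ y
      ((trivializationAt (Fin n → ℂ) E x).linearMapAt ℂ y v) := fun v =>
    (Trivialization.symmₗ_linearMapAt _ hx v).symm
  have h2 : ∀ u, A ((trivializationAt (Fin n → ℂ) E x).symmₗ ℂ y u) =
      (trivializationAt (Fin n → ℂ) E x).symmₗ ℂ y (endCoord n x y A *ᵥ u) := fun u => by
    rw [endCoord, LinearMap.toMatrix'_mulVec, LinearMap.comp_apply,
      Trivialization.symmₗ_linearMapAt _ hx, LinearMap.comp_apply]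
  rw [hs v, hs w, h2, h2, form_symm hx, form_symm hx, Matrix.star_mulVec,
    ← Matrix.dotProduct_mulVec, Matrix.mulVec_mulVec, hA, Matrix.mulVec_mulVec]

lemma smul_selfAdjoint {H : FormField E} {x : X} {A : Module.End ℂ (E x)}
    (hA : ∀ v w, H x (A v) w = H x v (A w)) (c : ℝ) (v w : E x) :
    H x (((c : ℂ) • A) v) w = H x v (((c : ℂ) • A) w) := by
  rw [LinearMap.smul_apply, LinearMap.map_smulₛₗ, LinearMap.smul_apply, LinearMap.smul_apply,
    map_smul, hA, Complex.conj_ofReal]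

/-- Exponentiate `Sᴴ = h S h⁻¹`. -/
lemma exp_selfAdjoint {h S : Matrix (Fin n) (Fin n) ℂ} (hu : IsUnit h.det) (hS : Sᴴ * h = h * S) :
    (NormedSpace.exp S)ᴴ * h = h * NormedSpace.exp S := by
  have e1 : Sᴴ = h * S * h⁻¹ := by
    rw [← hS, Matrix.mul_nonsing_inv_cancel_right _ _ hu]
  rw [← Matrix.exp_conjTranspose, e1, Matrix.exp_conj _ _ ((Matrix.isUnit_iff_isUnit_det _).2 hu),
    Matrix.nonsing_inv_mul_cancel_right _ _ hu]

variable [IsManifold 𝓘(ℂ, Fin d → ℂ) ω X]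

/-- With `B = e^{s/2}`, self-adjoint and invertible, `H(v, e^s w) = H(B v, B w)`. Symmetry and
positivity are inherited from `H` through this pullback. -/
lemma IsHermitianMetric.expForm {H : FormField E} (hH : IsHermitianMetric d n H)
    {s : ∀ x, Module.End ℂ (E x)} (hs : IsSmoothEnd d n s)
    (hsa : ∀ x v w, H x (s x v) w = H x v (s x w)) : IsHermitianMetric d n (expForm n H s) := by
  have hhalf : ∀ x : X, ∃ B : Module.End ℂ (E x), (∀ v w, H x (B v) w = H x v (B w)) ∧
      endExp n x (s x) = B * B ∧ Function.Injective B := fun x => by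
    have hx := mem_frameSet (n := n) (E := E) x
    have hu := gram_isUnit hH hx
    set S := endCoord n x x (((1 / 2 : ℝ) : ℂ) • s x) with hSdef
    have hSa : Sᴴ * gram n H x x = gram n H x x * S := by
      exact endCoord_selfAdjoint hx hH (smul_selfAdjoint (hsa x) _)
    have hS2 : endCoord n x x (s x) = S + S := by
      rw [hSdef, ← endCoord_add, ← add_smul]; norm_num
    have hmul : endExp n x (s x) = endExp n x (((1 / 2 : ℝ) : ℂ) • s x) * endExp n x (((1 / 2 : ℝ) : ℂ) • s x) :=
      endCoord_injective x (by
        rw [endCoord_mul hx, endCoord_endExp hx, endCoord_endExp hx, ← hSdef, hS2,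
          Matrix.exp_add_of_commute _ _ (Commute.refl S)])
    refine ⟨endExp n x (((1 / 2 : ℝ) : ℂ) • s x), selfAdjoint_of_endCoord hx ?_, hmul, ?_⟩
    · rw [endCoord_endExp hx]
      exact exp_selfAdjoint hu hSa
    · have h1 : endExp n x (-(((1 / 2 : ℝ) : ℂ) • s x)) * endExp n x (((1 / 2 : ℝ) : ℂ) • s x) = 1 :=
        endCoord_injective x (by
          have e1 : endCoord n x x (-(((1 / 2 : ℝ) : ℂ) • s x)) = -S :=
            map_neg (endCoordₗ (n := n) (E := E) x x) _
          rw [endCoord_mul hx, endCoord_endExp hx, endCoord_endExp hx, ← hSdef, e1,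
            ← Matrix.exp_add_of_commute _ _ (Commute.refl S).neg_left, neg_add_cancel,
            NormedSpace.exp_zero, endCoord_one hx])
      exact Function.LeftInverse.injective (g := endExp n x (-(((1 / 2 : ℝ) : ℂ) • s x)))
        fun v => congrArg (fun f : Module.End ℂ (E x) => f v) h1
  have key : ∀ x, ∃ B : Module.End ℂ (E x), Function.Injective B ∧
      ∀ v w, HiggsExtension.expForm n H s x v w = H x (B v) (B w) := fun x => by
    obtain ⟨B, h1, h2, h3⟩ := hhalf x
    refine ⟨B, h3, fun v w => ?_⟩
    rw [HiggsExtension.expForm, LinearMap.compl₂_apply, h2, h1]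
    rfl
  constructor
  · intro x v w
    obtain ⟨B, -, hB⟩ := key x
    rw [hB, hB, hH.conj_symm]
  · intro x v hv
    obtain ⟨B, hi, hB⟩ := key x
    rw [hB]
    exact hH.pos x _ fun h => hv (hi (h.trans (map_zero B).symm))
  · intro x i j
    let G : (Fin n → ℂ) × (Fin n → Fin n → ℂ) → ℂ :=
      fun q => ∑ k, q.1 k * NormedSpace.exp (Matrix.of q.2) k j
    have hG : ContDiff ℝ ∞ G := ContDiff.sum fun k _ =>
      (contDiff_pi.1 contDiff_fst k).mul ((contDiff_exp_apply k j).comp contDiff_snd)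
    have h1 : ContMDiffOn 𝓘(ℝ, Fin d → ℂ) 𝓘(ℝ, (Fin n → ℂ) × (Fin n → Fin n → ℂ)) ∞
        (fun y => ((fun k => gram n H x y i k, fun k l => endCoord n x y (s y) k l) :
          (Fin n → ℂ) × (Fin n → Fin n → ℂ))) (trivializationAt (Fin n → ℂ) E x).baseSet := by
      refine ContMDiffOn.prodMk_space ?_ ?_
      · exact contMDiffOn_pi_space.2 fun k => hH.smooth x i k
      · exact contMDiffOn_pi_space.2 fun k => contMDiffOn_pi_space.2 fun l => hs x k l
    refine (hG.contMDiff.comp_contMDiffOn h1).congr fun y hy => ?_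
    rw [gram_expForm hy, Matrix.mul_apply]
    rfl

variable {H : FormField E} {s : ∀ x, Module.End ℂ (E x)}

lemma IsSmoothEnd.smul (hs : IsSmoothEnd d n s) (c : ℂ) : IsSmoothEnd d n (fun x => c • s x) := by
  intro x i j
  have hc : ContMDiff 𝓘(ℝ, ℂ) 𝓘(ℝ, ℂ) ∞ fun z : ℂ => c * z :=
    (contDiff_const.mul contDiff_id).contMDiff
  refine (hc.comp_contMDiffOn (hs x i j)).congr fun y hy => ?_
  rw [endCoord_smul]
  rfl

variable (n) in
/-- The family of metrics `H e^{ts}`. -/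
abbrev expFam (H : FormField E) (s : ∀ x, Module.End ℂ (E x)) (t : ℝ) : FormField E :=
  expForm n H (fun x => (t : ℂ) • s x)

lemma expFam_zero (H : FormField E) (s : ∀ x, Module.End ℂ (E x)) : expFam n H s 0 = H := by
  funext x
  have : endExp n x ((0 : ℂ) • s x) = 1 := endCoord_injective x (by
    have h0 : endCoord n x x ((0 : ℂ) • s x) = 0 := by
      rw [endCoord_smul, zero_smul]
    rw [endCoord_endExp (mem_frameSet x), h0, NormedSpace.exp_zero, endCoord_one (mem_frameSet x)])
  rw [expFam, expForm, Complex.ofReal_zero, this]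
  rfl

lemma expFam_one (H : FormField E) (s : ∀ x, Module.End ℂ (E x)) :
    expFam n H s 1 = expForm n H s := by
  simp only [expFam, Complex.ofReal_one, one_smul]

lemma endL_smoothAt (P : Type*) [NormedAddCommGroup P] [NormedSpace ℝ P] (hs : IsSmoothEnd d n s)
    {x y : X} (hy : y ∈ dom d n E x) (p : P) :
    SmoothAt (endL n P s x) (p, chartAt (Fin d → ℂ) x y) :=
  (endCoord_isEndFamily hs).smooth x p y hy

lemma gramL_expFam {x y : X} (hy : y ∈ dom d n E x) (t : ℝ) : ∀ᶠ q : ℝ × (Fin d → ℂ) in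
    nhds (t, chartAt (Fin d → ℂ) x y), gramL n (expFam n H s) x q =
      gramL n (fun _ : ℝ => H) x q * NormedSpace.exp ((q.1 : ℂ) • endL n ℝ s x q) := by
  filter_upwards [eventually_symm_mem hy.1 (isOpen_dom x) hy t] with q hq
  rw [gramL, gram_expForm hq.2.2, endCoord_smul]
  rfl

lemma expFam_isMetricFamily (hH : IsHermitianMetric d n H) (hs : IsSmoothEnd d n s)
    (hsa : ∀ x v w, H x (s x v) w = H x v (s x w)) : IsMetricFamily d n (expFam n H s) where
  herm t := hH.expForm (hs.smul t) fun x => smul_selfAdjoint (hsa x) _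
  smooth x t y hy := by
    have h1 : ContDiffAt ℝ ∞ (fun q : ℝ × (Fin d → ℂ) => (q.1 : ℂ)) (t, chartAt (Fin d → ℂ) x y) :=
      Complex.ofRealCLM.contDiff.contDiffAt.comp _ contDiffAt_fst
    exact (((hH.isMetricFamily (P := ℝ)).smooth x t y hy).mul
      (SmoothAt.smul h1 (endL_smoothAt ℝ hs hy t)).exp).congr (gramL_expFam hy t)

/-- The derivative of `H e^{ts}` is `H e^{ts} s`, so the logarithmic derivative is `s` for all `t`.
Exponential paths thus make the variation `L` constant in time. -/
lemma chern_expFam (hH : IsHermitianMetric d n H) (hs : IsSmoothEnd d n s)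
    (hsa : ∀ x v w, H x (s x v) w = H x v (s x w)) {x y : X} (hy : y ∈ dom d n E x) (t : ℝ) :
    chern (gramL n (expFam n H s) x) (dp 1) (t, chartAt (Fin d → ℂ) x y) =
      endL n ℝ s x (t, chartAt (Fin d → ℂ) x y) := by
  have hF := expFam_isMetricFamily hH hs hsa
  set S := endL n ℝ s x (t, chartAt (Fin d → ℂ) x y) with hS
  set h := gramL n (fun _ : ℝ => H) x (t, chartAt (Fin d → ℂ) x y) with hh
  have h0 := (gramL_expFam (H := H) (s := s) hy t).self_of_nhds
  have h1 : cdM (dp 1) (gramL n (expFam n H s) x) (t, chartAt (Fin d → ℂ) x y) =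
      gramL n (expFam n H s) x (t, chartAt (Fin d → ℂ) x y) * S := by
    ext i j
    rw [cdM_apply, cd_dp]
    have h2 := fderiv_param_slice (hF.smooth x t y hy i j).dAt
    have h3 := h2.hasDerivAt
    have h4 : HasDerivAt (fun t : ℝ => gramL n (expFam n H s) x (t, chartAt (Fin d → ℂ) x y) i j)
        ((h * NormedSpace.exp ((t : ℂ) • S) * S) i j) t := by
      have e1 : ∀ t : ℝ, gramL n (expFam n H s) x (t, chartAt (Fin d → ℂ) x y) i j =
          ∑ k, h i k * NormedSpace.exp ((t : ℂ) • S) k j := fun t => by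
        rw [(gramL_expFam (H := H) (s := s) hy t).self_of_nhds, Matrix.mul_apply]
        rfl
      simp only [e1]
      rw [Matrix.mul_assoc, Matrix.mul_apply]
      exact HasDerivAt.fun_sum fun k _ => (hasDerivAt_exp_smul_apply S t k j).const_mul _
    rw [h0]
    exact h3.unique h4
  rw [chern, h1, Matrix.nonsing_inv_mul_cancel_left _ _ (hF.isUnit t hy)]

end ExpForm

/-! ### Positivity and Cauchy-Schwarz for the trace form. -/

section CauchySchwarz

open scoped ComplexOrder

variable {m : Type*} [Fintype m] [DecidableEq m] {ι : Type*} [Fintype ι]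

lemma exists_eq_mul_conjTranspose {m : Type*} [Fintype m] {h : Matrix m m ℂ} (hh : h.PosSemidef) :
    ∃ (k : ℕ) (V : Matrix m (Fin k) ℂ), h = V * Vᴴ := by
  obtain ⟨k, v, rfl⟩ := Matrix.posSemidef_iff_eq_sum_vecMulVec.1 hh
  refine ⟨k, Matrix.of fun a i => v i a, ?_⟩
  ext a b
  rw [Matrix.sum_apply, Matrix.mul_apply]
  rfl

variable {h : Matrix m m ℂ}

/-- Factor `h⁻¹ = V Vᴴ` and `h = W Wᴴ`; the trace is then the squared Hilbert-Schmidt norm of `Wᴴ U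
V`. -/
lemma trace_adj_mul_self_nonneg (hh : h.PosDef) (U : Matrix m m ℂ) : 0 ≤ (adj h U * U).trace ∧
    ((adj h U * U).trace = 0 → U = 0) := by
  have hu : IsUnit h.det := hh.det_pos.ne'.isUnit
  obtain ⟨k, V, hV⟩ := exists_eq_mul_conjTranspose hh.inv.posSemidef
  obtain ⟨l, W, hW⟩ := exists_eq_mul_conjTranspose hh.posSemidef
  have e : (adj h U * U).trace = ((Wᴴ * U * V)ᴴ * (Wᴴ * U * V)).trace := by
    have : adj h U * U = V * (Vᴴ * Uᴴ * (W * Wᴴ) * U) := by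
      rw [← hW, adj, hV]
      simp only [Matrix.mul_assoc]
    rw [this, Matrix.trace_mul_comm]
    simp only [Matrix.conjTranspose_mul, Matrix.conjTranspose_conjTranspose, Matrix.mul_assoc]
  rw [e]
  refine ⟨(Matrix.posSemidef_conjTranspose_mul_self _).trace_nonneg, fun h0 => ?_⟩
  have h1 := Matrix.trace_conjTranspose_mul_self_eq_zero_iff.1 h0
  have h2 : h * U * h⁻¹ = 0 := by
    calc h * U * h⁻¹ = W * (Wᴴ * U * V) * Vᴴ := by
          conv_lhs => rw [hV]
          nth_rw 1 [hW]
          simp only [Matrix.mul_assoc]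
      _ = 0 := by rw [h1, Matrix.mul_zero, Matrix.zero_mul]
  calc U = h⁻¹ * (h * U * h⁻¹) * h := by
        simp only [Matrix.mul_assoc, Matrix.nonsing_inv_mul_cancel_left _ _ hu,
          Matrix.nonsing_inv_mul _ hu, Matrix.mul_one]
    _ = 0 := by rw [h2, Matrix.mul_zero, Matrix.zero_mul]

/-- Factoring `γ = V Vᴴ` writes the contraction as a sum of squares, one for each column of `V`. -/
lemma sum_trace_adj_mul_nonneg (hh : h.PosDef) {γ : Matrix ι ι ℂ} (hγ : γ.PosSemidef)
    (R : ι → Matrix m m ℂ) : 0 ≤ ∑ j, ∑ k, γ j k * (adj h (R k) * R j).trace := by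
  obtain ⟨l, V, rfl⟩ := exists_eq_mul_conjTranspose hγ
  have e : ∑ j, ∑ k, (V * Vᴴ) j k * (adj h (R k) * R j).trace =
      ∑ a, (adj h (∑ k, V k a • R k) * ∑ j, V j a • R j).trace := by
    simp only [Matrix.mul_apply, Matrix.conjTranspose_apply, adj_sum, adj_smul, Finset.sum_mul,
      Matrix.mul_sum, Matrix.smul_mul, Matrix.mul_smul, Matrix.trace_sum,
      Matrix.trace_smul, smul_eq_mul]
    rw [Finset.sum_comm]
    conv_rhs => rw [Finset.sum_comm]
    refine Finset.sum_congr rfl fun k _ => ?_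
    rw [Finset.sum_comm]
    refine Finset.sum_congr rfl fun a _ => Finset.sum_congr rfl fun j _ => ?_
    rw [← starRingEnd_apply]
    ring
  rw [e]
  exact Finset.sum_nonneg fun a _ => (trace_adj_mul_self_nonneg hh _).1

/-- The Cauchy-Schwarz inequality for `End E`-valued one-forms. -/
lemma sum_trace_mul_le (hh : h.PosDef) {γ : Matrix ι ι ℂ} (hγ : γ.PosSemidef)
    {S : Matrix m m ℂ} (hS : adj h S = S) (R : ι → Matrix m m ℂ) :
    ∑ j, ∑ k, γ j k * ((S * adj h (R k)).trace * (S * R j).trace) ≤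
      (S * S).trace * ∑ j, ∑ k, γ j k * (adj h (R k) * R j).trace := by
  have hu : IsUnit h.det := hh.det_pos.ne'.isUnit
  have hf := trace_adj_mul_self_nonneg hh S
  rw [hS] at hf
  rcases hf.1.eq_or_lt with h0 | hpos
  · rw [← h0, hf.2 h0.symm]
    simp
  set c := (S * S).trace with hc
  have hcr : conj c = c := trace_mul_real hu hS hS
  -- Positivity is applied to `c` times the part of each `R j` orthogonal to `S`, where `c = Tr (S
  -- S)`; clearing denominators keeps everything polynomial.
  have h1 := sum_trace_adj_mul_nonneg hh hγ fun j => c • R j - (S * R j).trace • S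
  have h2 : ∀ j k, (adj h (c • R k - (S * R k).trace • S) * (c • R j - (S * R j).trace • S)).trace =
      c * (c * (adj h (R k) * R j).trace - (S * adj h (R k)).trace * (S * R j).trace) := fun j k => by
    have e1 : conj (S * R k).trace = (S * adj h (R k)).trace := by
      rw [← trace_adj hu, adj_mul hu, hS, Matrix.trace_mul_comm]
    rw [adj_sub, adj_smul, adj_smul, hS, hcr, e1]
    simp only [Matrix.sub_mul, Matrix.mul_sub, Matrix.smul_mul, Matrix.mul_smul, Matrix.trace_sub,
      Matrix.trace_smul, smul_eq_mul, ← hc, Matrix.trace_mul_comm (adj h (R k)) S]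
    ring
  have h3 : ∑ j, ∑ k, γ j k * (adj h (c • R k - (S * R k).trace • S) *
      (c • R j - (S * R j).trace • S)).trace =
      c * (c * ∑ j, ∑ k, γ j k * (adj h (R k) * R j).trace -
        ∑ j, ∑ k, γ j k * ((S * adj h (R k)).trace * (S * R j).trace)) := by
    simp only [h2, Finset.mul_sum, ← Finset.sum_sub_distrib]
    refine Finset.sum_congr rfl fun j _ => Finset.sum_congr rfl fun k _ => ?_
    ring
  rw [h3] at h1
  obtain ⟨hc1, hc2⟩ := Complex.lt_def.1 hpos
  obtain ⟨hd1, hd2⟩ := Complex.le_def.1 h1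
  rw [Complex.mul_re, ← hc2, Complex.zero_im, zero_mul, sub_zero, Complex.zero_re] at hd1
  rw [Complex.mul_im, ← hc2, Complex.zero_im, zero_mul, add_zero] at hd2
  exact sub_nonneg.1 (Complex.le_def.2 ⟨nonneg_of_mul_nonneg_right hd1 hc1,
    ((mul_eq_zero.1 hd2.symm).resolve_left hc1.ne').symm⟩)

/-- The preceding inequality with a single index and `γ = 1`. -/
lemma norm_trace_mul_sq_le (hh : h.PosDef) {S : Matrix m m ℂ} (hS : adj h S = S)
    (M : Matrix m m ℂ) : ‖(S * M).trace‖ ^ 2 ≤ (S * S).trace.re * (adj h M * M).trace.re := by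
  have hu : IsUnit h.det := hh.det_pos.ne'.isUnit
  have h1 := sum_trace_mul_le (ι := Unit) hh Matrix.PosSemidef.one hS fun _ => M
  simp only [Finset.univ_unique, Finset.sum_singleton, Matrix.one_apply_eq, one_mul] at h1
  have e1 : (S * adj h M).trace = conj (S * M).trace := by
    rw [← trace_adj hu, adj_mul hu, hS, Matrix.trace_mul_comm]
  have h2 := (Complex.le_def.1 h1).1
  have h3 : (S * S).trace.im = 0 := Complex.conj_eq_iff_im.1 (trace_mul_real hu hS hS)
  rw [e1, Complex.conj_mul', Complex.mul_re, h3, zero_mul, sub_zero] at h2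
  exact_mod_cast h2

end CauchySchwarz

/-! ### Norms of endomorphisms in matrices, and local congruence lemmas. -/

section Endomorphisms

variable {d n : ℕ} {X : Type*} [TopologicalSpace X] [ChartedSpace (Fin d → ℂ) X]
  [IsManifold 𝓘(ℂ, Fin d → ℂ) ω X]
  {E : X → Type*} [∀ x, AddCommGroup (E x)] [∀ x, Module ℂ (E x)]
  [TopologicalSpace (TotalSpace (Fin n → ℂ) E)] [∀ x, TopologicalSpace (E x)]
  [FiberBundle (Fin n → ℂ) E] [VectorBundle ℂ (Fin n → ℂ) E]
  [ContMDiffVectorBundle ω (Fin n → ℂ) E 𝓘(ℂ, Fin d → ℂ)]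

lemma endNorm_eq {H : FormField E} (x : X) (A : Module.End ℂ (E x)) : endNorm n H x A =
    √(adj (gram n H x x) (endCoord n x x A) * endCoord n x x A).trace.re := by
  rw [endNorm, endInner_eq]

lemma endNorm_sq {H : FormField E} (hH : IsHermitianMetric d n H) (x : X) (A : Module.End ℂ (E x)) :
    ((endNorm n H x A ^ 2 : ℝ) : ℂ) =
      (adj (gram n H x x) (endCoord n x x A) * endCoord n x x A).trace := by
  have h := Complex.le_def.1 (trace_adj_mul_self_nonneg (gram_posDef hH (mem_frameSet x))
    (endCoord n x x A)).1
  rw [endNorm_eq, Real.sq_sqrt h.1]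
  exact Complex.ext rfl h.2

end Endomorphisms

section Congruence

variable {W : Type*} [NormedAddCommGroup W] [NormedSpace ℝ W]
variable {m : Type*} [Fintype m] [DecidableEq m] {ι : Type*} [Fintype ι]

lemma nab_congr {h L L' : W → Matrix m m ℂ} {q : W} (hL : L =ᶠ[nhds q] L') (ξ : W × W) :
    nab h L ξ =ᶠ[nhds q] nab h L' ξ := by
  filter_upwards [hL.eventually_nhds] with r hr
  rw [nab, nab, cdM_congr hr, hr.self_of_nhds]

lemma divT_congr {h A L L' : W → Matrix m m ℂ} {γ : W → Matrix ι ι ℂ} {ξ : ι → W × W} {q : W}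
    (hL : L =ᶠ[nhds q] L') : divT h A L γ ξ q = divT h A L' γ ξ q := by
  refine Finset.sum_congr rfl fun j _ => Finset.sum_congr rfl fun k _ => congrArg _ (cd_congr ?_)
  filter_upwards [nab_congr hL (ξ j)] with r hr
  rw [hr]

lemma formQ_congr {h A L L' : W → Matrix m m ℂ} {θ : ι → W → Matrix m m ℂ} {γ : W → Matrix ι ι ℂ}
    {ξ : ι → W × W} {q : W} (hL : L =ᶠ[nhds q] L') :
    formQ h A L θ γ ξ q = formQ h A L' θ γ ξ q := by
  simp only [formQ, hL.self_of_nhds, (nab_congr hL _).self_of_nhds]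

end Congruence

lemma hasDerivAt_param_slice {d : ℕ} {F : ℝ × (Fin d → ℂ) → ℂ} {t : ℝ} {z : Fin d → ℂ}
    (hF : DifferentiableAt ℝ F (t, z)) :
    HasDerivAt (fun t => F (t, z)) (cd (dp 1) F (t, z)) t := by
  have h := (fderiv_param_slice hF).hasDerivAt
  rw [cd_dp]
  exact h

/-! ### Pointwise first and second variations along `H e^{ts}`. -/

section Exponential

variable {d n₁ n n₂ : ℕ} {X : Type*} [TopologicalSpace X] [ChartedSpace (Fin d → ℂ) X]
  [IsManifold 𝓘(ℂ, Fin d → ℂ) ω X] {E₁ E E₂ : X → Type*}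
  [∀ x, AddCommGroup (E₁ x)] [∀ x, Module ℂ (E₁ x)]
  [TopologicalSpace (TotalSpace (Fin n₁ → ℂ) E₁)] [∀ x, TopologicalSpace (E₁ x)]
  [FiberBundle (Fin n₁ → ℂ) E₁] [VectorBundle ℂ (Fin n₁ → ℂ) E₁]
  [ContMDiffVectorBundle ω (Fin n₁ → ℂ) E₁ 𝓘(ℂ, Fin d → ℂ)]
  [∀ x, AddCommGroup (E x)] [∀ x, Module ℂ (E x)]
  [TopologicalSpace (TotalSpace (Fin n → ℂ) E)] [∀ x, TopologicalSpace (E x)]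
  [FiberBundle (Fin n → ℂ) E] [VectorBundle ℂ (Fin n → ℂ) E]
  [ContMDiffVectorBundle ω (Fin n → ℂ) E 𝓘(ℂ, Fin d → ℂ)]
  [∀ x, AddCommGroup (E₂ x)] [∀ x, Module ℂ (E₂ x)]
  [TopologicalSpace (TotalSpace (Fin n₂ → ℂ) E₂)] [∀ x, TopologicalSpace (E₂ x)]
  [FiberBundle (Fin n₂ → ℂ) E₂] [VectorBundle ℂ (Fin n₂ → ℂ) E₂]

variable {H : FormField E} {s : ∀ x, Module.End ℂ (E x)} {g : FormField (Tang d X)} {α : ℝ}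

namespace IsTraceFreeSelfAdjoint

lemma metricFamily (hs : IsTraceFreeSelfAdjoint d n H s) (hH : IsHermitianMetric d n H) :
    IsMetricFamily d n (expFam n H s) := expFam_isMetricFamily hH hs.smooth hs.selfAdjoint

lemma chern_eventuallyEq (hs : IsTraceFreeSelfAdjoint d n H s) (hH : IsHermitianMetric d n H)
    {x y : X} (hy : y ∈ dom d n E x) (t : ℝ) : chern (gramL n (expFam n H s) x) (dp 1)
      =ᶠ[nhds (t, chartAt (Fin d → ℂ) x y)] endL n ℝ s x := by
  filter_upwards [eventually_symm_mem hy.1 (isOpen_dom x) hy t] with q hq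
  have := chern_expFam hH hs.smooth hs.selfAdjoint hq.2 q.1
  rwa [(chartAt (Fin d → ℂ) x).right_inv hq.1] at this

/-- Self-adjointness of `s` persists for every metric `H e^{ts}`, because `s` is the logarithmic
derivative of that family of metrics. -/
lemma adj_endL (hs : IsTraceFreeSelfAdjoint d n H s) (hH : IsHermitianMetric d n H)
    {x y : X} (hy : y ∈ dom d n E x) (t : ℝ) :
    adj (gramL n (expFam n H s) x (t, chartAt (Fin d → ℂ) x y))
      (endL n ℝ s x (t, chartAt (Fin d → ℂ) x y)) = endL n ℝ s x (t, chartAt (Fin d → ℂ) x y) := by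
  have := chern_dp_selfAdjoint (hs.metricFamily hH) 1 t hy
  rwa [(hs.chern_eventuallyEq hH hy t).self_of_nhds] at this

lemma eventually_selfAdjoint (hs : IsTraceFreeSelfAdjoint d n H s) (hH : IsHermitianMetric d n H)
    {x y : X} (hy : y ∈ dom d n E x) (t : ℝ) : ∀ᶠ q in nhds (t, chartAt (Fin d → ℂ) x y),
      (endL n ℝ s x q)ᴴ * gramL n (expFam n H s) x q = gramL n (expFam n H s) x q * endL n ℝ s x q := by
  filter_upwards [eventually_symm_mem hy.1 (isOpen_dom x) hy t] with q hq
  have h1 := hs.adj_endL hH hq.2 q.1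
  have h2 := (hs.metricFamily hH).isUnit q.1 hq.2
  rw [(chartAt (Fin d → ℂ) x).right_inv hq.1] at h1 h2
  exact (adj_eq_self_iff h2 _).1 h1

lemma endL_isEndFamily (hs : IsTraceFreeSelfAdjoint d n H s) : IsEndFamily (endL (d := d) n ℝ s) E :=
  endCoord_isEndFamily hs.smooth

lemma cdM_dp_endL (hs : IsTraceFreeSelfAdjoint d n H s) {x y : X} (hy : y ∈ dom d n E x) (t : ℝ) :
    cdM (dp 1) (endL n ℝ s x) (t, chartAt (Fin d → ℂ) x y) = 0 := by
  ext i k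
  have h := (endL_smoothAt ℝ hs.smooth hy t i k).comp (f := fun z : Fin d → ℂ => (t, z))
    (chartAt (Fin d → ℂ) x y) (contDiffAt_const.prodMk contDiffAt_id)
  exact cd_dp_snd _ (t, chartAt (Fin d → ℂ) x y) (h.differentiableAt (by simp)) 1

lemma trace_endL (hs : IsTraceFreeSelfAdjoint d n H s) (x : X) (t : ℝ) :
    (atC (endL (d := d) n ℝ s) t x).trace = 0 := by
  rw [atC, endL_center ℝ s t (mem_chart_source _ x),
    ← trace_eq_trace_endCoord (mem_frameSet x), hs.trace_eq_zero]

variable (n) in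
/-- The squared norm of `∇'' s` with respect to `H e^{ts}`. -/
def _root_.HiggsExtension.nablaSq (g : FormField (Tang d X)) (Θ : HiggsField d n E) (H : FormField E)
    (s : ∀ x, Module.End ℂ (E x)) (t : ℝ) (x : X) : ℝ :=
  (formQ (gramL n (expFam n H s) x) (endL n ℝ s x) (endL n ℝ s x) (thetaL n ℝ Θ x) (gammaL ℝ g x)
    (dhb ℝ d) (t, chartAt (Fin d → ℂ) x x)).re

lemma formQ_eq (hs : IsTraceFreeSelfAdjoint d n H s) (hg : IsHermitianMetric d d g)
    (hH : IsHermitianMetric d n H) (Θ : HiggsField d n E) (t : ℝ) (x : X) :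
    formQ (gramL n (expFam n H s) x) (endL n ℝ s x) (endL n ℝ s x) (thetaL n ℝ Θ x) (gammaL ℝ g x)
      (dhb ℝ d) (t, chartAt (Fin d → ℂ) x x) = (nablaSq n g Θ H s t x : ℂ) := by
  have hF := hs.metricFamily hH
  have hx := mem_dom (d := d) (n := n) (E := E) x
  have h1 := hs.eventually_selfAdjoint hH hx t
  have h2 := endL_smoothAt ℝ hs.smooth hx t
  exact (Complex.conj_eq_iff_re.1 (conj_formQ (hF.smooth x t x hx) (hF.isUnit t hx)
    (Filter.Eventually.of_forall fun q => hF.hermitian x q) (gammaL_hermitian hg x _) h2 h1 h2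
    h1)).symm

variable (e : HiggsExt d n₁ n n₂ E₁ E E₂)

lemma momentForm_eventuallyEq (hs : IsTraceFreeSelfAdjoint d n H s)
    (hg : IsHermitianMetric d d g) (hH : IsHermitianMetric d n H) (t : ℝ) (x : X) :
    (fun q : ℝ × (Fin d → ℂ) => e.momentForm g α (expFam n H s) 1 q.1
      ((chartAt (Fin d → ℂ) x).symm q.2)) =ᶠ[nhds (t, chartAt (Fin d → ℂ) x x)]
      fun q => (endL n ℝ s x q * e.momentL g α (expFam n H s) x q).trace := by
  have hF := hs.metricFamily hH
  filter_upwards [((chern_dp_isEndFamily hF 1).mul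
    (HiggsExt.momentL_isEndFamily (e := e) (α := α) hg hF)).trace_eventuallyEq t x,
    hs.chern_eventuallyEq hH (mem_dom x) t] with q h1 h2
  rw [← h2]
  exact h1

lemma momentForm_center (hs : IsTraceFreeSelfAdjoint d n H s)
    (hg : IsHermitianMetric d d g) (hH : IsHermitianMetric d n H) (t : ℝ) (x : X) :
    e.momentForm g α (expFam n H s) 1 t x =
      (atC (endL (d := d) n ℝ s) t x * atC (e.momentL g α (expFam n H s)) t x).trace := by
  have := (hs.momentForm_eventuallyEq e (α := α) hg hH t x).self_of_nhds
  simp only [(chartAt (Fin d → ℂ) x).left_inv (mem_chart_source (Fin d → ℂ) x)] at this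
  exact this

/-- The derivative of `Tr (s (i Λ F - α π))` along `H e^{ts}`. -/
lemma dpar_momentForm (hs : IsTraceFreeSelfAdjoint d n H s)
    (hg : IsHermitianMetric d d g) (hH : IsHermitianMetric d n H) (t : ℝ) (x : X) :
    dpar 1 (e.momentForm g α (expFam n H s) 1) t x =
      (endL n ℝ s x (t, chartAt (Fin d → ℂ) x x) *
        cdM (dp 1) (e.momentL g α (expFam n H s) x) (t, chartAt (Fin d → ℂ) x x)).trace := by
  have hF := hs.metricFamily hH
  have hx := mem_dom (d := d) (n := n) (E := E) x
  have h2 := endL_smoothAt ℝ hs.smooth hx t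
  have h3 := (HiggsExt.momentL_isEndFamily (e := e) (α := α) hg hF).smooth x t x hx
  rw [(HiggsExt.momentForm_smoothFam hg hF 1).dpar_eq 1 t x
    (hs.momentForm_eventuallyEq e hg hH t x), cd_trace _ (h2.mul h3), cdM_mul _ h2 h3,
    hs.cdM_dp_endL hx, Matrix.zero_mul, zero_add]

/-- The off-diagonal part of `s`, in matrices. -/
lemma trace_offDiagonal (hs : IsTraceFreeSelfAdjoint d n H s) (hH : IsHermitianMetric d n H)
    (t : ℝ) (x : X) :
    (atC (endL (d := d) n ℝ s) t x * (atC (e.projL (expFam n H s)) t x * atC (endL (d := d) n ℝ s) t x *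
      (1 - atC (e.projL (expFam n H s)) t x))).trace =
    ((endNorm n (expFam n H s t) x (e.offDiagonal (expFam n H s t) s x) ^ 2 : ℝ) : ℂ) := by
  have hF := hs.metricFamily hH
  have hx := mem_dom (d := d) (n := n) (E := E) x
  have hfx := mem_frameSet (n := n) (E := E) x
  have h1 := HiggsExt.projL_mul_self (e := e) hF hx t
  have h2 := HiggsExt.projL_selfAdjoint (e := e) hF hx t
  have h3 := hs.adj_endL hH hx t
  have hu := hF.isUnit t hx
  rw [endNorm_sq (hF.herm t), HiggsExt.offDiagonal, endCoord_mul hfx, endCoord_mul hfx, endCoord_sub,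
    endCoord_one hfx, ← HiggsExt.projL_apply (d := d) (expFam n H s) hx t,
    ← endL_center ℝ s t hx.1, ← gram_center hx.1]
  change _ = (adj (gramL n (expFam n H s) x (t, chartAt (Fin d → ℂ) x x)) _ * _).trace
  simp only [atC]
  set S := endL n ℝ s x (t, chartAt (Fin d → ℂ) x x)
  set p := e.projL (expFam n H s) x (t, chartAt (Fin d → ℂ) x x)
  set h := gramL n (expFam n H s) x (t, chartAt (Fin d → ℂ) x x)
  have h4 : adj h (1 - p) = 1 - p := by
    rw [adj_sub, h2, adj, Matrix.conjTranspose_one, Matrix.mul_one, Matrix.nonsing_inv_mul _ hu]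
  have h5 : (1 - p) * (1 - p) = 1 - p := by
    rw [Matrix.sub_mul, Matrix.one_mul, Matrix.mul_sub, Matrix.mul_one, h1, sub_self, sub_zero]
  rw [adj_mul hu, adj_mul hu, h2, h3, h4]
  -- Inserting `π = π²` and `1 - π = (1 - π)²` exhibits the trace as that of `u^* u`, with `u = π s
  -- (1 - π)`.
  calc (S * (p * S * (1 - p))).trace = (S * ((p * p) * S * ((1 - p) * (1 - p)))).trace := by
        rw [h1, h5]
    _ = ((S * p * p * S * (1 - p)) * (1 - p)).trace := by simp only [Matrix.mul_assoc]
    _ = _ := by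
        rw [Matrix.trace_mul_comm]
        simp only [Matrix.mul_assoc]

/-- The second variation, pointwise. -/
lemma dpar_momentForm_eq (hs : IsTraceFreeSelfAdjoint d n H s)
    (hg : IsHermitianMetric d d g) (hH : IsHermitianMetric d n H) (t : ℝ) (x : X) :
    dpar 1 (e.momentForm g α (expFam n H s) 1) t x =
      -2 * divNab g (expFam n H s) (endL n ℝ s) (endL n ℝ s) t x +
      ((nablaSq n g e.Θ H s t x - α * endNorm n (expFam n H s t) x
        (e.offDiagonal (expFam n H s t) s x) ^ 2 : ℝ) : ℂ) := by
  have hF := hs.metricFamily hH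
  have hx := mem_dom (d := d) (n := n) (E := E) x
  have hθ := fun j => thetaL_cdM_dp e.Θ hx j t 1
  -- The variation formula with `A = L = s`; its second argument is replaced by `s` afterwards, by
  -- congruence.
  have key := trace_mul_cdM_higgsP (A := endL n ℝ s x) (ξ := dhb ℝ d) (hF.smoothNear t hx)
    (hF.isUnit t hx) (fun j => thetaL_smoothAt e.Θ hx j t) (gammaL_smoothAt hg hx.1 t) (dp 1) hθ
    (by rw [cj_dp]; exact hθ) (gammaL_cdM_dp hg hx.1 t 1) (endL_smoothAt ℝ hs.smooth hx t)
  have hc := hs.chern_eventuallyEq hH hx t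
  rw [divT_congr hc, formQ_congr hc, hs.formQ_eq hg hH] at key
  rw [hs.dpar_momentForm e hg hH]
  have e1 : cdM (dp 1) (e.momentL g α (expFam n H s) x) (t, chartAt (Fin d → ℂ) x x) =
      cdM (dp 1) (higgsL g e.Θ (expFam n H s) x) (t, chartAt (Fin d → ℂ) x x) -
      (α : ℂ) • cdM (dp 1) (e.projL (expFam n H s) x) (t, chartAt (Fin d → ℂ) x x) := by
    have h1 := (higgsL_isEndFamily hg e.Θ hF).smooth x t x hx
    have h2 := (HiggsExt.projL_isEndFamily (e := e) hF).smooth x t x hx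
    have h3 := cdM_smul (f := fun _ => (α : ℂ)) (dp 1) contDiffAt_const h2
    rw [cd_const, zero_smul, zero_add] at h3
    exact (cdM_sub _ h1 (SmoothAt.smul contDiffAt_const h2)).trans (by rw [h3])
  -- The derivative of the projection is the off-diagonal block of `s`, which produces the term `-α
  -- |u|²`.
  rw [e1, HiggsExt.cdM_dp_projL hF hx, hc.self_of_nhds, Matrix.mul_sub, Matrix.trace_sub,
    Matrix.mul_smul, Matrix.trace_smul]
  have h5 := hs.trace_offDiagonal e hH t x
  simp only [atC] at h5
  rw [h5]
  refine (congrArg (fun c => c - _) key).trans ?_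
  rw [smul_eq_mul, Complex.ofReal_sub, Complex.ofReal_mul]
  simp only [divNab, atC, divT, divL]
  ring

/-- The multiple of the identity in `m⁰_α` pairs to zero with the trace-free `s`, and the factor
`-i` combines with `2i` to `2`. -/
lemma two_I_trace_m₀ (hs : IsTraceFreeSelfAdjoint d n H s)
    (hg : IsHermitianMetric d d g) (hH : IsHermitianMetric d n H) (t : ℝ) (x : X) :
    2 * I * LinearMap.trace ℂ (E x) (s x * e.m₀ g α (expFam n H s t) x) =
      2 * e.momentForm g α (expFam n H s) 1 t x := by
  have hF := hs.metricFamily hH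
  have hfx := mem_frameSet (n := n) (E := E) x
  have h1 : endCoord n x x (s x) = atC (endL (d := d) n ℝ s) t x :=
    (endL_center ℝ s t (mem_chart_source _ x)).symm
  rw [trace_eq_trace_endCoord hfx, endCoord_mul hfx, HiggsExt.endCoord_m₀ hF, h1,
    hs.momentForm_center e hg hH]
  simp only [Matrix.mul_smul, Matrix.mul_add, Matrix.trace_smul, Matrix.trace_add, Matrix.mul_one,
    hs.trace_endL, smul_eq_mul]
  linear_combination (-2 * (atC (endL (d := d) n ℝ s) t x *
    atC (e.momentL g α (expFam n H s)) t x).trace) * I_sq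

/-- The derivative of `m⁰_α(H e^{ts})`, up to a multiple of the identity. -/
lemma hasDerivAt_m₀ (hs : IsTraceFreeSelfAdjoint d n H s)
    (hg : IsHermitianMetric d d g) (hH : IsHermitianMetric d n H) (t : ℝ) (x : X) :
    ∃ c : ℂ, ∀ i j : Fin n,
      HasDerivAt (fun t : ℝ => endCoord n x x (e.m₀ g α (expFam n H s t) x) i j)
      (((-I) • (cdM (dp 1) (e.momentL g α (expFam n H s) x) (t, chartAt (Fin d → ℂ) x x) +
        c • (1 : Matrix (Fin n) (Fin n) ℂ))) i j) t := by
  have hF := hs.metricFamily hH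
  have hx := mem_dom (d := d) (n := n) (E := E) x
  have h1 := (HiggsExt.momentL_isEndFamily (e := e) (α := α) hg hF).smooth x t x hx
  have h2 := (higgsL_isEndFamily hg e.Θ hF).smooth x t x hx
  have h3 : ContDiffAt ℝ ∞ (fun q => (higgsL g e.Θ (expFam n H s) x q).trace)
      (t, chartAt (Fin d → ℂ) x x) := ContDiffAt.sum fun i _ => h2 i i
  refine ⟨-(1 / n) * cd (dp 1) (fun q => (higgsL g e.Θ (expFam n H s) x q).trace)
    (t, chartAt (Fin d → ℂ) x x), fun i j => ?_⟩
  have h4 := (hasDerivAt_param_slice (h1 i j).dAt).add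
    ((((hasDerivAt_param_slice h3.dAt).const_mul (-(1 / n : ℂ))).add_const
      ((α : ℂ) * ((n₁ : ℂ) / n))).mul_const ((1 : Matrix (Fin n) (Fin n) ℂ) i j))
  refine (h4.const_mul (-I)).congr_of_eventuallyEq (Filter.Eventually.of_forall fun τ => ?_)
  change endCoord n x x (e.m₀ g α (expFam n H s τ) x) i j = _
  rw [HiggsExt.endCoord_m₀ hF]
  rfl

end IsTraceFreeSelfAdjoint

end Exponential

/-! ### First and second variations after integration. -/

section Variations

variable {d n₁ n n₂ : ℕ} {X : Type*} [TopologicalSpace X] [T2Space X] [CompactSpace X]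
  [MeasurableSpace X] [BorelSpace X] [ChartedSpace (Fin d → ℂ) X]
  [IsManifold 𝓘(ℂ, Fin d → ℂ) ω X] {E₁ E E₂ : X → Type*}
  [∀ x, AddCommGroup (E₁ x)] [∀ x, Module ℂ (E₁ x)]
  [TopologicalSpace (TotalSpace (Fin n₁ → ℂ) E₁)] [∀ x, TopologicalSpace (E₁ x)]
  [FiberBundle (Fin n₁ → ℂ) E₁] [VectorBundle ℂ (Fin n₁ → ℂ) E₁]
  [ContMDiffVectorBundle ω (Fin n₁ → ℂ) E₁ 𝓘(ℂ, Fin d → ℂ)]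
  [∀ x, AddCommGroup (E x)] [∀ x, Module ℂ (E x)]
  [TopologicalSpace (TotalSpace (Fin n → ℂ) E)] [∀ x, TopologicalSpace (E x)]
  [FiberBundle (Fin n → ℂ) E] [VectorBundle ℂ (Fin n → ℂ) E]
  [ContMDiffVectorBundle ω (Fin n → ℂ) E 𝓘(ℂ, Fin d → ℂ)]
  [∀ x, AddCommGroup (E₂ x)] [∀ x, Module ℂ (E₂ x)]
  [TopologicalSpace (TotalSpace (Fin n₂ → ℂ) E₂)] [∀ x, TopologicalSpace (E₂ x)]
  [FiberBundle (Fin n₂ → ℂ) E₂] [VectorBundle ℂ (Fin n₂ → ℂ) E₂]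

variable {H : FormField E} {s : ∀ x, Module.End ℂ (E x)} {g : FormField (Tang d X)} {α : ℝ}

namespace IsTraceFreeSelfAdjoint

variable (e : HiggsExt d n₁ n n₂ E₁ E E₂)

/-- The first variation of the functional. -/
theorem hasDerivAt_M (hs : IsTraceFreeSelfAdjoint d n H s) (hg : IsKaehler g)
    (hH : IsHermitianMetric d n H) {K : FormField E} (hK : IsHermitianMetric d n K) (t : ℝ) :
    HasDerivAt (fun τ : ℝ => e.M g α (expFam n H s τ) K)
      (2 * I * ∫ x, LinearMap.trace ℂ (E x) (s x * e.m₀ g α (expFam n H s t) x) ∂(omegaPow g)) t := by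
  refine (HiggsExt.hasDerivAt_M hg (hs.metricFamily hH) hK t).congr_deriv ?_
  rw [← integral_const_mul, ← integral_const_mul]
  exact integral_congr_ae (Filter.Eventually.of_forall fun x =>
    (hs.two_I_trace_m₀ e hg.hermitian hH t x).symm)

/-- As `s` is self-adjoint, the inner product is `Tr (s L(s))`; as `s` is trace-free, the unknown
multiple `c` of the identity in the derivative drops out. -/
lemma two_I_endInner_linearization (hs : IsTraceFreeSelfAdjoint d n H s)
    (hg : IsHermitianMetric d d g) (hH : IsHermitianMetric d n H) (x : X) :
    2 * I * endInner n H x (s x) (e.linearization g α H s x) =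
      2 * dpar 1 (e.momentForm g α (expFam n H s) 1) 0 x := by
  have hx := mem_dom (d := d) (n := n) (E := E) x
  obtain ⟨c, hc⟩ := hs.hasDerivAt_m₀ e (α := α) hg hH 0 x
  have h1 : endCoord n x x (s x) = atC (endL (d := d) n ℝ s) 0 x :=
    (endL_center ℝ s 0 hx.1).symm
  have h2 := hs.adj_endL hH hx 0
  have h3 : gramL (d := d) n (expFam n H s) x (0, chartAt (Fin d → ℂ) x x) = gram n H x x := by
    rw [gramL, gram_center hx.1, expFam_zero]
  rw [h3] at h2
  have h4 : endCoord n x x (e.linearization g α H s x) =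
      (-I) • (cdM (dp 1) (e.momentL g α (expFam n H s) x) (0, chartAt (Fin d → ℂ) x x) +
        c • (1 : Matrix (Fin n) (Fin n) ℂ)) := by
    rw [HiggsExt.linearization, endCoord_endOfCoord]
    ext i j
    exact (hc i j).deriv
  rw [endInner_eq, h1, h4, hs.dpar_momentForm e hg hH]
  simp only [atC, h2]
  have h5 := hs.trace_endL x 0
  simp only [atC] at h5
  simp only [Matrix.mul_smul, Matrix.mul_add, Matrix.trace_smul, Matrix.trace_add, Matrix.mul_one,
    h5, smul_eq_mul]
  linear_combination (-2 * (endL (d := d) n ℝ s x (0, chartAt (Fin d → ℂ) x x) *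
    cdM (dp 1) (e.momentL g α (expFam n H s) x) (0, chartAt (Fin d → ℂ) x x)).trace) * I_sq

lemma integrable_offDiagonal (hs : IsTraceFreeSelfAdjoint d n H s)
    (hg : IsKaehler g) (hH : IsHermitianMetric d n H) (t : ℝ) :
    Integrable (fun x => endNorm n (expFam n H s t) x (e.offDiagonal (expFam n H s t) s x) ^ 2)
      (omegaPow g) := by
  have hF := hs.metricFamily hH
  have hp := HiggsExt.projL_isEndFamily (e := e) hF
  have h := ((hs.endL_isEndFamily.mul ((hp.mul hs.endL_isEndFamily).mul
    (IsEndFamily.one.sub hp))).smoothFam_trace.integrable hg.hermitian t).re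
  refine h.congr (Filter.Eventually.of_forall fun x => ?_)
  exact (congrArg Complex.re (hs.trace_offDiagonal e hH t x)).trans (Complex.ofReal_re _)

/-- The second variation of the functional. -/
lemma integral_dpar_momentForm (hs : IsTraceFreeSelfAdjoint d n H s)
    (hg : IsKaehler g) (hH : IsHermitianMetric d n H) (t : ℝ) :
    ∫ x, dpar 1 (e.momentForm g α (expFam n H s) 1) t x ∂(omegaPow g) =
      ((∫ x, nablaSq n g e.Θ H s t x ∂(omegaPow g) - α * ∫ x, endNorm n (expFam n H s t) x
        (e.offDiagonal (expFam n H s t) s x) ^ 2 ∂(omegaPow g) : ℝ) : ℂ) := by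
  have hF := hs.metricFamily hH
  have h1 := ((HiggsExt.momentForm_smoothFam (e := e) (α := α) hg.hermitian hF 1).dpar
    1).integrable hg.hermitian t
  obtain ⟨h2, h3⟩ := integral_divNab hg hF hs.endL_isEndFamily hs.endL_isEndFamily t
  have h4 := hs.integrable_offDiagonal e hg hH t
  have h5 := fun x => hs.dpar_momentForm_eq e (α := α) hg.hermitian hH t x
  -- Read off from the identity `h5`, all of whose other terms are already known to be integrable.
  have h6 : Integrable (nablaSq n g e.Θ H s t) (omegaPow g) := by
    refine ((h1.add (h2.const_mul 2)).re.add (h4.const_mul α)).congr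
      (Filter.Eventually.of_forall fun x => ?_)
    have := congrArg Complex.re (h5 x)
    simp only [Complex.add_re, Complex.mul_re, Complex.neg_re, Complex.neg_im, Complex.re_ofNat,
      Complex.im_ofNat, Complex.ofReal_re] at this
    simp only [Pi.add_apply, RCLike.re_eq_complex_re, Complex.add_re, Complex.mul_re,
      Complex.re_ofNat, Complex.im_ofNat, this]
    ring
  simp only [h5]
  have h7 : Integrable (fun x => ((nablaSq n g e.Θ H s t x - α * endNorm n (expFam n H s t) x
      (e.offDiagonal (expFam n H s t) s x) ^ 2 : ℝ) : ℂ)) (omegaPow g) :=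
    (h6.sub (h4.const_mul α)).ofReal
  rw [integral_add (h2.const_mul (-2)) h7, integral_const_mul, h3,
    mul_zero, zero_add]
  have h8 : ∫ x, (nablaSq n g e.Θ H s t x - α * endNorm n (expFam n H s t) x
      (e.offDiagonal (expFam n H s t) s x) ^ 2) ∂(omegaPow g) = ∫ x, nablaSq n g e.Θ H s t x ∂(omegaPow g)
      - α * ∫ x, endNorm n (expFam n H s t) x
        (e.offDiagonal (expFam n H s t) s x) ^ 2 ∂(omegaPow g) := by
    rw [integral_sub h6 (h4.const_mul α), integral_const_mul]
  exact (integral_ofReal (𝕜 := ℂ)).trans (congrArg _ h8)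

lemma nablaSq_zero (hs : IsTraceFreeSelfAdjoint d n H s) (hH : IsHermitianMetric d n H)
    (Θ : HiggsField d n E) (x : X) :
    nablaSq n g Θ H s 0 x = oneFormNormSq n g H x (nablaEnd Θ s x) := by
  have h := oneFormNormSq_nablaEnd (g := g) Θ (hs.metricFamily hH) hs.smooth 0 x
    (hs.eventually_selfAdjoint hH (mem_dom x) 0)
  rw [expFam_zero] at h
  exact h.symm

/-- The first variation is twice the integral of `momentForm` for all `t`, so it can be
differentiated under the integral sign; at `t = 0` the result is the pairing with the linearization,
and its divergence part integrates to zero. -/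
theorem second_variation (hs : IsTraceFreeSelfAdjoint d n H s) (hg : IsKaehler g)
    (hH : IsHermitianMetric d n H) {K : FormField E} (hK : IsHermitianMetric d n K) :
    (∀ (x : X) (i j : Fin n), DifferentiableAt ℝ (fun t : ℝ =>
      endCoord n x x (e.m₀ g α (expFam n H s t) x) i j) 0) ∧
    HasDerivAt (deriv (fun t : ℝ => e.M g α (expFam n H s t) K))
      (2 * I * ∫ x, endInner n H x (s x) (e.linearization g α H s x) ∂(omegaPow g)) 0 ∧
    2 * I * ∫ x, endInner n H x (s x) (e.linearization g α H s x) ∂(omegaPow g)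
      = ((2 * ((∫ x, oneFormNormSq n g H x (nablaEnd e.Θ s x) ∂(omegaPow g))
          - α * ∫ x, endNorm n H x (e.offDiagonal H s x) ^ 2 ∂(omegaPow g)) : ℝ) : ℂ) := by
  have hF := hs.metricFamily hH
  have h1 : 2 * I * ∫ x, endInner n H x (s x) (e.linearization g α H s x) ∂(omegaPow g) =
      2 * ∫ x, dpar 1 (e.momentForm g α (expFam n H s) 1) 0 x ∂(omegaPow g) := by
    rw [← integral_const_mul, ← integral_const_mul]
    exact integral_congr_ae (Filter.Eventually.of_forall fun x =>
      hs.two_I_endInner_linearization e hg.hermitian hH x)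
  refine ⟨fun x i j => ?_, ?_, ?_⟩
  · obtain ⟨c, hc⟩ := hs.hasDerivAt_m₀ e (α := α) hg.hermitian hH 0 x
    exact (hc i j).differentiableAt
  · have h2 : deriv (fun t : ℝ => e.M g α (expFam n H s t) K) =
        fun t => 2 * ∫ x, e.momentForm g α (expFam n H s) 1 t x ∂(omegaPow g) :=
      funext fun t => (HiggsExt.hasDerivAt_M hg hF hK t).deriv
    rw [h1, h2]
    exact ((HiggsExt.momentForm_smoothFam hg.hermitian hF 1).hasDerivAt_integral hg.hermitian
      (ph := fun t => t) (fun t => hasDerivAt_id t) 0).const_mul 2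
  · rw [h1, hs.integral_dpar_momentForm e hg hH, expFam_zero]
    simp only [hs.nablaSq_zero hH]
    push_cast
    ring

end IsTraceFreeSelfAdjoint

end Variations

/-! ### Derivatives of `Tr L²`, and Green's formula for the Laplacian. -/

section Square

variable {W : Type*} [NormedAddCommGroup W] [NormedSpace ℝ W] {m : Type*} [Fintype m] [DecidableEq m]

lemma cd_trace_sq (ξ : W × W) {L : W → Matrix m m ℂ} {q : W} (hL : SmoothAt L q) :
    cd ξ (fun q => (L q * L q).trace) q = 2 * (L q * cdM ξ L q).trace := by
  rw [cd_trace ξ (hL.mul hL), cdM_mul ξ hL hL, Matrix.trace_add,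
    Matrix.trace_mul_comm (cdM ξ L q) (L q)]
  ring

/-- `Tr (L [a, L])` vanishes, so the connection is invisible here. With `cd_trace_sq` this makes `Tr
(L ∂_h L)` equal to `∂ Tr L² / 2`. -/
lemma trace_mul_nab_self (h : W → Matrix m m ℂ) (ξ : W × W) (L : W → Matrix m m ℂ) (q : W) :
    (L q * nab h L ξ q).trace = (L q * cdM ξ L q).trace := by
  rw [nab, Matrix.mul_add, Matrix.mul_sub, Matrix.trace_add, Matrix.trace_sub,
    ← Matrix.mul_assoc (L q) (chern h ξ q), Matrix.trace_mul_comm (L q * chern h ξ q), sub_self,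
    add_zero]

end Square

section Green

variable {d : ℕ} {X : Type*} [TopologicalSpace X] [T2Space X] [CompactSpace X]
  [MeasurableSpace X] [BorelSpace X] [ChartedSpace (Fin d → ℂ) X]
  [IsManifold 𝓘(ℂ, Fin d → ℂ) ω X] {g : FormField (Tang d X)}

lemma SmoothFam.continuous_laplacian (hg : IsHermitianMetric d d g) {a : X → ℝ}
    (ha : SmoothFam (d := d) fun (_ : ℝ) x => (a x : ℂ)) : Continuous (laplacian g a) := by
  have h := (delForm_isOneForm (n := d) (E := Tang d X) ha).smoothFam_div hg
  have h2 : laplacian g a = fun x => (-4 * atC (divL g (delForm d fun (_ : ℝ) x => (a x : ℂ))) 0 x).re :=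
    funext fun x => laplacian_eq g ha 0 x
  rw [h2]
  exact Complex.continuous_re.comp (continuous_const.mul (h.continuous_slice 0))

lemma divL_mul_delForm (g : FormField (Tang d X)) {a b : X → ℝ}
    (ha : SmoothFam (d := d) fun (_ : ℝ) x => (a x : ℂ))
    (hb : SmoothFam (d := d) fun (_ : ℝ) x => (b x : ℂ)) (t : ℝ) (x : X) :
    divL g (fun x q j => (a ((chartAt (Fin d → ℂ) x).symm q.2) : ℂ) *
        delForm d (fun (_ : ℝ) x => (b x : ℂ)) x q j) x (t, chartAt (Fin d → ℂ) x x) =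
      (∑ j, ∑ k, gammaL ℝ g x (t, chartAt (Fin d → ℂ) x x) j k *
        (cd (cj (dhb ℝ d k)) (fun q => (a ((chartAt (Fin d → ℂ) x).symm q.2) : ℂ))
          (t, chartAt (Fin d → ℂ) x x) *
        cd (dhb ℝ d j) (fun q => (b ((chartAt (Fin d → ℂ) x).symm q.2) : ℂ))
          (t, chartAt (Fin d → ℂ) x x))) +
      a x * divL g (delForm d fun (_ : ℝ) x => (b x : ℂ)) x (t, chartAt (Fin d → ℂ) x x) := by
  rw [divL, divL, Finset.mul_sum, ← Finset.sum_add_distrib]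
  refine Finset.sum_congr rfl fun j _ => ?_
  rw [Finset.mul_sum, ← Finset.sum_add_distrib]
  refine Finset.sum_congr rfl fun k _ => ?_
  have h : DifferentiableAt ℝ (fun q : ℝ × (Fin d → ℂ) => delForm d (fun (_ : ℝ) x => (b x : ℂ)) x q j)
      (t, chartAt (Fin d → ℂ) x x) := (contDiffAt_cd (hb t x) _).dAt
  rw [cd_mul _ (ha t x).dAt h]
  simp only [(chartAt (Fin d → ℂ) x).left_inv (mem_chart_source (Fin d → ℂ) x)]
  rw [delForm]
  ring

/-- Green's formula. -/
lemma integral_mul_laplacian_comm (hg : IsKaehler g) {a b : X → ℝ}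
    (ha : SmoothFam (d := d) fun (_ : ℝ) x => (a x : ℂ))
    (hb : SmoothFam (d := d) fun (_ : ℝ) x => (b x : ℂ)) :
    Integrable (fun x => a x * laplacian g b x) (omegaPow g) ∧
    Integrable (fun x => b x * laplacian g a x) (omegaPow g) ∧
    ∫ x, a x * laplacian g b x ∂(omegaPow g) = ∫ x, b x * laplacian g a x ∂(omegaPow g) := by
  have hgh := hg.hermitian
  have := isFiniteMeasure_omegaPow hgh
  have hint : ∀ {u : X → ℝ}, Continuous u → Integrable u (omegaPow g) := fun hu =>
    hu.integrable_of_hasCompactSupport (HasCompactSupport.of_compactSpace _)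
  have hca : Continuous a := Complex.continuous_re.comp (ha.continuous_slice 0)
  have hcb : Continuous b := Complex.continuous_re.comp (hb.continuous_slice 0)
  have i1 : Integrable (fun x => a x * laplacian g b x) (omegaPow g) :=
    hint (hca.mul (hb.continuous_laplacian hgh))
  have i2 : Integrable (fun x => b x * laplacian g a x) (omegaPow g) :=
    hint (hcb.mul (ha.continuous_laplacian hgh))
  refine ⟨i1, i2, ?_⟩
  have hA := (delForm_isOneForm (n := d) (E := Tang d X) hb).mul_fun
    (f := fun x => (a x : ℂ)) fun p x y hy => ha.contDiffAt p hy
  have hB := (delForm_isOneForm (n := d) (E := Tang d X) ha).mul_fun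
    (f := fun x => (b x : ℂ)) fun p x y hy => hb.contDiffAt p hy
  have hAi := (hA.smoothFam_div hgh).integrable hgh 0
  have hBi := (hB.smoothFam_div hgh).integrable hgh 0
  have hA0 := hA.integral_div hg 0
  have hB0 := hB.integral_div hg 0
  have hpt : ∀ x, a x * laplacian g b x - b x * laplacian g a x =
      ((4 : ℂ) * (atC (divL g fun x (q : ℝ × (Fin d → ℂ)) j =>
        (b ((chartAt (Fin d → ℂ) x).symm q.2) : ℂ) *
          delForm d (fun (_ : ℝ) x => (a x : ℂ)) x q j) 0 x -
      atC (divL g fun x (q : ℝ × (Fin d → ℂ)) j =>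
        (a ((chartAt (Fin d → ℂ) x).symm q.2) : ℂ) *
          delForm d (fun (_ : ℝ) x => (b x : ℂ)) x q j) 0 x)).re := fun x => by
    have e1 := divL_mul_delForm g ha hb 0 x
    have e2 := divL_mul_delForm g hb ha 0 x
    have e3 := laplacian_eq g ha 0 x
    have e4 := laplacian_eq g hb 0 x
    have hc : ∀ {u : X → ℝ} (hu : SmoothFam (d := d) fun (_ : ℝ) x => (u x : ℂ)) (ξ),
        cd ξ (fun q : ℝ × (Fin d → ℂ) => (u ((chartAt (Fin d → ℂ) x).symm q.2) : ℂ))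
          (0, chartAt (Fin d → ℂ) x x) = conj (cd (cj ξ)
            (fun q : ℝ × (Fin d → ℂ) => (u ((chartAt (Fin d → ℂ) x).symm q.2) : ℂ))
            (0, chartAt (Fin d → ℂ) x x)) := fun {u} hu ξ => by
      have := cd_conj ξ (hu 0 x).dAt
      simp only [Complex.conj_ofReal] at this
      exact this
    -- The gradient terms of `div (b ∂a)` and `div (a ∂b)` are complex conjugates of each other,
    -- since `a` and `b` are real and `γ` is Hermitian. They cancel in the real part of the
    -- difference.
    have e5 : (∑ j, ∑ k, gammaL ℝ g x (0, chartAt (Fin d → ℂ) x x) j k *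
        (cd (cj (dhb ℝ d k)) (fun q => (b ((chartAt (Fin d → ℂ) x).symm q.2) : ℂ))
          (0, chartAt (Fin d → ℂ) x x) *
        cd (dhb ℝ d j) (fun q => (a ((chartAt (Fin d → ℂ) x).symm q.2) : ℂ))
          (0, chartAt (Fin d → ℂ) x x))) = conj (∑ j, ∑ k,
        gammaL ℝ g x (0, chartAt (Fin d → ℂ) x x) j k *
        (cd (cj (dhb ℝ d k)) (fun q => (a ((chartAt (Fin d → ℂ) x).symm q.2) : ℂ))
          (0, chartAt (Fin d → ℂ) x x) *
        cd (dhb ℝ d j) (fun q => (b ((chartAt (Fin d → ℂ) x).symm q.2) : ℂ))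
          (0, chartAt (Fin d → ℂ) x x))) := by
      rw [map_sum, Finset.sum_comm]
      refine Finset.sum_congr rfl fun j _ => ?_
      rw [map_sum]
      refine Finset.sum_congr rfl fun k _ => ?_
      rw [map_mul, map_mul, ← hc ha, ← congrFun (congrFun (gammaL_hermitian (P := ℝ) hgh x _) k) j,
        hc hb (dhb ℝ d j), Complex.conj_conj, Matrix.conjTranspose_apply, ← starRingEnd_apply]
      ring
    simp only [atC]
    rw [e1, e2, e3, e4, e5]
    simp only [Complex.mul_re, Complex.sub_re, Complex.add_re, Complex.conj_re, Complex.ofReal_re,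
      Complex.ofReal_im, Complex.neg_re, Complex.neg_im, Complex.re_ofNat, Complex.im_ofNat]
    ring
  rw [← sub_eq_zero, ← integral_sub i1 i2]
  simp only [hpt]
  have h := ((hBi.sub hAi).const_mul 4)
  refine (integral_re (𝕜 := ℂ) h).trans ?_
  have h0 := integral_sub hBi hAi
  rw [hA0, hB0, sub_zero] at h0
  rw [integral_const_mul]
  exact (congrArg (fun c : ℂ => (4 * c).re) h0).trans (by simp)

end Green

/-! ### The Bochner-Kato inequality for `(|s|² + ε)^{1/2}`. -/

section Estimate

variable {d n₁ n n₂ : ℕ} {X : Type*} [TopologicalSpace X] [ChartedSpace (Fin d → ℂ) X]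
  [IsManifold 𝓘(ℂ, Fin d → ℂ) ω X] {E₁ E E₂ : X → Type*}
  [∀ x, AddCommGroup (E₁ x)] [∀ x, Module ℂ (E₁ x)]
  [TopologicalSpace (TotalSpace (Fin n₁ → ℂ) E₁)] [∀ x, TopologicalSpace (E₁ x)]
  [FiberBundle (Fin n₁ → ℂ) E₁] [VectorBundle ℂ (Fin n₁ → ℂ) E₁]
  [ContMDiffVectorBundle ω (Fin n₁ → ℂ) E₁ 𝓘(ℂ, Fin d → ℂ)]
  [∀ x, AddCommGroup (E x)] [∀ x, Module ℂ (E x)]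
  [TopologicalSpace (TotalSpace (Fin n → ℂ) E)] [∀ x, TopologicalSpace (E x)]
  [FiberBundle (Fin n → ℂ) E] [VectorBundle ℂ (Fin n → ℂ) E]
  [ContMDiffVectorBundle ω (Fin n → ℂ) E 𝓘(ℂ, Fin d → ℂ)]
  [∀ x, AddCommGroup (E₂ x)] [∀ x, Module ℂ (E₂ x)]
  [TopologicalSpace (TotalSpace (Fin n₂ → ℂ) E₂)] [∀ x, TopologicalSpace (E₂ x)]
  [FiberBundle (Fin n₂ → ℂ) E₂] [VectorBundle ℂ (Fin n₂ → ℂ) E₂]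

variable {H : FormField E} {s : ∀ x, Module.End ℂ (E x)} {g : FormField (Tang d X)} {α : ℝ}

lemma eventually_contDiffAt_sqrt {f : X → ℝ} (hf : SmoothFam (d := d) fun (_ : ℝ) x => (f x : ℂ))
    (t : ℝ) {x : X} (hx : 0 < f x) : ∀ᶠ q : ℝ × (Fin d → ℂ) in nhds (t, chartAt (Fin d → ℂ) x x),
      0 < f ((chartAt (Fin d → ℂ) x).symm q.2) ∧ ContDiffAt ℝ ∞
        (fun q : ℝ × (Fin d → ℂ) => ((√(f ((chartAt (Fin d → ℂ) x).symm q.2)) : ℝ) : ℂ)) q := by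
  have h1 : ∀ {q}, ContDiffAt ℝ ∞ (fun q : ℝ × (Fin d → ℂ) =>
      (f ((chartAt (Fin d → ℂ) x).symm q.2) : ℂ)) q → ContDiffAt ℝ ∞ (fun q : ℝ × (Fin d → ℂ) =>
      f ((chartAt (Fin d → ℂ) x).symm q.2)) q := fun {q} h =>
    (Complex.reCLM.contDiff.contDiffAt.comp q h)
  have hc := (h1 (hf t x)).continuousAt
  have hp : ∀ᶠ q : ℝ × (Fin d → ℂ) in nhds (t, chartAt (Fin d → ℂ) x x),
      0 < f ((chartAt (Fin d → ℂ) x).symm q.2) :=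
    hc.eventually_const_lt (by
      simpa only [(chartAt (Fin d → ℂ) x).left_inv (mem_chart_source (Fin d → ℂ) x)] using hx)
  filter_upwards [hp, hf.eventually_contDiffAt t x] with q hq hq2
  exact ⟨hq, Complex.ofRealCLM.contDiff.contDiffAt.comp q ((h1 hq2).sqrt hq.ne')⟩

namespace IsTraceFreeSelfAdjoint

lemma endNorm_sq_eq (hs : IsTraceFreeSelfAdjoint d n H s) (hH : IsHermitianMetric d n H)
    (t : ℝ) (x : X) : ((endNorm n (expFam n H s t) x (s x) ^ 2 : ℝ) : ℂ) =
      (endL (d := d) n ℝ s x (t, chartAt (Fin d → ℂ) x x) *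
        endL (d := d) n ℝ s x (t, chartAt (Fin d → ℂ) x x)).trace := by
  have hx := mem_dom (d := d) (n := n) (E := E) x
  have h := hs.adj_endL hH hx t
  rw [gramL, gram_center hx.1] at h
  rw [endNorm_sq ((hs.metricFamily hH).herm t), ← endL_center ℝ s t hx.1, h]

/-- `s` is self-adjoint for each of these metrics, so its squared norm is `Tr s²`, which does not
mention the metric. -/
lemma endNorm_expFam (hs : IsTraceFreeSelfAdjoint d n H s) (hH : IsHermitianMetric d n H)
    (t : ℝ) (x : X) : endNorm n (expFam n H s t) x (s x) = endNorm n H x (s x) := by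
  have h1 := hs.endNorm_sq_eq hH t x
  have h2 := hs.endNorm_sq_eq hH 0 x
  rw [expFam_zero] at h2
  have h3 := Complex.ofReal_injective (h1.trans h2.symm)
  exact (sq_eq_sq₀ (Real.sqrt_nonneg _) (Real.sqrt_nonneg _)).1 h3

lemma endNorm_sq_smoothFam (hs : IsTraceFreeSelfAdjoint d n H s) (hH : IsHermitianMetric d n H) :
    SmoothFam (d := d) fun (_ : ℝ) x => ((endNorm n H x (s x) ^ 2 : ℝ) : ℂ) := by
  have h : (fun (_ : ℝ) x => ((endNorm n H x (s x) ^ 2 : ℝ) : ℂ)) =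
      fun t x => (atC (fun x q => endL (d := d) n ℝ s x q * endL (d := d) n ℝ s x q) t x).trace := by
    funext t x
    rw [← hs.endNorm_expFam hH t, hs.endNorm_sq_eq hH t]
    rfl
  rw [h]
  exact (hs.endL_isEndFamily.mul hs.endL_isEndFamily).smoothFam_trace

open scoped ComplexOrder in
/-- Bochner's formula and Kato's inequality for `(|s|² + ε)^{1/2}`. -/
lemma sqrt_mul_laplacian_le (hs : IsTraceFreeSelfAdjoint d n H s) (hg : IsHermitianMetric d d g)
    (hH : IsHermitianMetric d n H) (Θ : HiggsField d n E) {ε : ℝ} (hε : 0 ≤ ε) (t : ℝ) (x : X)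
    (hx0 : 0 < endNorm n H x (s x) ^ 2 + ε) :
    √(endNorm n H x (s x) ^ 2 + ε) * laplacian g (fun x => √(endNorm n H x (s x) ^ 2 + ε)) x ≤
      2 * nablaSq n g Θ H s t x -
        4 * (divNab g (expFam n H s) (endL n ℝ s) (endL n ℝ s) t x).re := by
  have hF := hs.metricFamily hH
  have hx := mem_dom (d := d) (n := n) (E := E) x
  set f : X → ℝ := fun x => endNorm n H x (s x) ^ 2 + ε with hf
  have hfs : SmoothFam (d := d) fun (_ : ℝ) x => (f x : ℂ) := by
    have h := (hs.endNorm_sq_smoothFam hH).add (f' := fun _ _ => (ε : ℂ))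
      (fun p x => contDiffAt_const)
    simpa only [hf, Complex.ofReal_add] using h
  set q₀ : ℝ × (Fin d → ℂ) := (t, chartAt (Fin d → ℂ) x x) with hq₀
  set S := endL (d := d) n ℝ s x with hS
  set h := gramL (d := d) n (expFam n H s) x with hh
  set ρ : ℝ × (Fin d → ℂ) → ℂ := fun q => ((√(f ((chartAt (Fin d → ℂ) x).symm q.2)) : ℝ) : ℂ) with hρ
  have hρs := eventually_contDiffAt_sqrt hfs t (x := x) hx0
  have hρ2 : (fun q => ρ q * ρ q) =ᶠ[nhds q₀] fun q => (S q * S q).trace + ε := by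
    filter_upwards [hρs, (hs.endL_isEndFamily.mul hs.endL_isEndFamily).trace_eventuallyEq t x]
      with q h1 h2
    rw [hρ, ← Complex.ofReal_mul, Real.mul_self_sqrt h1.1.le, hf]
    simp only [Complex.ofReal_add]
    rw [← h2, ← hs.endNorm_expFam hH q.1, hs.endNorm_sq_eq hH q.1]
    rfl
  have hSs : ∀ᶠ q in nhds q₀, SmoothAt S q := by
    filter_upwards [eventually_symm_mem hx.1 (isOpen_dom x) hx t] with q hq
    have := endL_smoothAt ℝ hs.smooth hq.2 q.1
    rwa [(chartAt (Fin d → ℂ) x).right_inv hq.1] at this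
  -- Half of the derivative of `ρ² = Tr s² + ε`.
  have hρd : ∀ ξ, ∀ᶠ q in nhds q₀, ρ q * cd ξ ρ q = (S q * cdM ξ S q).trace := fun ξ => by
    filter_upwards [hρ2.eventually_nhds, hρs, hSs] with q h1 h2 h3
    have h4 := cd_congr (ξ := ξ) h1
    have h5 : DifferentiableAt ℝ (fun q => (S q * S q).trace) q := (h3.mul h3).trace.dAt
    rw [cd_mul ξ h2.2.dAt h2.2.dAt, cd_add ξ h5 (differentiableAt_const _), cd_const, add_zero,
      cd_trace_sq ξ h3] at h4
    linear_combination h4 / 2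
  set γ := gammaL ℝ g x q₀ with hγ
  set R : Fin d → Matrix (Fin n) (Fin n) ℂ := fun j => nab h S (dhb ℝ d j) q₀ with hR
  set R' : Fin d → Matrix (Fin n) (Fin n) ℂ :=
    fun j => S q₀ * thetaL n ℝ Θ x j q₀ - thetaL n ℝ Θ x j q₀ * S q₀ with hR'
  have hγp : γ.PosSemidef := by
    rw [hγ, gammaL, hq₀, (chartAt (Fin d → ℂ) x).left_inv hx.1]
    exact (gram_posDef (E := Tang d X) hg (mem_frameSet x)).inv.posSemidef
  have hhp : (h q₀).PosDef := by
    rw [hh, gramL, gram_center hx.1]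
    exact gram_posDef (hF.herm t) (mem_frameSet x)
  have hu := hF.isUnit t hx
  have hSa : adj (h q₀) (S q₀) = S q₀ := hs.adj_endL hH hx t
  have hadj : ∀ k, adj (h q₀) (R k) = cdM (cj (dhb ℝ d k)) S q₀ := fun k =>
    adj_nab (hF.smooth x t x hx) hu (Filter.Eventually.of_forall fun q => hF.hermitian x q)
      hSs.self_of_nhds (hs.eventually_selfAdjoint hH hx t) _
  set Q : ℂ := ∑ j, ∑ k, γ j k * (cd (cj (dhb ℝ d k)) ρ q₀ * cd (dhb ℝ d j) ρ q₀) with hQ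
  -- As `Tr (s ∂_h s) = ρ ∂ρ`, its divergence is `|∂ρ|²`, here `Q`, plus `ρ` times the divergence of
  -- `∂ρ`.
  have hdiv : divNab g (expFam n H s) (endL n ℝ s) (endL n ℝ s) t x =
      Q + ρ q₀ * divL g (delForm d fun (_ : ℝ) x => ((√(f x) : ℝ) : ℂ)) x q₀ := by
    rw [divNab, atC, divL, divL, hQ, Finset.mul_sum, ← Finset.sum_add_distrib]
    refine Finset.sum_congr rfl fun j _ => ?_
    rw [Finset.mul_sum, ← Finset.sum_add_distrib]
    refine Finset.sum_congr rfl fun k _ => ?_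
    have e1 : (fun q => (S q * nab h S (dhb ℝ d j) q).trace) =ᶠ[nhds q₀]
        fun q => ρ q * cd (dhb ℝ d j) ρ q := by
      filter_upwards [hρd (dhb ℝ d j)] with q hq
      rw [trace_mul_nab_self, hq]
    rw [cd_congr e1, cd_mul _ hρs.self_of_nhds.2.dAt (contDiffAt_cd hρs.self_of_nhds.2 _).dAt]
    have e2 : (fun q => delForm d (fun (_ : ℝ) x => ((√(f x) : ℝ) : ℂ)) x q j) =
      cd (dhb ℝ d j) ρ := rfl
    rw [e2]
    ring
  have hlap := laplacian_eq_of_eventually (f := fun (_ : ℝ) x => √(f x)) g t x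
    (hρs.mono fun q hq => hq.2)
  have hρ0 : ρ q₀ = ((√(f x) : ℝ) : ℂ) := by
    rw [hρ, hq₀]
    simp only [(chartAt (Fin d → ℂ) x).left_inv hx.1]
  set W : ℂ := ∑ j, ∑ k, γ j k * (adj (h q₀) (R k) * R j).trace with hW
  have hform : nablaSq n g Θ H s t x =
      2 * W.re + 2 * (∑ j, ∑ k, γ j k * (adj (h q₀) (R' k) * R' j).trace).re := by
    rw [nablaSq, formQ, hW, ← mul_add, ← Complex.add_re, ← Finset.sum_add_distrib]
    simp only [Complex.mul_re, Complex.re_ofNat, Complex.im_ofNat, zero_mul, sub_zero]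
    refine congrArg (fun c : ℂ => 2 * c.re) (Finset.sum_congr rfl fun j _ => ?_)
    rw [← Finset.sum_add_distrib]
    refine Finset.sum_congr rfl fun k _ => ?_
    rw [hadj, hR', adj_sub, adj_mul hu, adj_mul hu, hSa, ← mul_add]
    refine congrArg _ (congrArg _ ?_)
    exact Matrix.trace_mul_comm _ _
  have h1 := (Complex.le_def.1 (sum_trace_adj_mul_nonneg hhp hγp R')).1
  have h2 := (Complex.le_def.1 (sum_trace_adj_mul_nonneg hhp hγp R)).1
  have h3 := (Complex.le_def.1 (sum_trace_mul_le hhp hγp hSa R)).1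
  have h4 : ∑ j, ∑ k, γ j k * ((S q₀ * adj (h q₀) (R k)).trace * (S q₀ * R j).trace) =
      ((f x : ℝ) : ℂ) * Q := by
    have e : ((f x : ℝ) : ℂ) = ρ q₀ * ρ q₀ := by
      rw [hρ0, ← Complex.ofReal_mul, Real.mul_self_sqrt hx0.le]
    simp only [hQ, Finset.mul_sum, e]
    refine Finset.sum_congr rfl fun j _ => Finset.sum_congr rfl fun k _ => ?_
    rw [hadj, ← (hρd _).self_of_nhds, hR, trace_mul_nab_self, ← (hρd _).self_of_nhds]
    ring
  have h5 : (S q₀ * S q₀).trace = ((endNorm n H x (s x) ^ 2 : ℝ) : ℂ) := by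
    rw [← hs.endNorm_expFam hH t, hs.endNorm_sq_eq hH t]
  rw [h4, h5, Complex.re_ofReal_mul, Complex.re_ofReal_mul] at h3
  rw [Complex.zero_re] at h1 h2
  -- Kato's inequality: by Cauchy-Schwarz `ρ² |∂ρ|² ≤ |s|² |∂_h s|²`, and `|s|² ≤ ρ²`, so that `ρ² >
  -- 0` may be cancelled.
  have h6 : Q.re ≤ W.re := by
    have : f x * Q.re ≤ f x * W.re := h3.trans (mul_le_mul_of_nonneg_right (by
      simp only [hf]; linarith) h2)
    exact le_of_mul_le_mul_left this hx0
  have h7 : √(f x) * laplacian g (fun x => √(f x)) x =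
      4 * Q.re - 4 * (divNab g (expFam n H s) (endL n ℝ s) (endL n ℝ s) t x).re := by
    rw [hlap, hdiv, hρ0, Complex.add_re, Complex.re_ofReal_mul]
    simp only [Complex.mul_re, Complex.neg_re, Complex.neg_im, Complex.re_ofNat, Complex.im_ofNat,
      neg_zero, zero_mul, sub_zero]
    ring
  rw [h7, hform]
  linarith

end IsTraceFreeSelfAdjoint

end Estimate

/-! ### Passage to the limit in the sense of distributions. -/

section Distributions

variable {d : ℕ} {X : Type*} [TopologicalSpace X] [T2Space X] [CompactSpace X]
  [MeasurableSpace X] [BorelSpace X] [ChartedSpace (Fin d → ℂ) X]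
  [IsManifold 𝓘(ℂ, Fin d → ℂ) ω X] {g : FormField (Tang d X)}

lemma smoothFam_of_contMDiff {ψ : X → ℝ} (hψ : ContMDiff 𝓘(ℝ, Fin d → ℂ) 𝓘(ℝ, ℝ) ∞ ψ) :
    SmoothFam (d := d) fun (_ : ℝ) x => (ψ x : ℂ) := fun p x => by
  have : IsManifold 𝓘(ℝ, Fin d → ℂ) ∞ X := isManifold_real
  have h := (contDiffAt_comp_chart_symm hψ.contMDiffAt (mem_chart_source (Fin d → ℂ) x)).comp
    (p, chartAt (Fin d → ℂ) x x) (f := fun q : ℝ × (Fin d → ℂ) => q.2) contDiffAt_snd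
  exact Complex.ofRealCLM.contDiff.contDiffAt.comp (p, chartAt (Fin d → ℂ) x x) h

/-- If `Δ (N² + ε)^{1/2} ≤ m` for all `ε > 0`, then `Δ N ≤ m` in the sense of distributions. -/
lemma integral_mul_laplacian_le (hg : IsKaehler g) {N m : X → ℝ} (hN : ∀ x, 0 ≤ N x)
    (hN2 : SmoothFam (d := d) fun (_ : ℝ) x => ((N x ^ 2 : ℝ) : ℂ)) (hm : Continuous m)
    (hle : ∀ ε > 0, ∀ x, laplacian g (fun x => √(N x ^ 2 + ε)) x ≤ m x) {ψ : X → ℝ}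
    (hψ : ContMDiff 𝓘(ℝ, Fin d → ℂ) 𝓘(ℝ, ℝ) ∞ ψ) (hψ0 : ∀ x, 0 ≤ ψ x) :
    ∫ x, N x * laplacian g ψ x ∂(omegaPow g) ≤ ∫ x, m x * ψ x ∂(omegaPow g) := by
  have hgh := hg.hermitian
  have := isFiniteMeasure_omegaPow hgh
  have hint : ∀ {u : X → ℝ}, Continuous u → Integrable u (omegaPow g) := fun hu =>
    hu.integrable_of_hasCompactSupport (HasCompactSupport.of_compactSpace _)
  have hψs := smoothFam_of_contMDiff hψ
  have hLψ := hψs.continuous_laplacian hgh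
  have hNc : Continuous N := by
    have : Continuous fun x => √(N x ^ 2) :=
      Real.continuous_sqrt.comp (Complex.continuous_re.comp (hN2.continuous_slice 0))
    simpa only [Real.sqrt_sq (hN _)] using this
  have iN : Integrable (fun x => N x * laplacian g ψ x) (omegaPow g) := hint (hNc.mul hLψ)
  have im : Integrable (fun x => m x * ψ x) (omegaPow g) := hint (hm.mul hψ.continuous)
  have iA : Integrable (fun x => |laplacian g ψ x|) (omegaPow g) := hint hLψ.abs
  set C := ∫ x, |laplacian g ψ x| ∂(omegaPow g) with hC
  have hC0 : 0 ≤ C := integral_nonneg fun x => abs_nonneg _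
  -- Taking `ε = δ²`, the smooth function `(N² + δ²)^{1/2}` lies between `N` and `N + δ`. Green's
  -- formula moves the Laplacian to it, and replacing it by `N` costs at most `δ ∫ |Δψ|`.
  have key : ∀ δ > 0, ∫ x, N x * laplacian g ψ x ∂(omegaPow g) ≤
      ∫ x, m x * ψ x ∂(omegaPow g) + δ * C := fun δ hδ => by
    have hpos : ∀ x, 0 < N x ^ 2 + δ ^ 2 := fun x => by positivity
    have hs : SmoothFam (d := d) fun (_ : ℝ) x => ((N x ^ 2 + δ ^ 2 : ℝ) : ℂ) := by
      have h := hN2.add (f' := fun _ _ => ((δ ^ 2 : ℝ) : ℂ)) fun p x => contDiffAt_const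
      simpa only [Complex.ofReal_add] using h
    have hr : SmoothFam (d := d) fun (_ : ℝ) x => ((√(N x ^ 2 + δ ^ 2) : ℝ) : ℂ) := fun t x =>
      (eventually_contDiffAt_sqrt hs t (hpos x)).self_of_nhds.2
    obtain ⟨i1, i2, h3⟩ := integral_mul_laplacian_comm hg hr hψs
    have h4 : ∫ x, ψ x * laplacian g (fun x => √(N x ^ 2 + δ ^ 2)) x ∂(omegaPow g) ≤
        ∫ x, m x * ψ x ∂(omegaPow g) := integral_mono i2 im fun x => by
      have := mul_le_mul_of_nonneg_left (hle (δ ^ 2) (by positivity) x) (hψ0 x)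
      simpa only [mul_comm (m x)] using this
    have h5 : ∫ x, N x * laplacian g ψ x ∂(omegaPow g) ≤
        ∫ x, (√(N x ^ 2 + δ ^ 2) * laplacian g ψ x + δ * |laplacian g ψ x|) ∂(omegaPow g) :=
      integral_mono iN (i1.add (iA.const_mul δ)) fun x => by
        have e1 : N x ≤ √(N x ^ 2 + δ ^ 2) := Real.le_sqrt_of_sq_le (by nlinarith)
        have e2 : √(N x ^ 2 + δ ^ 2) ≤ N x + δ :=
          (Real.sqrt_le_left (by linarith [hN x])).2 (by nlinarith [hN x])
        have e3 : (N x - √(N x ^ 2 + δ ^ 2)) * laplacian g ψ x ≤ δ * |laplacian g ψ x| :=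
          (le_abs_self _).trans (by
            rw [abs_mul]
            exact mul_le_mul_of_nonneg_right (abs_le.2 ⟨by linarith, by linarith⟩) (abs_nonneg _))
        change N x * laplacian g ψ x ≤ √(N x ^ 2 + δ ^ 2) * laplacian g ψ x + δ * |laplacian g ψ x|
        linarith
    rw [integral_add i1 (iA.const_mul δ), integral_const_mul, h3] at h5
    linarith
  refine le_of_forall_pos_le_add fun η hη => (key (η / (C + 1)) (by positivity)).trans ?_
  -- The `1` in `C + 1` guards against `C = 0` in the choice of `δ`.
  have : η / (C + 1) * C ≤ η := by
    rw [div_mul_eq_mul_div, div_le_iff₀ (by positivity)]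
    nlinarith
  linarith

end Distributions

/-! ### The differential inequality for `|s|`. -/

section Inequality

variable {d n₁ n n₂ : ℕ} {X : Type*} [TopologicalSpace X] [ChartedSpace (Fin d → ℂ) X]
  [IsManifold 𝓘(ℂ, Fin d → ℂ) ω X] {E₁ E E₂ : X → Type*}
  [∀ x, AddCommGroup (E₁ x)] [∀ x, Module ℂ (E₁ x)]
  [TopologicalSpace (TotalSpace (Fin n₁ → ℂ) E₁)] [∀ x, TopologicalSpace (E₁ x)]
  [FiberBundle (Fin n₁ → ℂ) E₁] [VectorBundle ℂ (Fin n₁ → ℂ) E₁]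
  [ContMDiffVectorBundle ω (Fin n₁ → ℂ) E₁ 𝓘(ℂ, Fin d → ℂ)]
  [∀ x, AddCommGroup (E x)] [∀ x, Module ℂ (E x)]
  [TopologicalSpace (TotalSpace (Fin n → ℂ) E)] [∀ x, TopologicalSpace (E x)]
  [FiberBundle (Fin n → ℂ) E] [VectorBundle ℂ (Fin n → ℂ) E]
  [ContMDiffVectorBundle ω (Fin n → ℂ) E 𝓘(ℂ, Fin d → ℂ)]
  [∀ x, AddCommGroup (E₂ x)] [∀ x, Module ℂ (E₂ x)]
  [TopologicalSpace (TotalSpace (Fin n₂ → ℂ) E₂)] [∀ x, TopologicalSpace (E₂ x)]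
  [FiberBundle (Fin n₂ → ℂ) E₂] [VectorBundle ℂ (Fin n₂ → ℂ) E₂]

variable {H : FormField E} {s : ∀ x, Module.End ℂ (E x)} {g : FormField (Tang d X)} {α : ℝ}

variable (e : HiggsExt d n₁ n n₂ E₁ E E₂)

lemma HiggsExt.momentL_selfAdjoint (hg : IsHermitianMetric d d g) {H : ℝ → FormField E}
    (hH : IsMetricFamily d n H) (t : ℝ) (x : X) :
    adj (gramL (d := d) n H x (t, chartAt (Fin d → ℂ) x x)) (atC (e.momentL g α H) t x) =
      atC (e.momentL g α H) t x := by
  have hx := mem_dom (d := d) (n := n) (E := E) x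
  simp only [atC, momentL]
  rw [adj_sub, adj_smul, higgsL_selfAdjoint hg hH t hx, projL_selfAdjoint hH hx t,
    Complex.conj_ofReal]

/-- Expanding `|m⁰_α|²` for `-i (i Λ F - α π + c)`, with `c` real, leaves only `c` and traces of
smooth families, which do not depend on frames. Continuity makes the right-hand side of the estimate
integrable. -/
lemma HiggsExt.continuous_endNorm_m₀ (hg : IsHermitianMetric d d g) (hH : IsHermitianMetric d n H) :
    Continuous fun x => endNorm n H x (e.m₀ g α H x) := by
  have hF : IsMetricFamily d n (fun _ : ℝ => H) := hH.isMetricFamily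
  have hm := momentL_isEndFamily (e := e) (α := α) hg hF
  have h1 := (hm.mul hm).smoothFam_trace.continuous_slice 0
  have h2 := hm.smoothFam_trace.continuous_slice 0
  have h3 := (higgsL_isEndFamily hg e.Θ hF).smoothFam_trace.continuous_slice 0
  set c : X → ℂ := fun x => -(1 / (n : ℂ)) * (atC (higgsL g e.Θ fun _ : ℝ => H) 0 x).trace +
    α * (n₁ / n : ℂ) with hc
  have hcc : Continuous c := (continuous_const.mul h3).add continuous_const
  have h4 : ∀ x, endNorm n H x (e.m₀ g α H x) =
      √((atC (fun x q => e.momentL g α (fun _ : ℝ => H) x q * e.momentL g α (fun _ : ℝ => H) x q)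
        0 x).trace + 2 * c x * (atC (e.momentL g α fun _ : ℝ => H) 0 x).trace + c x * c x * n).re :=
      fun x => by
    have hx := mem_dom (d := d) (n := n) (E := E) x
    have hu := hF.isUnit 0 hx
    have e1 : endCoord n x x (e.m₀ g α H x) =
        (-I) • (atC (e.momentL g α fun _ : ℝ => H) 0 x + c x • 1) := endCoord_m₀ hF 0 x
    have e2 := e.momentL_selfAdjoint (α := α) hg hF 0 x
    have e3 : conj (c x) = c x := by
      have h := trace_adj hu (atC (higgsL g e.Θ fun _ : ℝ => H) 0 x)
      simp only [atC, higgsL_selfAdjoint hg hF 0 hx] at h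
      simp only [hc, map_add, map_mul, map_neg, map_div₀, map_one, Complex.conj_natCast,
        Complex.conj_ofReal, atC, ← h]
    rw [gramL, gram_center hx.1] at e2 hu
    have e4 : adj (gram n H x x) (1 : Matrix (Fin n) (Fin n) ℂ) = 1 := by
      rw [adj, Matrix.conjTranspose_one, Matrix.mul_one, Matrix.nonsing_inv_mul _ hu]
    rw [endNorm_eq, e1, adj_smul, adj_add, adj_smul, e2, e4]
    rw [e3]
    simp only [atC]
    refine congrArg (fun c : ℂ => √c.re) ?_
    simp only [map_neg, Complex.conj_I, neg_neg, Matrix.smul_mul, Matrix.mul_smul, Matrix.trace_smul,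
      Matrix.add_mul, Matrix.mul_add, Matrix.one_mul, Matrix.mul_one, Matrix.trace_add,
      Matrix.trace_one, Fintype.card_fin, smul_eq_mul]
    linear_combination (-(e.momentL g α (fun _ : ℝ => H) x (0, chartAt (Fin d → ℂ) x x) *
      e.momentL g α (fun _ : ℝ => H) x (0, chartAt (Fin d → ℂ) x x)).trace - 2 * c x *
      (e.momentL g α (fun _ : ℝ => H) x (0, chartAt (Fin d → ℂ) x x)).trace - c x * c x * n) * I_sq
  simp only [h4]
  exact Real.continuous_sqrt.comp (Complex.continuous_re.comp
    ((h1.add ((continuous_const.mul hcc).mul h2)).add ((hcc.mul hcc).mul continuous_const)))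

namespace IsTraceFreeSelfAdjoint

/-- Cauchy-Schwarz for `Tr (s m⁰_α)` with respect to `H e^{ts}`, for which the norm of `s` is that
with respect to `H`. -/
lemma abs_momentForm_le (hs : IsTraceFreeSelfAdjoint d n H s) (hg : IsHermitianMetric d d g)
    (hH : IsHermitianMetric d n H) (t : ℝ) (x : X) :
    |(e.momentForm g α (expFam n H s) 1 t x).re| ≤
      endNorm n H x (s x) * endNorm n (expFam n H s t) x (e.m₀ g α (expFam n H s t) x) := by
  have hF := hs.metricFamily hH
  have hx := mem_dom (d := d) (n := n) (E := E) x
  have hfx := mem_frameSet (n := n) (E := E) x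
  have h1 : e.momentForm g α (expFam n H s) 1 t x =
      I * LinearMap.trace ℂ (E x) (s x * e.m₀ g α (expFam n H s t) x) := by
    linear_combination -(hs.two_I_trace_m₀ e (α := α) hg hH t x) / 2
  have h2 := hs.adj_endL hH hx t
  have h3 : gramL (d := d) n (expFam n H s) x (t, chartAt (Fin d → ℂ) x x) =
      gram n (expFam n H s t) x x := by rw [gramL, gram_center hx.1]
  rw [h3] at h2
  have h4 := norm_trace_mul_sq_le (gram_posDef (hF.herm t) hfx) h2
    (endCoord n x x (e.m₀ g α (expFam n H s t) x))
  rw [← hs.endNorm_sq_eq hH t, ← endNorm_sq (hF.herm t), hs.endNorm_expFam hH t, Complex.ofReal_re,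
    Complex.ofReal_re, ← mul_pow, endL_center ℝ s t hx.1, ← endCoord_mul hfx,
    ← trace_eq_trace_endCoord hfx] at h4
  refine (Complex.abs_re_le_norm _).trans ?_
  rw [h1, norm_mul, Complex.norm_I, one_mul]
  exact (sq_le_sq₀ (norm_nonneg _) (mul_nonneg (Real.sqrt_nonneg _) (Real.sqrt_nonneg _))).1 h4

/-- The differential inequality for `(|s|² + ε)^{1/2}`. -/
lemma laplacian_sqrt_le (hs : IsTraceFreeSelfAdjoint d n H s) (hg : IsHermitianMetric d d g)
    (hH : IsHermitianMetric d n H) (hα : α ≤ 0) {ε : ℝ} (hε : 0 ≤ ε) (x : X)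
    (hx0 : 0 < endNorm n H x (s x) ^ 2 + ε) :
    laplacian g (fun x => √(endNorm n H x (s x) ^ 2 + ε)) x ≤
      2 * (endNorm n H x (e.m₀ g α H x) +
        endNorm n (expForm n H s) x (e.m₀ g α (expForm n H s) x)) := by
  have hF := hs.metricFamily hH
  set ρ := √(endNorm n H x (s x) ^ 2 + ε) with hρ
  -- At the fixed point `x`, this is the integrand of the first variation of `M_α` along `H e^{ts}`.
  set D : ℝ → ℝ := fun t => 2 * (e.momentForm g α (expFam n H s) 1 t x).re with hD
  have hd : ∀ t, HasDerivAt D (2 * (dpar 1 (e.momentForm g α (expFam n H s) 1) t x).re) t :=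
    fun t => by
      have h := (HiggsExt.momentForm_smoothFam (e := e) (α := α) hg hF 1).hasDerivAt
        (ph := fun t => t) (hasDerivAt_id t) x
      exact (Complex.reCLM.hasFDerivAt.comp_hasDerivAt t h).const_mul 2
  -- Bochner-Kato bounds the left side, which is independent of `t`, by `D'(t)` plus `2 α |u|²`, and
  -- the latter is nonpositive because `α ≤ 0`.
  have h1 : ∀ t, ρ * laplacian g (fun x => √(endNorm n H x (s x) ^ 2 + ε)) x ≤ deriv D t := fun t => by
    refine (hs.sqrt_mul_laplacian_le hg hH e.Θ hε t x hx0).trans ?_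
    rw [(hd t).deriv, hs.dpar_momentForm_eq e hg hH, Complex.add_re, Complex.ofReal_re]
    simp only [Complex.mul_re, Complex.neg_re, Complex.neg_im, Complex.re_ofNat, Complex.im_ofNat,
      neg_zero, zero_mul, sub_zero]
    have := mul_nonneg (neg_nonneg.2 hα) (sq_nonneg (endNorm n (expFam n H s t) x
      (e.offDiagonal (expFam n H s t) s x)))
    linarith
  -- The mean value inequality on `[0, 1]` turns the lower bound for `D'` into one for `D(1) -
  -- D(0)`, whose terms are estimated at the metrics `H e^s` and `H`.
  have h2 := mul_sub_le_image_sub_of_le_deriv (fun t => (hd t).differentiableAt) h1 zero_le_one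
  have h3 := abs_le.1 (hs.abs_momentForm_le e (α := α) hg hH 0 x)
  have h4 := abs_le.1 (hs.abs_momentForm_le e (α := α) hg hH 1 x)
  rw [expFam_zero] at h3
  rw [expFam_one] at h4
  have h5 : endNorm n H x (s x) ≤ ρ := Real.le_sqrt_of_sq_le (by linarith)
  have hρ0 : 0 < ρ := Real.sqrt_pos.2 hx0
  have h6 := mul_le_mul_of_nonneg_right h5 (add_nonneg
    (Real.sqrt_nonneg (endInner n H x (e.m₀ g α H x) (e.m₀ g α H x)).re)
    (Real.sqrt_nonneg (endInner n (expForm n H s) x (e.m₀ g α (expForm n H s) x)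
      (e.m₀ g α (expForm n H s) x)).re))
  rw [← endNorm, ← endNorm] at h6
  refine le_of_mul_le_mul_left ?_ hρ0
  simp only [hD, sub_zero, mul_one] at h2
  linarith [h3.1, h3.2, h4.1, h4.2]

lemma endNorm_pos (hs : IsTraceFreeSelfAdjoint d n H s) (hH : IsHermitianMetric d n H) {x : X}
    (hx : s x ≠ 0) : 0 < endNorm n H x (s x) ^ 2 := by
  have hfx := mem_frameSet (n := n) (E := E) x
  refine lt_of_le_of_ne (sq_nonneg _) fun h0 => hx (endCoord_injective (n := n) x ?_)
  rw [(trace_adj_mul_self_nonneg (gram_posDef hH hfx) (endCoord n x x (s x))).2 (by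
    rw [← endNorm_sq hH, ← h0, Complex.ofReal_zero])]
  rw [endCoord, LinearMap.zero_comp, LinearMap.comp_zero, map_zero]

variable [T2Space X] [CompactSpace X] [MeasurableSpace X] [BorelSpace X]

/-- Where `s ≠ 0` the estimate for `(|s|² + ε)^{1/2}` is available at `ε = 0`. Across the zeros of
`s`, where `|s|` need not be smooth, the estimates for `ε > 0` have a right-hand side independent of
`ε` and pass to the limit. -/
theorem laplacian_endNorm_le (hs : IsTraceFreeSelfAdjoint d n H s) (hg : IsKaehler g)
    (hH : IsHermitianMetric d n H) (hα : α ≤ 0) :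
    (∀ x, s x ≠ 0 → laplacian g (fun x => endNorm n H x (s x)) x ≤
      2 * (endNorm n H x (e.m₀ g α H x) +
        endNorm n (expForm n H s) x (e.m₀ g α (expForm n H s) x))) ∧
    ∀ ψ : X → ℝ, ContMDiff 𝓘(ℝ, Fin d → ℂ) 𝓘(ℝ, ℝ) ∞ ψ → (∀ x, 0 ≤ ψ x) →
      ∫ x, endNorm n H x (s x) * laplacian g ψ x ∂(omegaPow g) ≤
        ∫ x, 2 * (endNorm n H x (e.m₀ g α H x) +
          endNorm n (expForm n H s) x (e.m₀ g α (expForm n H s) x)) * ψ x ∂(omegaPow g) := by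
  have hK : IsHermitianMetric d n (expForm n H s) := by
    rw [← expFam_one]
    exact (hs.metricFamily hH).herm 1
  refine ⟨fun x hx => ?_, fun ψ hψ hψ0 => integral_mul_laplacian_le hg (fun x => Real.sqrt_nonneg _)
    (hs.endNorm_sq_smoothFam hH) (continuous_const.mul
      ((e.continuous_endNorm_m₀ hg.hermitian hH).add (e.continuous_endNorm_m₀ hg.hermitian hK)))
    (fun ε hε x => hs.laplacian_sqrt_le e hg.hermitian hH hα hε.le x
      (add_pos_of_nonneg_of_pos (sq_nonneg _) hε)) hψ hψ0⟩
  have h := hs.laplacian_sqrt_le e hg.hermitian hH hα le_rfl x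
    (by rw [add_zero]; exact hs.endNorm_pos hH hx)
  have e1 : ∀ x, √(endNorm n H x (s x) ^ 2 + 0) = endNorm n H x (s x) := fun x => by
    rw [add_zero]
    exact Real.sqrt_sq (Real.sqrt_nonneg _)
  simpa only [e1] using h

end IsTraceFreeSelfAdjoint

end Inequality

end HiggsExtension

end

open Bundle MeasureTheory Complex HiggsExtension in
theorem mainTheorem7
    {d n₁ n n₂ : ℕ}
    -- a closed Kähler manifold
    {X : Type*} [TopologicalSpace X] [T2Space X] [CompactSpace X]
    [ChartedSpace (Fin d → ℂ) X] [IsManifold 𝓘(ℂ, Fin d → ℂ) ω X]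
    [MeasurableSpace X] [BorelSpace X]
    (g : FormField (Tang d X)) (hg : IsKaehler g)
    -- three holomorphic vector bundles, of ranks `n₁`, `n`, `n₂`
    {E₁ E E₂ : X → Type*}
    [∀ x, AddCommGroup (E₁ x)] [∀ x, Module ℂ (E₁ x)]
    [TopologicalSpace (TotalSpace (Fin n₁ → ℂ) E₁)] [∀ x, TopologicalSpace (E₁ x)]
    [FiberBundle (Fin n₁ → ℂ) E₁] [VectorBundle ℂ (Fin n₁ → ℂ) E₁]
    [ContMDiffVectorBundle ω (Fin n₁ → ℂ) E₁ 𝓘(ℂ, Fin d → ℂ)]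
    [∀ x, AddCommGroup (E x)] [∀ x, Module ℂ (E x)]
    [TopologicalSpace (TotalSpace (Fin n → ℂ) E)] [∀ x, TopologicalSpace (E x)]
    [FiberBundle (Fin n → ℂ) E] [VectorBundle ℂ (Fin n → ℂ) E]
    [ContMDiffVectorBundle ω (Fin n → ℂ) E 𝓘(ℂ, Fin d → ℂ)]
    [∀ x, AddCommGroup (E₂ x)] [∀ x, Module ℂ (E₂ x)]
    [TopologicalSpace (TotalSpace (Fin n₂ → ℂ) E₂)] [∀ x, TopologicalSpace (E₂ x)]
    [FiberBundle (Fin n₂ → ℂ) E₂] [VectorBundle ℂ (Fin n₂ → ℂ) E₂]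
    [ContMDiffVectorBundle ω (Fin n₂ → ℂ) E₂ 𝓘(ℂ, Fin d → ℂ)]
    -- an extension of Higgs bundles
    (e : HiggsExt d n₁ n n₂ E₁ E E₂) (α : ℝ) :
    -- additivity
    (∀ H K J : FormField E, IsHermitianMetric d n H → IsHermitianMetric d n K → IsHermitianMetric d n J →
      e.M g α H K + e.M g α K J = e.M g α H J) ∧
    -- first variation along `H(t) = H e^{ts}`
    (∀ (H K : FormField E) (s : ∀ x, Module.End ℂ (E x)),
      IsHermitianMetric d n H → IsHermitianMetric d n K → IsTraceFreeSelfAdjoint d n H s →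
      ∀ t : ℝ, HasDerivAt (fun τ : ℝ => e.M g α (expForm n H (fun x => (τ : ℂ) • s x)) K)
        (2 * I * ∫ x, LinearMap.trace ℂ (E x)
          (s x * e.m₀ g α (expForm n H (fun y => (t : ℂ) • s y)) x) ∂(omegaPow g)) t) ∧
    -- second variation: `L(s)` exists, and `2i⟨s, L(s)⟩ = d²/dt² M = 2(‖∇''s‖² - α‖u‖²)` at `0`
    (∀ (H K : FormField E) (s : ∀ x, Module.End ℂ (E x)),
      IsHermitianMetric d n H → IsHermitianMetric d n K → IsTraceFreeSelfAdjoint d n H s →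
      (∀ (x : X) (i j : Fin n), DifferentiableAt ℝ (fun t : ℝ =>
        endCoord n x x (e.m₀ g α (expForm n H (fun y => (t : ℂ) • s y)) x) i j) 0) ∧
      HasDerivAt (deriv (fun t : ℝ => e.M g α (expForm n H (fun x => (t : ℂ) • s x)) K))
        (2 * I * ∫ x, endInner n H x (s x) (e.linearization g α H s x) ∂(omegaPow g)) 0 ∧
      2 * I * ∫ x, endInner n H x (s x) (e.linearization g α H s x) ∂(omegaPow g)
        = ((2 * ((∫ x, oneFormNormSq n g H x (nablaEnd e.Θ s x) ∂(omegaPow g))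
            - α * ∫ x, endNorm n H x (e.offDiagonal H s x) ^ 2 ∂(omegaPow g)) : ℝ) : ℂ)) ∧
    -- the estimate for `Δ|s|`, `K = H e^s`, where `|s|` is taken with respect to `H` or to `K`
    (α ≤ 0 → ∀ (H K : FormField E) (s : ∀ x, Module.End ℂ (E x)),
      IsHermitianMetric d n H → IsTraceFreeSelfAdjoint d n H s → K = expForm n H s →
      ∀ N : X → ℝ, (N = (fun x => endNorm n H x (s x)) ∨ N = (fun x => endNorm n K x (s x))) →
      -- pointwise where `|s|` is smooth
      (∀ x, s x ≠ 0 →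
        laplacian g N x ≤ 2 * (endNorm n H x (e.m₀ g α H x) + endNorm n K x (e.m₀ g α K x))) ∧
      -- on all of `X`, in the sense of distributions
      (∀ ψ : X → ℝ, ContMDiff 𝓘(ℝ, Fin d → ℂ) 𝓘(ℝ, ℝ) ∞ ψ → (∀ x, 0 ≤ ψ x) →
        ∫ x, N x * laplacian g ψ x ∂(omegaPow g) ≤
          ∫ x, 2 * (endNorm n H x (e.m₀ g α H x) + endNorm n K x (e.m₀ g α K x)) * ψ x
            ∂(omegaPow g))) := by
  refine ⟨fun H K J hH hK hJ => HiggsExt.M_add hg hH hK hJ,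
    fun H K s hH hK hs t => hs.hasDerivAt_M e hg hH hK t,
    fun H K s hH hK hs => hs.second_variation e hg hH hK, ?_⟩
  rintro hα H K s hH hs rfl N hN
  -- Both choices of the norm give the same function, by the case `t = 1` of `endNorm_expFam`.
  have hN' : N = fun x => endNorm n H x (s x) := by
    rcases hN with h | h
    · exact h
    · rw [h, ← expFam_one]
      exact funext fun x => hs.endNorm_expFam hH 1 x
  rw [hN']
  exact hs.laplacian_endNorm_le e hg hH hα
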